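/- **Theorem (Accelerated box-constrained $\ell_\infty$ regression).** For $A\in\mathbb{R}^{n\times m}$ and $b\in\mathbb{R}^n$, call $x\in[-1,1]^m$ an $\epsilon$-approximate minimizer if $\|Ax-b\|_\infty\le\min_{y\in[-1,1]^m}\|Ay-b\|_\infty+\epsilon$. Let $\|A\|_\infty$ be the largest $\ell_1$ norm of a row of $A$. There is a single randomized algorithm with the following property. Its input consists of a matrix $A\in\mathbb{R}^{n\times m}$ in compressed sparse column format with $n\ge 1$ and at least $n$ nonzero entries (for instance, with no zero row), a vector $b\in\mathbb{R}^n$, an accuracy $\epsilon>0$, a failure probability $\delta\in(0,1)$, and a number $s$ such that some minimizer $x^*$ of $\|Ax-b\|_\infty$ over $[-1,1]^m$ satisfies $\|x^*\|_2^2\le s$. With probability at least $1-\delta$ the algorithm outputs an $\epsilon$-approximate minimizer of $\|Ax-b\|_\infty$ over $[-1,1]^m$, and if each column of $A$ has at most $c$ nonzero entries, it always halts within time $$\tilde O(F),\qquad F=mc+\frac{\left(\min(m,n)+\sqrt{m\min(n,s)}\right)c\,\|A\|_\infty}{\epsilon}.$$ Precisely, the time is at most $K\,F\,\log^k(2+F)\,(1+\log(1/\delta))$,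 where $K$ and $k$ are universal constants. Time is the number of unit-cost operations on a real random access machine: exact real arithmetic, comparison, $\exp$ and $\log$; arithmetic and indirect addressing on $w$-bit words, for any $w\ge K\log_2(2+F)$; and independent uniform samples from $[0,1]$. -/

import Mathlib

open MeasureTheory

/-! ### A randomized real RAM

Programs are finite, structured (`while`) programs over a random access machine with two sorts
of storage: machine words (natural numbers below `W`, arithmetic modulo `W`), used for indices and
addresses, and exact real numbers. Each sort has registers, named by the program, and a memory
that is addressed indirectly through word registers. The only numerical constants in a program are
natural numbers. Every elementary operation and every test costs one unit of time. -/

/-- Elementary instructions. Lower-case arguments `d a b v` are register names; instructions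
beginning with `i` act on words, those beginning with `r` on reals. -/
inductive Instr : Type
  /-- `d := k` -/
  | iconst (d k : ℕ)
  /-- `d := a + b` -/
  | iadd (d a b : ℕ)
  /-- `d := max (a - b) 0` -/
  | isub (d a b : ℕ)
  /-- `d := a * b` -/
  | imul (d a b : ℕ)
  /-- `d := ⌊a / 2⌋` -/
  | ihalf (d a : ℕ)
  /-- `d := wordMemory[a]` -/
  | iload (d a : ℕ)
  /-- `wordMemory[a] := v` -/
  | istore (a v : ℕ)
  /-- `d := k` -/
  | rconst (d k : ℕ)
  /-- `d := a`, where `a` is a word register -/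
  | rcast (d a : ℕ)
  /-- `d := a + b` -/
  | radd (d a b : ℕ)
  /-- `d := a - b` -/
  | rsub (d a b : ℕ)
  /-- `d := a * b` -/
  | rmul (d a b : ℕ)
  /-- `d := a / b` -/
  | rdiv (d a b : ℕ)
  /-- `d := exp a` -/
  | rexp (d a : ℕ)
  /-- `d := log a` -/
  | rlog (d a : ℕ)
  /-- `d := realMemory[a]`, where `a` is a word register -/
  | rload (d a : ℕ)
  /-- `realMemory[a] := v`, where `a` is a word register -/
  | rstore (a v : ℕ)
  /-- `d :=` a fresh uniformly random element of `[0,1]` -/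
  | rrand (d : ℕ)

/-- Tests: strict comparison of two word registers or of two real registers. -/
inductive Test : Type
  | ilt (a b : ℕ)
  | rlt (a b : ℕ)

/-- Programs. -/
inductive Prog : Type
  | instr (i : Instr)
  | seq (p q : Prog)
  | ite (t : Test) (p q : Prog)
  | loop (t : Test) (p : Prog)

/-- A state of the machine. -/
structure RamState : Type where
  /-- word registers -/
  ireg : ℕ → ℕ
  /-- word memory -/
  imem : ℕ → ℕ
  /-- real registers -/
  rreg : ℕ → ℝ
  /-- real memory -/
  rmem : ℕ → ℝ
  /-- number of random numbers consumed so far -/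
  pos : ℕ

/-- An infinite sequence of elements of `[0,1]`, the source of randomness of the machine. -/
abbrev Tape : Type := ℕ → unitInterval

/-- The entries of the random tape are independent and uniformly distributed on `[0,1]`. -/
noncomputable def tapeMeasure : Measure Tape :=
  Measure.infinitePi fun _ : ℕ => (volume : Measure unitInterval)

namespace RamState

/-- Write the word `v` into the word register `d`. -/
def setI (σ : RamState) (d v : ℕ) : RamState := { σ with ireg := Function.update σ.ireg d v }

/-- Write the real `v` into the real register `d`. -/
def setR (σ : RamState) (d : ℕ) (v : ℝ) : RamState :=
  { σ with rreg := Function.update σ.rreg d v }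

end RamState

/-- The effect of one instruction, for words modulo `W` and the random tape `ω`. -/
noncomputable def Instr.apply (W : ℕ) (ω : Tape) (σ : RamState) : Instr → RamState
  | iconst d k => σ.setI d (k % W)
  | iadd d a b => σ.setI d ((σ.ireg a + σ.ireg b) % W)
  | isub d a b => σ.setI d (σ.ireg a - σ.ireg b)
  | imul d a b => σ.setI d ((σ.ireg a * σ.ireg b) % W)
  | ihalf d a => σ.setI d (σ.ireg a / 2)
  | iload d a => σ.setI d (σ.imem (σ.ireg a))
  | istore a v => { σ with imem := Function.update σ.imem (σ.ireg a) (σ.ireg v) }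
  | rconst d k => σ.setR d k
  | rcast d a => σ.setR d (σ.ireg a)
  | radd d a b => σ.setR d (σ.rreg a + σ.rreg b)
  | rsub d a b => σ.setR d (σ.rreg a - σ.rreg b)
  | rmul d a b => σ.setR d (σ.rreg a * σ.rreg b)
  | rdiv d a b => σ.setR d (σ.rreg a / σ.rreg b)
  | rexp d a => σ.setR d (Real.exp (σ.rreg a))
  | rlog d a => σ.setR d (Real.log (σ.rreg a))
  | rload d a => σ.setR d (σ.rmem (σ.ireg a))
  | rstore a v => { σ with rmem := Function.update σ.rmem (σ.ireg a) (σ.rreg v) }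
  | rrand d => { σ.setR d (ω σ.pos : ℝ) with pos := σ.pos + 1 }

/-- The outcome of a test. -/
def Test.Holds (σ : RamState) : Test → Prop
  | ilt a b => σ.ireg a < σ.ireg b
  | rlt a b => σ.rreg a < σ.rreg b

/-- `Exec W ω p σ t σ'`: started in state `σ`, with words modulo `W` and random tape `ω`, the
program `p` halts after exactly `t` units of time, in state `σ'`. -/
inductive Exec (W : ℕ) (ω : Tape) : Prog → RamState → ℕ → RamState → Prop
  | instr (i : Instr) (σ : RamState) : Exec W ω (.instr i) σ 1 (i.apply W ω σ)
  | seq {p q : Prog} {σ σ₁ σ₂ : RamState} {t₁ t₂ : ℕ}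
      (h₁ : Exec W ω p σ t₁ σ₁) (h₂ : Exec W ω q σ₁ t₂ σ₂) :
      Exec W ω (.seq p q) σ (t₁ + t₂) σ₂
  | ite_true {c : Test} {p q : Prog} {σ σ₁ : RamState} {t : ℕ}
      (hc : c.Holds σ) (h : Exec W ω p σ t σ₁) : Exec W ω (.ite c p q) σ (1 + t) σ₁
  | ite_false {c : Test} {p q : Prog} {σ σ₁ : RamState} {t : ℕ}
      (hc : ¬ c.Holds σ) (h : Exec W ω q σ t σ₁) : Exec W ω (.ite c p q) σ (1 + t) σ₁
  | loop_true {c : Test} {p : Prog} {σ σ₁ σ₂ : RamState} {t₁ t₂ : ℕ}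
      (hc : c.Holds σ) (h₁ : Exec W ω p σ t₁ σ₁) (h₂ : Exec W ω (.loop c p) σ₁ t₂ σ₂) :
      Exec W ω (.loop c p) σ (1 + t₁ + t₂) σ₂
  | loop_false {c : Test} {p : Prog} {σ : RamState}
      (hc : ¬ c.Holds σ) : Exec W ω (.loop c p) σ 1 σ

/-! ### Sparse matrices as inputs -/

section Input

variable {n m : ℕ}

open Classical in
/-- The row indices of the nonzero entries of column `j`, in increasing order. -/
noncomputable def colSupport (A : Matrix (Fin n) (Fin m) ℝ) (j : Fin m) : List (Fin n) :=
  (List.finRange n).filter fun i => A i j ≠ 0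

/-- The number of nonzero entries of column `j`. -/
noncomputable def colNnz (A : Matrix (Fin n) (Fin m) ℝ) (j : Fin m) : ℕ :=
  (colSupport A j).length

/-- The number of nonzero entries of `A`. -/
noncomputable def nnz (A : Matrix (Fin n) (Fin m) ℝ) : ℕ := ∑ j, colNnz A j

/-- The word part of the input: `n`, `m`, then for each `j = 0, …, m` the number of nonzero entries
in the first `j` columns, then the row indices of the nonzero entries, column by column
(compressed sparse column format, indices starting from `0`). -/
noncomputable def wordInput (A : Matrix (Fin n) (Fin m) ℝ) : List ℕ :=
  [n, m]
    ++ (List.range (m + 1)).map (fun k => ∑ j : Fin m with j.val < k, colNnz A j)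
    ++ (List.finRange m).flatMap (fun j => (colSupport A j).map fun i => i.val)

/-- The real part of the input: three scalars, then the entries of `b`, then the nonzero entries of
`A`, column by column. -/
noncomputable def realInput (A : Matrix (Fin n) (Fin m) ℝ) (b : Fin n → ℝ) (ε δ s : ℝ) : List ℝ :=
  [ε, δ, s] ++ List.ofFn b
    ++ (List.finRange m).flatMap (fun j => (colSupport A j).map fun i => A i j)

/-- The initial state: the input is in the two memories, everything else is `0`. -/
noncomputable def initState (A : Matrix (Fin n) (Fin m) ℝ) (b : Fin n → ℝ) (ε δ s : ℝ) :
    RamState where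
  ireg _ := 0
  imem k := (wordInput A).getD k 0
  rreg _ := 0
  rmem k := (realInput A b ε δ s).getD k 0
  pos := 0

/-- The output of length `m`: the first `m` cells of the real memory. -/
def RamState.output (σ : RamState) (m : ℕ) : Fin m → ℝ := fun j => σ.rmem j

/-! ### Box-constrained regression in the sup norm -/

/-- The box `[-1,1]^m`. -/
def box (m : ℕ) : Set (Fin m → ℝ) := {x | ∀ j, x j ∈ Set.Icc (-1 : ℝ) 1}

/-- `‖Ax - b‖_∞` (the norm on `Fin n → ℝ` is the sup norm). -/
noncomputable def regObjective (A : Matrix (Fin n) (Fin m) ℝ) (b : Fin n → ℝ)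
    (x : Fin m → ℝ) : ℝ :=
  ‖A.mulVec x - b‖

/-- `x` is an `ε`-approximate minimizer of `‖Ax - b‖_∞` over the box. -/
def IsApproxMinimizer (A : Matrix (Fin n) (Fin m) ℝ) (b : Fin n → ℝ) (ε : ℝ) (x : Fin m → ℝ) :
    Prop :=
  x ∈ box m ∧ ∀ y ∈ box m, regObjective A b x ≤ regObjective A b y + ε

/-- `x` is a minimizer of `‖Ax - b‖_∞` over the box. -/
def IsBoxMinimizer (A : Matrix (Fin n) (Fin m) ℝ) (b : Fin n → ℝ) (x : Fin m → ℝ) : Prop :=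
  x ∈ box m ∧ IsMinOn (regObjective A b) (box m) x

/-- `‖A‖_∞`, the operator norm for the sup norms (the largest `ℓ₁` norm of a row). -/
noncomputable def matNormInf (A : Matrix (Fin n) (Fin m) ℝ) : ℝ :=
  letI : NormedAddCommGroup (Matrix (Fin n) (Fin m) ℝ) := Matrix.linftyOpNormedAddCommGroup
  ‖A‖

/-- `mc + (min(m,n) + √(m min(n,s))) c ‖A‖_∞ / ε`. -/
noncomputable def regressionBound (A : Matrix (Fin n) (Fin m) ℝ) (c : ℕ) (ε s : ℝ) : ℝ :=
  m * c + (min (m : ℝ) n + √(m * min (n : ℝ) s)) * c * matNormInf A / ε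

end Input

/-! ### A structured language with expressions, arrays and bounded loops, and its compiler -/

namespace Loop

/-- States of the structured language: word and real variables, word and real arrays. Array `0` is
the input/output area. -/
structure St where
  i : ℕ → ℕ
  r : ℕ → ℝ
  ia : ℕ → ℕ → ℕ
  ra : ℕ → ℕ → ℝ
  pos : ℕ

namespace St

/-- Assign a word variable. -/
def setI (s : St) (v x : ℕ) : St := { s with i := Function.update s.i v x }

/-- Assign a real variable. -/
def setR (s : St) (v : ℕ) (x : ℝ) : St := { s with r := Function.update s.r v x }

/-- Assign a cell of a word array. -/
def putI (s : St) (a e x : ℕ) : St :=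
  { s with ia := Function.update s.ia a (Function.update (s.ia a) e x) }

/-- Assign a cell of a real array. -/
def putR (s : St) (a e : ℕ) (x : ℝ) : St :=
  { s with ra := Function.update s.ra a (Function.update (s.ra a) e x) }

variable (s : St) (v x a e : ℕ) (y : ℝ)

@[simp] lemma setI_i : (s.setI v x).i = Function.update s.i v x := rfl
@[simp] lemma setI_r : (s.setI v x).r = s.r := rfl
@[simp] lemma setI_ia : (s.setI v x).ia = s.ia := rfl
@[simp] lemma setI_ra : (s.setI v x).ra = s.ra := rfl
@[simp] lemma setI_pos : (s.setI v x).pos = s.pos := rfl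
@[simp] lemma setR_i : (s.setR v y).i = s.i := rfl
@[simp] lemma setR_r : (s.setR v y).r = Function.update s.r v y := rfl
@[simp] lemma setR_ia : (s.setR v y).ia = s.ia := rfl
@[simp] lemma setR_ra : (s.setR v y).ra = s.ra := rfl
@[simp] lemma setR_pos : (s.setR v y).pos = s.pos := rfl
@[simp] lemma putI_i : (s.putI a e x).i = s.i := rfl
@[simp] lemma putI_r : (s.putI a e x).r = s.r := rfl
@[simp] lemma putI_ia :
    (s.putI a e x).ia = Function.update s.ia a (Function.update (s.ia a) e x) := rfl
@[simp] lemma putI_ra : (s.putI a e x).ra = s.ra := rfl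
@[simp] lemma putI_pos : (s.putI a e x).pos = s.pos := rfl
@[simp] lemma putR_i : (s.putR a e y).i = s.i := rfl
@[simp] lemma putR_r : (s.putR a e y).r = s.r := rfl
@[simp] lemma putR_ia : (s.putR a e y).ia = s.ia := rfl
@[simp] lemma putR_ra :
    (s.putR a e y).ra = Function.update s.ra a (Function.update (s.ra a) e y) := rfl
@[simp] lemma putR_pos : (s.putR a e y).pos = s.pos := rfl

end St

/-- Word expressions. -/
inductive IE : Type
  | var (v : ℕ)
  | const (k : ℕ)
  | add (a b : IE)
  | sub (a b : IE)
  | half (a : IE)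
  | arr (a : ℕ) (e : IE)

/-- Real expressions. -/
inductive RE : Type
  | var (v : ℕ)
  | const (k : ℕ)
  | cast (e : IE)
  | add (a b : RE)
  | sub (a b : RE)
  | mul (a b : RE)
  | div (a b : RE)
  | max (a b : RE)
  | exp (a : RE)
  | log (a : RE)
  | arr (a : ℕ) (e : IE)

/-- Commands. `loop v e c` runs `c` for `v = 0, …, e - 1`; `rep e c` runs `c` `⌈e⌉` times. -/
inductive Cmd : Type
  | iset (v : ℕ) (e : IE)
  | rset (v : ℕ) (e : RE)
  | iput (a : ℕ) (i e : IE)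
  | rput (a : ℕ) (i : IE) (e : RE)
  | rand (v : ℕ)
  | skip
  | seq (c d : Cmd)
  | ifI (a b : IE) (c d : Cmd)
  | ifR (a b : RE) (c d : Cmd)
  | loop (v : ℕ) (e : IE) (c : Cmd)
  | rep (e : RE) (c : Cmd)

instance : Add IE := ⟨IE.add⟩
instance : Sub IE := ⟨IE.sub⟩
instance (k : ℕ) : OfNat IE k := ⟨IE.const k⟩
instance : Add RE := ⟨RE.add⟩
instance : Sub RE := ⟨RE.sub⟩
instance : Mul RE := ⟨RE.mul⟩
instance : Div RE := ⟨RE.div⟩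
instance (k : ℕ) : OfNat RE k := ⟨RE.const k⟩

/-- Value of a word expression. -/
def IE.eval (s : St) : IE → ℕ
  | var v => s.i v
  | const k => k
  | add a b => a.eval s + b.eval s
  | sub a b => a.eval s - b.eval s
  | half a => a.eval s / 2
  | arr a e => s.ia a (e.eval s)

/-- Value of a real expression. -/
noncomputable def RE.eval (s : St) : RE → ℝ
  | var v => s.r v
  | const k => k
  | cast e => e.eval s
  | add a b => a.eval s + b.eval s
  | sub a b => a.eval s - b.eval s
  | mul a b => a.eval s * b.eval s
  | div a b => a.eval s / b.eval s
  | max a b => Max.max (a.eval s) (b.eval s)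
  | exp a => Real.exp (a.eval s)
  | log a => Real.log (a.eval s)
  | arr a e => s.ra a (e.eval s)

section eval
variable (s : St)
@[simp] lemma IE.eval_var (v : ℕ) : (IE.var v).eval s = s.i v := rfl
@[simp] lemma IE.eval_ofNat (k : ℕ) : (no_index (OfNat.ofNat k : IE)).eval s = k := rfl
@[simp] lemma IE.eval_add (a b : IE) : (a + b).eval s = a.eval s + b.eval s := rfl
@[simp] lemma IE.eval_sub (a b : IE) : (a - b).eval s = a.eval s - b.eval s := rfl
@[simp] lemma IE.eval_half (a : IE) : a.half.eval s = a.eval s / 2 := rfl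
@[simp] lemma IE.eval_arr (a : ℕ) (e : IE) : (IE.arr a e).eval s = s.ia a (e.eval s) := rfl
@[simp] lemma RE.eval_var (v : ℕ) : (RE.var v).eval s = s.r v := rfl
@[simp] lemma RE.eval_ofNat (k : ℕ) : (no_index (OfNat.ofNat k : RE)).eval s = (k : ℝ) := rfl
@[simp] lemma RE.eval_cast (e : IE) : (RE.cast e).eval s = (e.eval s : ℝ) := rfl
@[simp] lemma RE.eval_add (a b : RE) : (a + b).eval s = a.eval s + b.eval s := rfl
@[simp] lemma RE.eval_sub (a b : RE) : (a - b).eval s = a.eval s - b.eval s := rfl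
@[simp] lemma RE.eval_mul (a b : RE) : (a * b).eval s = a.eval s * b.eval s := rfl
@[simp] lemma RE.eval_div (a b : RE) : (a / b).eval s = a.eval s / b.eval s := rfl
@[simp] lemma RE.eval_max (a b : RE) : (a.max b).eval s = Max.max (a.eval s) (b.eval s) := rfl
@[simp] lemma RE.eval_exp (a : RE) : a.exp.eval s = Real.exp (a.eval s) := rfl
@[simp] lemma RE.eval_log (a : RE) : a.log.eval s = Real.log (a.eval s) := rfl
@[simp] lemma RE.eval_arr (a : ℕ) (e : IE) : (RE.arr a e).eval s = s.ra a (e.eval s) := rfl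
end eval

/-- Iterate a family of maps. -/
def iter {α : Type*} (f : ℕ → α → α) : ℕ → α → α
  | 0, s => s
  | k + 1, s => f k (iter f k s)

/-- The effect of a command. -/
noncomputable def Cmd.den (ω : Tape) : Cmd → St → St
  | iset v e, s => s.setI v (e.eval s)
  | rset v e, s => s.setR v (e.eval s)
  | iput a i e, s => s.putI a (i.eval s) (e.eval s)
  | rput a i e, s => s.putR a (i.eval s) (e.eval s)
  | rand v, s => { s.setR v (ω s.pos : ℝ) with pos := s.pos + 1 }
  | skip, s => s
  | seq c d, s => d.den ω (c.den ω s)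
  | ifI a b c d, s => if a.eval s < b.eval s then c.den ω s else d.den ω s
  | ifR a b c d, s => open Classical in if a.eval s < b.eval s then c.den ω s else d.den ω s
  | loop v e c, s => iter (fun k s => c.den ω (s.setI v k)) (e.eval s) s
  | rep e c, s => iter (fun _ s => c.den ω s) ⌈e.eval s⌉₊ s

/-- Time for the evaluation of a word expression. -/
def IE.cost : IE → ℕ
  | var _ => 1
  | const _ => 1
  | add a b => a.cost + (b.cost + 1)
  | sub a b => a.cost + (b.cost + 1)
  | half a => a.cost + 1
  | arr _ e => e.cost + 5

/-- Time for the evaluation of a real expression. -/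
def RE.cost : RE → ℕ
  | var _ => 1
  | const _ => 1
  | cast e => e.cost + 1
  | add a b => a.cost + (b.cost + 1)
  | sub a b => a.cost + (b.cost + 1)
  | mul a b => a.cost + (b.cost + 1)
  | div a b => a.cost + (b.cost + 1)
  | max a b => a.cost + (b.cost + 2)
  | exp a => a.cost + 1
  | log a => a.cost + 1
  | arr _ e => e.cost + 5

/-- Time for the execution of a command. -/
noncomputable def Cmd.cost (ω : Tape) : Cmd → St → ℕ
  | iset _ e, _ => e.cost + 1
  | rset _ e, _ => e.cost + 1
  | iput _ i e, _ => e.cost + ((i.cost + 4) + 1)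
  | rput _ i e, _ => e.cost + ((i.cost + 4) + 1)
  | rand _, _ => 1
  | skip, _ => 1
  | seq c d, s => c.cost ω s + d.cost ω (c.den ω s)
  | ifI a b c d, s =>
    a.cost + (b.cost + (1 + if a.eval s < b.eval s then c.cost ω s else d.cost ω s))
  | ifR a b c d, s => open Classical in
    a.cost + (b.cost + (1 + if a.eval s < b.eval s then c.cost ω s else d.cost ω s))
  | loop v e c, s => e.cost + (1 + (∑ k ∈ Finset.range (e.eval s),
      (c.cost ω ((iter (fun k s => c.den ω (s.setI v k)) k s).setI v k) + 4) + 1))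
  | rep e c, s => e.cost + (1 + (∑ k ∈ Finset.range ⌈e.eval s⌉₊,
      (c.cost ω (iter (fun _ s => c.den ω s) k s) + 3) + 1))

section Ok
variable (W E H : ℕ)

/-- Admissible index `e` of the array `a`. -/
def OkIdx (a e : ℕ) : Prop := if a = 0 then e < H else a < 16 ∧ e < E

/-- No overflow and no access out of bounds in the evaluation of a word expression. -/
def IE.ok (s : St) : IE → Prop
  | var _ => True
  | const k => k < W
  | add a b => a.ok s ∧ b.ok s ∧ a.eval s + b.eval s < W
  | sub a b => a.ok s ∧ b.ok s
  | half a => a.ok s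
  | arr a e => e.ok s ∧ OkIdx E H a (e.eval s)

/-- No overflow and no access out of bounds in the evaluation of a real expression. -/
def RE.ok (s : St) : RE → Prop
  | var _ => True
  | const _ => True
  | cast e => e.ok W E H s
  | add a b => a.ok s ∧ b.ok s
  | sub a b => a.ok s ∧ b.ok s
  | mul a b => a.ok s ∧ b.ok s
  | div a b => a.ok s ∧ b.ok s
  | max a b => a.ok s ∧ b.ok s
  | exp a => a.ok s
  | log a => a.ok s
  | arr a e => e.ok W E H s ∧ OkIdx E H a (e.eval s)

/-- No overflow and no access out of bounds in the execution of a command. -/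
def Cmd.ok (ω : Tape) : Cmd → St → Prop
  | iset _ e, s => e.ok W E H s
  | rset _ e, s => e.ok W E H s
  | iput a i e, s => i.ok W E H s ∧ e.ok W E H s ∧ OkIdx E H a (i.eval s)
  | rput a i e, s => i.ok W E H s ∧ e.ok W E H s ∧ OkIdx E H a (i.eval s)
  | rand _, _ => True
  | skip, _ => True
  | seq c d, s => c.ok ω s ∧ d.ok ω (c.den ω s)
  | ifI a b c d, s => a.ok W E H s ∧ b.ok W E H s ∧
      (a.eval s < b.eval s → c.ok ω s) ∧ (¬ a.eval s < b.eval s → d.ok ω s)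
  | ifR a b c d, s => a.ok W E H s ∧ b.ok W E H s ∧
      (a.eval s < b.eval s → c.ok ω s) ∧ (¬ a.eval s < b.eval s → d.ok ω s)
  | loop v e c, s => e.ok W E H s ∧ e.eval s < W ∧ ∀ k < e.eval s,
      c.ok ω ((iter (fun k s => c.den ω (s.setI v k)) k s).setI v k)
  | rep e c, s => e.ok W E H s ∧ ∀ k < ⌈e.eval s⌉₊, c.ok ω (iter (fun _ s => c.den ω s) k s)

section simps
variable (s : St)
@[simp] lemma IE.ok_var (v : ℕ) : (IE.var v).ok W E H s := trivial
@[simp] lemma IE.ok_ofNat (k : ℕ) : (no_index (OfNat.ofNat k : IE)).ok W E H s ↔ k < W := Iff.rfl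
@[simp] lemma IE.ok_add (a b : IE) : (a + b).ok W E H s ↔
    a.ok W E H s ∧ b.ok W E H s ∧ a.eval s + b.eval s < W := Iff.rfl
@[simp] lemma IE.ok_sub (a b : IE) : (a - b).ok W E H s ↔ a.ok W E H s ∧ b.ok W E H s := Iff.rfl
@[simp] lemma IE.ok_half (a : IE) : a.half.ok W E H s ↔ a.ok W E H s := Iff.rfl
@[simp] lemma IE.ok_arr (a : ℕ) (e : IE) : (IE.arr a e).ok W E H s ↔
    e.ok W E H s ∧ OkIdx E H a (e.eval s) := Iff.rfl
@[simp] lemma RE.ok_var (v : ℕ) : (RE.var v).ok W E H s := trivial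
@[simp] lemma RE.ok_ofNat (k : ℕ) : (no_index (OfNat.ofNat k : RE)).ok W E H s := trivial
@[simp] lemma RE.ok_cast (e : IE) : (RE.cast e).ok W E H s ↔ e.ok W E H s := Iff.rfl
@[simp] lemma RE.ok_add (a b : RE) :
    (a + b).ok W E H s ↔ a.ok W E H s ∧ b.ok W E H s := Iff.rfl
@[simp] lemma RE.ok_sub (a b : RE) :
    (a - b).ok W E H s ↔ a.ok W E H s ∧ b.ok W E H s := Iff.rfl
@[simp] lemma RE.ok_mul (a b : RE) :
    (a * b).ok W E H s ↔ a.ok W E H s ∧ b.ok W E H s := Iff.rfl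
@[simp] lemma RE.ok_div (a b : RE) :
    (a / b).ok W E H s ↔ a.ok W E H s ∧ b.ok W E H s := Iff.rfl
@[simp] lemma RE.ok_max (a b : RE) :
    (a.max b).ok W E H s ↔ a.ok W E H s ∧ b.ok W E H s := Iff.rfl
@[simp] lemma RE.ok_exp (a : RE) : a.exp.ok W E H s ↔ a.ok W E H s := Iff.rfl
@[simp] lemma RE.ok_log (a : RE) : a.log.ok W E H s ↔ a.ok W E H s := Iff.rfl
@[simp] lemma RE.ok_arr (a : ℕ) (e : IE) : (RE.arr a e).ok W E H s ↔
    e.ok W E H s ∧ OkIdx E H a (e.eval s) := Iff.rfl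
@[simp] lemma okIdx_zero (e : ℕ) : OkIdx E H 0 e ↔ e < H := by simp [OkIdx]
@[simp] lemma okIdx_succ (a e : ℕ) : OkIdx E H (a + 1) e ↔ a + 1 < 16 ∧ e < E := by
  simp [OkIdx]
end simps

end Ok

/-! ### Compilation -/

/-- Physical address of cell `e` of array `a`. -/
def loc (H a e : ℕ) : ℕ := if a = 0 then e else H + 16 * e + a

/-- Replace the index in temporary `d` by the physical address. Temporaries live in odd registers,
of which `1`, `3`, `5` hold the offset of the arrays, `16` and `0`; variables in even ones. -/
def compAddr (a d : ℕ) : Prog :=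
  if a = 0 then
    (Prog.instr (.isub (2 * d + 1) (2 * d + 1) 5)).seq
      ((Prog.instr (.isub (2 * d + 1) (2 * d + 1) 5)).seq
        ((Prog.instr (.isub (2 * d + 1) (2 * d + 1) 5)).seq
          (Prog.instr (.isub (2 * d + 1) (2 * d + 1) 5))))
  else
    (Prog.instr (.imul (2 * d + 1) (2 * d + 1) 3)).seq
      ((Prog.instr (.iadd (2 * d + 1) 1 (2 * d + 1))).seq
        ((Prog.instr (.iconst (2 * (d + 1) + 1) a)).seq
          (Prog.instr (.iadd (2 * d + 1) (2 * d + 1) (2 * (d + 1) + 1)))))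

/-- Compile a word expression, with result in temporary `d`. -/
def IE.comp : IE → ℕ → Prog
  | var v, d => .instr (.isub (2 * d + 1) (2 * v) 5)
  | const k, d => .instr (.iconst (2 * d + 1) k)
  | add a b, d => (a.comp d).seq ((b.comp (d + 1)).seq
      (.instr (.iadd (2 * d + 1) (2 * d + 1) (2 * (d + 1) + 1))))
  | sub a b, d => (a.comp d).seq ((b.comp (d + 1)).seq
      (.instr (.isub (2 * d + 1) (2 * d + 1) (2 * (d + 1) + 1))))
  | half a, d => (a.comp d).seq (.instr (.ihalf (2 * d + 1) (2 * d + 1)))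
  | arr a e, d => (e.comp d).seq ((compAddr a d).seq (.instr (.iload (2 * d + 1) (2 * d + 1))))

/-- Compile a real expression, with result in temporary `d`. -/
def RE.comp : RE → ℕ → Prog
  | var v, d => .instr (.radd (2 * d + 1) (2 * v) 1)
  | const k, d => .instr (.rconst (2 * d + 1) k)
  | cast e, d => (e.comp d).seq (.instr (.rcast (2 * d + 1) (2 * d + 1)))
  | add a b, d => (a.comp d).seq ((b.comp (d + 1)).seq
      (.instr (.radd (2 * d + 1) (2 * d + 1) (2 * (d + 1) + 1))))
  | sub a b, d => (a.comp d).seq ((b.comp (d + 1)).seq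
      (.instr (.rsub (2 * d + 1) (2 * d + 1) (2 * (d + 1) + 1))))
  | mul a b, d => (a.comp d).seq ((b.comp (d + 1)).seq
      (.instr (.rmul (2 * d + 1) (2 * d + 1) (2 * (d + 1) + 1))))
  | div a b, d => (a.comp d).seq ((b.comp (d + 1)).seq
      (.instr (.rdiv (2 * d + 1) (2 * d + 1) (2 * (d + 1) + 1))))
  | max a b, d => (a.comp d).seq ((b.comp (d + 1)).seq
      (.ite (.rlt (2 * d + 1) (2 * (d + 1) + 1))
        (.instr (.radd (2 * d + 1) (2 * (d + 1) + 1) 1))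
        (.instr (.radd (2 * d + 1) (2 * d + 1) 1))))
  | exp a, d => (a.comp d).seq (.instr (.rexp (2 * d + 1) (2 * d + 1)))
  | log a, d => (a.comp d).seq (.instr (.rlog (2 * d + 1) (2 * d + 1)))
  | arr a e, d => (e.comp d).seq ((compAddr a d).seq (.instr (.rload (2 * d + 1) (2 * d + 1))))

/-- Compile a command, preserving the temporaries below `d`. -/
def Cmd.comp : Cmd → ℕ → Prog
  | iset v e, d => (e.comp d).seq (.instr (.isub (2 * v) (2 * d + 1) 5))
  | rset v e, d => (e.comp d).seq (.instr (.radd (2 * v) (2 * d + 1) 1))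
  | iput a i e, d => (e.comp d).seq (((i.comp (d + 1)).seq (compAddr a (d + 1))).seq
      (.instr (.istore (2 * (d + 1) + 1) (2 * d + 1))))
  | rput a i e, d => (e.comp d).seq (((i.comp (d + 1)).seq (compAddr a (d + 1))).seq
      (.instr (.rstore (2 * (d + 1) + 1) (2 * d + 1))))
  | rand v, _ => .instr (.rrand (2 * v))
  | skip, d => .instr (.iconst (2 * d + 1) 0)
  | seq c c', d => (c.comp d).seq (c'.comp d)
  | ifI a b c c', d => (a.comp d).seq ((b.comp (d + 1)).seq
      (.ite (.ilt (2 * d + 1) (2 * (d + 1) + 1)) (c.comp d) (c'.comp d)))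
  | ifR a b c c', d => (a.comp d).seq ((b.comp (d + 1)).seq
      (.ite (.rlt (2 * d + 1) (2 * (d + 1) + 1)) (c.comp d) (c'.comp d)))
  | loop v e c, d => (e.comp d).seq ((Prog.instr (.iconst (2 * (d + 1) + 1) 0)).seq
      (.loop (.ilt (2 * (d + 1) + 1) (2 * d + 1))
        ((Prog.instr (.isub (2 * v) (2 * (d + 1) + 1) 5)).seq
          ((c.comp (d + 2)).seq ((Prog.instr (.iconst (2 * (d + 2) + 1) 1)).seq
            (.instr (.iadd (2 * (d + 1) + 1) (2 * (d + 1) + 1) (2 * (d + 2) + 1))))))))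
  | rep e c, d => (e.comp d).seq ((Prog.instr (.rconst (2 * (d + 1) + 1) 0)).seq
      (.loop (.rlt (2 * (d + 1) + 1) (2 * d + 1))
        ((c.comp (d + 2)).seq ((Prog.instr (.rconst (2 * (d + 2) + 1) 1)).seq
          (.instr (.radd (2 * (d + 1) + 1) (2 * (d + 1) + 1) (2 * (d + 2) + 1)))))))

/-- The machine state `σ` represents the state `s`. -/
structure Rep (E H : ℕ) (σ : RamState) (s : St) : Prop where
  i : ∀ v, σ.ireg (2 * v) = s.i v
  r : ∀ v, σ.rreg (2 * v) = s.r v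
  ia : ∀ a e, OkIdx E H a e → σ.imem (loc H a e) = s.ia a e
  ra : ∀ a e, OkIdx E H a e → σ.rmem (loc H a e) = s.ra a e
  pos : σ.pos = s.pos
  h1 : σ.ireg 1 = H
  h3 : σ.ireg 3 = 16
  h5 : σ.ireg 5 = 0
  hr : σ.rreg 1 = 0

/-- `σ'` differs from `σ` only in temporaries from `d` on. -/
structure TempOnly (d : ℕ) (σ σ' : RamState) : Prop where
  imem : σ'.imem = σ.imem
  rmem : σ'.rmem = σ.rmem
  pos : σ'.pos = σ.pos
  ireg : ∀ r, (∀ k, d ≤ k → r ≠ 2 * k + 1) → σ'.ireg r = σ.ireg r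
  rreg : ∀ r, (∀ k, d ≤ k → r ≠ 2 * k + 1) → σ'.rreg r = σ.rreg r

lemma TempOnly.trans {d d' d'' : ℕ} {σ σ' σ'' : RamState} (h : TempOnly d' σ σ')
    (h' : TempOnly d'' σ' σ'') (hd : d ≤ d') (hd' : d ≤ d'') : TempOnly d σ σ'' :=
  ⟨h'.imem.trans h.imem, h'.rmem.trans h.rmem, h'.pos.trans h.pos,
    fun r hr => (h'.ireg r fun k hk => hr k (hd'.trans hk)).trans
      (h.ireg r fun k hk => hr k (hd.trans hk)),
    fun r hr => (h'.rreg r fun k hk => hr k (hd'.trans hk)).trans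
      (h.rreg r fun k hk => hr k (hd.trans hk))⟩

lemma TempOnly.rep {E H d : ℕ} {σ σ' : RamState} {s : St} (h : TempOnly d σ σ') (hd : 3 ≤ d)
    (hR : Rep E H σ s) : Rep E H σ' s where
  i v := (h.ireg _ (by omega)).trans (hR.i v)
  r v := (h.rreg _ (by omega)).trans (hR.r v)
  ia a e he := by rw [h.imem]; exact hR.ia a e he
  ra a e he := by rw [h.rmem]; exact hR.ra a e he
  pos := h.pos.trans hR.pos
  h1 := (h.ireg _ (by omega)).trans hR.h1
  h3 := (h.ireg _ (by omega)).trans hR.h3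
  h5 := (h.ireg _ (by omega)).trans hR.h5
  hr := (h.rreg _ (by omega)).trans hR.hr

lemma TempOnly.setI {d d' : ℕ} (σ : RamState) (x : ℕ) (h : d ≤ d') :
    TempOnly d σ (σ.setI (2 * d' + 1) x) :=
  ⟨rfl, rfl, rfl, fun _ hr => Function.update_of_ne (hr d' h) _ _, fun _ _ => rfl⟩

lemma TempOnly.setR {d d' : ℕ} (σ : RamState) (x : ℝ) (h : d ≤ d') :
    TempOnly d σ (σ.setR (2 * d' + 1) x) :=
  ⟨rfl, rfl, rfl, fun _ _ => rfl, fun _ hr => Function.update_of_ne (hr d' h) _ _⟩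

section Sim
variable {W E H : ℕ} {ω : Tape}

@[simp] lemma ireg_setI (σ : RamState) (d x r : ℕ) :
    (σ.setI d x).ireg r = if r = d then x else σ.ireg r := by
  simp [RamState.setI, Function.update_apply]

@[simp] lemma ireg_setR (σ : RamState) (d : ℕ) (x : ℝ) : (σ.setR d x).ireg = σ.ireg := rfl

@[simp] lemma rreg_setR (σ : RamState) (d : ℕ) (x : ℝ) (r : ℕ) :
    (σ.setR d x).rreg r = if r = d then x else σ.rreg r := by
  simp [RamState.setR, Function.update_apply]

@[simp] lemma rreg_setI (σ : RamState) (d x : ℕ) : (σ.setI d x).rreg = σ.rreg := rfl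

lemma exec_compAddr (hW : H + 16 * E + 16 ≤ W) {a d : ℕ} (hd : 3 ≤ d) {σ : RamState} {s : St}
    (hR : Rep E H σ s) (hi : OkIdx E H a (σ.ireg (2 * d + 1))) :
    ∃ σ', Exec W ω (compAddr a d) σ 4 σ' ∧ TempOnly d σ σ' ∧
      σ'.ireg (2 * d + 1) = loc H a (σ.ireg (2 * d + 1)) := by
  unfold compAddr
  by_cases ha : a = 0
  · subst ha
    refine ⟨_, by
      rw [if_pos rfl]
      exact .seq (.instr _ _) (.seq (.instr _ _) (.seq (.instr _ _) (.instr _ _))), ?_, ?_⟩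
    · exact ((TempOnly.setI _ _ le_rfl).trans (.setI _ _ le_rfl) le_rfl le_rfl).trans
        ((TempOnly.setI _ _ le_rfl).trans (.setI _ _ le_rfl) le_rfl le_rfl) le_rfl le_rfl
    · simp [Instr.apply, loc, hR.h5, show (5 : ℕ) ≠ 2 * d + 1 by omega]
  · rw [if_neg ha]
    simp only [OkIdx, ha, if_false] at hi
    refine ⟨_, .seq (.instr _ _) (.seq (.instr _ _) (.seq (.instr _ _) (.instr _ _))), ?_, ?_⟩
    · exact ((TempOnly.setI _ _ le_rfl).trans (.setI _ _ le_rfl) le_rfl le_rfl).trans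
        ((TempOnly.setI (d' := d + 1) _ _ (by omega)).trans (.setI _ _ le_rfl) le_rfl le_rfl)
        le_rfl le_rfl
    · have h1 : (1 : ℕ) ≠ 2 * d + 1 := by omega
      have h2 : 2 * d + 1 ≠ 2 * (d + 1) + 1 := by omega
      simp only [Instr.apply, ireg_setI, if_true, if_neg h1, if_neg h2, hR.h3, hR.h1, loc,
        if_neg ha]
      set x := σ.ireg (2 * d + 1)
      rw [Nat.mod_eq_of_lt (a := x * 16) (by omega), Nat.mod_eq_of_lt (a := H + x * 16) (by omega),
        Nat.mod_eq_of_lt (a := a) (by omega), Nat.mod_eq_of_lt (by omega)]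
      ring

lemma IE.exec_comp (hW : H + 16 * E + 16 ≤ W) {s : St} (e : IE) : ∀ {d : ℕ} {σ : RamState},
    3 ≤ d → Rep E H σ s → e.ok W E H s →
    ∃ σ', Exec W ω (e.comp d) σ e.cost σ' ∧ TempOnly d σ σ' ∧
      σ'.ireg (2 * d + 1) = e.eval s := by
  induction e with
  | var v =>
    intro d σ hd hR _
    exact ⟨_, .instr _ _, .setI _ _ le_rfl, by simp [Instr.apply, hR.h5, hR.i, IE.eval]⟩
  | const k =>
    intro d σ hd hR hk
    exact ⟨_, .instr _ _, .setI _ _ le_rfl, by simp [Instr.apply, IE.eval, Nat.mod_eq_of_lt hk]⟩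
  | add a b iha ihb =>
    intro d σ hd hR ⟨ha, hb, hk⟩
    obtain ⟨σ₁, e₁, t₁, v₁⟩ := iha hd hR ha
    obtain ⟨σ₂, e₂, t₂, v₂⟩ := ihb (d := d + 1) (by omega) (t₁.rep hd hR) hb
    refine ⟨_, .seq e₁ (.seq e₂ (.instr _ _)),
      (t₁.trans t₂ le_rfl (by omega)).trans (.setI _ _ le_rfl) le_rfl le_rfl, ?_⟩
    simp [Instr.apply, v₂, t₂.ireg (2 * d + 1) (by omega), v₁, IE.eval, Nat.mod_eq_of_lt hk]
  | sub a b iha ihb =>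
    intro d σ hd hR ⟨ha, hb⟩
    obtain ⟨σ₁, e₁, t₁, v₁⟩ := iha hd hR ha
    obtain ⟨σ₂, e₂, t₂, v₂⟩ := ihb (d := d + 1) (by omega) (t₁.rep hd hR) hb
    refine ⟨_, .seq e₁ (.seq e₂ (.instr _ _)),
      (t₁.trans t₂ le_rfl (by omega)).trans (.setI _ _ le_rfl) le_rfl le_rfl, ?_⟩
    simp [Instr.apply, v₂, t₂.ireg (2 * d + 1) (by omega), v₁, IE.eval]
  | half a iha =>
    intro d σ hd hR ha
    obtain ⟨σ₁, e₁, t₁, v₁⟩ := iha hd hR ha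
    refine ⟨_, .seq e₁ (.instr _ _), t₁.trans (.setI _ _ le_rfl) le_rfl le_rfl, ?_⟩
    simp [Instr.apply, v₁, IE.eval]
  | arr a e ihe =>
    intro d σ hd hR ⟨he, hi⟩
    obtain ⟨σ₁, e₁, t₁, v₁⟩ := ihe hd hR he
    obtain ⟨σ₂, e₂, t₂, v₂⟩ := exec_compAddr (ω := ω) hW hd (t₁.rep hd hR) (v₁ ▸ hi)
    refine ⟨_, .seq e₁ (.seq e₂ (.instr _ _)),
      (t₁.trans t₂ le_rfl le_rfl).trans (.setI _ _ le_rfl) le_rfl le_rfl, ?_⟩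
    simp [Instr.apply, v₂, v₁, IE.eval, t₂.imem, t₁.imem, hR.ia _ _ hi]

lemma RE.exec_comp (hW : H + 16 * E + 16 ≤ W) {s : St} (e : RE) : ∀ {d : ℕ} {σ : RamState},
    3 ≤ d → Rep E H σ s → e.ok W E H s →
    ∃ σ', Exec W ω (e.comp d) σ e.cost σ' ∧ TempOnly d σ σ' ∧
      σ'.rreg (2 * d + 1) = e.eval s := by
  have bin {a b : RE} {d : ℕ} {σ : RamState} (hd : 3 ≤ d) (hR : Rep E H σ s)
      (iha : ∀ {d : ℕ} {σ : RamState}, 3 ≤ d → Rep E H σ s → a.ok W E H s →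
        ∃ σ', Exec W ω (a.comp d) σ a.cost σ' ∧ TempOnly d σ σ' ∧ σ'.rreg (2 * d + 1) = a.eval s)
      (ihb : ∀ {d : ℕ} {σ : RamState}, 3 ≤ d → Rep E H σ s → b.ok W E H s →
        ∃ σ', Exec W ω (b.comp d) σ b.cost σ' ∧ TempOnly d σ σ' ∧ σ'.rreg (2 * d + 1) = b.eval s)
      (hab : a.ok W E H s ∧ b.ok W E H s) {p : Prog} {t : ℕ} (f : RamState → ℝ)
      (hp : ∀ σ, Exec W ω p σ t (σ.setR (2 * d + 1) (f σ)))
      {y : ℝ} (hf : ∀ σ : RamState, σ.rreg 1 = 0 → σ.rreg (2 * d + 1) = a.eval s →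
        σ.rreg (2 * (d + 1) + 1) = b.eval s → f σ = y) :
      ∃ σ', Exec W ω ((a.comp d).seq ((b.comp (d + 1)).seq p)) σ (a.cost + (b.cost + t)) σ' ∧
        TempOnly d σ σ' ∧ σ'.rreg (2 * d + 1) = y := by
    obtain ⟨σ₁, e₁, t₁, v₁⟩ := iha hd hR hab.1
    obtain ⟨σ₂, e₂, t₂, v₂⟩ := ihb (d := d + 1) (by omega) (t₁.rep hd hR) hab.2
    refine ⟨_, .seq e₁ (.seq e₂ (hp _)),
      (t₁.trans t₂ le_rfl (by omega)).trans (.setR _ _ le_rfl) le_rfl le_rfl, ?_⟩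
    simp only [rreg_setR, if_true]
    exact hf _ (t₂.rep (by omega) (t₁.rep hd hR)).hr (by rw [t₂.rreg _ (by omega), v₁]) v₂
  induction e with
  | var v =>
    intro d σ hd hR _
    exact ⟨_, .instr _ _, .setR _ _ le_rfl, by simp [Instr.apply, hR.hr, hR.r, RE.eval]⟩
  | const k =>
    intro d σ hd hR hk
    exact ⟨_, .instr _ _, .setR _ _ le_rfl, by simp [Instr.apply, RE.eval]⟩
  | cast e =>
    intro d σ hd hR he
    obtain ⟨σ₁, e₁, t₁, v₁⟩ := e.exec_comp (ω := ω) hW hd hR he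
    refine ⟨_, .seq e₁ (.instr _ _), t₁.trans (.setR _ _ le_rfl) le_rfl le_rfl, ?_⟩
    simp [Instr.apply, v₁, RE.eval]
  | add a b iha ihb =>
    intro d σ hd hR hab
    exact bin hd hR iha ihb hab _ (fun σ => .instr _ _) fun σ _ h h' => by rw [h, h']; rfl
  | sub a b iha ihb =>
    intro d σ hd hR hab
    exact bin hd hR iha ihb hab _ (fun σ => .instr _ _) fun σ _ h h' => by rw [h, h']; rfl
  | mul a b iha ihb =>
    intro d σ hd hR hab
    exact bin hd hR iha ihb hab _ (fun σ => .instr _ _) fun σ _ h h' => by rw [h, h']; rfl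
  | div a b iha ihb =>
    intro d σ hd hR hab
    exact bin hd hR iha ihb hab _ (fun σ => .instr _ _) fun σ _ h h' => by rw [h, h']; rfl
  | max a b iha ihb =>
    intro d σ hd hR hab
    classical
    refine bin hd hR iha ihb hab (t := 1 + 1) (fun σ =>
      if σ.rreg (2 * d + 1) < σ.rreg (2 * (d + 1) + 1) then σ.rreg (2 * (d + 1) + 1) + σ.rreg 1
      else σ.rreg (2 * d + 1) + σ.rreg 1) (fun σ => ?_) fun σ h0 h h' => ?_
    · by_cases hc : σ.rreg (2 * d + 1) < σ.rreg (2 * (d + 1) + 1)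
      · rw [if_pos hc]; exact .ite_true hc (.instr _ _)
      · rw [if_neg hc]; exact .ite_false hc (.instr _ _)
    · simp only [h0, h, h', add_zero, RE.eval]
      split_ifs with hc
      · exact (max_eq_right hc.le).symm
      · exact (max_eq_left (not_lt.1 hc)).symm
  | exp a iha =>
    intro d σ hd hR ha
    obtain ⟨σ₁, e₁, t₁, v₁⟩ := iha hd hR ha
    refine ⟨_, .seq e₁ (.instr _ _), t₁.trans (.setR _ _ le_rfl) le_rfl le_rfl, ?_⟩
    simp [Instr.apply, v₁, RE.eval]
  | log a iha =>
    intro d σ hd hR ha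
    obtain ⟨σ₁, e₁, t₁, v₁⟩ := iha hd hR ha
    refine ⟨_, .seq e₁ (.instr _ _), t₁.trans (.setR _ _ le_rfl) le_rfl le_rfl, ?_⟩
    simp [Instr.apply, v₁, RE.eval]
  | arr a e =>
    intro d σ hd hR ⟨he, hi⟩
    obtain ⟨σ₁, e₁, t₁, v₁⟩ := e.exec_comp (ω := ω) hW hd hR he
    obtain ⟨σ₂, e₂, t₂, v₂⟩ := exec_compAddr (ω := ω) hW hd (t₁.rep hd hR) (v₁ ▸ hi)
    refine ⟨_, .seq e₁ (.seq e₂ (.instr _ _)),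
      (t₁.trans t₂ le_rfl le_rfl).trans (.setR _ _ le_rfl) le_rfl le_rfl, ?_⟩
    simp [Instr.apply, v₂, v₁, RE.eval, t₂.rmem, t₁.rmem, hR.ra _ _ hi]

lemma loc_inj {a e a' e' : ℕ} (h : OkIdx E H a e) (h' : OkIdx E H a' e')
    (hl : loc H a e = loc H a' e') : a = a' ∧ e = e' := by
  unfold OkIdx at h h'
  unfold loc at hl
  split_ifs at h h' hl <;> omega

lemma Rep.setI {σ : RamState} {s : St} (hR : Rep E H σ s) (v x : ℕ) :
    Rep E H (σ.setI (2 * v) x) (s.setI v x) where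
  i w := by
    by_cases h : w = v
    · subst h; simp
    · simp [h, hR.i]
  r := hR.r
  ia := hR.ia
  ra := hR.ra
  pos := hR.pos
  h1 := by rw [ireg_setI, if_neg (by omega), hR.h1]
  h3 := by rw [ireg_setI, if_neg (by omega), hR.h3]
  h5 := by rw [ireg_setI, if_neg (by omega), hR.h5]
  hr := hR.hr

lemma Rep.setR {σ : RamState} {s : St} (hR : Rep E H σ s) (v : ℕ) (x : ℝ) :
    Rep E H (σ.setR (2 * v) x) (s.setR v x) where
  r w := by
    by_cases h : w = v
    · subst h; simp
    · simp [h, hR.r]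
  i := hR.i
  ia := hR.ia
  ra := hR.ra
  pos := hR.pos
  h1 := hR.h1
  h3 := hR.h3
  h5 := hR.h5
  hr := by rw [rreg_setR, if_neg (by omega), hR.hr]

lemma Rep.putI {σ : RamState} {s : St} (hR : Rep E H σ s) {a e : ℕ} (h : OkIdx E H a e) (x : ℕ) :
    Rep E H { σ with imem := Function.update σ.imem (loc H a e) x } (s.putI a e x) where
  i := hR.i
  r := hR.r
  ia a' e' h' := by
    by_cases hl : loc H a' e' = loc H a e
    · obtain ⟨rfl, rfl⟩ := loc_inj h' h hl
      simp
    · simp only [Function.update_of_ne hl, hR.ia a' e' h', St.putI_ia]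
      by_cases ha : a' = a
      · subst ha
        have : e' ≠ e := fun h => hl (h ▸ rfl)
        simp [this]
      · simp [ha]
  ra := hR.ra
  pos := hR.pos
  h1 := hR.h1
  h3 := hR.h3
  h5 := hR.h5
  hr := hR.hr

lemma Rep.putR {σ : RamState} {s : St} (hR : Rep E H σ s) {a e : ℕ} (h : OkIdx E H a e) (x : ℝ) :
    Rep E H { σ with rmem := Function.update σ.rmem (loc H a e) x } (s.putR a e x) where
  i := hR.i
  r := hR.r
  ra a' e' h' := by
    by_cases hl : loc H a' e' = loc H a e
    · obtain ⟨rfl, rfl⟩ := loc_inj h' h hl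
      simp
    · simp only [Function.update_of_ne hl, hR.ra a' e' h', St.putR_ra]
      by_cases ha : a' = a
      · subst ha
        have : e' ≠ e := fun h => hl (h ▸ rfl)
        simp [this]
      · simp [ha]
  ia := hR.ia
  pos := hR.pos
  h1 := hR.h1
  h3 := hR.h3
  h5 := hR.h5
  hr := hR.hr

/-- The temporaries below `d` agree. -/
def Keeps (d : ℕ) (σ σ' : RamState) : Prop :=
  ∀ k < d, σ'.ireg (2 * k + 1) = σ.ireg (2 * k + 1) ∧ σ'.rreg (2 * k + 1) = σ.rreg (2 * k + 1)

lemma Keeps.trans {d : ℕ} {σ σ' σ'' : RamState} (h : Keeps d σ σ') (h' : Keeps d σ' σ'') :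
    Keeps d σ σ'' := fun k hk =>
  ⟨(h' k hk).1.trans (h k hk).1, (h' k hk).2.trans (h k hk).2⟩

lemma Keeps.mono {d d' : ℕ} {σ σ' : RamState} (h : Keeps d' σ σ') (hd : d ≤ d') :
    Keeps d σ σ' := fun k hk => h k (by omega)

lemma TempOnly.keeps {d d' : ℕ} {σ σ' : RamState} (h : TempOnly d' σ σ') (hd : d ≤ d') :
    Keeps d σ σ' := fun k hk => ⟨h.ireg _ (by omega), h.rreg _ (by omega)⟩

lemma exec_loop {t : Test} {p : Prog} {N : ℕ} {P : ℕ → RamState → Prop} {c : ℕ → ℕ}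
    (hs : ∀ k < N, ∀ σ, P k σ → t.Holds σ ∧ ∃ σ', Exec W ω p σ (c k) σ' ∧ P (k + 1) σ')
    (he : ∀ σ, P N σ → ¬ t.Holds σ) :
    ∀ {j k : ℕ}, k + j = N → ∀ {σ}, P k σ → ∃ σ', Exec W ω (.loop t p) σ
      (∑ l ∈ Finset.range j, (c (k + l) + 1) + 1) σ' ∧ P N σ' := by
  intro j
  induction j with
  | zero =>
    rintro k rfl σ h
    exact ⟨σ, by simpa using Exec.loop_false (he σ h), h⟩
  | succ j ih =>
    intro k hk σ h
    obtain ⟨ht, σ₁, e₁, h₁⟩ := hs k (by omega) σ h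
    obtain ⟨σ₂, e₂, h₂⟩ := ih (k := k + 1) (by omega) h₁
    refine ⟨σ₂, ?_, h₂⟩
    have := Exec.loop_true ht e₁ e₂
    convert this using 1
    rw [Finset.sum_range_succ']
    simp only [add_zero, add_assoc, add_comm 1]
    omega

theorem Cmd.exec_comp (hW : H + 16 * E + 16 ≤ W) (c : Cmd) :
    ∀ {d : ℕ} {σ : RamState} {s : St}, 3 ≤ d → Rep E H σ s → c.ok W E H ω s →
    ∃ σ', Exec W ω (c.comp d) σ (c.cost ω s) σ' ∧ Keeps d σ σ' ∧ Rep E H σ' (c.den ω s) := by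
  induction c with
  | iset v e =>
    intro d σ s hd hR he
    obtain ⟨σ₁, e₁, t₁, v₁⟩ := e.exec_comp (ω := ω) hW hd hR he
    refine ⟨_, .seq e₁ (.instr _ _), fun k hk => ?_, ?_⟩
    · simp [Instr.apply, (t₁.keeps le_rfl k hk).1, (t₁.keeps le_rfl k hk).2,
        show 2 * k + 1 ≠ 2 * v by omega]
    · simpa [Instr.apply, v₁, (t₁.rep hd hR).h5, Cmd.den] using (t₁.rep hd hR).setI v (e.eval s)
  | rset v e =>
    intro d σ s hd hR he
    obtain ⟨σ₁, e₁, t₁, v₁⟩ := e.exec_comp (ω := ω) hW hd hR he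
    refine ⟨_, .seq e₁ (.instr _ _), fun k hk => ?_, ?_⟩
    · simp [Instr.apply, (t₁.keeps le_rfl k hk).1, (t₁.keeps le_rfl k hk).2,
        show 2 * k + 1 ≠ 2 * v by omega]
    · simpa [Instr.apply, v₁, (t₁.rep hd hR).hr, Cmd.den] using (t₁.rep hd hR).setR v (e.eval s)
  | iput a i e =>
    intro d σ s hd hR ⟨hi, he, hx⟩
    obtain ⟨σ₁, e₁, t₁, v₁⟩ := e.exec_comp (ω := ω) hW hd hR he
    have hR₁ := t₁.rep hd hR
    obtain ⟨σ₂, e₂, t₂, v₂⟩ := i.exec_comp (ω := ω) (d := d + 1) hW (by omega) hR₁ hi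
    have hR₂ := t₂.rep (by omega) hR₁
    obtain ⟨σ₃, e₃, t₃, v₃⟩ := exec_compAddr (ω := ω) (d := d + 1) hW (by omega) hR₂ (v₂ ▸ hx)
    have hR₃ := t₃.rep (by omega) hR₂
    refine ⟨_, .seq e₁ (.seq (.seq e₂ e₃) (.instr _ _)), ?_, ?_⟩
    · exact ((t₁.keeps le_rfl).trans (t₂.keeps (by omega))).trans (t₃.keeps (by omega))
    · simp only [Instr.apply, v₃, v₂, t₃.ireg (2 * d + 1) (by omega),
        t₂.ireg (2 * d + 1) (by omega), v₁]
      exact hR₃.putI hx _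
  | rput a i e =>
    intro d σ s hd hR ⟨hi, he, hx⟩
    obtain ⟨σ₁, e₁, t₁, v₁⟩ := e.exec_comp (ω := ω) hW hd hR he
    have hR₁ := t₁.rep hd hR
    obtain ⟨σ₂, e₂, t₂, v₂⟩ := i.exec_comp (ω := ω) (d := d + 1) hW (by omega) hR₁ hi
    have hR₂ := t₂.rep (by omega) hR₁
    obtain ⟨σ₃, e₃, t₃, v₃⟩ := exec_compAddr (ω := ω) (d := d + 1) hW (by omega) hR₂ (v₂ ▸ hx)
    have hR₃ := t₃.rep (by omega) hR₂
    refine ⟨_, .seq e₁ (.seq (.seq e₂ e₃) (.instr _ _)), ?_, ?_⟩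
    · exact ((t₁.keeps le_rfl).trans (t₂.keeps (by omega))).trans (t₃.keeps (by omega))
    · simp only [Instr.apply, v₃, v₂, t₃.rreg (2 * d + 1) (by omega),
        t₂.rreg (2 * d + 1) (by omega), v₁]
      exact hR₃.putR hx _
  | rand v =>
    intro d σ s hd hR _
    refine ⟨_, .instr _ _, fun k hk => ?_, ?_⟩
    · simp [Instr.apply, show 2 * k + 1 ≠ 2 * v by omega]
    · have := hR.setR v (ω σ.pos)
      simp only [Instr.apply, Cmd.den]
      rw [hR.pos] at this ⊢
      exact ⟨this.i, this.r, this.ia, this.ra, rfl, this.h1, this.h3, this.h5, this.hr⟩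
  | skip =>
    intro d σ s hd hR _
    have : TempOnly d σ (σ.setI (2 * d + 1) (0 % W)) := .setI _ _ le_rfl
    exact ⟨_, .instr _ _, this.keeps le_rfl, this.rep hd hR⟩
  | seq c c' ih ih' =>
    intro d σ s hd hR ⟨h, h'⟩
    obtain ⟨σ₁, e₁, k₁, r₁⟩ := ih hd hR h
    obtain ⟨σ₂, e₂, k₂, r₂⟩ := ih' hd r₁ h'
    exact ⟨σ₂, .seq e₁ e₂, k₁.trans k₂, r₂⟩
  | ifI a b c c' ih ih' =>
    intro d σ s hd hR ⟨ha, hb, h, h'⟩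
    obtain ⟨σ₁, e₁, t₁, v₁⟩ := a.exec_comp (ω := ω) hW hd hR ha
    have hR₁ := t₁.rep hd hR
    obtain ⟨σ₂, e₂, t₂, v₂⟩ := b.exec_comp (ω := ω) (d := d + 1) hW (by omega) hR₁ hb
    have hR₂ := t₂.rep (by omega) hR₁
    have hk := (t₁.keeps le_rfl).trans (t₂.keeps (Nat.le_succ d))
    have ht : (Test.ilt (2 * d + 1) (2 * (d + 1) + 1)).Holds σ₂ ↔ a.eval s < b.eval s := by
      simp [Test.Holds, v₂, t₂.ireg (2 * d + 1) (by omega), v₁]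
    by_cases hc : a.eval s < b.eval s
    · obtain ⟨σ₃, e₃, k₃, r₃⟩ := ih hd hR₂ (h hc)
      simp only [Cmd.cost, Cmd.den, if_pos hc]
      exact ⟨σ₃, .seq e₁ (.seq e₂ (.ite_true (ht.2 hc) e₃)), hk.trans k₃, r₃⟩
    · obtain ⟨σ₃, e₃, k₃, r₃⟩ := ih' hd hR₂ (h' hc)
      simp only [Cmd.cost, Cmd.den, if_neg hc]
      exact ⟨σ₃, .seq e₁ (.seq e₂ (.ite_false (mt ht.1 hc) e₃)), hk.trans k₃, r₃⟩
  | ifR a b c c' ih ih' =>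
    intro d σ s hd hR ⟨ha, hb, h, h'⟩
    obtain ⟨σ₁, e₁, t₁, v₁⟩ := a.exec_comp (ω := ω) hW hd hR ha
    have hR₁ := t₁.rep hd hR
    obtain ⟨σ₂, e₂, t₂, v₂⟩ := b.exec_comp (ω := ω) (d := d + 1) hW (by omega) hR₁ hb
    have hR₂ := t₂.rep (by omega) hR₁
    have hk := (t₁.keeps le_rfl).trans (t₂.keeps (Nat.le_succ d))
    have ht : (Test.rlt (2 * d + 1) (2 * (d + 1) + 1)).Holds σ₂ ↔ a.eval s < b.eval s := by
      simp [Test.Holds, v₂, t₂.rreg (2 * d + 1) (by omega), v₁]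
    by_cases hc : a.eval s < b.eval s
    · obtain ⟨σ₃, e₃, k₃, r₃⟩ := ih hd hR₂ (h hc)
      simp only [Cmd.cost, Cmd.den, if_pos hc]
      exact ⟨σ₃, .seq e₁ (.seq e₂ (.ite_true (ht.2 hc) e₃)), hk.trans k₃, r₃⟩
    · obtain ⟨σ₃, e₃, k₃, r₃⟩ := ih' hd hR₂ (h' hc)
      simp only [Cmd.cost, Cmd.den, if_neg hc]
      exact ⟨σ₃, .seq e₁ (.seq e₂ (.ite_false (mt ht.1 hc) e₃)), hk.trans k₃, r₃⟩
  | loop v e c ih =>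
    intro d σ s hd hR ⟨he, hN, hc⟩
    obtain ⟨σ₁, e₁, t₁, v₁⟩ := e.exec_comp (ω := ω) hW hd hR he
    have hR₁ := t₁.rep hd hR
    set N := e.eval s
    set f : ℕ → St → St := fun k s => c.den ω (s.setI v k)
    set σ₂ := σ₁.setI (2 * (d + 1) + 1) (0 % W)
    have t₂ : TempOnly (d + 1) σ₁ σ₂ := .setI _ _ le_rfl
    have key := exec_loop (W := W) (ω := ω) (t := .ilt (2 * (d + 1) + 1) (2 * d + 1)) (N := N)
      (p := (Prog.instr (.isub (2 * v) (2 * (d + 1) + 1) 5)).seq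
          ((c.comp (d + 2)).seq ((Prog.instr (.iconst (2 * (d + 2) + 1) 1)).seq
            (.instr (.iadd (2 * (d + 1) + 1) (2 * (d + 1) + 1) (2 * (d + 2) + 1))))))
      (P := fun k σ' => Rep E H σ' (iter f k s) ∧ σ'.ireg (2 * (d + 1) + 1) = k ∧
        σ'.ireg (2 * d + 1) = N ∧ Keeps d σ σ')
      (c := fun k => 1 + (c.cost ω ((iter f k s).setI v k) + (1 + 1)))
      ?_ ?_ (j := N) (k := 0) (by simp) (σ := σ₂)
      ⟨t₂.rep (by omega) hR₁, by simp [σ₂], by rw [t₂.ireg _ (by omega), v₁],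
        (t₁.keeps le_rfl).trans (t₂.keeps (by omega))⟩
    · obtain ⟨σ₃, e₃, r₃, -, -, k₃⟩ := key
      refine ⟨σ₃, ?_, k₃, r₃⟩
      have := Exec.seq e₁ (.seq (.instr (.iconst (2 * (d + 1) + 1) 0) σ₁) e₃)
      have hcost : (Cmd.loop v e c).cost ω s = e.cost + (1 + (∑ k ∈ Finset.range N,
          (1 + (c.cost ω ((iter f (0 + k) s).setI v (0 + k)) + (1 + 1)) + 1) + 1)) := by
        simp only [Cmd.cost, zero_add]
        congr 3
        refine Finset.sum_congr rfl fun k _ => ?_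
        simp only [f]
        omega
      rw [hcost]
      exact this
    · rintro k hk σ' ⟨hr, hk1, hk2, hkeep⟩
      refine ⟨by simp [Test.Holds, hk1, hk2, hk], ?_⟩
      have hr1 := hr.setI v k
      obtain ⟨σ₃, e₃, k₃, r₃⟩ := ih (d := d + 2) (by omega) hr1 (hc k hk)
      have hx1 := (k₃ (d + 1) (by omega)).1
      have hx0 := (k₃ d (by omega)).1
      rw [ireg_setI, if_neg (by omega)] at hx1 hx0
      have t₄ : TempOnly (d + 1) σ₃ ((σ₃.setI (2 * (d + 2) + 1) (1 % W)).setI (2 * (d + 1) + 1)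
          (k + 1)) :=
        (TempOnly.setI (d := d + 1) _ _ (by omega)).trans (.setI _ _ le_rfl) le_rfl le_rfl
      refine ⟨_, .seq (.instr _ _) (.seq (by
          simp only [Instr.apply, hk1, hr.h5, Nat.sub_zero]; exact e₃)
          (.seq (.instr _ _) (.instr _ _))), ?_⟩
      have hlt : 1 % W = 1 := Nat.mod_eq_of_lt (by omega)
      have hlt' : (k + 1) % W = k + 1 := Nat.mod_eq_of_lt (by omega)
      have : (Instr.iadd (2 * (d + 1) + 1) (2 * (d + 1) + 1) (2 * (d + 2) + 1)).apply W ω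
          ((Instr.iconst (2 * (d + 2) + 1) 1).apply W ω σ₃) =
          (σ₃.setI (2 * (d + 2) + 1) (1 % W)).setI (2 * (d + 1) + 1) (k + 1) := by
        simp only [Instr.apply, ireg_setI, if_true, if_neg (show 2 * (d + 1) + 1 ≠ 2 * (d + 2) + 1
          by omega), hx1, hk1, hlt, hlt']
      rw [this]
      refine ⟨t₄.rep (by omega) r₃, by simp, ?_, ?_⟩
      · rw [t₄.ireg _ (by omega), hx0, hk2]
      · refine hkeep.trans (Keeps.trans (fun l hl => ?_) (t₄.keeps (by omega)))
        have h1 := k₃ l (by omega)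
        rw [ireg_setI, if_neg (by omega)] at h1
        exact h1
    · rintro σ' ⟨-, h1, h2, -⟩
      simp [Test.Holds, h1, h2]
  | rep e c ih =>
    intro d σ s hd hR ⟨he, hc⟩
    obtain ⟨σ₁, e₁, t₁, v₁⟩ := e.exec_comp (ω := ω) hW hd hR he
    have hR₁ := t₁.rep hd hR
    set z := e.eval s
    set f : ℕ → St → St := fun _ s => c.den ω s
    set σ₂ := σ₁.setR (2 * (d + 1) + 1) ((0 : ℕ) : ℝ)
    have t₂ : TempOnly (d + 1) σ₁ σ₂ := .setR _ _ le_rfl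
    have key := exec_loop (W := W) (ω := ω) (t := .rlt (2 * (d + 1) + 1) (2 * d + 1)) (N := ⌈z⌉₊)
      (p := (c.comp (d + 2)).seq ((Prog.instr (.rconst (2 * (d + 2) + 1) 1)).seq
            (.instr (.radd (2 * (d + 1) + 1) (2 * (d + 1) + 1) (2 * (d + 2) + 1)))))
      (P := fun k σ' => Rep E H σ' (iter f k s) ∧ σ'.rreg (2 * (d + 1) + 1) = k ∧
        σ'.rreg (2 * d + 1) = z ∧ Keeps d σ σ')
      (c := fun k => c.cost ω (iter f k s) + (1 + 1))
      ?_ ?_ (j := ⌈z⌉₊) (k := 0) (by simp) (σ := σ₂)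
      ⟨t₂.rep (by omega) hR₁, by simp [σ₂], by rw [t₂.rreg _ (by omega), v₁],
        (t₁.keeps le_rfl).trans (t₂.keeps (by omega))⟩
    · obtain ⟨σ₃, e₃, r₃, -, -, k₃⟩ := key
      refine ⟨σ₃, ?_, k₃, r₃⟩
      have := Exec.seq e₁ (.seq (.instr (.rconst (2 * (d + 1) + 1) 0) σ₁) e₃)
      have hcost : (Cmd.rep e c).cost ω s = e.cost + (1 + (∑ k ∈ Finset.range ⌈z⌉₊,
          (c.cost ω (iter f (0 + k) s) + (1 + 1) + 1) + 1)) := by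
        simp only [Cmd.cost, zero_add]
        rfl
      rw [hcost]
      exact this
    · rintro k hk σ' ⟨hr, hk1, hk2, hkeep⟩
      refine ⟨by simpa [Test.Holds, hk1, hk2] using Nat.lt_ceil.1 hk, ?_⟩
      obtain ⟨σ₃, e₃, k₃, r₃⟩ := ih (d := d + 2) (by omega) hr (hc k hk)
      have hx1 := (k₃ (d + 1) (by omega)).2
      have hx0 := (k₃ d (by omega)).2
      have t₄ : TempOnly (d + 1) σ₃ ((σ₃.setR (2 * (d + 2) + 1) ((1 : ℕ) : ℝ)).setR
          (2 * (d + 1) + 1) ((k + 1 : ℕ) : ℝ)) :=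
        (TempOnly.setR (d := d + 1) _ _ (by omega)).trans (.setR _ _ le_rfl) le_rfl le_rfl
      refine ⟨_, .seq e₃ (.seq (.instr _ _) (.instr _ _)), ?_⟩
      have : (Instr.radd (2 * (d + 1) + 1) (2 * (d + 1) + 1) (2 * (d + 2) + 1)).apply W ω
          ((Instr.rconst (2 * (d + 2) + 1) 1).apply W ω σ₃) =
          (σ₃.setR (2 * (d + 2) + 1) ((1 : ℕ) : ℝ)).setR (2 * (d + 1) + 1)
            ((k + 1 : ℕ) : ℝ) := by
        simp only [Instr.apply, rreg_setR, if_true, if_neg (show 2 * (d + 1) + 1 ≠ 2 * (d + 2) + 1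
          by omega), hx1, hk1]
        push_cast
        rfl
      rw [this]
      refine ⟨t₄.rep (by omega) r₃, by simp, ?_, ?_⟩
      · rw [t₄.rreg _ (by omega), hx0, hk2]
      · exact hkeep.trans ((k₃.mono (by omega)).trans (t₄.keeps (by omega)))
    · rintro σ' ⟨-, h1, h2, -⟩
      simp only [Test.Holds, h1, h2, not_lt]
      exact Nat.le_ceil z

end Sim

end Loop

/-! ### One step of the primal-dual coordinate method -/

namespace Regr

open Finset

/-- Generalised Kullback-Leibler divergence between `exp u` and `exp z`. -/
noncomputable def kl (u z : ℝ) : ℝ := Real.exp u * (u - z) - Real.exp u + Real.exp z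

lemma kl_nonneg (u z : ℝ) : 0 ≤ kl u z := by
  have h := Real.add_one_le_exp (z - u)
  have h2 : Real.exp z = Real.exp u * Real.exp (z - u) := by rw [← Real.exp_add]; ring_nf
  unfold kl
  rw [h2]
  nlinarith [Real.exp_pos u]

lemma kl_lower (u z : ℝ) : Real.exp z / 2 - Real.exp u ≤ kl u z := by
  have h := Real.add_one_le_exp (z - u - Real.log 2)
  have hl : Real.log 2 < 1 := Real.log_two_lt_d9.trans (by norm_num)
  have h2 : Real.exp z = 2 * (Real.exp u * Real.exp (z - u - Real.log 2)) := by
    nth_rewrite 1 [← Real.exp_log (show (0 : ℝ) < 2 by norm_num)]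
    rw [← Real.exp_add, ← Real.exp_add]
    ring_nf
  unfold kl
  nlinarith [Real.exp_pos u]

lemma exp_le_quadratic {z : ℝ} (hz : z ≤ 1) : Real.exp z ≤ 1 + z + z ^ 2 := by
  rcases le_total (-1) z with h | h
  · have := Real.abs_exp_sub_one_sub_id_le (abs_le.2 ⟨h, hz⟩)
    linarith [(abs_le.1 this).2]
  · have : Real.exp z ≤ 1 := Real.exp_le_one_iff.2 (by linarith)
    nlinarith

lemma kl_dual_step {t θ σ v vs Z z u : ℝ} (hσ : σ * t = θ) (ht : 0 < t) (hθ0 : 0 < θ) (hθ : θ < 1)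
    (hz : z = (1 - θ) * Z + σ * v) (hu : σ * u ≤ 1) :
    kl (vs / t) (z + σ * u) ≤ (1 - θ) * kl (vs / t) Z +
      σ * ((Real.exp z - Real.exp (vs / t)) * (v - vs)) +
      (σ * ((Real.exp z - Real.exp (vs / t)) * u) + σ ^ 2 * (Real.exp z * u ^ 2)) := by
  have h1 : Real.exp (z + σ * u) ≤ Real.exp z * (1 + σ * u + (σ * u) ^ 2) := by
    rw [Real.exp_add]
    exact mul_le_mul_of_nonneg_left (exp_le_quadratic hu) (Real.exp_pos z).le
  have h2 : Real.exp z * (1 + (Z - z)) ≤ Real.exp Z := by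
    have := Real.add_one_le_exp (Z - z)
    have h : Real.exp Z = Real.exp z * Real.exp (Z - z) := by rw [← Real.exp_add]; ring_nf
    rw [h]
    exact mul_le_mul_of_nonneg_left (by linarith) (Real.exp_pos z).le
  have h2' := mul_le_mul_of_nonneg_left h2 (show 0 ≤ 1 - θ by linarith)
  have h3 := kl_nonneg z (vs / t)
  have h3' := mul_nonneg hθ0.le h3
  have hvs : θ * (vs / t) = σ * vs := by rw [← hσ]; field_simp
  have hZ : (1 - θ) * Z = z - σ * v := by linarith
  unfold kl at *
  set y := Real.exp z
  set ys := Real.exp (vs / t)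
  set r := vs / t
  have e1 : (1 - θ) * (ys * (r - Z) - ys + Real.exp Z) =
      ys * (r - θ * r - (1 - θ) * Z) - (1 - θ) * ys + (1 - θ) * Real.exp Z := by ring
  have e2 : (1 - θ) * (y * (1 + (Z - z))) = y * ((1 - θ) + (1 - θ) * Z - (1 - θ) * z) := by ring
  have e3 : θ * (y * (z - r) - y + ys) = y * (θ * z - θ * r) - θ * y + θ * ys := by ring
  rw [e1, hvs, hZ]
  rw [e2, hZ] at h2'
  rw [e3, hvs] at h3'
  nlinarith

lemma primal_step {x xs xh q w τ μ g gs : ℝ} (hτ : 0 < τ) (hw : 0 ≤ w) (hμ : 0 ≤ μ)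
    (hq : 4 * (μ * τ) ≤ q) (h1 : 0 ≤ (g + μ * w * xh + q * w / τ * (xh - x)) * (xs - xh))
    (h2 : 0 ≤ (gs + μ * w * xs) * (xh - xs)) :
    (g - gs) * (xh - xs) + q * w / (4 * τ) * (xh - x) ^ 2 ≤
      (1 - μ * τ) * (w / (2 * τ) * (x - xs) ^ 2) -
      w / (2 * τ) * ((1 - q) * (x - xs) ^ 2 + q * (xh - xs) ^ 2) := by
  have hwt : 0 ≤ w / τ := div_nonneg hw hτ.le
  have e1 : q * w / (4 * τ) = q * (w / τ) / 4 := by field_simp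
  have e2 : w / (2 * τ) = (w / τ) / 2 := by field_simp
  have e3 : q * w / τ = q * (w / τ) := by ring
  have e4 : μ * w = (μ * τ) * (w / τ) := by field_simp
  rw [e3, e4] at h1
  rw [e4] at h2
  rw [e1, e2]
  set ω := w / τ
  set k := μ * τ
  have hk : 0 ≤ k := mul_nonneg hμ hτ.le
  have h5 : 0 ≤ ω * ((q - 4 * k) * (xh - x) ^ 2) :=
    mul_nonneg hwt (mul_nonneg (by linarith) (sq_nonneg _))
  have h6 : 0 ≤ ω * k * ((x - xs) - 2 * (x - xh)) ^ 2 := by positivity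
  nlinarith

variable {ι κ : Type*} (I : Finset ι) (J : Finset κ)

/-- The potential of the method. -/
noncomputable def pot (w xs : κ → ℝ) (zs : ι → ℝ) (τ σ : ℝ) (x : κ → ℝ) (Z : ι → ℝ) : ℝ :=
  ∑ j ∈ J, w j / (2 * τ) * (x j - xs j) ^ 2 + 1 / σ * ∑ i ∈ I, kl (zs i) (Z i)

lemma pot_nonneg {w xs : κ → ℝ} {zs : ι → ℝ} {τ σ : ℝ} (hτ : 0 ≤ τ) (hσ : 0 ≤ σ)
    (hw : ∀ j ∈ J, 0 ≤ w j) (x : κ → ℝ) (Z : ι → ℝ) : 0 ≤ pot I J w xs zs τ σ x Z := by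
  unfold pot
  refine add_nonneg (sum_nonneg fun j hj => ?_) (mul_nonneg (by positivity)
    (sum_nonneg fun i _ => kl_nonneg _ _))
  have := hw j hj
  positivity

theorem pot_step [DecidableEq κ] {a : ι → κ → ℝ} {β v vs : ι → ℝ} {c w xs x xh q : κ → ℝ}
    {Z z : ι → ℝ} {t θ σ τ μ : ℝ} (hσt : σ * t = θ) (hσ : 0 < σ) (ht : 0 < t) (hθ : θ < 1)
    (hτ : 0 < τ) (hμ : 0 ≤ μ) (hθτ : θ ≤ μ * τ)
    (hv : ∀ i ∈ I, v i = ∑ j ∈ J, a i j * x j + β i)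
    (hvs : ∀ i ∈ I, vs i = ∑ j ∈ J, a i j * xs j + β i)
    (hz : ∀ i ∈ I, z i = (1 - θ) * Z i + σ * v i)
    (hw : ∀ j ∈ J, 0 ≤ w j) (hq0 : ∀ j ∈ J, 0 < q j) (hq1 : ∑ j ∈ J, q j ≤ 1)
    (hq : ∀ j ∈ J, 4 * (μ * τ) ≤ q j)
    (hd : ∀ j ∈ J, ∀ i ∈ I, σ * (a i j * (xh j - x j) / q j) ≤ 1)
    (hL : ∀ j ∈ J, 4 * τ * σ * ∑ i ∈ I, Real.exp (z i) * a i j ^ 2 ≤ w j * q j ^ 2)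
    (hprox : ∀ j ∈ J, 0 ≤ (c j + ∑ i ∈ I, a i j * Real.exp (z i) + μ * w j * xh j +
      q j * w j / τ * (xh j - x j)) * (xs j - xh j))
    (hopt : ∀ j ∈ J, 0 ≤ (c j + ∑ i ∈ I, a i j * Real.exp (vs i / t) + μ * w j * xs j) *
      (xh j - xs j)) :
    ∑ j ∈ J, q j * pot I J w xs (fun i => vs i / t) τ σ (Function.update x j (xh j))
        (fun i => z i + σ * (a i j * (xh j - x j) / q j)) +
      (1 - ∑ j ∈ J, q j) * pot I J w xs (fun i => vs i / t) τ σ x z ≤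
      (1 - θ) * pot I J w xs (fun i => vs i / t) τ σ x Z := by
  have hθ0 : 0 < θ := by rw [← hσt]; positivity
  set X : ℝ := ∑ j ∈ J, w j / (2 * τ) * (x j - xs j) ^ 2 with hX
  set δ : ι → ℝ := fun i => Real.exp (z i) - Real.exp (vs i / t) with hδ
  set d : κ → ℝ := fun j => xh j - x j with hdd
  -- the primal part
  have hprim : ∑ j ∈ J, q j * (∑ l ∈ J, w l / (2 * τ) *
        (Function.update x j (xh j) l - xs l) ^ 2) + (1 - ∑ j ∈ J, q j) * X =
      ∑ j ∈ J, w j / (2 * τ) * ((1 - q j) * (x j - xs j) ^ 2 + q j * (xh j - xs j) ^ 2) := by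
    have h1 : ∀ j ∈ J, ∑ l ∈ J, w l / (2 * τ) * (Function.update x j (xh j) l - xs l) ^ 2 =
        X + w j / (2 * τ) * ((xh j - xs j) ^ 2 - (x j - xs j) ^ 2) := by
      intro j hj
      rw [hX, ← add_sum_erase _ _ hj, ← add_sum_erase (a := j) J
        (fun j => w j / (2 * τ) * (x j - xs j) ^ 2) hj]
      have : ∑ l ∈ J.erase j, w l / (2 * τ) * (Function.update x j (xh j) l - xs l) ^ 2 =
          ∑ l ∈ J.erase j, w l / (2 * τ) * (x l - xs l) ^ 2 :=
        sum_congr rfl fun l hl => by rw [Function.update_of_ne (ne_of_mem_erase hl)]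
      rw [this, Function.update_self]
      ring
    rw [sum_congr rfl fun j hj => by rw [h1 j hj]]
    simp only [mul_add, sum_add_distrib, ← sum_mul]
    have : ∑ j ∈ J, w j / (2 * τ) * ((1 - q j) * (x j - xs j) ^ 2) =
        X - ∑ j ∈ J, q j * (w j / (2 * τ) * (x j - xs j) ^ 2) := by
      rw [hX, ← sum_sub_distrib]
      exact sum_congr rfl fun j _ => by ring
    rw [this]
    have : ∑ j ∈ J, q j * (w j / (2 * τ) * ((xh j - xs j) ^ 2 - (x j - xs j) ^ 2)) =
        ∑ j ∈ J, w j / (2 * τ) * (q j * (xh j - xs j) ^ 2) -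
        ∑ j ∈ J, q j * (w j / (2 * τ) * (x j - xs j) ^ 2) := by
      rw [← sum_sub_distrib]
      exact sum_congr rfl fun j _ => by ring
    rw [this]
    ring
  -- the dual part
  set base : ι → ℝ := fun i => (1 - θ) * kl (vs i / t) (Z i) + σ * (δ i * (v i - vs i)) with hbase
  have hdual : ∀ j ∈ J, ∑ i ∈ I, kl (vs i / t) (z i + σ * (a i j * d j / q j)) ≤
      ∑ i ∈ I, base i + (σ * (d j / q j * ∑ i ∈ I, a i j * δ i) +
        σ ^ 2 * ((d j / q j) ^ 2 * ∑ i ∈ I, Real.exp (z i) * a i j ^ 2)) := by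
    intro j hj
    rw [mul_sum, mul_sum, mul_sum, mul_sum, ← sum_add_distrib, ← sum_add_distrib]
    refine sum_le_sum fun i hi => ?_
    refine (kl_dual_step hσt ht hθ0 hθ (hz i hi) (hd j hj i hi)).trans (le_of_eq ?_)
    simp only [hbase, hδ]
    ring
  have hnoop : ∑ i ∈ I, kl (vs i / t) (z i) ≤ ∑ i ∈ I, base i := by
    refine sum_le_sum fun i hi => ?_
    have := kl_dual_step (vs := vs i) (u := 0) hσt ht hθ0 hθ (hz i hi) (by simp)
    simpa [hbase, hδ] using this
  have hbs : ∑ i ∈ I, base i = (1 - θ) * ∑ i ∈ I, kl (vs i / t) (Z i) +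
      σ * ∑ j ∈ J, (x j - xs j) * ∑ i ∈ I, a i j * δ i := by
    rw [hbase, sum_add_distrib, ← mul_sum, ← mul_sum]
    congr 2
    simp_rw [mul_sum]
    rw [sum_comm]
    refine sum_congr rfl fun i hi => ?_
    rw [hv i hi, hvs i hi, add_sub_add_right_eq_sub, ← sum_sub_distrib, mul_sum]
    exact sum_congr rfl fun j _ => by ring
  have hdsum : ∑ j ∈ J, q j * ∑ i ∈ I, kl (vs i / t) (z i + σ * (a i j * d j / q j)) +
      (1 - ∑ j ∈ J, q j) * ∑ i ∈ I, kl (vs i / t) (z i) ≤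
      (1 - θ) * ∑ i ∈ I, kl (vs i / t) (Z i) + σ * ∑ j ∈ J, ((xh j - xs j) * ∑ i ∈ I, a i j * δ i +
        q j * w j / (4 * τ) * (d j) ^ 2) := by
    calc _ ≤ ∑ j ∈ J, q j * (∑ i ∈ I, base i + (σ * (d j / q j * ∑ i ∈ I, a i j * δ i) +
        σ ^ 2 * ((d j / q j) ^ 2 * ∑ i ∈ I, Real.exp (z i) * a i j ^ 2))) +
        (1 - ∑ j ∈ J, q j) * ∑ i ∈ I, base i := by
          refine add_le_add (sum_le_sum fun j hj =>
            mul_le_mul_of_nonneg_left (hdual j hj) (hq0 j hj).le)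
            (mul_le_mul_of_nonneg_left hnoop (by linarith))
      _ = ∑ i ∈ I, base i + ∑ j ∈ J, q j * (σ * (d j / q j * ∑ i ∈ I, a i j * δ i) +
        σ ^ 2 * ((d j / q j) ^ 2 * ∑ i ∈ I, Real.exp (z i) * a i j ^ 2)) := by
          simp only [mul_add, sum_add_distrib, ← sum_mul]
          ring
      _ ≤ ∑ i ∈ I, base i + ∑ j ∈ J, σ * (d j * ∑ i ∈ I, a i j * δ i +
          q j * w j / (4 * τ) * (d j) ^ 2) := by
          refine add_le_add le_rfl (sum_le_sum fun j hj => ?_)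
          have hq' := hq0 j hj
          have hL' := hL j hj
          set L := ∑ i ∈ I, Real.exp (z i) * a i j ^ 2
          have e1 : q j * (σ * (d j / q j * ∑ i ∈ I, a i j * δ i) +
              σ ^ 2 * ((d j / q j) ^ 2 * L)) =
              σ * (d j * ∑ i ∈ I, a i j * δ i + σ * L / q j * (d j) ^ 2) := by
            field_simp
          rw [e1]
          have e2 : σ * L / q j ≤ q j * w j / (4 * τ) := by
            rw [div_le_div_iff₀ hq' (by positivity)]
            nlinarith
          have := mul_le_mul_of_nonneg_right e2 (sq_nonneg (d j))
          exact mul_le_mul_of_nonneg_left (by linarith) hσ.le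
      _ = _ := by
          rw [hbs, ← Finset.mul_sum, add_assoc, ← mul_add, ← Finset.sum_add_distrib]
          congr 2
          refine sum_congr rfl fun j _ => ?_
          simp only [hdd]
          ring
  -- combination
  have hcol : ∀ j ∈ J, (xh j - xs j) * ∑ i ∈ I, a i j * δ i + q j * w j / (4 * τ) * (d j) ^ 2 ≤
      (1 - θ) * (w j / (2 * τ) * (x j - xs j) ^ 2) -
      w j / (2 * τ) * ((1 - q j) * (x j - xs j) ^ 2 + q j * (xh j - xs j) ^ 2) := by
    intro j hj
    have h := primal_step hτ (hw j hj) hμ (hq j hj) (hprox j hj) (hopt j hj)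
    have e : ∑ i ∈ I, a i j * δ i = (c j + ∑ i ∈ I, a i j * Real.exp (z i)) -
        (c j + ∑ i ∈ I, a i j * Real.exp (vs i / t)) := by
      rw [add_sub_add_left_eq_sub, ← sum_sub_distrib]
      exact sum_congr rfl fun i _ => by simp only [hδ]; ring
    rw [e]
    have hx : 0 ≤ w j / (2 * τ) * (x j - xs j) ^ 2 := by
      have := hw j hj
      positivity
    nlinarith
  have hsum := sum_le_sum hcol
  rw [sum_sub_distrib, ← mul_sum, ← hX, ← hprim] at hsum
  have hfin := mul_le_mul_of_nonneg_left hdsum (show 0 ≤ 1 / σ by positivity)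
  rw [mul_add (1 / σ) _ (σ * _), ← mul_assoc (1 / σ) σ, one_div_mul_cancel hσ.ne', one_mul] at hfin
  have elhs : ∑ j ∈ J, q j * pot I J w xs (fun i => vs i / t) τ σ (Function.update x j (xh j))
        (fun i => z i + σ * (a i j * (xh j - x j) / q j)) +
      (1 - ∑ j ∈ J, q j) * pot I J w xs (fun i => vs i / t) τ σ x z =
      (∑ j ∈ J, q j * (∑ l ∈ J, w l / (2 * τ) *
        (Function.update x j (xh j) l - xs l) ^ 2) + (1 - ∑ j ∈ J, q j) * X) +
      1 / σ * (∑ j ∈ J, q j * ∑ i ∈ I, kl (vs i / t) (z i + σ * (a i j * d j / q j)) +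
      (1 - ∑ j ∈ J, q j) * ∑ i ∈ I, kl (vs i / t) (z i)) := by
    simp only [pot, mul_add, sum_add_distrib, hX, hdd]
    have : ∑ j ∈ J, q j * (1 / σ * ∑ i ∈ I, kl (vs i / t) (z i + σ * (a i j * (xh j - x j) / q j)))
        = 1 / σ * ∑ j ∈ J, q j *
          ∑ i ∈ I, kl (vs i / t) (z i + σ * (a i j * (xh j - x j) / q j)) := by
      rw [mul_sum]
      exact sum_congr rfl fun j _ => by ring
    rw [this]
    ring
  rw [elhs]
  unfold pot
  rw [mul_add, ← hX]
  linarith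

end Regr

/-! ### The regularised problem and the parameters of the method -/

namespace Regr

open Finset

section Params
variable (n m : ℕ) (e S : ℝ)

/-- Logarithmic factor. -/
noncomputable def pL : ℝ := 1 + Real.log (2 * n)
/-- Bound on the total weight of the sampling tree. -/
noncomputable def pT : ℝ := 1000 * pL n
/-- Number of coordinate steps per unit of time of the method. -/
noncomputable def pB : ℝ := (min n m : ℕ) + e * m + Real.exp (Real.log (m * S) / 2)
/-- Dual step size. -/
noncomputable def pσ : ℝ := 1 / (1000 * pT n * pB n m e S)
/-- Primal step size. -/
noncomputable def pτ : ℝ := 1 / (3 * pT n * pT n * m * pσ n m e S)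
/-- Primal regularisation. -/
noncomputable def pμ : ℝ := e * m / (400 * pT n * pB n m e S * pB n m e S)
/-- Dual regularisation. -/
noncomputable def pt : ℝ := e / (20 * pL n)
/-- Rate of contraction. -/
noncomputable def pθ : ℝ := pσ n m e S * pt n e
/-- Weight of the level coordinate. -/
noncomputable def pW : ℝ := 36 * pT n * pB n m e S * pB n m e S / m

end Params

section ParamLemmas
variable {n m : ℕ} {e S : ℝ}

lemma one_le_pL (hn : 0 < n) : 1 + Real.log 2 ≤ pL n := by
  have : (1 : ℝ) ≤ n := by exact_mod_cast hn
  have := Real.log_le_log (show (0 : ℝ) < 2 by norm_num) (show (2 : ℝ) ≤ 2 * n by linarith)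
  unfold pL
  linarith

lemma pL_ge (hn : 0 < n) : (1.69 : ℝ) ≤ pL n := by
  have := one_le_pL hn
  have := Real.log_two_gt_d9
  linarith

lemma pT_ge (hn : 0 < n) : (1690 : ℝ) ≤ pT n := by
  have := pL_ge hn
  unfold pT
  linarith

lemma pB_ge_min (he : 0 < e) : ((min n m : ℕ) : ℝ) ≤ pB n m e S := by
  have := Real.exp_pos (Real.log (m * S) / 2)
  have : 0 ≤ e * m := by positivity
  unfold pB
  linarith

lemma one_le_pB (hn : 0 < n) (hm : 0 < m) (he : 0 < e) : 1 ≤ pB n m e S := by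
  refine le_trans ?_ (pB_ge_min he)
  exact_mod_cast Nat.le_min.2 ⟨hn, hm⟩

lemma pB_ge_em : e * m ≤ pB n m e S := by
  have := Real.exp_pos (Real.log (m * S) / 2)
  have : (0 : ℝ) ≤ (min n m : ℕ) := by positivity
  unfold pB
  linarith

lemma pB_sq (he : 0 < e) (hS : 0 ≤ S) : m * S ≤ pB n m e S * pB n m e S := by
  have h0 : (0 : ℝ) ≤ m * S := by positivity
  have h1 : Real.exp (Real.log (m * S) / 2) ≤ pB n m e S := by
    have : (0 : ℝ) ≤ (min n m : ℕ) := by positivity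
    have : 0 ≤ e * m := by positivity
    unfold pB
    linarith
  have h2 : m * S ≤ Real.exp (Real.log (m * S) / 2) * Real.exp (Real.log (m * S) / 2) := by
    rw [← Real.exp_add, add_halves]
    rcases h0.eq_or_lt with h | h
    · rw [← h]; exact (Real.exp_pos _).le
    · rw [Real.exp_log h]
  exact h2.trans (mul_self_le_mul_self (Real.exp_pos _).le h1)

variable (hn : 0 < n) (hm : 0 < m) (he : 0 < e) (he1 : e < 1) (hS : 0 ≤ S)
include hn hm he

lemma pσ_pos : 0 < pσ n m e S := by
  have := pT_ge hn
  have := one_le_pB (S := S) hn hm he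
  unfold pσ
  positivity

lemma pτ_eq : pτ n m e S = 1000 * pB n m e S / (3 * pT n * m) := by
  have := pT_ge hn
  have := one_le_pB (S := S) hn hm he
  have : (0 : ℝ) < m := by exact_mod_cast hm
  have h1 : pT n ≠ 0 := by positivity
  have h2 : pB n m e S ≠ 0 := by positivity
  unfold pτ pσ
  field_simp

lemma pτ_pos : 0 < pτ n m e S := by
  have := pT_ge hn
  have := one_le_pB (S := S) hn hm he
  have : (0 : ℝ) < m := by exact_mod_cast hm
  rw [pτ_eq hn hm he]
  positivity

lemma pμ_pos : 0 < pμ n m e S := by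
  have := pT_ge hn
  have := one_le_pB (S := S) hn hm he
  have : (0 : ℝ) < m := by exact_mod_cast hm
  unfold pμ
  positivity

omit hm in
lemma pt_pos : 0 < pt n e := by
  have := pL_ge hn
  unfold pt
  positivity

lemma pθ_pos : 0 < pθ n m e S := mul_pos (pσ_pos hn hm he) (pt_pos hn he)

lemma pW_pos : 0 < pW n m e S := by
  have := pT_ge hn
  have := one_le_pB (S := S) hn hm he
  have : (0 : ℝ) < m := by exact_mod_cast hm
  unfold pW
  positivity

omit hm in
lemma pt_mul : pt n e * pL n = e / 20 := by
  have := pL_ge hn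
  have h : pL n ≠ 0 := by positivity
  unfold pt
  field_simp

lemma pσ_mul : pσ n m e S * (1000 * pT n * pB n m e S) = 1 := by
  have := pT_ge hn
  have := one_le_pB (S := S) hn hm he
  unfold pσ
  have : 1000 * pT n * pB n m e S ≠ 0 := by positivity
  field_simp

lemma pμτ_eq : pμ n m e S * pτ n m e S = 1000 * e / (1200 * pT n * pT n * pB n m e S) := by
  have := pT_ge hn
  have := one_le_pB (S := S) hn hm he
  have : (0 : ℝ) < m := by exact_mod_cast hm
  have h1 : pT n ≠ 0 := by positivity
  have h2 : pB n m e S ≠ 0 := by positivity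
  rw [pτ_eq hn hm he]
  unfold pμ
  field_simp
  norm_num

lemma pθ_eq : pθ n m e S = e / (20 * pT n * pT n * pB n m e S) := by
  have := pL_ge hn
  have := pT_ge hn
  have := one_le_pB (S := S) hn hm he
  have h1 : pL n ≠ 0 := by positivity
  have h2 : pB n m e S ≠ 0 := by positivity
  unfold pθ pσ pt pT
  field_simp

lemma pθ_le : pθ n m e S ≤ pμ n m e S * pτ n m e S := by
  have := pT_ge hn
  have := one_le_pB (S := S) hn hm he
  rw [pμτ_eq hn hm he, pθ_eq hn hm he, div_le_div_iff₀ (by positivity) (by positivity)]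
  have : 0 ≤ e * (pT n * pT n * pB n m e S) := by positivity
  nlinarith

include he1 in
lemma pθ_lt : pθ n m e S < 1 := by
  have hT := pT_ge hn
  have hB := one_le_pB (S := S) hn hm he
  rw [pθ_eq hn hm he, div_lt_one (by positivity)]
  have : 1 ≤ pT n * pT n := by nlinarith
  nlinarith [mul_le_mul this hB zero_le_one (by positivity)]

omit hm in
include he1 in
lemma pt_le : pt n e ≤ 1 / 20 := by
  have := pL_ge hn
  unfold pt
  rw [div_le_div_iff₀ (by positivity) (by norm_num)]
  linarith

lemma pμ_mul_W : pμ n m e S * pW n m e S = 36 / 400 * e := by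
  have := pT_ge hn
  have := one_le_pB (S := S) hn hm he
  have : (0 : ℝ) < m := by exact_mod_cast hm
  have h1 : pT n ≠ 0 := by positivity
  have h2 : pB n m e S ≠ 0 := by positivity
  unfold pμ pW
  field_simp

include hS in
lemma pμ_mul_S : pμ n m e S * S ≤ e / 400 := by
  have hT := pT_ge hn
  have hB := one_le_pB (S := S) hn hm he
  have : (0 : ℝ) < m := by exact_mod_cast hm
  have hsq := pB_sq (n := n) (m := m) he hS
  unfold pμ
  rw [div_mul_eq_mul_div, div_le_div_iff₀ (by positivity) (by norm_num)]
  have h1 := mul_le_mul_of_nonneg_left hsq (show 0 ≤ 400 * e by positivity)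
  have h2 : 0 ≤ e * (pB n m e S * pB n m e S) := by positivity
  nlinarith

end ParamLemmas

/-- A normalised instance: rows `r < 2n`, columns `j < m`, and the column `m` of the level. -/
structure Inst where
  n : ℕ
  m : ℕ
  a : ℕ → ℕ → ℝ
  β : ℕ → ℝ
  w : ℕ → ℝ
  e : ℝ
  S : ℝ

namespace Inst
variable (P : Inst)

/-- Value of row `r` without the level. -/
def row (x : ℕ → ℝ) (r : ℕ) : ℝ := ∑ j ∈ range P.m, P.a r j * x j + P.β r

/-- Value of row `r` with the level. -/
def val (x : ℕ → ℝ) (r : ℕ) : ℝ := ∑ j ∈ range (P.m + 1), P.a r j * x j + P.β r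

/-- Linear cost. -/
def c (j : ℕ) : ℝ := if j = P.m then 3 else 0

/-- Regularised objective. -/
noncomputable def obj (x : ℕ → ℝ) : ℝ :=
  ∑ j ∈ range (P.m + 1), P.c j * x j +
    pt P.n P.e * ∑ r ∈ range (2 * P.n), Real.exp (P.val x r / pt P.n P.e) +
    pμ P.n P.m P.e P.S / 2 * ∑ j ∈ range (P.m + 1), P.w j * x j ^ 2

/-- The assumptions on a normalised instance; `G` is the optimal value. -/
structure Good (G : ℝ) : Prop where
  hn : 0 < P.n
  hm : 0 < P.m
  he : 0 < P.e
  he1 : P.e < 1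
  hS : 0 ≤ P.S
  hS2 : P.S ≤ 2 * P.n
  row_le : ∀ r < 2 * P.n, ∑ j ∈ range P.m, |P.a r j| ≤ 1
  a_m : ∀ r < 2 * P.n, P.a r P.m = -3
  a_out : ∀ r j, (2 * P.n ≤ r ∨ P.m < j) → P.a r j = 0
  w_pos : ∀ j < P.m, 0 < P.w j
  w_m : P.w P.m = pW P.n P.m P.e P.S
  a_le : ∀ r < 2 * P.n, ∀ j < P.m, |P.a r j| ≤ P.w j
  a_pair : ∀ r < 2 * P.n, ∀ j < P.m, |P.a (2 * (r / 2)) j| = |P.a r j|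
  β_le : ∀ r < 2 * P.n, P.β r ≤ 0
  β_ge : ∀ r < 2 * P.n, -4 ≤ P.β r
  opt : ∃ x : ℕ → ℝ, (∀ j, x j ∈ Set.Icc (-1 : ℝ) 1) ∧ ∑ j ∈ range P.m, P.w j * x j ^ 2 ≤ P.S ∧
    ∀ r < 2 * P.n, P.row x r ≤ G
  lower : ∀ x : ℕ → ℝ, (∀ j, x j ∈ Set.Icc (-1 : ℝ) 1) → ∃ r < 2 * P.n, G ≤ P.row x r
  G_ge : -1 ≤ G
  G_le : G ≤ 1

variable {P} {G : ℝ} (hP : P.Good G)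
include hP

lemma val_eq (x : ℕ → ℝ) {r : ℕ} (hr : r < 2 * P.n) : P.val x r = P.row x r - 3 * x P.m := by
  unfold val row
  rw [sum_range_succ, hP.a_m r hr]
  ring

omit hP in
lemma sum_c (x : ℕ → ℝ) : ∑ j ∈ range (P.m + 1), P.c j * x j = 3 * x P.m := by
  unfold c
  simp

lemma abs_row_le {x : ℕ → ℝ} (hx : ∀ j, x j ∈ Set.Icc (-1 : ℝ) 1) {r : ℕ} (hr : r < 2 * P.n) :
    |∑ j ∈ range P.m, P.a r j * x j| ≤ 1 := by
  refine (abs_sum_le_sum_abs _ _).trans (le_trans (sum_le_sum fun j _ => ?_) (hP.row_le r hr))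
  rw [abs_mul]
  exact mul_le_of_le_one_right (abs_nonneg _) (abs_le.2 (hx j))

lemma abs_val_le {x : ℕ → ℝ} (hx : ∀ j, x j ∈ Set.Icc (-1 : ℝ) 1) {r : ℕ} (hr : r < 2 * P.n) :
    |P.val x r| ≤ 8 := by
  have h1 := abs_le.1 (abs_row_le hP hx hr)
  have h2 := hP.β_le r hr
  have h3 := hP.β_ge r hr
  have h4 := hx P.m
  rw [val_eq hP x hr, abs_le]
  unfold row
  constructor <;> linarith [h4.1, h4.2]

omit hP in
lemma continuous_obj : Continuous P.obj := by
  unfold obj val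
  fun_prop

omit hP in
lemma val_update (x : ℕ → ℝ) {j : ℕ} (hj : j ∈ range (P.m + 1)) (z : ℝ) (r : ℕ) :
    P.val (Function.update x j z) r = P.val x r + P.a r j * (z - x j) := by
  unfold val
  rw [← add_sum_erase _ _ hj, ← add_sum_erase (a := j) _ (fun j => P.a r j * x j) hj]
  rw [sum_congr rfl fun l hl => by rw [Function.update_of_ne (ne_of_mem_erase hl)]]
  rw [Function.update_self]
  ring

lemma exists_minimizer : ∃ xs : ℕ → ℝ, (∀ j, xs j ∈ Set.Icc (-1 : ℝ) 1) ∧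
    (∀ x : ℕ → ℝ, (∀ j, x j ∈ Set.Icc (-1 : ℝ) 1) → P.obj xs ≤ P.obj x) ∧
    ∀ j ∈ range (P.m + 1), ∀ z ∈ Set.Icc (-1 : ℝ) 1,
      0 ≤ (P.c j + ∑ r ∈ range (2 * P.n), P.a r j * Real.exp (P.val xs r / pt P.n P.e) +
        pμ P.n P.m P.e P.S * P.w j * xs j) * (z - xs j) := by
  have hcomp : IsCompact (Set.univ.pi fun _ : ℕ => Set.Icc (-1 : ℝ) 1) :=
    isCompact_univ_pi fun _ => isCompact_Icc
  obtain ⟨xs, hxs, hmin⟩ := hcomp.exists_isMinOn ⟨fun _ => 0, fun _ _ => by norm_num⟩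
    (continuous_obj (P := P)).continuousOn
  have hbox : ∀ j, xs j ∈ Set.Icc (-1 : ℝ) 1 := fun j => hxs j trivial
  have hmin' : ∀ x : ℕ → ℝ, (∀ j, x j ∈ Set.Icc (-1 : ℝ) 1) → P.obj xs ≤ P.obj x :=
    fun x hx => hmin fun j _ => hx j
  refine ⟨xs, hbox, hmin', fun j hj z hz => ?_⟩
  have ht := pt_pos hP.hn hP.he
  set t := pt P.n P.e
  set μ := pμ P.n P.m P.e P.S
  set d := z - xs j
  have hsum (f : ℕ → ℝ → ℝ) (s : ℝ) :
      ∑ l ∈ range (P.m + 1), f l (Function.update xs j (xs j + s * d) l) =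
        f j (xs j + s * d) + ∑ l ∈ (range (P.m + 1)).erase j, f l (xs l) := by
    rw [← add_sum_erase _ _ hj, Function.update_self]
    rw [sum_congr rfl fun l hl => by rw [Function.update_of_ne (ne_of_mem_erase hl)]]
  have hform : ∀ s, P.obj (Function.update xs j (xs j + s * d)) =
      (P.c j * (xs j + s * d) + ∑ l ∈ (range (P.m + 1)).erase j, P.c l * xs l) +
      t * ∑ r ∈ range (2 * P.n), Real.exp ((P.val xs r + P.a r j * (s * d)) / t) +
      μ / 2 * (P.w j * (xs j + s * d) ^ 2 +
        ∑ l ∈ (range (P.m + 1)).erase j, P.w l * xs l ^ 2) := by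
    intro s
    unfold obj
    rw [hsum (fun l y => P.c l * y), hsum (fun l y => P.w l * y ^ 2)]
    simp only [val_update xs hj, add_sub_cancel_left]
    rfl
  have hder : HasDerivAt (fun s => P.obj (Function.update xs j (xs j + s * d)))
      ((P.c j + ∑ r ∈ range (2 * P.n), P.a r j * Real.exp (P.val xs r / t) + μ * P.w j * xs j) * d)
      0 := by
    simp only [hform]
    have h1 : HasDerivAt (fun s : ℝ => xs j + s * d) d 0 := by
      simpa using ((hasDerivAt_id (0 : ℝ)).mul_const d).const_add (xs j)
    have h2 : ∀ r ∈ range (2 * P.n),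
        HasDerivAt (fun s : ℝ => Real.exp ((P.val xs r + P.a r j * (s * d)) / t))
        (Real.exp (P.val xs r / t) * (P.a r j * d / t)) 0 := by
      intro r _
      have h3 : HasDerivAt (fun s : ℝ => (P.val xs r + P.a r j * (s * d)) / t)
          (P.a r j * d / t) 0 := by
        simpa using ((((hasDerivAt_id (0 : ℝ)).mul_const d).const_mul (P.a r j)).const_add
          (P.val xs r)).div_const t
      simpa using h3.exp
    have h4 := HasDerivAt.fun_sum h2
    have h5 := (((h1.const_mul (P.c j)).add_const
      (∑ l ∈ (range (P.m + 1)).erase j, P.c l * xs l)).add (h4.const_mul t)).add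
      ((((h1.fun_pow 2).const_mul (P.w j)).add_const
        (∑ l ∈ (range (P.m + 1)).erase j, P.w l * xs l ^ 2)).const_mul (μ / 2))
    refine h5.congr_deriv ?_
    simp only [zero_mul, add_zero]
    have : t * ∑ r ∈ range (2 * P.n), Real.exp (P.val xs r / t) * (P.a r j * d / t) =
        (∑ r ∈ range (2 * P.n), P.a r j * Real.exp (P.val xs r / t)) * d := by
      rw [mul_sum, sum_mul]
      exact sum_congr rfl fun r _ => by field_simp
    rw [this]
    push_cast
    ring
  have hslope := hder.tendsto_slope_zero_right
  refine ge_of_tendsto hslope ?_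
  filter_upwards [Ioc_mem_nhdsGT (show (0 : ℝ) < 1 by norm_num)] with s hs
  simp only [zero_add, zero_mul, add_zero, Function.update_eq_self, smul_eq_mul]
  refine mul_nonneg (inv_nonneg.2 hs.1.le) (sub_nonneg.2 (hmin' _ fun l => ?_))
  by_cases hl : l = j
  · subst hl
    rw [Function.update_self]
    have h1 := hbox l
    constructor <;> simp only [d] <;> nlinarith [h1.1, h1.2, hz.1, hz.2, hs.1, hs.2]
  · rw [Function.update_of_ne hl]
    exact hbox l

/-- The minimiser of the regularised problem. -/
structure Saddle (P : Inst) (G : ℝ) (xs : ℕ → ℝ) : Prop where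
  box : ∀ j, xs j ∈ Set.Icc (-1 : ℝ) 1
  opt : ∀ j ∈ range (P.m + 1), ∀ z ∈ Set.Icc (-1 : ℝ) 1,
    0 ≤ (P.c j + ∑ r ∈ range (2 * P.n), P.a r j * Real.exp (P.val xs r / pt P.n P.e) +
      pμ P.n P.m P.e P.S * P.w j * xs j) * (z - xs j)
  sum_le : ∑ r ∈ range (2 * P.n), Real.exp (P.val xs r / pt P.n P.e) ≤ 2
  norm_le : ∑ j ∈ range (P.m + 1), P.w j * xs j ^ 2 ≤
    80 * pT P.n * pB P.n P.m P.e P.S * pB P.n P.m P.e P.S / P.m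
  row_le : ∀ r < 2 * P.n, P.row xs r ≤ G + P.e / 10

theorem exists_saddle : ∃ xs, Saddle P G xs := by
  obtain ⟨xs, hbox, hmin, hopt⟩ := exists_minimizer hP
  have hn := hP.hn
  have hm := hP.hm
  have he := hP.he
  have he1 := hP.he1
  have hS := hP.hS
  have ht := pt_pos hn he
  have htl := pt_mul hn he
  have ht2 := pt_le hn he he1
  have hL := pL_ge hn
  have hμ := pμ_pos (S := P.S) hn hm he
  have hμW := pμ_mul_W (S := P.S) hn hm he
  have hμS := pμ_mul_S hn hm he hS
  obtain ⟨x0, hx0, hx0S, hx0G⟩ := hP.opt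
  have hlogL : Real.log (2 * P.n) = pL P.n - 1 := by unfold pL; ring
  have hn2 : (0 : ℝ) < 2 * P.n := by have : (0 : ℝ) < P.n := by exact_mod_cast hn
                                     positivity
  set t := pt P.n P.e
  set μ := pμ P.n P.m P.e P.S with hμdef
  set l1 := (G + t * (pL P.n - 1)) / 3 with hl1
  have htlog : t * (pL P.n - 1) = P.e / 20 - t := by linarith
  have hl1' : l1 ∈ Set.Icc (-1 : ℝ) 1 := by
    have h1 := hP.G_ge
    have h2 := hP.G_le
    have h3 : 0 ≤ t * (pL P.n - 1) := mul_nonneg ht.le (by linarith)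
    rw [hl1]
    constructor <;> linarith
  set x1 := Function.update x0 P.m l1 with hx1def
  have hx1 : ∀ j, x1 j ∈ Set.Icc (-1 : ℝ) 1 := by
    intro j
    by_cases hj : j = P.m
    · rw [hj, hx1def, Function.update_self]; exact hl1'
    · rw [hx1def, Function.update_of_ne hj]; exact hx0 j
  have hx1r : ∀ r, P.row x1 r = P.row x0 r := by
    intro r
    unfold row
    congr 1
    refine sum_congr rfl fun j hj => ?_
    rw [hx1def, Function.update_of_ne (mem_range.1 hj).ne]
  have hobj1 : P.obj x1 ≤ G + P.e / 10 := by
    have hexp : ∑ r ∈ range (2 * P.n), Real.exp (P.val x1 r / t) ≤ 1 := by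
      calc _ ≤ ∑ r ∈ range (2 * P.n), (2 * P.n : ℝ)⁻¹ := by
            refine sum_le_sum fun r hr => ?_
            rw [← Real.exp_log (inv_pos.2 hn2), Real.exp_le_exp, Real.log_inv, hlogL,
              div_le_iff₀ ht, val_eq hP x1 (mem_range.1 hr), hx1r]
            have := hx0G r (mem_range.1 hr)
            have h3 : x1 P.m = l1 := by rw [hx1def, Function.update_self]
            rw [h3, hl1]
            linarith
        _ = 1 := by
            rw [sum_const, card_range, nsmul_eq_mul]
            push_cast
            exact mul_inv_cancel₀ hn2.ne'
    have hreg : ∑ j ∈ range (P.m + 1), P.w j * x1 j ^ 2 ≤ P.S + pW P.n P.m P.e P.S := by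
      rw [sum_range_succ]
      refine add_le_add (le_trans (le_of_eq ?_) hx0S) ?_
      · refine sum_congr rfl fun j hj => ?_
        rw [hx1def, Function.update_of_ne (mem_range.1 hj).ne]
      · rw [hP.w_m]
        refine mul_le_of_le_one_right (pW_pos hn hm he).le ?_
        have := hx1 P.m
        exact (sq_le_one_iff_abs_le_one _).2 (abs_le.2 this)
    unfold obj
    rw [sum_c]
    have h3 : x1 P.m = l1 := by rw [hx1def, Function.update_self]
    have h5 := mul_le_mul_of_nonneg_left hreg hμ.le
    have h6 := mul_le_mul_of_nonneg_left hexp ht.le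
    rw [h3, hl1]
    change 3 * ((G + t * (pL P.n - 1)) / 3) + t * _ + μ / 2 * _ ≤ _
    rw [mul_add, hμW] at h5
    linarith
  have hxs1 := (hmin x1 hx1).trans hobj1
  have hlow : ∀ r < 2 * P.n, P.row xs r + t +
      μ / 2 * ∑ j ∈ range (P.m + 1), P.w j * xs j ^ 2 ≤ P.obj xs := by
    intro r hr
    have h1 : Real.exp (P.val xs r / t) ≤ ∑ r ∈ range (2 * P.n), Real.exp (P.val xs r / t) :=
      single_le_sum (f := fun r => Real.exp (P.val xs r / t)) (fun r _ => (Real.exp_pos _).le)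
        (mem_range.2 hr)
    have h2 := Real.add_one_le_exp (P.val xs r / t)
    have h3 := mul_le_mul_of_nonneg_left (h2.trans h1) ht.le
    rw [mul_add, mul_div_cancel₀ _ ht.ne', val_eq hP xs hr] at h3
    unfold obj
    rw [sum_c]
    change _ ≤ 3 * xs P.m + t * _ + μ / 2 * _
    linarith
  have hnn : 0 ≤ μ / 2 * ∑ j ∈ range (P.m + 1), P.w j * xs j ^ 2 := by
    refine mul_nonneg (by positivity) (sum_nonneg fun j hj => mul_nonneg ?_ (sq_nonneg _))
    rcases (Nat.lt_succ_iff.1 (mem_range.1 hj)).lt_or_eq with h | h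
    · exact (hP.w_pos j h).le
    · rw [h, hP.w_m]; exact (pW_pos hn hm he).le
  have hrow : ∀ r < 2 * P.n, P.row xs r ≤ G + P.e / 10 := fun r hr => by
    linarith [hlow r hr]
  refine ⟨xs, hbox, hopt, ?_, ?_, hrow⟩
  · by_cases h1 : xs P.m = 1
    · calc _ ≤ ∑ r ∈ range (2 * P.n), (2 * P.n : ℝ)⁻¹ := by
            refine sum_le_sum fun r hr => ?_
            have hr' := mem_range.1 hr
            rw [← Real.exp_log (inv_pos.2 hn2), Real.exp_le_exp, Real.log_inv, hlogL,
              div_le_iff₀ ht, val_eq hP xs hr', h1]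
            have := (abs_le.1 (abs_row_le hP hbox hr')).2
            have h3 := hP.β_le r hr'
            have : P.row xs r ≤ 1 := by unfold row; linarith
            linarith
        _ = 1 := by
            rw [sum_const, card_range, nsmul_eq_mul]
            push_cast
            exact mul_inv_cancel₀ hn2.ne'
        _ ≤ 2 := by norm_num
    · have h2 : xs P.m < 1 := lt_of_le_of_ne (hbox P.m).2 h1
      have h3 := hopt P.m (by simp) 1 (by norm_num)
      have h4 := nonneg_of_mul_nonneg_left h3 (by linarith)
      have h5 : ∑ r ∈ range (2 * P.n), P.a r P.m * Real.exp (P.val xs r / t) =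
          -3 * ∑ r ∈ range (2 * P.n), Real.exp (P.val xs r / t) := by
        rw [mul_sum]
        exact sum_congr rfl fun r hr => by rw [hP.a_m r (mem_range.1 hr)]
      rw [h5, hP.w_m, hμW] at h4
      have h6 : P.c P.m = 3 := by simp [c]
      rw [h6] at h4
      have h7 : 36 / 400 * P.e * xs P.m ≤ 1 := by
        have := (hbox P.m).2
        nlinarith
      change ∑ r ∈ range (2 * P.n), Real.exp (P.val xs r / t) ≤ 2
      linarith
  · obtain ⟨r, hr, hGr⟩ := hP.lower xs hbox
    have h1 := hlow r hr
    have h2 : μ * ∑ j ∈ range (P.m + 1), P.w j * xs j ^ 2 ≤ P.e / 5 := by linarith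
    have hT := pT_ge hn
    have hB := one_le_pB (S := P.S) hn hm he
    have hm' : (0 : ℝ) < P.m := by exact_mod_cast hm
    have h3 : μ * (80 * pT P.n * pB P.n P.m P.e P.S * pB P.n P.m P.e P.S / P.m) = P.e / 5 := by
      have h1 : pT P.n ≠ 0 := by positivity
      have h2 : pB P.n P.m P.e P.S ≠ 0 := by positivity
      rw [hμdef]
      unfold pμ
      field_simp
      norm_num
    exact le_of_mul_le_mul_left (h2.trans h3.ge) hμ

end Inst

end Regr

/-! ### The coordinate method -/

namespace Regr

open Finset

/-- State of the method. -/
structure AS where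
  x : ℕ → ℝ
  v : ℕ → ℝ
  ρ : ℕ → ℝ
  leaf : ℕ → ℝ
  κ : ℝ
  cnt : ℝ
  frz : Prop

namespace Inst
variable (P : Inst)

/-- Dual step size. -/
noncomputable abbrev σ : ℝ := pσ P.n P.m P.e P.S
/-- Primal step size. -/
noncomputable abbrev τ : ℝ := pτ P.n P.m P.e P.S
/-- Primal regularisation. -/
noncomputable abbrev μ : ℝ := pμ P.n P.m P.e P.S
/-- Dual regularisation. -/
noncomputable abbrev t : ℝ := pt P.n P.e
/-- Rate of contraction. -/
noncomputable abbrev θ : ℝ := pθ P.n P.m P.e P.S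
/-- Bound on the total weight of the sampling tree. -/
noncomputable abbrev T0 : ℝ := pT P.n
/-- Length of a batch. -/
abbrev B0 : ℕ := min P.n P.m

/-- Probability of column `j` in row `i` of the sampler; row `n` is an artificial row. -/
noncomputable def wt (i j : ℕ) : ℝ :=
  if i < P.n then if j < P.m then |P.a (2 * i) j| else 0
  else if j < P.m then 1 / (2 * P.m) else 1 / (2 * P.B0)

/-- Total weight of the leaves. -/
noncomputable def tot (leaf : ℕ → ℝ) : ℝ := ∑ l ∈ range (2 * P.n + 1), leaf l

/-- Probability of the choice of column `j`. -/
noncomputable def q (leaf : ℕ → ℝ) (j : ℕ) : ℝ :=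
  (∑ l ∈ range (2 * P.n + 1), leaf l * P.wt (l / 2) j) / P.tot leaf

/-- Logarithm of the current dual variable. -/
noncomputable def z (s : AS) (r : ℕ) : ℝ := (s.v r + s.κ * s.ρ r) / P.t

/-- Gradient. -/
noncomputable def g (s : AS) (j : ℕ) : ℝ :=
  P.c j + ∑ r ∈ range (2 * P.n), P.a r j * Real.exp (P.z s r)

/-- New value of coordinate `j`. -/
noncomputable def xh (s : AS) (j : ℕ) : ℝ :=
  max (-1) (min 1 ((P.q s.leaf j * P.w j / P.τ * s.x j - P.g s j) /
    (P.q s.leaf j * P.w j / P.τ + P.μ * P.w j)))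

/-- Weight of a leaf after it is updated. -/
noncomputable def newLeaf (v ρ κ : ℝ) : ℝ :=
  max (Real.exp ((v + κ * ρ) / P.t)) (1 / (2 * P.n))

/-- Step in coordinate `j`. -/
noncomputable def core (s : AS) (j : ℕ) : AS :=
  let d := P.xh s j - s.x j
  let v := fun r => s.v r + P.a r j * d
  let ρ := fun r => s.ρ r + P.a r j * d * (P.θ / P.q s.leaf j - 1) / s.κ
  let κ := s.κ * (1 - P.θ)
  { x := if j ≤ P.m then Function.update s.x j (P.xh s j) else s.x
    v := v
    ρ := ρ
    leaf := fun r => open Classical in if P.a r j = 0 then s.leaf r else P.newLeaf (v r) (ρ r) κ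
    κ := κ
    cnt := s.cnt + if j = P.m then 1 else 0
    frz := s.frz }

/-- Recompute all leaves. -/
noncomputable def refresh (s : AS) : AS :=
  { s with leaf := fun r => if r < 2 * P.n then P.newLeaf (s.v r) (s.ρ r) s.κ else s.leaf r }

/-- Number of batches, before rounding. -/
noncomputable def zb : ℝ :=
  2 * Real.log (1000000 * (P.m + P.n : ℕ) / P.e) / (P.θ * P.B0)

/-- Bound on the number of steps in the level coordinate. -/
noncomputable def cap : ℝ := 4 * (P.zb + 1)

/-- The initial state. -/
noncomputable def init : AS where
  x _ := 0
  v := P.β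
  ρ r := - (P.t * Real.log (2 * P.n)) - P.β r
  leaf r := if r = 2 * P.n then 2 else 0
  κ := 1 - P.θ
  cnt := 0
  frz := False

/-- Deterministic invariant; `a` bounds the number of steps since the last refresh. -/
structure Inv (a : ℕ) (s : AS) : Prop where
  box : ∀ j, s.x j ∈ Set.Icc (-1 : ℝ) 1
  v : ∀ r < 2 * P.n, s.v r = P.val s.x r
  κ : 0 < s.κ
  leaf_last : s.leaf (2 * P.n) = 2
  leaf : ∀ r < 2 * P.n, ∃ d ≤ a, s.leaf r = P.newLeaf (s.v r) (s.ρ r) (s.κ / (1 - P.θ) ^ d) ∧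
    (d = 0 ∨ s.leaf r ≤ P.T0)
  cnt : 0 ≤ s.cnt

/-- The potential of a state. -/
noncomputable def Φ (xs : ℕ → ℝ) (s : AS) : ℝ :=
  pot (range (2 * P.n)) (range (P.m + 1)) P.w xs (fun r => P.val xs r / P.t) P.τ P.σ s.x
    (fun r => (s.v r + s.κ / (1 - P.θ) * s.ρ r) / P.t)

variable {P} {G : ℝ} (hP : P.Good G)
include hP

lemma σ_pos : 0 < P.σ := pσ_pos hP.hn hP.hm hP.he
lemma τ_pos : 0 < P.τ := pτ_pos hP.hn hP.hm hP.he
lemma μ_pos : 0 < P.μ := pμ_pos hP.hn hP.hm hP.he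
lemma t_pos : 0 < P.t := pt_pos hP.hn hP.he
lemma θ_pos : 0 < P.θ := pθ_pos hP.hn hP.hm hP.he
lemma θ_lt : P.θ < 1 := pθ_lt hP.hn hP.hm hP.he hP.he1
lemma T0_ge : 1690 ≤ P.T0 := pT_ge hP.hn
lemma one_le_B0 : 1 ≤ P.B0 := Nat.le_min.2 ⟨hP.hn, hP.hm⟩

lemma σ_mul_B0 : P.σ * (1000 * P.T0 * P.B0) ≤ 1 := by
  have h := pσ_mul (S := P.S) hP.hn hP.hm hP.he
  have hσ := σ_pos hP
  have hT := T0_ge hP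
  rw [← h]
  have := pB_ge_min (n := P.n) (m := P.m) (S := P.S) hP.he
  gcongr

lemma w_nonneg : ∀ j ∈ range (P.m + 1), 0 < P.w j := by
  intro j hj
  rcases (Nat.lt_succ_iff.1 (mem_range.1 hj)).lt_or_eq with h | h
  · exact hP.w_pos j h
  · rw [h, hP.w_m]; exact pW_pos hP.hn hP.hm hP.he

/-! ### Drift of the dual variables between updates -/

omit hP in
lemma newLeaf_pos (v ρ κ : ℝ) : 0 < P.newLeaf v ρ κ :=
  lt_max_of_lt_left (Real.exp_pos _)

lemma half_inv_eq : (1 / (2 * P.n) : ℝ) = Real.exp (-Real.log (2 * P.n)) := by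
  have : (0 : ℝ) < P.n := by exact_mod_cast hP.hn
  rw [Real.exp_neg, Real.exp_log (by positivity), one_div]

lemma newLeaf_eq (v ρ κ : ℝ) :
    P.newLeaf v ρ κ = Real.exp (max ((v + κ * ρ) / P.t) (-Real.log (2 * P.n))) := by
  unfold newLeaf
  rw [half_inv_eq hP, Real.exp_monotone.map_max]

lemma drift_bound {d : ℕ} (hd : d ≤ P.B0) : 0 ≤ 1 - (1 - P.θ) ^ d ∧
    (1 - (1 - P.θ) ^ d) / P.t ≤ 1 / (1000 * P.T0) := by
  have hθ := θ_pos hP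
  have hθ1 := θ_lt hP
  have ht := t_pos hP
  have hT := T0_ge hP
  have hσ := σ_pos hP
  refine ⟨sub_nonneg.2 (pow_le_one₀ (by linarith) (by linarith)), ?_⟩
  have h1 := one_add_mul_le_pow (show (-2 : ℝ) ≤ -P.θ by linarith) d
  have h2 : (d : ℝ) * P.θ ≤ P.B0 * P.θ := by
    have : (d : ℝ) ≤ P.B0 := by exact_mod_cast hd
    gcongr
  rw [div_le_div_iff₀ ht (by positivity), one_mul]
  have h3 : 1 - (1 - P.θ) ^ d ≤ P.B0 * P.θ := by
    have : (1 + -P.θ) ^ d = (1 - P.θ) ^ d := by ring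
    rw [this] at h1
    linarith
  have h4 := mul_le_mul_of_nonneg_right (σ_mul_B0 hP) ht.le
  have h5 : P.B0 * P.θ = P.σ * P.B0 * P.t := by
    change (P.B0 : ℝ) * (P.σ * P.t) = _
    ring
  have := mul_le_mul_of_nonneg_right h3 (show 0 ≤ 1000 * P.T0 by positivity)
  rw [h5] at this
  nlinarith

lemma t_mul_log : 0 ≤ P.t * Real.log (2 * P.n) ∧ P.t * Real.log (2 * P.n) ≤ 1 / 20 := by
  have h := pt_mul hP.hn hP.he
  have ht := t_pos hP
  have he1 := hP.he1
  have h1 := pL_ge hP.hn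
  have h2 : Real.log (2 * P.n) = pL P.n - 1 := by unfold pL; ring
  rw [h2]
  refine ⟨mul_nonneg ht.le (by linarith), ?_⟩
  change P.t * pL P.n = _ at h
  nlinarith

lemma split_old {v ρ κ : ℝ} {d : ℕ} : v + κ * ρ =
    (1 - P.θ) ^ d * (v + κ / (1 - P.θ) ^ d * ρ) + (1 - (1 - P.θ) ^ d) * v := by
  have : (1 - P.θ) ^ d ≠ 0 := pow_ne_zero _ (by linarith [θ_lt hP])
  field_simp
  ring

lemma exp_le_newLeaf {v ρ κ : ℝ} (hv : |v| ≤ 8) {d : ℕ} (hd : d ≤ P.B0) :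
    Real.exp ((v + κ * ρ) / P.t) ≤ 3 * P.newLeaf v ρ (κ / (1 - P.θ) ^ d) := by
  have ht := t_pos hP
  have hT := T0_ge hP
  obtain ⟨h0, h1⟩ := drift_bound hP hd
  have hl := t_mul_log hP
  rw [newLeaf_eq hP, split_old hP (d := d)]
  set po := v + κ / (1 - P.θ) ^ d * ρ
  set α := 1 - (1 - P.θ) ^ d with hα
  have hα1 : (1 - P.θ) ^ d = 1 - α := by rw [hα]; ring
  rw [hα1]
  set M := max (po / P.t) (-Real.log (2 * P.n)) with hM
  have hM1 : po / P.t ≤ M := le_max_left _ _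
  have hM2 : -Real.log (2 * P.n) ≤ M := le_max_right _ _
  have hle : ((1 - α) * po + α * v) / P.t ≤ M + 1 := by
    have e : ((1 - α) * po + α * v) / P.t = (1 - α) * (po / P.t) + α / P.t * v := by ring
    have hα2 : 0 ≤ 1 - α := by rw [← hα1]; exact pow_nonneg (by linarith [θ_lt hP]) _
    have h2 : (1 - α) * (po / P.t) ≤ (1 - α) * M := mul_le_mul_of_nonneg_left hM1 hα2
    have h3 : α / P.t * (v - P.t * M) ≤ 1 / (1000 * P.T0) * 9 := by
      refine mul_le_mul_of_nonneg h1 ?_ (div_nonneg h0 ht.le) (by norm_num)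
      have := (abs_le.1 hv).2
      nlinarith
    have h4 : α / P.t * (P.t * M) = α * M := by field_simp
    have h5 : 1 / (1000 * P.T0) * 9 ≤ 1 := by
      rw [div_mul_eq_mul_div, div_le_one (by positivity)]
      linarith
    rw [e]
    nlinarith
  calc Real.exp _ ≤ Real.exp (M + 1) := Real.exp_le_exp.2 hle
    _ = Real.exp 1 * Real.exp M := by rw [Real.exp_add]; ring
    _ ≤ 3 * Real.exp M := by
        have := Real.exp_one_lt_d9
        gcongr
        linarith

lemma newLeaf_le {v ρ κ : ℝ} (hv : |v| ≤ 8) {d : ℕ} (hd : d ≤ P.B0)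
    (h : d = 0 ∨ P.newLeaf v ρ (κ / (1 - P.θ) ^ d) ≤ P.T0) :
    P.newLeaf v ρ (κ / (1 - P.θ) ^ d) ≤ 3 * P.newLeaf v ρ κ := by
  rcases h with rfl | h
  · simp only [pow_zero, div_one]
    linarith [newLeaf_pos (P := P) v ρ κ]
  have ht := t_pos hP
  have hT := T0_ge hP
  obtain ⟨h0, h1⟩ := drift_bound hP hd
  have hl := t_mul_log hP
  rw [newLeaf_eq hP] at h
  rw [newLeaf_eq hP, newLeaf_eq hP]
  set po := v + κ / (1 - P.θ) ^ d * ρ with hpo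
  set M := max ((v + κ * ρ) / P.t) (-Real.log (2 * P.n)) with hM
  have hM1 : (v + κ * ρ) / P.t ≤ M := le_max_left _ _
  have hM2 : -Real.log (2 * P.n) ≤ M := le_max_right _ _
  rw [split_old hP (d := d), ← hpo] at hM1
  set α := 1 - (1 - P.θ) ^ d with hα
  have hα1 : (1 - P.θ) ^ d = 1 - α := by rw [hα]; ring
  rw [hα1] at hM1
  have hpoT : po / P.t ≤ P.T0 := by
    have h2 := (le_max_left (po / P.t) (-Real.log (2 * P.n))).trans
      ((Real.le_log_iff_exp_le (by positivity)).2 h)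
    exact h2.trans ((Real.log_le_sub_one_of_pos (by positivity)).trans (by linarith))
  have hle : max (po / P.t) (-Real.log (2 * P.n)) ≤ M + 1 := by
    refine max_le ?_ (by linarith)
    have e : ((1 - α) * po + α * v) / P.t = po / P.t - α / P.t * (po - v) := by ring
    rw [e] at hM1
    have h3 : α / P.t * (po - v) ≤ 1 / (1000 * P.T0) * (P.T0 + 8) := by
      refine mul_le_mul_of_nonneg h1 ?_ (div_nonneg h0 ht.le) (by linarith)
      have h4 := (abs_le.1 hv).1
      have h5 := pt_le hP.hn hP.he hP.he1
      have h6 : po ≤ P.T0 * P.t := (div_le_iff₀ ht).1 hpoT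
      have h7 : P.T0 * P.t ≤ P.T0 * 1 := by
        refine mul_le_mul_of_nonneg_left ?_ (by linarith)
        change P.t ≤ _ at h5
        linarith
      linarith
    have h5 : 1 / (1000 * P.T0) * (P.T0 + 8) ≤ 1 := by
      rw [div_mul_eq_mul_div, div_le_one (by positivity)]
      linarith
    linarith
  calc Real.exp _ ≤ Real.exp (M + 1) := Real.exp_le_exp.2 hle
    _ = Real.exp 1 * Real.exp M := by rw [Real.exp_add]; ring
    _ ≤ 3 * Real.exp M := by
        have := Real.exp_one_lt_d9
        gcongr
        linarith

end Inst
end Regr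

namespace Regr

open Finset

namespace Inst
variable {P : Inst} {G : ℝ} (hP : P.Good G)
include hP

/-! ### Preservation of the invariant -/

omit hP in
lemma xh_mem (s : AS) (j : ℕ) : P.xh s j ∈ Set.Icc (-1 : ℝ) 1 :=
  ⟨le_max_left _ _, max_le (by norm_num) (min_le_left _ _)⟩

omit hP in
lemma Inv.leaf_ge {a : ℕ} {s : AS} (h : P.Inv a s) {r : ℕ} (hr : r < 2 * P.n) :
    1 / (2 * P.n : ℝ) ≤ s.leaf r := by
  obtain ⟨d, -, hd, -⟩ := h.leaf r hr
  rw [hd]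
  exact le_max_right _ _

omit hP in
lemma Inv.leaf_nonneg {a : ℕ} {s : AS} (h : P.Inv a s) {r : ℕ} (hr : r < 2 * P.n + 1) :
    0 ≤ s.leaf r := by
  rcases (Nat.lt_succ_iff.1 hr).lt_or_eq with h1 | h1
  · exact le_trans (by positivity) (h.leaf_ge h1)
  · rw [h1, h.leaf_last]; norm_num

omit hP in
lemma Inv.tot_eq {a : ℕ} {s : AS} (h : P.Inv a s) :
    P.tot s.leaf = ∑ l ∈ range (2 * P.n), s.leaf l + 2 := by
  unfold tot
  rw [sum_range_succ, h.leaf_last]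

omit hP in
lemma Inv.leaf_le_tot {a : ℕ} {s : AS} (h : P.Inv a s) {r : ℕ} (hr : r < 2 * P.n) :
    s.leaf r ≤ P.tot s.leaf :=
  single_le_sum (f := s.leaf) (fun l hl => h.leaf_nonneg (mem_range.1 hl))
    (mem_range.2 (by omega))

omit hP in
lemma Inv.two_le_tot {a : ℕ} {s : AS} (h : P.Inv a s) : 2 ≤ P.tot s.leaf := by
  rw [h.tot_eq]
  have : 0 ≤ ∑ l ∈ range (2 * P.n), s.leaf l :=
    sum_nonneg fun l hl => h.leaf_nonneg (by have := mem_range.1 hl; omega)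
  linarith

omit hP in
lemma Inv.frz {a : ℕ} {s : AS} (h : P.Inv a s) (b : Prop) : P.Inv a { s with frz := b } :=
  ⟨h.box, h.v, h.κ, h.leaf_last, h.leaf, h.cnt⟩

lemma Inv.core {a : ℕ} {s : AS} (h : P.Inv a s) (hT : P.tot s.leaf ≤ P.T0) (j : ℕ) :
    P.Inv (a + 1) (P.core s j) where
  box l := by
    simp only [Inst.core]
    split_ifs
    · by_cases hl : l = j
      · rw [hl, Function.update_self]; exact xh_mem s j
      · rw [Function.update_of_ne hl]; exact h.box l
    · exact h.box l
  v r hr := by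
    simp only [Inst.core]
    split_ifs with hj
    · rw [val_update _ (mem_range.2 (by omega)), h.v r hr]
    · rw [hP.a_out r j (Or.inr (by omega)), h.v r hr, zero_mul, add_zero]
  κ := mul_pos h.κ (by linarith [θ_lt hP])
  leaf_last := by
    simp only [Inst.core, hP.a_out (2 * P.n) j (Or.inl le_rfl), if_true]
    exact h.leaf_last
  leaf r hr := by
    by_cases ha : P.a r j = 0
    · obtain ⟨d, hd, he, -⟩ := h.leaf r hr
      refine ⟨d + 1, by omega, ?_, Or.inr ?_⟩
      · simp only [Inst.core, ha, if_true, zero_mul, add_zero, zero_div]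
        rw [he, pow_succ, mul_div_mul_right _ _ (by linarith [θ_lt hP])]
      · simp only [Inst.core, ha, if_true]
        exact (h.leaf_le_tot hr).trans hT
    · refine ⟨0, by omega, ?_, Or.inl rfl⟩
      simp only [Inst.core, ha, if_false, pow_zero, div_one]
  cnt := by
    simp only [Inst.core]
    have := h.cnt
    split_ifs <;> linarith

omit hP in
lemma Inv.refresh {a : ℕ} {s : AS} (h : P.Inv a s) : P.Inv 0 (P.refresh s) where
  box := h.box
  v := h.v
  κ := h.κ
  leaf_last := by simp [Inst.refresh, h.leaf_last]
  leaf r hr := ⟨0, le_rfl, by simp [Inst.refresh, hr], Or.inl rfl⟩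
  cnt := h.cnt

lemma inv_refresh_init : P.Inv 0 (P.refresh P.init) where
  box _ := by simp [Inst.refresh, Inst.init]
  v r _ := by simp [Inst.refresh, Inst.init, val]
  κ := by
    have := θ_lt hP
    simpa [Inst.refresh, Inst.init] using this
  leaf_last := by simp [Inst.refresh, Inst.init]
  leaf r hr := ⟨0, le_rfl, by simp [Inst.refresh, hr], Or.inl rfl⟩
  cnt := by simp [Inst.refresh, Inst.init]

/-! ### The sampling probabilities -/

lemma sum_range_two_mul_wt {a : ℕ} {s : AS} (h : P.Inv a s) (j : ℕ) :
    ∑ l ∈ range (2 * P.n + 1), s.leaf l * P.wt (l / 2) j =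
      ∑ l ∈ range (2 * P.n), s.leaf l * (if j < P.m then |P.a l j| else 0) +
        (if j < P.m then 1 / (P.m : ℝ) else 1 / P.B0) := by
  rw [sum_range_succ, h.leaf_last]
  congr 1
  · refine sum_congr rfl fun l hl => ?_
    have hl' := mem_range.1 hl
    unfold wt
    rw [if_pos (by omega)]
    split_ifs with hj
    · rw [hP.a_pair l hl' j hj]
    · rfl
  · unfold wt
    rw [if_neg (by omega)]
    split_ifs
    · field_simp
    · field_simp

lemma q_lt {a : ℕ} {s : AS} (h : P.Inv a s) {j : ℕ} (hj : j < P.m) :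
    P.q s.leaf j = (∑ l ∈ range (2 * P.n), s.leaf l * |P.a l j| + 1 / P.m) / P.tot s.leaf := by
  unfold q
  rw [sum_range_two_mul_wt hP h]
  simp only [if_pos hj]

lemma q_m {a : ℕ} {s : AS} (h : P.Inv a s) :
    P.q s.leaf P.m = 1 / P.B0 / P.tot s.leaf := by
  unfold q
  rw [sum_range_two_mul_wt hP h]
  simp

omit hP in
lemma wt_nonneg (i j : ℕ) : 0 ≤ P.wt i j := by
  unfold wt
  split_ifs <;> positivity

lemma sum_wt_le (i : ℕ) : ∑ j ∈ range (P.m + 1), P.wt i j ≤ 1 := by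
  have hm : (0 : ℝ) < P.m := by exact_mod_cast hP.hm
  have hB : (1 : ℝ) ≤ P.B0 := by exact_mod_cast one_le_B0 hP
  rw [sum_range_succ]
  unfold wt
  by_cases h : i < P.n
  · simp only [if_pos h, lt_irrefl, if_false, add_zero]
    rw [sum_congr rfl fun j hj => if_pos (mem_range.1 hj)]
    exact hP.row_le _ (by omega)
  · simp only [if_neg h, lt_irrefl, if_false]
    rw [sum_congr rfl fun j hj => if_pos (mem_range.1 hj), sum_const, card_range, nsmul_eq_mul]
    have h1 : (P.m : ℝ) * (1 / (2 * P.m)) = 1 / 2 := by field_simp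
    have h2 : 1 / (2 * (P.B0 : ℝ)) ≤ 1 / 2 :=
      one_div_le_one_div_of_le (by norm_num) (by linarith)
    linarith

lemma sum_q_le {a : ℕ} {s : AS} (h : P.Inv a s) : ∑ j ∈ range (P.m + 1), P.q s.leaf j ≤ 1 := by
  have hT := h.two_le_tot
  unfold q
  rw [← sum_div, div_le_one (by linarith), sum_comm]
  unfold tot
  refine sum_le_sum fun l hl => ?_
  rw [← mul_sum]
  exact mul_le_of_le_one_right (h.leaf_nonneg (mem_range.1 hl))
    (sum_wt_le hP _)

lemma q_pos {a : ℕ} {s : AS} (h : P.Inv a s) {j : ℕ} (hj : j ∈ range (P.m + 1)) :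
    0 < P.q s.leaf j := by
  have hT := h.two_le_tot
  have hm : (0 : ℝ) < P.m := by exact_mod_cast hP.hm
  have hB : (1 : ℝ) ≤ P.B0 := by exact_mod_cast one_le_B0 hP
  rcases (Nat.lt_succ_iff.1 (mem_range.1 hj)).lt_or_eq with h1 | h1
  · rw [q_lt hP h h1]
    refine div_pos (add_pos_of_nonneg_of_pos (sum_nonneg fun l hl => mul_nonneg
      (h.leaf_nonneg (by have := mem_range.1 hl; omega)) (abs_nonneg _)) (by positivity))
      (by linarith)
  · rw [h1, q_m hP h]
    positivity

/-! ### The conditions of the convergence theorem -/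

lemma exp_z_le {a : ℕ} {s : AS} (h : P.Inv a s) (ha : a ≤ P.B0) {r : ℕ} (hr : r < 2 * P.n) :
    Real.exp (P.z s r) ≤ 3 * s.leaf r := by
  obtain ⟨d, hd, he, -⟩ := h.leaf r hr
  rw [he]
  exact exp_le_newLeaf hP (by rw [h.v r hr]; exact abs_val_le hP h.box hr) (hd.trans ha)

lemma cond_mu {a : ℕ} {s : AS} (h : P.Inv a s) (hT : P.tot s.leaf ≤ P.T0) {j : ℕ}
    (hj : j ∈ range (P.m + 1)) : 4 * (P.μ * P.τ) ≤ P.q s.leaf j := by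
  have hT2 := h.two_le_tot
  have hT0 := T0_ge hP
  have hm : (0 : ℝ) < P.m := by exact_mod_cast hP.hm
  have hB : (1 : ℝ) ≤ P.B0 := by exact_mod_cast one_le_B0 hP
  have hBm : (P.B0 : ℝ) ≤ P.m := by exact_mod_cast Nat.min_le_right _ _
  have hpB := one_le_pB (S := P.S) hP.hn hP.hm hP.he
  have he := hP.he
  have h1 : 1 / P.m / P.tot s.leaf ≤ P.q s.leaf j := by
    rcases (Nat.lt_succ_iff.1 (mem_range.1 hj)).lt_or_eq with h1 | h1
    · rw [q_lt hP h h1]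
      have : 0 ≤ ∑ l ∈ range (2 * P.n), s.leaf l * |P.a l j| := sum_nonneg fun l hl => mul_nonneg
        (h.leaf_nonneg (by have := mem_range.1 hl; omega)) (abs_nonneg _)
      gcongr
      linarith
    · rw [h1, q_m hP h]
      gcongr
  refine le_trans ?_ h1
  have h2 : 1 / P.m / P.T0 ≤ 1 / P.m / P.tot s.leaf := by gcongr
  refine le_trans ?_ h2
  rw [show P.μ * P.τ = _ from pμτ_eq hP.hn hP.hm hP.he, div_div, ← mul_div_assoc,
    div_le_div_iff₀ (by positivity) (by positivity)]
  have h3 := pB_ge_em (n := P.n) (m := P.m) (e := P.e) (S := P.S)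
  have h4 : 4 * (1000 * P.e) * (P.m * P.T0) ≤ 4000 * pB P.n P.m P.e P.S * P.T0 := by
    have := mul_le_mul_of_nonneg_right h3 (show 0 ≤ 4000 * P.T0 by positivity)
    linarith
  have h5 : 4000 * pB P.n P.m P.e P.S * P.T0 ≤ 1200 * pT P.n * pT P.n * pB P.n P.m P.e P.S := by
    have : 0 ≤ pB P.n P.m P.e P.S * P.T0 := by positivity
    have h6 : (4000 : ℝ) ≤ 1200 * P.T0 := by linarith
    have := mul_le_mul_of_nonneg_right h6 this
    change _ ≤ 1200 * P.T0 * P.T0 * _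
    linarith
  linarith

lemma cond_step {a : ℕ} {s : AS} (h : P.Inv a s) (hT : P.tot s.leaf ≤ P.T0) {j : ℕ}
    (hj : j ∈ range (P.m + 1)) {r : ℕ} (hr : r < 2 * P.n) {d : ℝ} (hd : |d| ≤ 2) :
    P.σ * (P.a r j * d / P.q s.leaf j) ≤ 1 := by
  have hT2 := h.two_le_tot
  have hT0 := T0_ge hP
  have hn : (0 : ℝ) < P.n := by exact_mod_cast hP.hn
  have hm : (0 : ℝ) < P.m := by exact_mod_cast hP.hm
  have hB : (1 : ℝ) ≤ P.B0 := by exact_mod_cast one_le_B0 hP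
  have hσ := σ_pos hP
  have hq := q_pos hP h hj
  have hσB := σ_mul_B0 hP
  have had : P.a r j * d ≤ 2 * |P.a r j| := by
    refine (le_abs_self _).trans ?_
    rw [abs_mul]
    nlinarith [abs_nonneg (P.a r j)]
  suffices hs : |P.a r j| ≤ 6 * P.B0 * P.T0 * P.q s.leaf j by
    rw [← mul_div_assoc, div_le_one hq]
    calc P.σ * (P.a r j * d) ≤ P.σ * (2 * (6 * P.B0 * P.T0 * P.q s.leaf j)) :=
          mul_le_mul_of_nonneg_left (by linarith) hσ.le
      _ = (P.σ * (1000 * P.T0 * P.B0)) * P.q s.leaf j * (12 / 1000) := by ring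
      _ ≤ 1 * P.q s.leaf j * 1 := by gcongr; norm_num
      _ = P.q s.leaf j := by ring
  have key : |P.a r j| ≤ 3 * (P.B0 * P.tot s.leaf * P.q s.leaf j) := by
    rcases (Nat.lt_succ_iff.1 (mem_range.1 hj)).lt_or_eq with h1 | h1
    · have hnn : ∀ l ∈ range (2 * P.n), 0 ≤ s.leaf l * |P.a l j| := fun l hl => mul_nonneg
        (h.leaf_nonneg (by have := mem_range.1 hl; omega)) (abs_nonneg _)
      have hs : 1 / (2 * P.n : ℝ) * |P.a r j| ≤ ∑ l ∈ range (2 * P.n), s.leaf l * |P.a l j| :=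
        (mul_le_mul_of_nonneg_right (h.leaf_ge hr) (abs_nonneg _)).trans
          (single_le_sum (f := fun l => s.leaf l * |P.a l j|) hnn (mem_range.2 hr))
      have ha1 : |P.a r j| ≤ 1 :=
        (single_le_sum (f := fun j => |P.a r j|) (fun _ _ => abs_nonneg _)
          (mem_range.2 h1)).trans (hP.row_le r hr)
      have e : P.B0 * P.tot s.leaf * P.q s.leaf j =
          P.B0 * (∑ l ∈ range (2 * P.n), s.leaf l * |P.a l j| + 1 / P.m) := by
        rw [q_lt hP h h1]
        field_simp
      rw [e]
      rcases Nat.le_total P.n P.m with hnm | hnm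
      · have : P.B0 = P.n := min_eq_left hnm
        rw [this]
        have h2 : P.n * (1 / (2 * P.n : ℝ) * |P.a r j|) = |P.a r j| / 2 := by field_simp
        have h3 := mul_le_mul_of_nonneg_left hs hn.le
        have h4 : 0 ≤ P.n * (1 / P.m : ℝ) := by positivity
        nlinarith [abs_nonneg (P.a r j)]
      · have : P.B0 = P.m := min_eq_right hnm
        rw [this]
        have h2 : (P.m : ℝ) * (1 / P.m : ℝ) = 1 := by field_simp
        have h3 := mul_nonneg hm.le (sum_nonneg hnn)
        nlinarith
    · rw [h1, q_m hP h, hP.a_m r hr]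
      have : P.B0 * P.tot s.leaf * (1 / P.B0 / P.tot s.leaf) = 1 := by field_simp
      rw [this]
      norm_num
  refine key.trans ?_
  have : P.B0 * P.tot s.leaf * P.q s.leaf j ≤ P.B0 * P.T0 * P.q s.leaf j := by gcongr
  have h6 : 0 ≤ P.B0 * P.T0 * P.q s.leaf j := by positivity
  linarith

lemma τσ_eq : P.τ * P.σ = 1 / (3 * P.T0 * P.T0 * P.m) := by
  have hσ := σ_pos hP
  have hT0 := T0_ge hP
  have hm : (0 : ℝ) < P.m := by exact_mod_cast hP.hm
  have h1 : P.T0 ≠ 0 := by positivity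
  change 1 / (3 * P.T0 * P.T0 * P.m * P.σ) * P.σ = _
  field_simp

lemma cond_L {a : ℕ} {s : AS} (h : P.Inv a s) (ha : a ≤ P.B0) (hT : P.tot s.leaf ≤ P.T0) {j : ℕ}
    (hj : j ∈ range (P.m + 1)) :
    4 * P.τ * P.σ * ∑ r ∈ range (2 * P.n), Real.exp (P.z s r) * P.a r j ^ 2 ≤
      P.w j * P.q s.leaf j ^ 2 := by
  have hT2 := h.two_le_tot
  have hT0 := T0_ge hP
  have hm : (0 : ℝ) < P.m := by exact_mod_cast hP.hm
  have hB : (1 : ℝ) ≤ P.B0 := by exact_mod_cast one_le_B0 hP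
  have hw := w_nonneg hP j hj
  have hT0' : (0 : ℝ) < P.T0 := by linarith
  have e4 : 4 * P.τ * P.σ = 4 / (3 * P.T0 * P.T0 * P.m) := by
    rw [mul_assoc, τσ_eq hP]
    ring
  rw [e4]
  rcases (Nat.lt_succ_iff.1 (mem_range.1 hj)).lt_or_eq with h1 | h1
  · set Λ := ∑ l ∈ range (2 * P.n), s.leaf l * |P.a l j| with hΛ
    have hΛ0 : 0 ≤ Λ := sum_nonneg fun l hl => mul_nonneg
        (h.leaf_nonneg (by have := mem_range.1 hl; omega)) (abs_nonneg _)
    have hs : ∑ r ∈ range (2 * P.n), Real.exp (P.z s r) * P.a r j ^ 2 ≤ 3 * P.w j * Λ := by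
      rw [hΛ, mul_sum]
      refine sum_le_sum fun r hr => ?_
      have hr' := mem_range.1 hr
      have h2 := exp_z_le hP h ha hr'
      have h3 := hP.a_le r hr' j h1
      rw [← sq_abs]
      have h4 : 0 ≤ s.leaf r := h.leaf_nonneg (by omega)
      calc _ ≤ 3 * s.leaf r * (P.w j * |P.a r j|) := by
            rw [sq]
            gcongr
        _ = _ := by ring
    have hq : 1 / P.m * (4 * Λ) / P.T0 ^ 2 ≤ P.q s.leaf j ^ 2 := by
      rw [q_lt hP h h1, ← hΛ, div_pow]
      have h2 : 1 / P.m * (4 * Λ) ≤ (Λ + 1 / P.m) ^ 2 := by nlinarith [sq_nonneg (Λ - 1 / P.m)]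
      gcongr
    calc _ ≤ 4 / (3 * P.T0 * P.T0 * P.m) * (3 * P.w j * Λ) := by gcongr
      _ = P.w j * (1 / P.m * (4 * Λ) / P.T0 ^ 2) := by field_simp
      _ ≤ _ := by gcongr
  · have hs : ∑ r ∈ range (2 * P.n), Real.exp (P.z s r) * P.a r j ^ 2 ≤ 27 * P.T0 := by
      calc _ ≤ ∑ r ∈ range (2 * P.n), 27 * s.leaf r := by
            refine sum_le_sum fun r hr => ?_
            have hr' := mem_range.1 hr
            have h2 := exp_z_le hP h ha hr'
            have h3 : P.a r j = -3 := h1 ▸ hP.a_m r hr'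
            rw [h3]
            linarith
        _ ≤ 27 * P.tot s.leaf := by
            rw [← mul_sum, h.tot_eq]
            linarith
        _ ≤ _ := by linarith
    rw [h1] at hs
    rw [h1, q_m hP h, hP.w_m]
    have hpB := pB_ge_min (n := P.n) (m := P.m) (S := P.S) hP.he
    have hpB1 : (P.B0 : ℝ) ^ 2 ≤ pB P.n P.m P.e P.S * pB P.n P.m P.e P.S := by
      rw [sq]; exact mul_self_le_mul_self (by positivity) hpB
    have hq : 1 / (P.B0 * P.T0 : ℝ) ^ 2 ≤ (1 / P.B0 / P.tot s.leaf) ^ 2 := by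
      rw [div_div, div_pow, one_pow]
      gcongr
    calc _ ≤ 4 / (3 * P.T0 * P.T0 * P.m) * (27 * P.T0) := by gcongr
      _ = 36 * P.T0 * P.B0 ^ 2 / P.m * (1 / (P.B0 * P.T0 : ℝ) ^ 2) := by
          field_simp
          norm_num
      _ ≤ pW P.n P.m P.e P.S * (1 / (P.B0 * P.T0 : ℝ) ^ 2) := by
          unfold pW
          rw [mul_assoc (36 * pT P.n)]
          gcongr
      _ ≤ _ := by
          have := pW_pos (S := P.S) hP.hn hP.hm hP.he
          gcongr

omit hP in
lemma clip_prox {A g D y : ℝ} (hD : 0 < D) (hy : y ∈ Set.Icc (-1 : ℝ) 1) :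
    0 ≤ (D * max (-1) (min 1 ((A - g) / D)) + g - A) * (y - max (-1) (min 1 ((A - g) / D))) := by
  set ξ := (A - g) / D with hξ
  have e : A - g = D * ξ := by rw [hξ]; field_simp
  have e2 : ∀ c, D * c + g - A = D * (c - ξ) := fun c => by linarith
  rw [e2]
  rcases le_total ξ (-1) with h | h
  · rw [min_eq_right (by linarith), max_eq_left h]
    exact mul_nonneg (mul_nonneg hD.le (by linarith)) (by linarith [hy.1])
  · rcases le_total ξ 1 with h' | h'
    · rw [min_eq_right h', max_eq_right h]
      simp
    · rw [min_eq_left h', max_eq_right (by norm_num)]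
      exact mul_nonneg_of_nonpos_of_nonpos
        (mul_nonpos_of_nonneg_of_nonpos hD.le (by linarith)) (by linarith [hy.2])

lemma cond_prox {a : ℕ} {s : AS} (h : P.Inv a s) {j : ℕ} (hj : j ∈ range (P.m + 1)) {y : ℝ}
    (hy : y ∈ Set.Icc (-1 : ℝ) 1) :
    0 ≤ (P.c j + ∑ r ∈ range (2 * P.n), P.a r j * Real.exp (P.z s r) + P.μ * P.w j * P.xh s j +
      P.q s.leaf j * P.w j / P.τ * (P.xh s j - s.x j)) * (y - P.xh s j) := by
  have hw := w_nonneg hP j hj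
  have hq := q_pos hP h hj
  have hτ := τ_pos hP
  have hμ := μ_pos hP
  have hD : 0 < P.q s.leaf j * P.w j / P.τ + P.μ * P.w j := by positivity
  have := clip_prox (A := P.q s.leaf j * P.w j / P.τ * s.x j) (g := P.g s j) hD hy
  change 0 ≤ (_ * P.xh s j + P.g s j - _) * (y - P.xh s j) at this
  convert this using 2
  unfold g
  ring

/-- Expected decrease of the potential in one step. -/
theorem Φ_step {xs : ℕ → ℝ} (hxs : Saddle P G xs) {a : ℕ} {s : AS} (h : P.Inv a s)
    (ha : a ≤ P.B0) (hT : P.tot s.leaf ≤ P.T0) :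
    ∑ j ∈ range (P.m + 1), P.q s.leaf j * P.Φ xs (P.core s j) +
      (1 - ∑ j ∈ range (P.m + 1), P.q s.leaf j) * P.Φ xs (P.core s (P.m + 1)) ≤
      (1 - P.θ) * P.Φ xs s := by
  have hθ1 := θ_lt hP
  have hσ := σ_pos hP
  have ht := t_pos hP
  have h1θ : 1 - P.θ ≠ 0 := by linarith
  have hκ := h.κ
  have hstep := pot_step (I := range (2 * P.n)) (J := range (P.m + 1)) (a := P.a) (β := P.β)
    (v := s.v) (vs := P.val xs) (c := P.c) (w := P.w) (xs := xs) (x := s.x) (xh := P.xh s)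
    (q := P.q s.leaf) (Z := fun r => (s.v r + s.κ / (1 - P.θ) * s.ρ r) / P.t) (z := P.z s)
    (t := P.t) (θ := P.θ) (σ := P.σ) (τ := P.τ) (μ := P.μ) rfl hσ ht hθ1 (τ_pos hP)
    (μ_pos hP).le (pθ_le hP.hn hP.hm hP.he) (fun r hr => h.v r (mem_range.1 hr))
    (fun r _ => rfl) ?_ (fun j hj => (w_nonneg hP j hj).le) (fun j hj => q_pos hP h hj)
    (sum_q_le hP h) (fun j hj => cond_mu hP h hT hj) (fun j hj r hr => ?_)
    (fun j hj => cond_L hP h ha hT hj) (fun j hj => cond_prox hP h hj (hxs.box j))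
    (fun j hj => hxs.opt j hj _ (xh_mem s j))
  · have e1 : ∀ j ∈ range (P.m + 1), P.Φ xs (P.core s j) =
        pot (range (2 * P.n)) (range (P.m + 1)) P.w xs (fun r => P.val xs r / P.t) P.τ P.σ
          (Function.update s.x j (P.xh s j))
          (fun i => P.z s i + P.σ * (P.a i j * (P.xh s j - s.x j) / P.q s.leaf j)) := by
      intro j hj
      have hq := q_pos hP h hj
      unfold Φ Inst.core
      simp only [if_pos (Nat.lt_succ_iff.1 (mem_range.1 hj))]
      congr 1
      funext r
      have hθe : P.θ = P.σ * P.t := rfl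
      unfold z
      rw [mul_div_assoc s.κ, div_self h1θ, mul_one]
      field_simp
      rw [hθe]
      ring
    have e2 : P.Φ xs (P.core s (P.m + 1)) =
        pot (range (2 * P.n)) (range (P.m + 1)) P.w xs (fun r => P.val xs r / P.t) P.τ P.σ
          s.x (P.z s) := by
      unfold Φ Inst.core
      simp only [if_neg (show ¬ P.m + 1 ≤ P.m by omega), hP.a_out _ (P.m + 1) (Or.inr (by omega))]
      congr 1
      funext r
      unfold z
      rw [mul_div_assoc s.κ, div_self h1θ]
      ring
    rw [sum_congr rfl fun j hj => by rw [e1 j hj], e2]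
    exact hstep
  · intro r hr
    unfold z
    have hθe : P.θ = P.σ * P.t := rfl
    have : P.σ = P.θ / P.t := by rw [hθe]; field_simp
    rw [this]
    field_simp
    ring
  · refine cond_step hP h hT hj (mem_range.1 hr) (abs_le.2 ?_)
    have h1 := xh_mem (P := P) s j
    have h2 := h.box j
    constructor <;> linarith [h1.1, h1.2, h2.1, h2.2]

end Inst
end Regr

namespace Regr

open Finset

namespace Inst
variable {P : Inst} {G : ℝ} (hP : P.Good G)

/-- One step from a state whose leaves are up to date, with choice `j` of the column. -/
noncomputable def step (P : Inst) (s : AS) (j : ℕ) : AS :=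
  open Classical in
  if s.frz then s else if P.T0 < P.tot s.leaf then { s with frz := True }
  else if P.cap < s.cnt then { s with frz := True } else P.core s j

/-- Number of batches. -/
noncomputable def Nb (P : Inst) : ℕ := ⌈P.zb⌉₊

/-- Number of steps. -/
noncomputable def N (P : Inst) : ℕ := P.Nb * P.B0

/-- The supermartingale used in the analysis. -/
noncomputable def V (P : Inst) (xs : ℕ → ℝ) (k : ℕ) (s : AS) : ℝ :=
  open Classical in
  if s.frz then 1 else 20 * P.σ / P.T0 * P.Φ xs s +
    (s.cnt + (P.N - k) / (2 * P.B0)) / P.cap +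
    8 * P.τ / P.e ^ 2 * (1 - P.θ) ^ (P.N - k) * P.Φ xs s

/-- Leaves are recomputed at the beginning of every batch. -/
noncomputable def pre (P : Inst) (k : ℕ) (s : AS) : AS := if P.B0 ∣ k then P.refresh s else s

include hP

lemma log_arg_pos : 0 < Real.log (1000000 * (P.m + P.n : ℕ) / P.e) := by
  have he := hP.he
  refine Real.log_pos ?_
  rw [lt_div_iff₀ he]
  have : (1 : ℝ) ≤ (P.m + P.n : ℕ) := by exact_mod_cast (by have := hP.hn; omega)
  linarith [hP.he1]

lemma zb_pos : 0 < P.zb := by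
  have h := log_arg_pos hP
  have hθ := θ_pos hP
  have hB : (1 : ℝ) ≤ P.B0 := by exact_mod_cast one_le_B0 hP
  unfold zb
  positivity

lemma cap_pos : 0 < P.cap := by
  have := zb_pos hP
  unfold cap
  linarith

lemma Φ_nonneg (xs : ℕ → ℝ) (s : AS) : 0 ≤ P.Φ xs s :=
  pot_nonneg _ _ (τ_pos hP).le (σ_pos hP).le (fun j hj => (w_nonneg hP j hj).le) _ _

lemma σ_mul_Φ (xs : ℕ → ℝ) (s : AS) : P.σ * P.Φ xs s =
    P.σ / (2 * P.τ) * ∑ j ∈ range (P.m + 1), P.w j * (s.x j - xs j) ^ 2 +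
    ∑ r ∈ range (2 * P.n), kl (P.val xs r / P.t)
      ((s.v r + s.κ / (1 - P.θ) * s.ρ r) / P.t) := by
  have hσ := σ_pos hP
  unfold Φ pot
  rw [mul_add, ← mul_assoc, mul_one_div_cancel hσ.ne', one_mul, mul_sum, mul_sum]
  congr 1
  exact sum_congr rfl fun j _ => by ring

lemma σ_div_τ : P.σ / (2 * P.τ) * (80 * P.T0 * pB P.n P.m P.e P.S * pB P.n P.m P.e P.S / P.m) =
    12 / 100000 * P.T0 := by
  have hT := T0_ge hP
  have hB := one_le_pB (S := P.S) hP.hn hP.hm hP.he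
  have hm : (0 : ℝ) < P.m := by exact_mod_cast hP.hm
  have h1 : P.T0 ≠ 0 := by positivity
  have h2 : pB P.n P.m P.e P.S ≠ 0 := by positivity
  have e1 : P.σ = 1 / (1000 * P.T0 * pB P.n P.m P.e P.S) := rfl
  have e2 : P.τ = 1000 * pB P.n P.m P.e P.S / (3 * P.T0 * P.m) := pτ_eq hP.hn hP.hm hP.he
  rw [e1, e2]
  field_simp
  norm_num

lemma σ_Φ_init {xs : ℕ → ℝ} (hxs : Saddle P G xs) : P.σ * P.Φ xs P.init ≤ 5 / 1000 * P.T0 := by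
  have hT := T0_ge hP
  have hL := pL_ge hP.hn
  have hn : (0 : ℝ) < P.n := by exact_mod_cast hP.hn
  have hθ := θ_lt hP
  have hτ := τ_pos hP
  have hσ := σ_pos hP
  have ht := t_pos hP
  rw [σ_mul_Φ hP]
  have h1 : P.σ / (2 * P.τ) * ∑ j ∈ range (P.m + 1), P.w j * (P.init.x j - xs j) ^ 2 ≤
      12 / 100000 * P.T0 := by
    rw [← σ_div_τ hP]
    refine mul_le_mul_of_nonneg_left ?_ (by positivity)
    simpa [Inst.init] using hxs.norm_le
  have hZ : ∀ r, (P.init.v r + P.init.κ / (1 - P.θ) * P.init.ρ r) / P.t =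
      -Real.log (2 * P.n) := by
    intro r
    simp only [Inst.init]
    rw [div_self (by linarith)]
    field_simp
    ring
  have hLe : Real.log (2 * P.n) = pL P.n - 1 := by unfold pL; ring
  have h2 : ∑ r ∈ range (2 * P.n), kl (P.val xs r / P.t)
      ((P.init.v r + P.init.κ / (1 - P.θ) * P.init.ρ r) / P.t) ≤ 4 * pL P.n := by
    calc _ ≤ ∑ r ∈ range (2 * P.n), (Real.exp (P.val xs r / P.t) * pL P.n + 1 / (2 * P.n)) := by
          refine sum_le_sum fun r hr => ?_
          rw [hZ]
          unfold kl
          rw [← half_inv_eq hP]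
          have h3 : Real.exp (P.val xs r / P.t) ≤ 2 :=
            (single_le_sum (f := fun r => Real.exp (P.val xs r / P.t))
              (fun _ _ => (Real.exp_pos _).le) hr).trans hxs.sum_le
          have h4 : P.val xs r / P.t ≤ 1 := by
            have := Real.add_one_le_exp (P.val xs r / P.t)
            linarith
          have h5 := mul_le_mul_of_nonneg_left h4 (Real.exp_pos (P.val xs r / P.t)).le
          have h6 := (Real.exp_pos (P.val xs r / P.t)).le
          rw [hLe]
          nlinarith
      _ = (∑ r ∈ range (2 * P.n), Real.exp (P.val xs r / P.t)) * pL P.n + 1 := by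
          rw [sum_add_distrib, ← sum_mul, sum_const, card_range, nsmul_eq_mul]
          push_cast
          field_simp
      _ ≤ 2 * pL P.n + 1 := by
          have := hxs.sum_le
          gcongr
      _ ≤ _ := by linarith
  have h7 : P.T0 = 1000 * pL P.n := rfl
  linarith

lemma tot_le {a : ℕ} {s : AS} (h : P.Inv a s) (ha : a ≤ P.B0) : P.tot s.leaf ≤
    9 * ∑ r ∈ range (2 * P.n), Real.exp ((s.v r + s.κ / (1 - P.θ) * s.ρ r) / P.t) + 14 := by
  have hn : (0 : ℝ) < P.n := by exact_mod_cast hP.hn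
  rw [h.tot_eq]
  have : ∑ l ∈ range (2 * P.n), s.leaf l ≤ ∑ r ∈ range (2 * P.n),
      (9 * Real.exp ((s.v r + s.κ / (1 - P.θ) * s.ρ r) / P.t) + 12 * (1 / (2 * P.n))) := by
    refine sum_le_sum fun r hr => ?_
    have hr' := mem_range.1 hr
    have hv : |s.v r| ≤ 8 := by rw [h.v r hr']; exact abs_val_le hP h.box hr'
    obtain ⟨d, hd, he, hd0⟩ := h.leaf r hr'
    have h1 := newLeaf_le hP (ρ := s.ρ r) (κ := s.κ) hv (hd.trans ha) (by rwa [← he])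
    have h2 := exp_le_newLeaf hP (ρ := s.ρ r) (κ := s.κ) hv (one_le_B0 hP)
    rw [pow_one] at h2
    have h0 : (0 : ℝ) ≤ 1 / (2 * P.n) := by positivity
    have h3 : ∀ κ, P.newLeaf (s.v r) (s.ρ r) κ ≤
        Real.exp ((s.v r + κ * s.ρ r) / P.t) + 1 / (2 * P.n) := fun κ =>
      max_le (by linarith) (by linarith [Real.exp_pos ((s.v r + κ * s.ρ r) / P.t)])
    rw [he]
    linarith [h3 s.κ, h3 (s.κ / (1 - P.θ))]
  rw [sum_add_distrib, ← mul_sum, sum_const, card_range, nsmul_eq_mul] at this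
  have e : ((2 * P.n : ℕ) : ℝ) * (12 * (1 / (2 * P.n))) = 12 := by
    push_cast
    field_simp
  rw [e] at this
  linarith

lemma one_le_of_tot {xs : ℕ → ℝ} (hxs : Saddle P G xs) {a : ℕ} {s : AS} (h : P.Inv a s)
    (ha : a ≤ P.B0) (hT : P.T0 < P.tot s.leaf) : 1 ≤ 20 * P.σ / P.T0 * P.Φ xs s := by
  have hT0 := T0_ge hP
  have h1 := tot_le hP h ha
  have hτ := τ_pos hP
  have hσ := σ_pos hP
  rw [div_mul_eq_mul_div, le_div_iff₀ (by linarith), one_mul, mul_assoc, σ_mul_Φ hP]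
  have h2 : 0 ≤ P.σ / (2 * P.τ) * ∑ j ∈ range (P.m + 1), P.w j * (s.x j - xs j) ^ 2 :=
    mul_nonneg (by positivity) (sum_nonneg fun j hj =>
      mul_nonneg (w_nonneg hP j hj).le (sq_nonneg _))
  have h3 : ∑ r ∈ range (2 * P.n), (Real.exp ((s.v r + s.κ / (1 - P.θ) * s.ρ r) / P.t) / 2 -
      Real.exp (P.val xs r / P.t)) ≤ ∑ r ∈ range (2 * P.n), kl (P.val xs r / P.t)
      ((s.v r + s.κ / (1 - P.θ) * s.ρ r) / P.t) := sum_le_sum fun r _ => kl_lower _ _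
  rw [sum_sub_distrib, ← sum_div] at h3
  have h4 := hxs.sum_le
  change ∑ r ∈ range (2 * P.n), Real.exp (P.val xs r / P.t) ≤ 2 at h4
  linarith

lemma V_nonneg {xs : ℕ → ℝ} {k : ℕ} (hk : k ≤ P.N) {s : AS} (hs : 0 ≤ s.cnt) :
    0 ≤ P.V xs k s := by
  have h1 := Φ_nonneg hP xs s
  have h2 := cap_pos hP
  have h3 := τ_pos hP
  have h4 := σ_pos hP
  have h5 := T0_ge hP
  have h6 : (0 : ℝ) ≤ P.N - k := by
    have : (k : ℝ) ≤ P.N := by exact_mod_cast hk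
    linarith
  have h7 := hP.he
  have h8 : 0 ≤ 1 - P.θ := by linarith [θ_lt hP]
  unfold V
  split_ifs
  · exact zero_le_one
  · positivity

lemma step_inv {a : ℕ} {s : AS} (h : P.Inv a s) (j : ℕ) : P.Inv (a + 1) (P.step s j) := by
  have hmono : ∀ b, P.Inv (a + 1) { s with frz := b } := fun b =>
    ⟨h.box, h.v, h.κ, h.leaf_last, fun r hr => by
      obtain ⟨d, hd, he⟩ := h.leaf r hr
      exact ⟨d, by omega, he⟩, h.cnt⟩
  unfold step
  split_ifs with h1 h2
  · exact hmono s.frz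
  · exact hmono _
  · exact hmono _
  · exact h.core hP (not_lt.1 h2) j

lemma V_step {xs : ℕ → ℝ} (hxs : Saddle P G xs) {k : ℕ} (hk : k < P.N) {a : ℕ} {s : AS}
    (h : P.Inv a s) (ha : a ≤ P.B0) :
    ∑ j ∈ range (P.m + 1), P.q s.leaf j * P.V xs (k + 1) (P.step s j) +
      (1 - ∑ j ∈ range (P.m + 1), P.q s.leaf j) * P.V xs (k + 1) (P.step s (P.m + 1)) ≤
      P.V xs k s := by
  have hconst : ∀ s' : AS, (∀ j, P.step s j = s') → P.V xs (k + 1) s' ≤ P.V xs k s →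
      ∑ j ∈ range (P.m + 1), P.q s.leaf j * P.V xs (k + 1) (P.step s j) +
      (1 - ∑ j ∈ range (P.m + 1), P.q s.leaf j) * P.V xs (k + 1) (P.step s (P.m + 1)) ≤
      P.V xs k s := by
    intro s' h1 h2
    simp only [h1, ← sum_mul]
    linarith
  have hcap := cap_pos hP
  have hΦ := Φ_nonneg hP xs s
  have hτ := τ_pos hP
  have hσ := σ_pos hP
  have hT0 := T0_ge hP
  have he := hP.he
  have hθ := θ_pos hP
  have hθ1 : 0 < 1 - P.θ := by linarith [θ_lt hP]
  have hB : (1 : ℝ) ≤ P.B0 := by exact_mod_cast one_le_B0 hP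
  have hNk : (k : ℝ) + 1 ≤ P.N := by exact_mod_cast hk
  by_cases h1 : s.frz
  · exact hconst s (fun j => by simp [step, h1]) (by simp [V, h1])
  have hVs : P.V xs k s = 20 * P.σ / P.T0 * P.Φ xs s +
    (s.cnt + (P.N - k) / (2 * P.B0)) / P.cap +
    8 * P.τ / P.e ^ 2 * (1 - P.θ) ^ (P.N - k) * P.Φ xs s := by simp only [V, if_neg h1]
  have hp1 : 0 ≤ 20 * P.σ / P.T0 * P.Φ xs s := by positivity
  have hp2 : 0 ≤ (s.cnt + (P.N - k) / (2 * P.B0)) / P.cap := by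
    have := h.cnt
    have : (0 : ℝ) ≤ P.N - k := by linarith
    positivity
  have hp3 : 0 ≤ 8 * P.τ / P.e ^ 2 * (1 - P.θ) ^ (P.N - k) * P.Φ xs s := by positivity
  by_cases h2 : P.T0 < P.tot s.leaf
  · refine hconst { s with frz := True } (fun j => by simp [step, h1, h2]) ?_
    have := one_le_of_tot hP hxs h ha h2
    rw [hVs]
    simp only [V, if_true]
    linarith
  by_cases h3 : P.cap < s.cnt
  · refine hconst { s with frz := True } (fun j => by simp [step, h1, h2, h3]) ?_
    have : 1 ≤ (s.cnt + (P.N - k) / (2 * P.B0)) / P.cap := by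
      have : (0 : ℝ) ≤ (P.N - k) / (2 * P.B0) := div_nonneg (by linarith) (by linarith)
      rw [one_le_div hcap]
      linarith
    rw [hVs]
    simp only [V, if_true]
    linarith
  have hstep : ∀ j, P.step s j = P.core s j := fun j => by simp [step, h1, h2, h3]
  have hT := not_lt.1 h2
  have hmain := Φ_step hP hxs h ha hT
  have hfr : ∀ j, ¬ (P.core s j).frz := fun j => h1
  have hcnt : ∀ j, (P.core s j).cnt = s.cnt + if j = P.m then 1 else 0 := fun j => rfl
  have hpow : (1 - P.θ) ^ (P.N - k) = (1 - P.θ) ^ (P.N - (k + 1)) * (1 - P.θ) := by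
    rw [← pow_succ]
    congr 1
    omega
  have hqm : P.q s.leaf P.m ≤ 1 / (2 * P.B0) := by
    rw [q_m hP h, div_div]
    have := h.two_le_tot
    refine one_div_le_one_div_of_le (by positivity) ?_
    nlinarith
  simp only [hstep]
  rw [hVs]
  simp only [V, if_neg (hfr _), hcnt]
  set A := 20 * P.σ / P.T0 with hA
  set C := 8 * P.τ / P.e ^ 2 with hC
  set p := (1 - P.θ) ^ (P.N - (k + 1)) with hp
  set Q := ∑ j ∈ range (P.m + 1), P.q s.leaf j with hQ
  have hA0 : 0 ≤ A := by positivity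
  have hCp : 0 ≤ C * p := by positivity
  rw [hpow, if_neg (show ¬ P.m + 1 = P.m by omega)]
  have e1 : ∑ j ∈ range (P.m + 1), P.q s.leaf j * (A * P.Φ xs (P.core s j) +
      (s.cnt + (if j = P.m then 1 else 0) + (P.N - (k + 1 : ℕ)) / (2 * P.B0)) / P.cap +
      C * p * P.Φ xs (P.core s j)) =
      (A + C * p) * ∑ j ∈ range (P.m + 1), P.q s.leaf j * P.Φ xs (P.core s j) +
      Q * ((s.cnt + (P.N - (k + 1 : ℕ)) / (2 * P.B0)) / P.cap) + P.q s.leaf P.m / P.cap := by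
    have e2 : P.q s.leaf P.m / P.cap =
        ∑ j ∈ range (P.m + 1), P.q s.leaf j * ((if j = P.m then 1 else 0) / P.cap) := by
      rw [sum_eq_single P.m]
      · simp only [if_true]
        ring
      · intro j _ hj
        simp [hj]
      · simp
    rw [e2, hQ, sum_mul, mul_sum, ← sum_add_distrib, ← sum_add_distrib]
    exact sum_congr rfl fun j _ => by ring
  rw [e1]
  have h5 := mul_le_mul_of_nonneg_left hmain (add_nonneg hA0 hCp)
  have h6 : P.q s.leaf P.m / P.cap ≤ 1 / (2 * P.B0) / P.cap := by gcongr
  have h7 : A * ((1 - P.θ) * P.Φ xs s) ≤ A * P.Φ xs s := by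
    refine mul_le_mul_of_nonneg_left ?_ hA0
    nlinarith
  have e3 : (s.cnt + (P.N - k) / (2 * P.B0)) / P.cap =
      (s.cnt + (P.N - (k + 1 : ℕ)) / (2 * P.B0)) / P.cap + 1 / (2 * P.B0) / P.cap := by
    push_cast
    field_simp
    ring
  rw [e3, add_zero]
  set K := (s.cnt + (P.N - (k + 1 : ℕ)) / (2 * P.B0)) / P.cap
  linarith

lemma pre_inv {k a : ℕ} {s : AS} (h : P.Inv a (P.pre k s)) (ha : a = k % P.B0) (j : ℕ) :
    P.Inv ((k + 1) % P.B0) (P.pre (k + 1) (P.step (P.pre k s) j)) := by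
  have h1 := step_inv hP h j
  have hB := one_le_B0 hP
  by_cases hd : P.B0 ∣ k + 1
  · rw [show ∀ s, P.pre (k + 1) s = P.refresh s from fun s => if_pos hd,
      Nat.mod_eq_zero_of_dvd hd]
    exact h1.refresh
  · have : (k + 1) % P.B0 = a + 1 := by
      rw [Nat.add_mod_eq_ite, ← ha]
      rcases hB.eq_or_lt with h2 | h2
      · rw [← h2] at hd
        simp at hd
      · rw [Nat.mod_eq_of_lt h2, if_neg]
        intro h4
        refine hd ?_
        have h3 := Nat.mod_lt k (show P.B0 > 0 by omega)
        have h5 : k % P.B0 + 1 = P.B0 := by omega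
        have h6 := Nat.div_add_mod k P.B0
        exact ⟨k / P.B0 + 1, by rw [mul_add]; omega⟩
    rw [show ∀ s, P.pre (k + 1) s = s from fun s => if_neg hd, this]
    exact h1

lemma pB_sq_le : pB P.n P.m P.e P.S * pB P.n P.m P.e P.S ≤ 8 * (P.m + P.n : ℕ) * P.m := by
  have hm : (1 : ℝ) ≤ P.m := by exact_mod_cast hP.hm
  have hn : (1 : ℝ) ≤ P.n := by exact_mod_cast hP.hn
  have he1 := hP.he1
  have he := hP.he
  have h1 : Real.exp (Real.log (P.m * P.S) / 2) * Real.exp (Real.log (P.m * P.S) / 2) ≤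
      2 * P.m * P.n := by
    rw [← Real.exp_add, add_halves]
    rcases hP.hS.eq_or_lt with h | h
    · rw [← h]
      simp only [mul_zero, Real.log_zero, Real.exp_zero]
      nlinarith
    · rw [Real.exp_log (by positivity)]
      nlinarith [hP.hS2]
  have h2 : ((min P.n P.m : ℕ) : ℝ) ≤ P.m := by exact_mod_cast Nat.min_le_right _ _
  have h2' : (0 : ℝ) ≤ (min P.n P.m : ℕ) := by positivity
  have h3 : P.e * P.m ≤ P.m := by nlinarith
  have h4 : 0 ≤ P.e * P.m := by positivity
  unfold pB
  set E := Real.exp (Real.log (P.m * P.S) / 2)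
  have h5 : 0 ≤ E := (Real.exp_pos _).le
  set D := ((min P.n P.m : ℕ) : ℝ) + P.e * P.m
  have h6 : D * D ≤ (2 * P.m) * (2 * P.m) :=
    mul_self_le_mul_self (by positivity) (by linarith)
  push_cast
  nlinarith [sq_nonneg (D - E)]

lemma V_init {xs : ℕ → ℝ} (hxs : Saddle P G xs) : P.V xs 0 P.init ≤ 1 / 2 := by
  have hcap := cap_pos hP
  have hzb := zb_pos hP
  have hΦ := Φ_nonneg hP xs P.init
  have hτ := τ_pos hP
  have hσ := σ_pos hP
  have hT0 := T0_ge hP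
  have he := hP.he
  have hθ := θ_pos hP
  have hθ1 : 0 < 1 - P.θ := by linarith [θ_lt hP]
  have hB : (1 : ℝ) ≤ P.B0 := by exact_mod_cast one_le_B0 hP
  have hm : (1 : ℝ) ≤ P.m := by exact_mod_cast hP.hm
  have hn : (1 : ℝ) ≤ P.n := by exact_mod_cast hP.hn
  have h0 := σ_Φ_init hP hxs
  have hV : P.V xs 0 P.init = 20 * P.σ / P.T0 * P.Φ xs P.init +
      (0 + (P.N - (0 : ℕ)) / (2 * P.B0)) / P.cap +
      8 * P.τ / P.e ^ 2 * (1 - P.θ) ^ (P.N - 0) * P.Φ xs P.init := by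
    have : ¬ P.init.frz := fun h => h
    have hc : P.init.cnt = 0 := rfl
    simp only [V, if_neg this, hc]
  rw [hV]
  have h1 : 20 * P.σ / P.T0 * P.Φ xs P.init ≤ 1 / 10 := by
    rw [div_mul_eq_mul_div, div_le_iff₀ (by linarith)]
    linarith
  have h2 : (0 + (P.N - (0 : ℕ)) / (2 * P.B0)) / P.cap ≤ 1 / 8 := by
    have h3 : (P.Nb : ℝ) ≤ P.zb + 1 := (Nat.ceil_lt_add_one hzb.le).le
    unfold N
    have e : (0 + ((P.Nb * P.B0 : ℕ) - ((0 : ℕ) : ℝ)) / (2 * P.B0)) = P.Nb / 2 := by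
      have : (P.B0 : ℝ) ≠ 0 := by linarith
      rw [Nat.cast_mul]
      field_simp
      simp
    rw [e, div_le_iff₀ hcap]
    unfold cap
    linarith
  have h3 : (1 - P.θ) ^ P.N ≤ (P.e / (1000000 * (P.m + P.n : ℕ))) ^ 2 := by
    have hx : 0 < 1000000 * ((P.m + P.n : ℕ) : ℝ) / P.e := by
      have : (0 : ℝ) < (P.m + P.n : ℕ) := by push_cast; linarith
      positivity
    calc (1 - P.θ) ^ P.N ≤ Real.exp (-P.θ) ^ P.N := by
          have := Real.add_one_le_exp (-P.θ)
          gcongr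
          linarith
      _ = Real.exp (-(P.N * P.θ)) := by rw [← Real.exp_nat_mul]; ring_nf
      _ ≤ Real.exp (-(2 * Real.log (1000000 * (P.m + P.n : ℕ) / P.e))) := by
          rw [Real.exp_le_exp, neg_le_neg_iff]
          have h4 : P.zb ≤ P.Nb := Nat.le_ceil _
          have h5 : P.zb * (P.θ * P.B0) = 2 * Real.log (1000000 * (P.m + P.n : ℕ) / P.e) := by
            unfold zb
            rw [div_mul_cancel₀]
            have : (P.B0 : ℝ) ≠ 0 := by linarith
            exact mul_ne_zero hθ.ne' this
          rw [← h5]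
          unfold N
          rw [Nat.cast_mul]
          have := mul_le_mul_of_nonneg_right h4 (show 0 ≤ P.θ * P.B0 by positivity)
          linarith
      _ = _ := by
          rw [two_mul, neg_add, Real.exp_add, Real.exp_neg, Real.exp_log hx, inv_div]
          ring
  have h4 : P.τ * P.Φ xs P.init ≤ 1700 * P.T0 * (8 * (P.m + P.n : ℕ)) := by
    have e1 : P.σ = 1 / (1000 * P.T0 * pB P.n P.m P.e P.S) := rfl
    have e2 : P.τ = 1000 * pB P.n P.m P.e P.S / (3 * P.T0 * P.m) := pτ_eq hP.hn hP.hm hP.he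
    have hpB := one_le_pB (S := P.S) hP.hn hP.hm hP.he
    have e3 : P.τ = 1000000 / 3 * (pB P.n P.m P.e P.S * pB P.n P.m P.e P.S) / P.m * P.σ := by
      rw [e1, e2]
      field_simp
      norm_num
    have h5 := pB_sq_le hP
    have h6 : 1000000 / 3 * (pB P.n P.m P.e P.S * pB P.n P.m P.e P.S) / P.m ≤
        1000000 / 3 * (8 * (P.m + P.n : ℕ)) := by
      rw [div_le_iff₀ (by linarith)]
      linarith
    rw [e3, mul_assoc]
    have h7 : 0 ≤ P.σ * P.Φ xs P.init := by positivity
    have h8 : 0 ≤ P.T0 * (P.m + P.n : ℕ) := by positivity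
    calc _ ≤ 1000000 / 3 * (8 * (P.m + P.n : ℕ)) * (5 / 1000 * P.T0) := by gcongr
      _ ≤ _ := by
        push_cast at *
        linarith
  have h5 : P.T0 ≤ 2000 * (P.m + P.n : ℕ) := by
    have : Real.log (2 * P.n) ≤ 2 * P.n - 1 := Real.log_le_sub_one_of_pos (by positivity)
    change 1000 * (1 + Real.log (2 * P.n)) ≤ _
    push_cast
    linarith
  have h6 : 8 * P.τ / P.e ^ 2 * (1 - P.θ) ^ (P.N - 0) * P.Φ xs P.init ≤ 1 / 10 := by
    rw [Nat.sub_zero]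
    have hM : (1 : ℝ) ≤ (P.m + P.n : ℕ) := by push_cast; linarith
    set M : ℝ := ((P.m + P.n : ℕ) : ℝ)
    calc _ = (1 - P.θ) ^ P.N * (8 / P.e ^ 2) * (P.τ * P.Φ xs P.init) := by ring
      _ ≤ (P.e / (1000000 * M)) ^ 2 * (8 / P.e ^ 2) * (1700 * (2000 * M) * (8 * M)) := by
        have h7 : P.τ * P.Φ xs P.init ≤ 1700 * (2000 * M) * (8 * M) := by
          refine h4.trans ?_
          gcongr
        have h8 : 0 ≤ P.τ * P.Φ xs P.init := by positivity
        gcongr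
      _ ≤ 1 / 10 := by
        have : (P.e / (1000000 * M)) ^ 2 * (8 / P.e ^ 2) * (1700 * (2000 * M) * (8 * M)) =
          8 * (1700 * 2000 * 8) / 1000000 ^ 2 := by field_simp
        rw [this]
        norm_num
  linarith

lemma row_le_of_V {xs : ℕ → ℝ} (hxs : Saddle P G xs) {s : AS} (hs : 0 ≤ s.cnt)
    (h : P.V xs P.N s < 1) {r : ℕ} (hr : r < 2 * P.n) : P.row s.x r ≤ G + P.e := by
  have hcap := cap_pos hP
  have hΦ := Φ_nonneg hP xs s
  have hτ := τ_pos hP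
  have hσ := σ_pos hP
  have hT0 := T0_ge hP
  have he := hP.he
  have hfr : ¬ s.frz := by
    intro hf
    simp [V, hf] at h
  simp only [V, if_neg hfr, sub_self, zero_div, add_zero, Nat.sub_self, pow_zero, mul_one] at h
  have h1 : 0 ≤ 20 * P.σ / P.T0 * P.Φ xs s := by positivity
  have h2 : 0 ≤ s.cnt / P.cap := by positivity
  have h3 : 8 * P.τ / P.e ^ 2 * P.Φ xs s < 1 := by linarith
  rw [div_mul_eq_mul_div, div_lt_one (by positivity)] at h3
  have h4 : 1 / (2 * P.τ) * ∑ j ∈ range (P.m + 1), P.w j * (s.x j - xs j) ^ 2 ≤ P.Φ xs s := by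
    have hk : 0 ≤ 1 / P.σ * ∑ r ∈ range (2 * P.n), kl (P.val xs r / P.t)
        ((s.v r + s.κ / (1 - P.θ) * s.ρ r) / P.t) :=
      mul_nonneg (by positivity) (sum_nonneg fun _ _ => kl_nonneg _ _)
    unfold Φ pot
    rw [mul_sum]
    have : ∑ j ∈ range (P.m + 1), 1 / (2 * P.τ) * (P.w j * (s.x j - xs j) ^ 2) =
        ∑ j ∈ range (P.m + 1), P.w j / (2 * P.τ) * (s.x j - xs j) ^ 2 :=
      sum_congr rfl fun j _ => by ring
    linarith
  rw [one_div_mul_eq_div, div_le_iff₀ (by positivity)] at h4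
  have h5 : ∑ j ∈ range (P.m + 1), P.w j * (s.x j - xs j) ^ 2 ≤ P.e ^ 2 / 4 := by nlinarith
  rw [sum_range_succ] at h5
  have h6 : 0 ≤ P.w P.m * (s.x P.m - xs P.m) ^ 2 :=
    mul_nonneg (w_nonneg hP _ (by simp)).le (sq_nonneg _)
  have h7 : (∑ j ∈ range P.m, |P.a r j| * |s.x j - xs j|) ^ 2 ≤ (P.e / 2) ^ 2 := by
    calc _ ≤ (∑ j ∈ range P.m, |P.a r j|) * ∑ j ∈ range P.m, |P.a r j| * (s.x j - xs j) ^ 2 := by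
          refine sum_sq_le_sum_mul_sum_of_sq_le_mul _ (fun j _ => abs_nonneg _)
            (fun j _ => by positivity) fun j _ => ?_
          rw [mul_pow, sq_abs (s.x j - xs j)]
          exact le_of_eq (by ring)
      _ ≤ 1 * ∑ j ∈ range P.m, P.w j * (s.x j - xs j) ^ 2 := by
          refine mul_le_mul (hP.row_le r hr) (sum_le_sum fun j hj => ?_)
            (sum_nonneg fun j _ => by positivity) zero_le_one
          have := hP.a_le r hr j (mem_range.1 hj)
          gcongr
      _ ≤ _ := by linarith
  have h8 := abs_le_of_sq_le_sq' h7 (by positivity)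
  have h9 := hxs.row_le r hr
  have h10 : P.row s.x r - P.row xs r ≤ ∑ j ∈ range P.m, |P.a r j| * |s.x j - xs j| := by
    unfold row
    rw [add_sub_add_right_eq_sub, ← sum_sub_distrib]
    refine sum_le_sum fun j _ => ?_
    rw [← mul_sub, ← abs_mul]
    exact le_abs_self _
  linarith [h8.2]

end Inst
end Regr

/-! ### Chains driven by the random tape -/

namespace Regr

open ProbabilityTheory

/-- The events that depend on the first `o` entries of the tape. -/
abbrev past (o : ℕ) : MeasurableSpace Tape :=
  MeasurableSpace.comap (fun (ω : Tape) (i : Finset.range o) => ω i) inferInstance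

lemma past_le (o : ℕ) : past o ≤ (inferInstance : MeasurableSpace Tape) := by
  rw [← measurable_iff_comap_le]
  fun_prop

lemma measurable_past {o i : ℕ} (hi : i < o) : Measurable[past o] fun ω : Tape => ω i := by
  have h : Measurable fun f : Finset.range o → unitInterval => f ⟨i, Finset.mem_range.2 hi⟩ :=
    measurable_pi_apply _
  exact h.comp (comap_measurable _)

lemma past_mono {o o' : ℕ} (h : o ≤ o') : past o ≤ past o' := by
  rw [← measurable_iff_comap_le]
  exact @measurable_pi_lambda _ _ _ (past o') _ _ fun i =>
    measurable_past ((Finset.mem_range.1 i.2).trans_le h)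

instance : IsProbabilityMeasure tapeMeasure := by unfold tapeMeasure; infer_instance

lemma map_tape (o : ℕ) : tapeMeasure.map (fun ω : Tape => ω o) = volume := by
  unfold tapeMeasure
  exact Measure.infinitePi_map_eval _ o

lemma indep_past (o : ℕ) :
    Indep (past o) (MeasurableSpace.comap (fun ω : Tape => ω o) inferInstance) tapeMeasure := by
  have h1 : iIndepFun (fun (i : ℕ) (ω : Tape) => ω i) tapeMeasure := by
    unfold tapeMeasure
    exact iIndepFun_infinitePi (X := fun _ u => u) (fun _ => measurable_id)
  have h2 := h1.indepFun_finset (Finset.range o) {o} (by simp) (fun i => measurable_pi_apply i)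
  have hm : Measurable fun f : ({o} : Finset ℕ) → unitInterval =>
      f ⟨o, Finset.mem_singleton_self o⟩ := measurable_pi_apply _
  exact h2.comp measurable_id hm

lemma lintegral_past {o : ℕ} {A : Set Tape} (hA : MeasurableSet[past o] A)
    {f : unitInterval → ENNReal} (hf : Measurable f) :
    ∫⁻ ω in A, f (ω o) ∂tapeMeasure = tapeMeasure A * ∫⁻ u, f u := by
  have hi : Measurable[past o] (A.indicator (1 : Tape → ENNReal)) :=
    @Measurable.indicator Tape ENNReal A 1 (past o) _ _ (@measurable_one _ _ _ (past o) _) hA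
  have h1 := lintegral_mul_eq_lintegral_mul_lintegral_of_independent_measurableSpace (past_le o)
    (measurable_iff_comap_le.1 (measurable_pi_apply o)) (indep_past o)
    (f := A.indicator 1) (g := fun ω => f (ω o))
    hi (hf.comp (comap_measurable _))
  have hA' := past_le o _ hA
  rw [← map_tape o, lintegral_map hf (measurable_pi_apply o), ← lintegral_indicator_one hA', ← h1,
    ← lintegral_indicator hA']
  refine lintegral_congr fun ω => ?_
  by_cases h : ω ∈ A <;> simp [h]

variable {α : Type*} (s0 : α) (step : ℕ → α → unitInterval → α)

/-- The chain that starts in `s0` and reads the tape from position `o`. -/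
def chain (o : ℕ) (ω : Tape) : ℕ → α
  | 0 => s0
  | k + 1 => step k (chain o ω k) (ω (o + k))

variable {s0 step}
variable (hmeas : ∀ k s (A : Set α), MeasurableSet {u | step k s u ∈ A})
  (hfin : ∀ k s, (Set.range (step k s)).Finite)
include hfin

lemma chain_finite (o k : ℕ) : (Set.range fun ω => chain s0 step o ω k).Finite := by
  induction k with
  | zero => exact (Set.finite_singleton s0).subset (by rintro _ ⟨ω, rfl⟩; rfl)
  | succ k ih =>
    refine (ih.biUnion fun s _ => hfin k s).subset ?_
    rintro _ ⟨ω, rfl⟩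
    exact Set.mem_biUnion ⟨ω, rfl⟩ ⟨_, rfl⟩

include hmeas

lemma chain_past (o k : ℕ) (A : Set α) :
    MeasurableSet[past (o + k)] {ω | chain s0 step o ω k ∈ A} := by
  induction k generalizing A with
  | zero => exact @MeasurableSet.const _ (past (o + 0)) (s0 ∈ A)
  | succ k ih =>
    have e : {ω | chain s0 step o ω (k + 1) ∈ A} =
        ⋃ s ∈ Set.range fun ω => chain s0 step o ω k, ({ω | chain s0 step o ω k ∈ ({s} : Set α)} ∩
          {ω | step k s (ω (o + k)) ∈ A}) := by
      ext ω
      simp only [chain, Set.mem_ofPred_eq, Set.mem_iUnion, Set.mem_inter_iff,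
        Set.mem_singleton_iff, exists_prop]
      constructor
      · exact fun h => ⟨_, ⟨ω, rfl⟩, rfl, h⟩
      · rintro ⟨s, -, rfl, h⟩
        exact h
    rw [e]
    refine Set.Finite.measurableSet_biUnion (chain_finite hfin o k) fun s _ => ?_
    exact MeasurableSet.inter (past_mono (by omega) _ (ih {s}))
      (measurable_past (o := o + (k + 1)) (by omega) (hmeas k s A))

lemma lintegral_chain_le {V : ℕ → α → ENNReal} {J : ℕ → α → Prop} {N : ℕ} (hJ0 : J 0 s0)
    (hJ : ∀ k < N, ∀ s, J k s → ∀ u, J (k + 1) (step k s u))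
    (hV : ∀ k < N, ∀ s, J k s → ∫⁻ u, V (k + 1) (step k s u) ≤ V k s)
    {o : ℕ} {A : Set Tape} (hA : MeasurableSet[past o] A) {k : ℕ} (hk : k ≤ N) :
    ∫⁻ ω in A, V k (chain s0 step o ω k) ∂tapeMeasure ≤ tapeMeasure A * V 0 s0 := by
  induction k with
  | zero => simp [chain, mul_comm]
  | succ k ih =>
    have hJk : ∀ j ≤ k, ∀ ω, J j (chain s0 step o ω j) := by
      intro j hj ω
      induction j with
      | zero => exact hJ0
      | succ j ihj => exact hJ j (by omega) _ (ihj (by omega)) _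
    refine le_trans ?_ (ih (by omega))
    classical
    set F := (chain_finite (s0 := s0) hfin o k).toFinset with hF
    set B : α → Set Tape := fun s => A ∩ {ω | chain s0 step o ω k ∈ ({s} : Set α)} with hB
    have hBp : ∀ s, MeasurableSet[past (o + k)] (B s) := fun s =>
      MeasurableSet.inter (past_mono (by omega) _ hA) (chain_past hmeas hfin o k {s})
    have hBm : ∀ s, MeasurableSet (B s) := fun s => past_le _ _ (hBp s)
    have hAU : A = ⋃ s ∈ F, B s := by
      ext ω
      simp only [hB, Set.mem_iUnion, Set.mem_inter_iff, Set.mem_ofPred_eq, Set.mem_singleton_iff,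
        exists_prop]
      constructor
      · exact fun h => ⟨_, by simp [hF], h, rfl⟩
      · rintro ⟨s, -, h, -⟩
        exact h
    have hd : Set.PairwiseDisjoint (F : Set α) B := by
      intro s _ s' _ hss
      refine Set.disjoint_left.2 fun ω h1 h2 => hss ?_
      exact h1.2.symm.trans h2.2
    rw [hAU, lintegral_biUnion_finset hd (fun s _ => hBm s),
      lintegral_biUnion_finset hd (fun s _ => hBm s)]
    refine Finset.sum_le_sum fun s hs => ?_
    have hs' : J k s := by
      obtain ⟨ω, rfl⟩ := (Set.Finite.mem_toFinset _).1 hs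
      exact hJk k le_rfl ω
    calc _ = ∫⁻ ω in B s, V (k + 1) (step k s (ω (o + k))) ∂tapeMeasure := by
          refine setLIntegral_congr_fun (hBm s) fun ω hω => ?_
          have : chain s0 step o ω k = s := hω.2
          simp only [chain, this]
      _ = tapeMeasure (B s) * ∫⁻ u, V (k + 1) (step k s u) :=
          lintegral_past (f := fun u => V (k + 1) (step k s u)) (hBp s)
            fun C _ => hmeas k s (V (k + 1) ⁻¹' C)
      _ ≤ tapeMeasure (B s) * V k s := by gcongr; exact hV k (by omega) s hs'
      _ = ∫⁻ ω in B s, V k s ∂tapeMeasure := by simp [mul_comm]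
      _ = _ := by
          refine setLIntegral_congr_fun (hBm s) fun ω hω => ?_
          have : chain s0 step o ω k = s := hω.2
          simp only [this]

/-- The probability that all of `R` independent runs end with a large potential. -/
theorem measure_chain_le {V : ℕ → α → ENNReal} {J : ℕ → α → Prop} {N : ℕ} (hJ0 : J 0 s0)
    (hJ : ∀ k < N, ∀ s, J k s → ∀ u, J (k + 1) (step k s u))
    (hV : ∀ k < N, ∀ s, J k s → ∫⁻ u, V (k + 1) (step k s u) ≤ V k s)
    {p : ENNReal} (hp : V 0 s0 ≤ p) (R : ℕ) :
    tapeMeasure {ω | ∀ r < R, 1 ≤ V N (chain s0 step (r * N) ω N)} ≤ p ^ R := by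
  have hbad : ∀ r, MeasurableSet[past (r * N + N)] {ω | 1 ≤ V N (chain s0 step (r * N) ω N)} :=
    fun r => chain_past hmeas hfin (r * N) N {s | 1 ≤ V N s}
  have hall : ∀ R, MeasurableSet[past (R * N)]
      {ω | ∀ r < R, 1 ≤ V N (chain s0 step (r * N) ω N)} := by
    intro R
    have e : {ω | ∀ r < R, 1 ≤ V N (chain s0 step (r * N) ω N)} =
        ⋂ r ∈ Set.Iio R, {ω | 1 ≤ V N (chain s0 step (r * N) ω N)} := by
      ext ω
      simp
    rw [e]
    refine Set.Finite.measurableSet_biInter (Set.finite_Iio R) fun r hr => ?_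
    refine past_mono ?_ _ (hbad r)
    have h1 : r < R := hr
    have : (r + 1) * N ≤ R * N := Nat.mul_le_mul_right _ h1
    linarith
  induction R with
  | zero => simp
  | succ R ih =>
    have e : {ω | ∀ r < R + 1, 1 ≤ V N (chain s0 step (r * N) ω N)} =
        {ω | 1 ≤ V N (chain s0 step (R * N) ω N)} ∩
          {ω | ∀ r < R, 1 ≤ V N (chain s0 step (r * N) ω N)} := by
      ext ω
      simp only [Set.mem_ofPred_eq, Set.mem_inter_iff]
      constructor
      · exact fun h => ⟨h R (by omega), fun r hr => h r (by omega)⟩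
      · rintro ⟨h1, h2⟩ r hr
        rcases (Nat.lt_succ_iff.1 hr).lt_or_eq with h | h
        · exact h2 r h
        · exact h ▸ h1
    set A := {ω | ∀ r < R, 1 ≤ V N (chain s0 step (r * N) ω N)} with hA
    rw [e, ← Measure.restrict_apply (past_le _ _ (hbad R))]
    have hm : Measurable fun ω => V N (chain s0 step (R * N) ω N) := fun C _ =>
      past_le _ _ (chain_past hmeas hfin (R * N) N (V N ⁻¹' C))
    calc _ ≤ ∫⁻ ω in A, V N (chain s0 step (R * N) ω N) ∂tapeMeasure := by
          have := mul_meas_ge_le_lintegral (μ := tapeMeasure.restrict A) hm 1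
          simpa using this
      _ ≤ tapeMeasure A * V 0 s0 := lintegral_chain_le hmeas hfin hJ0 hJ hV (hall R) le_rfl
      _ ≤ p ^ R * p := by gcongr
      _ = p ^ (R + 1) := (pow_succ _ _).symm

end Regr

/-! ### The sampler -/

namespace Regr

open Finset

lemma volume_unitInterval_Ico {T a b : ℝ} (hT : 0 < T) (ha : 0 ≤ a) (hb : b ≤ T) :
    volume {u : unitInterval | a ≤ u * T ∧ u * T < b} = ENNReal.ofReal ((b - a) / T) := by
  have e : {u : unitInterval | a ≤ u * T ∧ u * T < b} =
      Subtype.val ⁻¹' Set.Ico (a / T) (b / T) := by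
    ext u
    simp [div_le_iff₀ hT, lt_div_iff₀ hT]
  rw [e, Measure.Subtype.volume_def, comap_subtype_coe_apply
    (show MeasurableSet (unitInterval : Set ℝ) from measurableSet_Icc), Subtype.image_preimage_coe,
    Set.inter_eq_self_of_subset_right, Real.volume_Ico, sub_div]
  intro x hx
  exact ⟨(div_nonneg ha hT.le).trans hx.1, hx.2.le.trans ((div_le_one hT).2 hb)⟩

namespace Inst
variable (P : Inst)

/-- Total weight of the leaves before `l`. -/
noncomputable def pre' (leaf : ℕ → ℝ) (l : ℕ) : ℝ := ∑ i ∈ range l, leaf i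

/-- Cumulative weight of the columns before `j` in a row of the sampler. -/
noncomputable def cw (i j : ℕ) : ℝ := ∑ k ∈ range j, P.wt i k

/-- The random number `u` selects leaf `l` and column `j`. -/
def Cell (leaf : ℕ → ℝ) (l j : ℕ) (u : ℝ) : Prop :=
  pre' leaf l + leaf l * P.cw (l / 2) j ≤ u * P.tot leaf ∧
    u * P.tot leaf < pre' leaf l + leaf l * P.cw (l / 2) (j + 1)

/-- The random number `u` selects column `j`. -/
def Hit (leaf : ℕ → ℝ) (u : ℝ) (j : ℕ) : Prop :=
  j ≤ P.m ∧ ∃ l < 2 * P.n + 1, P.Cell leaf l j u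

/-- The column selected by `u`, or `m + 1`. -/
noncomputable def pick (leaf : ℕ → ℝ) (u : ℝ) : ℕ :=
  sInf {j | P.Hit leaf u j ∨ j = P.m + 1}

variable {P} {G : ℝ} (hP : P.Good G)

lemma cw_mono (i : ℕ) : Monotone (P.cw i) := fun _ _ hab =>
  sum_le_sum_of_subset_of_nonneg (range_subset_range.2 hab) fun _ _ _ => wt_nonneg _ _

lemma cw_nonneg (i j : ℕ) : 0 ≤ P.cw i j := sum_nonneg fun _ _ => wt_nonneg _ _

lemma pre'_succ (leaf : ℕ → ℝ) (l : ℕ) : pre' leaf (l + 1) = pre' leaf l + leaf l :=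
  sum_range_succ _ _

lemma pre'_mono {leaf : ℕ → ℝ} {N : ℕ} (h : ∀ l < N, 0 ≤ leaf l) {a b : ℕ} (hab : a ≤ b)
    (hb : b ≤ N) : pre' leaf a ≤ pre' leaf b :=
  sum_le_sum_of_subset_of_nonneg (range_subset_range.2 hab) fun i hi _ =>
    h i ((mem_range.1 hi).trans_le hb)

include hP

lemma cw_le_one {i j : ℕ} (hj : j ≤ P.m + 1) : P.cw i j ≤ 1 :=
  (cw_mono i hj).trans (sum_wt_le hP i)

lemma Cell.pre {leaf : ℕ → ℝ} (h0 : ∀ l < 2 * P.n + 1, 0 ≤ leaf l) {l j : ℕ} {u : ℝ}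
    (hl : l < 2 * P.n + 1) (hj : j ≤ P.m) (h : P.Cell leaf l j u) :
    pre' leaf l ≤ u * P.tot leaf ∧ u * P.tot leaf < pre' leaf (l + 1) := by
  have h1 := mul_nonneg (h0 l hl) (cw_nonneg (P := P) (l / 2) j)
  have h2 := mul_le_mul_of_nonneg_left
    (cw_le_one hP (i := l / 2) (show j + 1 ≤ P.m + 1 by omega)) (h0 l hl)
  rw [pre'_succ]
  exact ⟨by linarith [h.1], by linarith [h.2]⟩

omit hP in
lemma leaf_unique {leaf : ℕ → ℝ} {N : ℕ} (h0 : ∀ l < N, 0 ≤ leaf l) {l l' : ℕ} {X : ℝ}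
    (hl : l < N) (hl' : l' < N) (h : pre' leaf l ≤ X ∧ X < pre' leaf (l + 1))
    (h' : pre' leaf l' ≤ X ∧ X < pre' leaf (l' + 1)) : l = l' := by
  rcases lt_trichotomy l l' with hlt | rfl | hlt
  · have := pre'_mono h0 (show l + 1 ≤ l' from hlt) hl'.le
    linarith [h.2, h'.1]
  · rfl
  · have := pre'_mono h0 (show l' + 1 ≤ l from hlt) hl.le
    linarith [h.1, h'.2]

omit hP in
lemma Cell.unique {leaf : ℕ → ℝ} {l j j' : ℕ} {u : ℝ} (h0 : 0 ≤ leaf l) (h : P.Cell leaf l j u)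
    (h' : P.Cell leaf l j' u) : j = j' := by
  rcases lt_trichotomy j j' with hlt | rfl | hlt
  · have := mul_le_mul_of_nonneg_left (cw_mono (P := P) (l / 2) (show j + 1 ≤ j' from hlt)) h0
    linarith [h.2, h'.1]
  · rfl
  · have := mul_le_mul_of_nonneg_left (cw_mono (P := P) (l / 2) (show j' + 1 ≤ j from hlt)) h0
    linarith [h.1, h'.2]

lemma Hit.unique {leaf : ℕ → ℝ} (h0 : ∀ l < 2 * P.n + 1, 0 ≤ leaf l) {u : ℝ} {j j' : ℕ}
    (h : P.Hit leaf u j) (h' : P.Hit leaf u j') : j = j' := by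
  obtain ⟨hj, l, hl, h⟩ := h
  obtain ⟨hj', l', hl', h'⟩ := h'
  obtain rfl := leaf_unique h0 hl hl' (h.pre hP h0 hl hj) (h'.pre hP h0 hl' hj')
  exact h.unique (h0 l hl) h'

omit hP in
lemma pick_spec (leaf : ℕ → ℝ) (u : ℝ) :
    P.Hit leaf u (P.pick leaf u) ∨ P.pick leaf u = P.m + 1 :=
  Nat.sInf_mem (s := {j | P.Hit leaf u j ∨ j = P.m + 1}) ⟨P.m + 1, Or.inr rfl⟩

omit hP in
lemma pick_le_of_hit {leaf : ℕ → ℝ} {u : ℝ} {j : ℕ} (h : P.Hit leaf u j) : P.pick leaf u ≤ j :=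
  Nat.sInf_le (Or.inl h)

lemma pick_eq {leaf : ℕ → ℝ} (h0 : ∀ l < 2 * P.n + 1, 0 ≤ leaf l) {u : ℝ} {j : ℕ}
    (h : P.Hit leaf u j) : P.pick leaf u = j := by
  rcases pick_spec leaf u with h' | h'
  · exact h'.unique hP h0 h
  · have := pick_le_of_hit h
    have := h.1
    omega

omit hP in
lemma pick_eq_none {leaf : ℕ → ℝ} {u : ℝ} (h : ∀ j, ¬ P.Hit leaf u j) :
    P.pick leaf u = P.m + 1 :=
  (pick_spec leaf u).resolve_left (h _)

omit hP in
lemma pick_le (leaf : ℕ → ℝ) (u : ℝ) : P.pick leaf u ≤ P.m + 1 :=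
  Nat.sInf_le (Or.inr rfl)

lemma pick_eq_iff {leaf : ℕ → ℝ} (h0 : ∀ l < 2 * P.n + 1, 0 ≤ leaf l) {u : ℝ} {j : ℕ}
    (hj : j ≤ P.m) : P.pick leaf u = j ↔ ∃ l ∈ range (2 * P.n + 1), P.Cell leaf l j u := by
  constructor
  · intro h
    by_cases hex : ∃ j, P.Hit leaf u j
    · obtain ⟨j', h'⟩ := hex
      rw [pick_eq hP h0 h'] at h
      obtain ⟨-, l, hl, hc⟩ := h'
      exact ⟨l, mem_range.2 hl, h ▸ hc⟩
    · rw [pick_eq_none (by simpa using hex)] at h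
      omega
  · rintro ⟨l, hl, h⟩
    exact pick_eq hP h0 ⟨hj, l, mem_range.1 hl, h⟩

omit hP in
lemma measurableSet_Cell (leaf : ℕ → ℝ) (l j : ℕ) :
    MeasurableSet {u : unitInterval | P.Cell leaf l j u} := by
  unfold Cell
  exact (measurableSet_le measurable_const (measurable_subtype_coe.mul_const _)).inter
    (measurableSet_lt (measurable_subtype_coe.mul_const _) measurable_const)

omit hP in
lemma measurableSet_pick (leaf : ℕ → ℝ) (A : Set ℕ) :
    MeasurableSet {u : unitInterval | P.pick leaf u ∈ A} := by
  have hm : Measurable fun u : unitInterval => P.pick leaf u := by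
    refine measurable_of_Iic fun j => ?_
    have e : (fun u : unitInterval => P.pick leaf u) ⁻¹' Set.Iic j =
        {_u : unitInterval | P.m + 1 ≤ j} ∪ ⋃ i ∈ range (P.m + 1) ∩ range (j + 1),
          ⋃ l ∈ range (2 * P.n + 1), {u : unitInterval | P.Cell leaf l i u} := by
      ext u
      simp only [Set.mem_preimage, Set.mem_Iic, Set.mem_union, Set.mem_ofPred_eq, Set.mem_iUnion,
        exists_prop, mem_inter, mem_range, Nat.lt_succ_iff]
      constructor
      · intro h
        rcases pick_spec leaf u with ⟨h1, l, h2, h3⟩ | h'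
        · exact Or.inr ⟨_, ⟨h1, h⟩, l, by omega, h3⟩
        · exact Or.inl (h' ▸ h)
      · rintro (h | ⟨i, ⟨h1, h2⟩, l, hl, h3⟩)
        · exact (pick_le _ _).trans h
        · exact (pick_le_of_hit ⟨h1, l, by omega, h3⟩).trans h2
    rw [e]
    refine (MeasurableSet.const _).union ?_
    exact Finset.measurableSet_biUnion _ fun i _ => Finset.measurableSet_biUnion _ fun l _ =>
      measurableSet_Cell leaf l i
  exact hm (MeasurableSet.of_discrete (s := A))

lemma volume_pick {leaf : ℕ → ℝ} (h0 : ∀ l < 2 * P.n + 1, 0 ≤ leaf l) (hT : 0 < P.tot leaf)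
    {j : ℕ} (hj : j ≤ P.m) : volume {u : unitInterval | P.pick leaf u = j} =
      ENNReal.ofReal (P.q leaf j) := by
  have e : {u : unitInterval | P.pick leaf u = j} =
      ⋃ l ∈ range (2 * P.n + 1), {u : unitInterval | P.Cell leaf l j u} := by
    ext u
    simp only [Set.mem_ofPred_eq, Set.mem_iUnion, exists_prop]
    exact pick_eq_iff hP h0 hj
  have hpre : ∀ l, 0 ≤ pre' leaf (min l (2 * P.n + 1)) := fun l => by
    refine le_trans (le_of_eq (by simp [pre'])) (pre'_mono h0 (Nat.zero_le _) (min_le_right _ _))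
  rw [e, measure_biUnion_finset]
  · unfold q
    rw [sum_div, ENNReal.ofReal_sum_of_nonneg fun l hl => div_nonneg (mul_nonneg
      (h0 l (mem_range.1 hl)) (wt_nonneg _ _)) hT.le]
    refine sum_congr rfl fun l hl => ?_
    have hl' := mem_range.1 hl
    unfold Cell
    rw [volume_unitInterval_Ico hT]
    · congr 2
      unfold cw
      rw [sum_range_succ]
      ring
    · have := hpre l
      rw [min_eq_left hl'.le] at this
      have := mul_nonneg (h0 l hl') (cw_nonneg (P := P) (l / 2) j)
      linarith
    · have h2 := mul_le_mul_of_nonneg_left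
        (cw_le_one hP (i := l / 2) (show j + 1 ≤ P.m + 1 by omega)) (h0 l hl')
      have h3 := pre'_mono h0 (show l + 1 ≤ 2 * P.n + 1 from hl') le_rfl
      rw [pre'_succ] at h3
      change _ ≤ P.tot leaf at h3
      linarith
  · intro l hl l' hl' hne
    refine Set.disjoint_left.2 fun u h1 h2 => hne ?_
    have hl := mem_range.1 (mem_coe.1 hl)
    have hl' := mem_range.1 (mem_coe.1 hl')
    exact leaf_unique h0 hl hl' (Cell.pre hP h0 hl hj h1) (Cell.pre hP h0 hl' hj h2)
  · exact fun l _ => measurableSet_Cell leaf l j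

lemma lintegral_pick {leaf : ℕ → ℝ} (h0 : ∀ l < 2 * P.n + 1, 0 ≤ leaf l) (hT : 0 < P.tot leaf)
    {F : ℕ → ℝ} (hF : ∀ j, 0 ≤ F j) :
    ∫⁻ u : unitInterval, ENNReal.ofReal (F (P.pick leaf u)) =
      ENNReal.ofReal (∑ j ∈ range (P.m + 1), P.q leaf j * F j +
        (1 - ∑ j ∈ range (P.m + 1), P.q leaf j) * F (P.m + 1)) := by
  set A : ℕ → Set unitInterval := fun j => {u | P.pick leaf u = j} with hA
  have hAm : ∀ j, MeasurableSet (A j) := fun j => measurableSet_pick leaf {j}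
  have hU : (Set.univ : Set unitInterval) = ⋃ j ∈ range (P.m + 2), A j := by
    ext u
    simp only [Set.mem_univ, Set.mem_iUnion, exists_prop, true_iff]
    exact ⟨_, mem_range.2 (Nat.lt_succ_of_le (pick_le leaf u)), rfl⟩
  have hd : Set.PairwiseDisjoint (range (P.m + 2) : Set ℕ) A := fun j _ j' _ hne =>
    Set.disjoint_left.2 fun u h1 h2 => hne (h1.symm.trans h2)
  have hq : ∀ j ∈ range (P.m + 1), 0 ≤ P.q leaf j := fun j _ =>
    div_nonneg (sum_nonneg fun l hl => mul_nonneg (h0 l (mem_range.1 hl)) (wt_nonneg _ _)) hT.le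
  have hv : ∀ j ∈ range (P.m + 1), volume (A j) = ENNReal.ofReal (P.q leaf j) := fun j hj =>
    volume_pick hP h0 hT (Nat.lt_succ_iff.1 (mem_range.1 hj))
  have hone : (1 : ENNReal) = ENNReal.ofReal (∑ j ∈ range (P.m + 1), P.q leaf j) +
      volume (A (P.m + 1)) := by
    rw [← measure_univ (μ := (volume : Measure unitInterval)), hU,
      measure_biUnion_finset hd fun j _ => hAm j, sum_range_succ, sum_congr rfl hv,
      ENNReal.ofReal_sum_of_nonneg hq]
  have hsum : ∑ j ∈ range (P.m + 1), P.q leaf j ≤ 1 := by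
    have : ENNReal.ofReal (∑ j ∈ range (P.m + 1), P.q leaf j) ≤ 1 := by
      rw [hone]
      exact le_self_add
    simpa using this
  have hlast : volume (A (P.m + 1)) =
      ENNReal.ofReal (1 - ∑ j ∈ range (P.m + 1), P.q leaf j) := by
    rw [ENNReal.ofReal_sub _ (sum_nonneg hq), ENNReal.ofReal_one]
    exact ENNReal.eq_sub_of_add_eq ENNReal.ofReal_ne_top (by rw [add_comm]; exact hone.symm)
  rw [← setLIntegral_univ, hU, lintegral_biUnion_finset hd fun j _ => hAm j]
  have hj : ∀ j, ∫⁻ u in A j, ENNReal.ofReal (F (P.pick leaf u)) =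
      volume (A j) * ENNReal.ofReal (F j) := by
    intro j
    rw [setLIntegral_congr_fun (g := fun _ => ENNReal.ofReal (F j)) (hAm j) fun u hu => by
      have : P.pick leaf u = j := hu
      simp only [this]]
    simp [mul_comm]
  simp only [hj]
  rw [sum_range_succ, ENNReal.ofReal_add (sum_nonneg fun j hj => mul_nonneg (hq j hj) (hF j))
    (mul_nonneg (by linarith) (hF _)), ENNReal.ofReal_sum_of_nonneg fun j hj =>
      mul_nonneg (hq j hj) (hF j), ENNReal.ofReal_mul (by linarith), hlast]
  congr 1
  exact sum_congr rfl fun j hj => by rw [hv j hj, ENNReal.ofReal_mul (hq j hj)]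

end Inst
end Regr

/-! ### Failure probability of the method -/

namespace Regr

open Finset

namespace Inst

/-- One step of the method, with the random number `u`. -/
noncomputable def ustep (P : Inst) (k : ℕ) (s : AS) (u : ℝ) : AS :=
  P.step (P.pre k s) (P.pick (P.pre k s).leaf u)

variable {P : Inst} {G : ℝ} (hP : P.Good G)

lemma V_pre (xs : ℕ → ℝ) (k k' : ℕ) (s : AS) : P.V xs k (P.pre k' s) = P.V xs k s := by
  unfold pre
  split_ifs <;> rfl

lemma pre_x (k : ℕ) (s : AS) : (P.pre k s).x = s.x := by
  unfold pre
  split_ifs <;> rfl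

lemma pre_cnt (k : ℕ) (s : AS) : (P.pre k s).cnt = s.cnt := by
  unfold pre
  split_ifs <;> rfl

include hP

lemma inv_init : P.Inv (0 % P.B0) (P.pre 0 P.init) := by
  rw [Nat.zero_mod, pre, if_pos (dvd_zero _)]
  exact inv_refresh_init hP

lemma inv_ustep {k : ℕ} {s : AS} (h : P.Inv (k % P.B0) (P.pre k s)) (u : ℝ) :
    P.Inv ((k + 1) % P.B0) (P.pre (k + 1) (P.ustep k s u)) :=
  pre_inv hP h rfl _

lemma box_chain (o k : ℕ) (ω : Tape) (j : ℕ) :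
    (chain P.init (fun k s (u : unitInterval) => P.ustep k s u) o ω k).x j ∈
      Set.Icc (-1 : ℝ) 1 := by
  have : P.Inv (k % P.B0)
      (P.pre k (chain P.init (fun k s (u : unitInterval) => P.ustep k s u) o ω k)) := by
    induction k with
    | zero => exact inv_init hP
    | succ k ih => exact inv_ustep hP ih _
  have h := this.box j
  rwa [pre_x] at h

/-- With high probability one of `R` independent runs finds an approximate solution. -/
theorem measure_runs_le (R : ℕ) :
    tapeMeasure {ω | ∀ r < R, ∃ i < 2 * P.n, G + P.e <
      P.row (chain P.init (fun k s (u : unitInterval) => P.ustep k s u) (r * P.N) ω P.N).x i} ≤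
      (1 / 2) ^ R := by
  obtain ⟨xs, hxs⟩ := exists_saddle hP
  set st : ℕ → AS → unitInterval → AS := fun k s u => P.ustep k s u with hst
  have hmeas : ∀ k s (A : Set AS), MeasurableSet {u : unitInterval | st k s u ∈ A} :=
    fun k s A => measurableSet_pick (P.pre k s).leaf {j | P.step (P.pre k s) j ∈ A}
  have hfin : ∀ k s, (Set.range (st k s)).Finite := by
    intro k s
    refine ((Set.finite_Iic (P.m + 1)).image (P.step (P.pre k s))).subset ?_
    rintro _ ⟨u, rfl⟩
    exact ⟨_, pick_le _ _, rfl⟩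
  have hBB : ∀ k, k % P.B0 ≤ P.B0 := fun k => (Nat.mod_lt k (one_le_B0 hP)).le
  have key := measure_chain_le (s0 := P.init) (step := st) hmeas hfin
    (V := fun k s => ENNReal.ofReal (P.V xs k s))
    (J := fun k s => P.Inv (k % P.B0) (P.pre k s)) (N := P.N) (p := 1 / 2)
    (inv_init hP) (fun k _ s h u => inv_ustep hP h u) (fun k hk s h => ?_) ?_ R
  · refine le_trans (measure_mono fun ω hω => ?_) key
    intro r hr
    obtain ⟨i, hi, hlt⟩ := hω r hr
    rw [ENNReal.one_le_ofReal]
    by_contra hV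
    have hinv : ∀ k, P.Inv (k % P.B0) (P.pre k (chain P.init st (r * P.N) ω k)) := by
      intro k
      induction k with
      | zero => exact inv_init hP
      | succ k ih => exact inv_ustep hP ih _
    have hc := (hinv P.N).cnt
    rw [pre_cnt] at hc
    exact (row_le_of_V hP hxs hc (not_le.1 hV) hi).not_gt hlt
  · have hT := h.two_le_tot
    have h1 := V_step hP hxs hk h (hBB k)
    have := lintegral_pick hP (leaf := (P.pre k s).leaf) (fun l hl => h.leaf_nonneg hl)
      (by linarith) (F := fun j => P.V xs (k + 1) (P.step (P.pre k s) j))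
      (fun j => V_nonneg hP hk (step_inv hP h j).cnt)
    refine (le_of_eq this).trans ?_
    rw [← V_pre xs k k s]
    exact ENNReal.ofReal_le_ofReal h1
  · refine (ENNReal.ofReal_le_ofReal (V_init hP hxs)).trans (le_of_eq ?_)
    rw [one_div, one_div, ENNReal.ofReal_inv_of_pos (by norm_num)]
    norm_num

end Inst
end Regr

/-! ### Reasoning about commands -/

namespace Loop

namespace Cmd

/-- Word variables are modified only at or above `a`, real variables `b`, word arrays `p`, real
arrays `q`; random numbers are used only if `z`. -/
def above (a b p q : ℕ) (z : Bool) : Cmd → Bool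
  | iset v _ => a.ble v
  | rset v _ => b.ble v
  | iput x _ _ => p.ble x
  | rput x _ _ => q.ble x
  | rand v => b.ble v && z
  | skip => true
  | seq c d => c.above a b p q z && d.above a b p q z
  | ifI _ _ c d => c.above a b p q z && d.above a b p q z
  | ifR _ _ c d => c.above a b p q z && d.above a b p q z
  | loop v _ c => a.ble v && c.above a b p q z
  | rep _ c => c.above a b p q z

end Cmd

/-- Agreement of two states below the given bounds. -/
structure Below (a b p q : ℕ) (z : Bool) (s s' : St) : Prop where
  i : ∀ (v : ℕ) (_ : v < a := by norm_num), s'.i v = s.i v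
  r : ∀ (v : ℕ) (_ : v < b := by norm_num), s'.r v = s.r v
  ia : ∀ (x : ℕ) (_ : x < p := by norm_num), s'.ia x = s.ia x
  ra : ∀ (x : ℕ) (_ : x < q := by norm_num), s'.ra x = s.ra x
  pos : z = false → s'.pos = s.pos

namespace Below
variable {a b p q : ℕ} {z : Bool} {s s' s'' : St}

lemma rfl' : Below a b p q z s s :=
  ⟨fun _ _ => rfl, fun _ _ => rfl, fun _ _ => rfl, fun _ _ => rfl, fun _ => rfl⟩

lemma trans (h : Below a b p q z s s') (h' : Below a b p q z s' s'') : Below a b p q z s s'' :=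
  ⟨fun v hv => (h'.i v hv).trans (h.i v hv), fun v hv => (h'.r v hv).trans (h.r v hv),
    fun v hv => (h'.ia v hv).trans (h.ia v hv), fun v hv => (h'.ra v hv).trans (h.ra v hv),
    fun hz => (h'.pos hz).trans (h.pos hz)⟩

lemma setI {v : ℕ} (hv : a ≤ v) (x : ℕ) : Below a b p q z s (s.setI v x) :=
  ⟨fun w hw => by simp [show w ≠ v by omega], fun _ _ => rfl, fun _ _ => rfl, fun _ _ => rfl,
    fun _ => rfl⟩

lemma setR {v : ℕ} (hv : b ≤ v) (x : ℝ) : Below a b p q z s (s.setR v x) :=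
  ⟨fun _ _ => rfl, fun w hw => by simp [show w ≠ v by omega], fun _ _ => rfl, fun _ _ => rfl,
    fun _ => rfl⟩

end Below

lemma Below.iter {a b p q : ℕ} {z : Bool} {f : ℕ → St → St}
    (hf : ∀ k s, Below a b p q z s (f k s)) (s : St) (k : ℕ) :
    Below a b p q z s (iter f k s) := by
  induction k with
  | zero => exact .rfl'
  | succ k ih => exact ih.trans (hf k _)

theorem Cmd.den_below {a b p q : ℕ} {z : Bool} {ω : Tape} {c : Cmd}
    (h : c.above a b p q z = true) (s : St) : Below a b p q z s (c.den ω s) := by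
  induction c generalizing s with
  | iset v e => exact .setI (Nat.le_of_ble_eq_true h) _
  | rset v e => exact .setR (Nat.le_of_ble_eq_true h) _
  | iput x i e =>
    have := Nat.le_of_ble_eq_true h
    exact ⟨fun _ _ => rfl, fun _ _ => rfl, fun w hw => by simp [Cmd.den, show w ≠ x by omega],
      fun _ _ => rfl, fun _ => rfl⟩
  | rput x i e =>
    have := Nat.le_of_ble_eq_true h
    exact ⟨fun _ _ => rfl, fun _ _ => rfl, fun _ _ => rfl,
      fun w hw => by simp [Cmd.den, show w ≠ x by omega], fun _ => rfl⟩
  | rand v =>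
    simp only [above, Bool.and_eq_true] at h
    have h1 := Below.setR (s := s) (a := a) (p := p) (q := q) (z := z)
      (Nat.le_of_ble_eq_true h.1) (ω s.pos : ℝ)
    exact { h1 with pos := fun hz => by simp [h.2] at hz }
  | skip => exact .rfl'
  | seq c d ihc ihd =>
    simp only [above, Bool.and_eq_true] at h
    exact (ihc h.1 s).trans (ihd h.2 _)
  | ifI x y c d ihc ihd =>
    simp only [above, Bool.and_eq_true] at h
    simp only [Cmd.den]
    split_ifs
    · exact ihc h.1 s
    · exact ihd h.2 s
  | ifR x y c d ihc ihd =>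
    simp only [above, Bool.and_eq_true] at h
    simp only [Cmd.den]
    split_ifs
    · exact ihc h.1 s
    · exact ihd h.2 s
  | loop v e c ih =>
    simp only [above, Bool.and_eq_true] at h
    exact Below.iter (fun k s => (Below.setI (Nat.le_of_ble_eq_true h.1) k).trans (ih h.2 _)) _ _
  | rep e c ih => exact Below.iter (fun k s => ih h s) _ _

variable (W E H : ℕ) (ω : Tape)

/-- Started in `s`, the command `c` is executed without error in time at most `T`, and `Q` holds
for the final state. -/
structure Tri (c : Cmd) (s : St) (T : ℕ) (Q : St → Prop) : Prop where
  ok : c.ok W E H ω s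
  cost : c.cost ω s ≤ T
  post : Q (c.den ω s)

variable {W E H ω} {c d : Cmd} {s : St} {T T₁ T₂ : ℕ} {Q R : St → Prop}

namespace Tri

lemma mono (h : Tri W E H ω c s T₁ Q) (hT : T₁ ≤ T) (hQ : ∀ s', Q s' → R s') :
    Tri W E H ω c s T R := ⟨h.ok, h.cost.trans hT, hQ _ h.post⟩

lemma le (h : Tri W E H ω c s T₁ Q) (hT : T₁ ≤ T) : Tri W E H ω c s T Q := h.mono hT fun _ => id

lemma conseq (h : Tri W E H ω c s T Q) (hQ : ∀ s', Q s' → R s') : Tri W E H ω c s T R :=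
  h.mono le_rfl hQ

lemma frame (h : Tri W E H ω c s T Q) {a b p q : ℕ} {z : Bool}
    (hc : c.above a b p q z = true) :
    Tri W E H ω c s T fun s' => Q s' ∧ Below a b p q z s s' :=
  ⟨h.ok, h.cost, h.post, Cmd.den_below hc s⟩

lemma seq (h : Tri W E H ω c s T₁ R) (h' : ∀ s', R s' → Tri W E H ω d s' T₂ Q) :
    Tri W E H ω (c.seq d) s (T₁ + T₂) Q :=
  have h2 := h' _ h.post
  ⟨⟨h.ok, h2.ok⟩, Nat.add_le_add h.cost h2.cost, h2.post⟩

/-- Symbolic execution of a first command without loops. -/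
lemma step (hok : c.ok W E H ω s) (hc : c.cost ω s ≤ T₁)
    (h' : Tri W E H ω d (c.den ω s) T₂ Q) : Tri W E H ω (c.seq d) s (T₁ + T₂) Q :=
  ⟨⟨hok, h'.ok⟩, Nat.add_le_add hc h'.cost, h'.post⟩

lemma ifI {x y : IE} (hx : x.ok W E H s) (hy : y.ok W E H s)
    (h1 : x.eval s < y.eval s → Tri W E H ω c s T Q)
    (h2 : ¬ x.eval s < y.eval s → Tri W E H ω d s T Q) :
    Tri W E H ω (.ifI x y c d) s (x.cost + y.cost + 1 + T) Q := by
  by_cases h : x.eval s < y.eval s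
  · refine ⟨⟨hx, hy, fun _ => (h1 h).ok, fun h' => absurd h h'⟩, ?_, ?_⟩
    · simp only [Cmd.cost, if_pos h]
      have := (h1 h).cost
      omega
    · simp only [Cmd.den, if_pos h]
      exact (h1 h).post
  · refine ⟨⟨hx, hy, fun h' => absurd h' h, fun _ => (h2 h).ok⟩, ?_, ?_⟩
    · simp only [Cmd.cost, if_neg h]
      have := (h2 h).cost
      omega
    · simp only [Cmd.den, if_neg h]
      exact (h2 h).post

lemma ifR {x y : RE} (hx : x.ok W E H s) (hy : y.ok W E H s)
    (h1 : x.eval s < y.eval s → Tri W E H ω c s T Q)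
    (h2 : ¬ x.eval s < y.eval s → Tri W E H ω d s T Q) :
    Tri W E H ω (.ifR x y c d) s (x.cost + y.cost + 1 + T) Q := by
  by_cases h : x.eval s < y.eval s
  · refine ⟨⟨hx, hy, fun _ => (h1 h).ok, fun h' => absurd h h'⟩, ?_, ?_⟩
    · simp only [Cmd.cost, if_pos h]
      have := (h1 h).cost
      omega
    · simp only [Cmd.den, if_pos h]
      exact (h1 h).post
  · refine ⟨⟨hx, hy, fun h' => absurd h' h, fun _ => (h2 h).ok⟩, ?_, ?_⟩
    · simp only [Cmd.cost, if_neg h]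
      have := (h2 h).cost
      omega
    · simp only [Cmd.den, if_neg h]
      exact (h2 h).post

lemma iter_acc {f : ℕ → St → St} {g : ℕ → St → St} {a N : ℕ} (I : ℕ → ℕ → St → Prop)
    (h0 : I 0 0 s) (hf : ∀ k s, f k s = c.den ω (g k s))
    (hs : ∀ k < N, ∀ t s', I k t s' → ∃ T', Tri W E H ω c (g k s') T'
      fun s'' => I (k + 1) (t + (T' + a)) s'') :
    ∀ k ≤ N, (∃ t, ∑ j ∈ Finset.range k, (c.cost ω (g j (iter f j s)) + a) ≤ t ∧
      I k t (iter f k s)) ∧ ∀ j < k, c.ok W E H ω (g j (iter f j s)) := by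
  intro k hk
  induction k with
  | zero => exact ⟨⟨0, by simp, h0⟩, by simp⟩
  | succ k ih =>
    obtain ⟨⟨t, h1, h2⟩, h3⟩ := ih (by omega)
    obtain ⟨T', h4⟩ := hs k (by omega) _ _ h2
    refine ⟨⟨t + (T' + a), ?_, ?_⟩, fun j hj => ?_⟩
    · rw [Finset.sum_range_succ]
      have := h4.cost
      omega
    · have := h4.post
      rwa [← hf] at this
    · rcases (Nat.lt_succ_iff.1 hj).lt_or_eq with h | h
      · exact h3 j h
      · exact h ▸ h4.ok

/-- Bounded loops; the second argument of the invariant bounds the time used so far. -/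
lemma loop_acc {v : ℕ} {e : IE} (N : ℕ) (I : ℕ → ℕ → St → Prop) (he : e.ok W E H s)
    (hN : e.eval s = N) (hW : N < W) (h0 : I 0 0 s)
    (hs : ∀ k < N, ∀ t s', I k t s' → ∃ T', Tri W E H ω c (s'.setI v k) T'
      fun s'' => I (k + 1) (t + (T' + 4)) s'')
    (he' : ∀ t s', I N t s' → t ≤ T ∧ Q s') :
    Tri W E H ω (.loop v e c) s (e.cost + 2 + T) Q := by
  obtain ⟨⟨t, h1, h2⟩, h3⟩ := iter_acc (f := fun k s => c.den ω (s.setI v k))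
    (g := fun k s => s.setI v k) (a := 4) I h0 (fun _ _ => rfl) hs N le_rfl
  obtain ⟨h4, h5⟩ := he' _ _ h2
  refine ⟨⟨he, by rwa [hN], by rw [hN]; exact h3⟩, ?_, ?_⟩
  · simp only [Cmd.cost, hN]
    omega
  · simp only [Cmd.den, hN]
    exact h5

/-- Bounded loops with a body whose running time is bounded. -/
lemma loop {v : ℕ} {e : IE} (N : ℕ) (I : ℕ → St → Prop) (he : e.ok W E H s)
    (hN : e.eval s = N) (hW : N < W) (h0 : I 0 s)
    (hs : ∀ k < N, ∀ s', I k s' → Tri W E H ω c (s'.setI v k) T (I (k + 1)))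
    (he' : ∀ s', I N s' → Q s') :
    Tri W E H ω (.loop v e c) s (e.cost + 2 + N * (T + 4)) Q := by
  refine loop_acc N (fun k t s' => I k s' ∧ t = k * (T + 4)) he hN hW ⟨h0, by simp⟩ ?_ ?_
  · rintro k hk t s' ⟨h1, rfl⟩
    exact ⟨T, (hs k hk s' h1).conseq fun s'' h2 => ⟨h2, by ring⟩⟩
  · rintro t s' ⟨h1, rfl⟩
    exact ⟨le_rfl, he' s' h1⟩

/-- Repetition; the second argument of the invariant bounds the time used so far. -/
lemma rep_acc {e : RE} (N : ℕ) (I : ℕ → ℕ → St → Prop) (he : e.ok W E H s)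
    (hN : ⌈e.eval s⌉₊ = N) (h0 : I 0 0 s)
    (hs : ∀ k < N, ∀ t s', I k t s' → ∃ T', Tri W E H ω c s' T'
      fun s'' => I (k + 1) (t + (T' + 3)) s'')
    (he' : ∀ t s', I N t s' → t ≤ T ∧ Q s') :
    Tri W E H ω (.rep e c) s (e.cost + 2 + T) Q := by
  obtain ⟨⟨t, h1, h2⟩, h3⟩ := iter_acc (f := fun _ s => c.den ω s)
    (g := fun _ s => s) (a := 3) I h0 (fun _ _ => rfl) hs N le_rfl
  obtain ⟨h4, h5⟩ := he' _ _ h2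
  refine ⟨⟨he, by rw [hN]; exact h3⟩, ?_, ?_⟩
  · simp only [Cmd.cost, hN]
    omega
  · simp only [Cmd.den, hN]
    exact h5

/-- Bounded loops that modify only cells and variables above given bounds. -/
lemma loop_frame {v : ℕ} {e : IE} (N : ℕ) (I : ℕ → St → Prop) {a b p q : ℕ} {z : Bool}
    (hc : (Cmd.loop v e c).above a b p q z = true) (he : e.ok W E H s)
    (hN : e.eval s = N) (hW : N < W) (h0 : I 0 s)
    (hs : ∀ k < N, ∀ s', I k s' → Below a b p q z s s' →
      Tri W E H ω c (s'.setI v k) T (I (k + 1))) :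
    Tri W E H ω (.loop v e c) s (e.cost + 2 + N * (T + 4))
      fun s' => I N s' ∧ Below a b p q z s s' := by
  have hc' := hc
  simp only [Cmd.above, Bool.and_eq_true] at hc'
  refine loop N (fun k s' => I k s' ∧ Below a b p q z s s') he hN hW ⟨h0, .rfl'⟩ ?_ fun _ h => h
  rintro k hk s' ⟨h1, h2⟩
  exact ((hs k hk s' h1 h2).frame hc'.2).conseq fun s'' h => ⟨h.1,
    (h2.trans (.setI (Nat.le_of_ble_eq_true hc'.1) k)).trans h.2⟩

end Tri

section costs
@[simp] lemma IE.cost_var (v : ℕ) : (IE.var v).cost = 1 := rfl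
@[simp] lemma IE.cost_ofNat (k : ℕ) : (no_index (OfNat.ofNat k : IE)).cost = 1 := rfl
@[simp] lemma IE.cost_add (a b : IE) : (a + b).cost = a.cost + (b.cost + 1) := rfl
@[simp] lemma IE.cost_sub (a b : IE) : (a - b).cost = a.cost + (b.cost + 1) := rfl
@[simp] lemma IE.cost_half (a : IE) : a.half.cost = a.cost + 1 := rfl
@[simp] lemma IE.cost_arr (a : ℕ) (e : IE) : (IE.arr a e).cost = e.cost + 5 := rfl
@[simp] lemma RE.cost_var (v : ℕ) : (RE.var v).cost = 1 := rfl
@[simp] lemma RE.cost_ofNat (k : ℕ) : (no_index (OfNat.ofNat k : RE)).cost = 1 := rfl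
@[simp] lemma RE.cost_cast (e : IE) : (RE.cast e).cost = e.cost + 1 := rfl
@[simp] lemma RE.cost_add (a b : RE) : (a + b).cost = a.cost + (b.cost + 1) := rfl
@[simp] lemma RE.cost_sub (a b : RE) : (a - b).cost = a.cost + (b.cost + 1) := rfl
@[simp] lemma RE.cost_mul (a b : RE) : (a * b).cost = a.cost + (b.cost + 1) := rfl
@[simp] lemma RE.cost_div (a b : RE) : (a / b).cost = a.cost + (b.cost + 1) := rfl
@[simp] lemma RE.cost_max (a b : RE) : (a.max b).cost = a.cost + (b.cost + 2) := rfl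
@[simp] lemma RE.cost_exp (a : RE) : a.exp.cost = a.cost + 1 := rfl
@[simp] lemma RE.cost_log (a : RE) : a.log.cost = a.cost + 1 := rfl
@[simp] lemma RE.cost_arr (a : ℕ) (e : IE) : (RE.arr a e).cost = e.cost + 5 := rfl
end costs

end Loop

/-! ### The sampling tree -/

namespace Loop

infixr:50 " ;; " => Loop.Cmd.seq

open Finset

/-- Every inner node of a complete binary tree of height `h` is the sum of its children. -/
def TreeOK (h : ℕ) (tr : ℕ → ℝ) : Prop :=
  ∀ a, 1 ≤ a → a < 2 ^ h → tr a = tr (2 * a) + tr (2 * a + 1)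

lemma TreeOK.sum {h : ℕ} {tr : ℕ → ℝ} (ht : TreeOK h tr) (k : ℕ) {a : ℕ} (ha : 1 ≤ a)
    (hk : (a + 1) * 2 ^ k ≤ 2 * 2 ^ h) : tr a = ∑ i ∈ range (2 ^ k), tr (a * 2 ^ k + i) := by
  induction k generalizing a with
  | zero => simp
  | succ k ih =>
    have h1 : 1 ≤ 2 ^ k := Nat.one_le_two_pow
    rw [pow_succ] at hk
    have h2 : a < 2 ^ h := by nlinarith
    have h3 : (2 * a + 1 + 1) * 2 ^ k ≤ 2 * 2 ^ h := by linarith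
    rw [ht a ha h2, ih (by omega) (by nlinarith), ih (by omega) h3, pow_succ, mul_two,
      sum_range_add]
    congr 1
    · exact sum_congr rfl fun i _ => by congr 1; ring
    · exact sum_congr rfl fun i _ => by congr 1; ring

lemma TreeOK.update {h : ℕ} {tr : ℕ → ℝ} {P : ℕ → Prop}
    (ht : ∀ a, 1 ≤ a → a < 2 ^ h → P a → tr a = tr (2 * a) + tr (2 * a + 1)) {b : ℕ} :
    ∀ a, 1 ≤ a → a < 2 ^ h → (P a ∨ a = b) → a ≠ b / 2 →
      Function.update tr b (tr (2 * b) + tr (2 * b + 1)) a =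
        Function.update tr b (tr (2 * b) + tr (2 * b + 1)) (2 * a) +
        Function.update tr b (tr (2 * b) + tr (2 * b + 1)) (2 * a + 1) := by
  intro a ha hah hP hab
  rw [Function.update_of_ne (show 2 * a ≠ b by omega),
    Function.update_of_ne (show 2 * a + 1 ≠ b by omega)]
  by_cases h : a = b
  · rw [h, Function.update_self]
  · rw [Function.update_of_ne h]
    exact ht a ha hah (hP.resolve_right h)

/-- Assign the leaf in word variable `14` the value of real variable `29`. -/
def setLeaf : Cmd :=
  .iset 15 (.var 5 + .var 14) ;;
  .rput 10 (.var 15) (.var 29) ;;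
  .loop 16 (.var 4) (.iset 15 (.half (.var 15)) ;;
    .rput 10 (.var 15) (.arr 10 (.var 15 + .var 15) + .arr 10 (.var 15 + .var 15 + 1)))

variable {W E H : ℕ} {ω : Tape}

lemma setLeaf_spec {s : St} {h r : ℕ} (ht : TreeOK h (s.ra 10)) (h4 : s.i 4 = h)
    (h5 : s.i 5 = 2 ^ h) (h14 : s.i 14 = r) (hr : r < 2 ^ h) (hE : 2 * 2 ^ h ≤ E) (hW : E ≤ W) :
    Tri W E H ω setLeaf s (20 + 50 * h) fun s' => (TreeOK h (s'.ra 10) ∧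
      ∀ l < 2 ^ h, s'.ra 10 (2 ^ h + l) = if l = r then s.r 29 else s.ra 10 (2 ^ h + l)) ∧
      Below 15 1000 16 10 false s s' := by
  refine Tri.frame ?_ (by decide)
  have hh : h < 2 ^ h := Nat.lt_two_pow_self
  unfold setLeaf
  refine Tri.le (Tri.step (T₁ := 4) (by simp [Cmd.ok, h5, h14]; omega) (by simp [Cmd.cost])
    (Tri.step (T₁ := 7) (by simp [Cmd.ok, Cmd.den, h5, h14]; omega) (by simp [Cmd.cost])
    (Tri.loop (T := 43) h (fun k s' => s'.i 15 = (2 ^ h + r) / 2 ^ k ∧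
      (∀ a, 1 ≤ a → a < 2 ^ h → (∀ j, a ≠ (2 ^ h + r) / 2 ^ (k + 1 + j)) →
        s'.ra 10 a = s'.ra 10 (2 * a) + s'.ra 10 (2 * a + 1)) ∧
      ∀ l < 2 ^ h, s'.ra 10 (2 ^ h + l) = if l = r then s.r 29 else s.ra 10 (2 ^ h + l))
      (by simp) (by simp [Cmd.den, h4]) (by omega) ?_ ?_ ?_))) ?_
  · refine ⟨by simp [Cmd.den, h5, h14], fun a ha hah hP => ?_, fun l hl => ?_⟩
    · have h0 := hP 0
      simp only [Cmd.den, IE.eval_add, IE.eval_var, RE.eval_var, St.putR_ra, St.setI_ra,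
        St.setI_i, Function.update_self, St.setI_r, h5, h14]
      rw [Function.update_of_ne (by omega), Function.update_of_ne (by omega),
        Function.update_of_ne (by omega)]
      exact ht a ha hah
    · simp only [Cmd.den, IE.eval_add, IE.eval_var, RE.eval_var, St.putR_ra, St.setI_ra,
        St.setI_i, Function.update_self, St.setI_r, h5, h14, Function.update_apply,
        Nat.add_left_cancel_iff]
  · rintro k hk s' ⟨h15, hv, hl⟩
    have e1 : (2 ^ h + r) / 2 ^ k / 2 = (2 ^ h + r) / 2 ^ (k + 1) := by
      rw [Nat.div_div_eq_div_mul, pow_succ]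
    have hb1 : 1 ≤ (2 ^ h + r) / 2 ^ (k + 1) := by
      rw [Nat.one_le_div_iff (by positivity)]
      exact (Nat.pow_le_pow_right (by norm_num) hk).trans (Nat.le_add_right _ _)
    have hb2 : (2 ^ h + r) / 2 ^ (k + 1) < 2 ^ h := by
      rw [Nat.div_lt_iff_lt_mul (by positivity)]
      have : 2 ≤ 2 ^ (k + 1) := by rw [pow_succ]; have := Nat.one_le_two_pow (n := k); omega
      nlinarith
    set b := (2 ^ h + r) / 2 ^ (k + 1) with hb
    refine ⟨?_, ?_, ?_, ?_, ?_⟩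
    · simp [Cmd.ok, Cmd.den, h15, e1]
      omega
    · simp [Cmd.cost]
    · simp [Cmd.den, h15, e1]
    · intro a ha hah hP
      have := TreeOK.update (tr := s'.ra 10) hv (b := b) a ha hah ?_ ?_
      · simpa [Cmd.den, h15, e1, ← two_mul] using this
      · by_cases hab : a = b
        · exact Or.inr hab
        · refine Or.inl fun j => ?_
          cases j with
          | zero => exact hab
          | succ j =>
            have := hP j
            rwa [add_right_comm _ 1 j] at this
      · have := hP 0
        rwa [add_zero, pow_succ, ← Nat.div_div_eq_div_mul, ← hb] at this
    · intro l hl'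
      simp only [Cmd.den, St.putR_ra, St.setI_ra, Function.update_self, IE.eval_var, St.setI_i,
        IE.eval_half, h15, Function.update_of_ne (show 15 ≠ 16 by norm_num), e1]
      rw [Function.update_of_ne (by omega), hl l hl']
  · rintro s' ⟨-, hv, hl⟩
    refine ⟨fun a ha hah => hv a ha hah fun j => ?_, hl⟩
    have : (2 ^ h + r) / 2 ^ (h + 1 + j) = 0 := by
      refine Nat.div_eq_of_lt ?_
      have : 2 ^ (h + 1) ≤ 2 ^ (h + 1 + j) := Nat.pow_le_pow_right (by norm_num) (by omega)
      rw [pow_succ] at this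
      omega
    omega
  · simp only [IE.cost_var]
    omega

end Loop

/-! ### Sampling -/

namespace Loop

open Finset Regr

/-- The rows of the sampler: row `i` occupies the positions from `rp i` to `rp (i + 1)`, with
columns `cj` and cumulative weights `pw`. -/
structure RowOK (P : Inst) (h E : ℕ) (rp cj : ℕ → ℕ) (pw : ℕ → ℝ) : Prop where
  le : ∀ i ≤ P.n, rp i ≤ rp (i + 1)
  lt : ∀ i ≤ P.n, rp (i + 1) < rp i + 2 ^ h
  bd : ∀ i ≤ P.n + 1, rp i < E
  col : ∀ i ≤ P.n, ∀ p, rp i ≤ p → p < rp (i + 1) → cj p ≤ P.m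
  prev : ∀ i ≤ P.n, ∀ p, rp i ≤ p → p < rp (i + 1) →
    (if p = rp i then 0 else pw (p - 1)) = P.cw i (cj p)
  last : ∀ i ≤ P.n, (if rp (i + 1) = rp i then 0 else pw (rp (i + 1) - 1)) = P.cw i (P.m + 1)
  pw : ∀ i ≤ P.n, ∀ p, rp i ≤ p → p < rp (i + 1) → pw p = P.cw i (cj p + 1)

/-- The columns: column `j` occupies the positions from `ap j` to `ap (j + 1)`, with rows `er` and
entries `ev`. -/
structure ColOK (P : Inst) (E : ℕ) (ap er : ℕ → ℕ) (ev : ℕ → ℝ) : Prop where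
  le : ∀ j ≤ P.m, ap j ≤ ap (j + 1)
  bd : ∀ j ≤ P.m + 1, ap j < E
  row : ∀ j ≤ P.m, ∀ e, ap j ≤ e → e < ap (j + 1) → er e < 2 * P.n
  val : ∀ j ≤ P.m, ∀ e, ap j ≤ e → e < ap (j + 1) → ev e = P.a (er e) j
  ne : ∀ j ≤ P.m, ∀ e, ap j ≤ e → e < ap (j + 1) → ev e ≠ 0
  inj : ∀ j ≤ P.m, ∀ e e', ap j ≤ e → e < ap (j + 1) → ap j ≤ e' → e' < ap (j + 1) →
    er e = er e' → e = e'
  cov : ∀ j ≤ P.m, ∀ r, P.a r j ≠ 0 → ∃ e, ap j ≤ e ∧ e < ap (j + 1) ∧ er e = r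

/-- The tree holds the weights `leaf`. -/
structure LeafOK (P : Inst) (h : ℕ) (leaf : ℕ → ℝ) (tr : ℕ → ℝ) : Prop where
  tree : TreeOK h tr
  leaf : ∀ l < 2 * P.n + 1, tr (2 ^ h + l) = leaf l
  rest : ∀ l < 2 ^ h, 2 * P.n + 1 ≤ l → tr (2 ^ h + l) = 0

lemma LeafOK.pre' {P : Inst} {h : ℕ} {leaf tr : ℕ → ℝ} (ht : LeafOK P h leaf tr) {l : ℕ}
    (hl : l ≤ 2 * P.n + 1) : ∑ i ∈ range l, tr (2 ^ h + i) = Inst.pre' leaf l :=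
  sum_congr rfl fun i hi => ht.leaf i ((mem_range.1 hi).trans_le hl)

lemma LeafOK.root {P : Inst} {h : ℕ} {leaf tr : ℕ → ℝ} (ht : LeafOK P h leaf tr)
    (hh : 2 * P.n + 1 ≤ 2 ^ h) : tr 1 = P.tot leaf := by
  have e : range (2 ^ h) = range (2 * P.n + 1 + (2 ^ h - (2 * P.n + 1))) := by congr 1; omega
  rw [ht.tree.sum h le_rfl (by omega), e, sum_range_add]
  simp only [one_mul]
  rw [ht.pre' le_rfl]
  have : ∑ i ∈ range (2 ^ h - (2 * P.n + 1)), tr (2 ^ h + (2 * P.n + 1 + i)) = 0 :=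
    sum_eq_zero fun i hi => ht.rest _ (by have := mem_range.1 hi; omega) (by omega)
  rw [this, add_zero]
  rfl

/-- Find the leaf that is selected by the real variable `23`. -/
def findLeaf : Cmd :=
  .rset 30 (.var 23 * .arr 10 1) ;;
  .iset 15 1 ;;
  .loop 16 (.var 4) (.iset 15 (.var 15 + .var 15) ;;
    .ifR (.var 30) (.arr 10 (.var 15)) .skip
      (.rset 30 (.var 30 - .arr 10 (.var 15)) ;; .iset 15 (.var 15 + 1)))

/-- Find the position in the row of the selected leaf by bisection. -/
def findCol : Cmd :=
  .rset 31 (.arr 10 (.var 15)) ;;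
  .iset 14 (.half (.var 15 - .var 5)) ;;
  .iset 17 (.arr 1 (.var 14)) ;;
  .iset 20 (.arr 1 (.var 14 + 1)) ;;
  .iset 18 (.var 20) ;;
  .loop 16 (.var 4) (.ifI (.var 17) (.var 18)
    (.iset 19 (.half (.var 17 + .var 18)) ;;
      .ifR (.var 30) (.var 31 * .arr 1 (.var 19)) (.iset 18 (.var 19)) (.iset 17 (.var 19 + 1)))
    .skip) ;;
  .ifI (.var 17) (.var 20) (.iset 11 (.arr 2 (.var 17))) .skip

/-- Select a column with the random number in the real variable `23`. -/
def findCmd : Cmd :=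
  .iset 11 (.var 1 + 1) ;;
  .ifR (.var 23) 1 (findLeaf ;; findCol) .skip

variable {W E H : ℕ} {ω : Tape}

lemma findLeaf_spec {s : St} {h : ℕ} (ht : TreeOK h (s.ra 10)) (h4 : s.i 4 = h)
    (hE : 2 * 2 ^ h ≤ E) (hW : E ≤ W) (h0 : 0 ≤ s.r 23 * s.ra 10 1)
    (h1 : s.r 23 * s.ra 10 1 < s.ra 10 1) :
    Tri W E H ω findLeaf s (30 + 50 * h) fun s' => (∃ l < 2 ^ h, s'.i 15 = 2 ^ h + l ∧
      s'.r 30 = s.r 23 * s.ra 10 1 - ∑ i ∈ range l, s.ra 10 (2 ^ h + i) ∧ 0 ≤ s'.r 30 ∧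
      s'.r 30 < s.ra 10 (2 ^ h + l)) ∧ Below 15 30 16 16 false s s' := by
  have hh : h < 2 ^ h := Nat.lt_two_pow_self
  unfold findLeaf
  refine Tri.le (Tri.step (T₁ := 9) (by simp [Cmd.ok]; omega) (by simp [Cmd.cost])
    (Tri.step (T₁ := 2) (by simp [Cmd.ok]; omega) (by simp [Cmd.cost])
    ((Tri.loop_frame (T := 45) h (fun k s' => 2 ^ k ≤ s'.i 15 ∧ s'.i 15 < 2 * 2 ^ k ∧
      s'.r 30 = s.r 23 * s.ra 10 1 -
        ∑ i ∈ range (s'.i 15 * 2 ^ (h - k) - 2 ^ h), s.ra 10 (2 ^ h + i) ∧ 0 ≤ s'.r 30 ∧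
      s'.r 30 < s.ra 10 (s'.i 15)) (a := 15) (b := 30) (p := 16) (q := 16) (z := false)
      (by decide) (by simp) (by simp [Cmd.den, h4]) (by omega) ?_ ?_).conseq ?_))) ?_
  · simp only [Cmd.den, IE.eval_ofNat, St.setI_i, Function.update_self, St.setI_r, St.setR_r,
      RE.eval_mul, RE.eval_arr, RE.eval_var]
    refine ⟨by simp, by simp, by simp, h0, h1⟩
  · rintro k hk s' ⟨i1, i2, i3, i4, i5⟩ hB
    have h10 : s'.ra 10 = s.ra 10 := hB.ra 10
    set a := s'.i 15 with ha
    have hpow : 2 ^ (h - k) = 2 * 2 ^ (h - (k + 1)) := by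
      rw [← pow_succ']
      congr 1
      omega
    have hk2 : 2 ^ k * 2 ^ (h - k) = 2 ^ h := by rw [← pow_add]; congr 1; omega
    have hlt : 2 ^ (k + 1) ≤ 2 ^ h := Nat.pow_le_pow_right (by norm_num) hk
    rw [pow_succ] at hlt
    have h1k : 1 ≤ 2 ^ k := Nat.one_le_two_pow
    set M := 2 ^ (h - (k + 1)) with hM
    have hlow : 2 ^ h ≤ a * (2 * M) := by
      rw [← hpow, ← hk2]
      exact Nat.mul_le_mul_right _ i1
    have hup : (a + 1) * (2 * M) ≤ 2 * 2 ^ h := by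
      rw [← hpow, ← hk2, ← mul_assoc]
      exact Nat.mul_le_mul_right _ i2
    have hval := ht a (by omega) (by omega)
    have hsum := ht.sum (h - (k + 1)) (a := 2 * a) (by omega) (by rw [← hM]; nlinarith)
    refine Tri.le (Tri.step (T₁ := 4) (by simp [Cmd.ok, ← ha]; omega) (by simp [Cmd.cost])
      (Tri.ifR (T := 20) (by simp) (by simp [Cmd.den, ← ha]; omega) ?_ ?_))
      (by simp)
    · intro hc
      simp only [Cmd.den, RE.eval_var, RE.eval_arr, IE.eval_add, IE.eval_var, St.setI_r,
        St.setI_ra, St.setI_i, Function.update_self, ← ha, h10, ← two_mul,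
        Function.update_of_ne (show 15 ≠ 16 by norm_num)] at hc
      refine ⟨by simp [Cmd.ok], by simp [Cmd.cost], ?_⟩
      simp only [Cmd.den, IE.eval_add, IE.eval_var, St.setI_r,
        St.setI_i, Function.update_self, ← ha, ← two_mul, pow_succ,
        Function.update_of_ne (show 15 ≠ 16 by norm_num)]
      rw [hpow, ← mul_assoc, mul_comm a] at i3
      exact ⟨by omega, by omega, i3, i4, hc⟩
    · intro hc
      simp only [Cmd.den, RE.eval_var, RE.eval_arr, IE.eval_add, IE.eval_var, St.setI_r,
        St.setI_ra, St.setI_i, Function.update_self, ← ha, h10, ← two_mul,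
        Function.update_of_ne (show 15 ≠ 16 by norm_num)] at hc
      refine ⟨?_, by simp [Cmd.cost], ?_⟩
      · simp [Cmd.ok, Cmd.den, ← ha]
        omega
      simp only [Cmd.den, IE.eval_add, IE.eval_var, St.setI_r, IE.eval_ofNat, RE.eval_sub,
        RE.eval_var, RE.eval_arr, St.setR_i, St.setR_r, St.setI_ra, h10,
        St.setI_i, Function.update_self, ← ha, ← two_mul, pow_succ,
        Function.update_of_ne (show 15 ≠ 16 by norm_num)]
      refine ⟨by omega, by omega, ?_, by linarith, by linarith⟩
      rw [i3, hsum, ← hM]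
      have e1 : (2 * a + 1) * M - 2 ^ h = (a * 2 ^ (h - k) - 2 ^ h) + M := by
        have : (2 * a + 1) * M = a * (2 * M) + M := by ring
        rw [this, hpow]
        omega
      rw [e1, sum_range_add, sub_sub]
      congr 2
      refine sum_congr rfl fun i _ => ?_
      congr 1
      rw [hpow]
      have : 2 * a * M = a * (2 * M) := by ring
      omega
  · rintro s' ⟨⟨i1, i2, i3, i4, i5⟩, hB⟩
    refine ⟨⟨s'.i 15 - 2 ^ h, by omega, by omega, ?_, i4, ?_⟩, ?_⟩
    · simpa using i3
    · rwa [Nat.add_sub_cancel' i1]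
    · exact ((Below.setR (by norm_num) _).trans (Below.setI (by norm_num) _)).trans hB
  · simp only [IE.cost_var]
    omega

lemma findCol_spec {P : Inst} {s : St} {h l : ℕ}
    (hrow : RowOK P h E (s.ia 1) (s.ia 2) (s.ra 1)) (h4 : s.i 4 = h)
    (h5 : s.i 5 = 2 ^ h) (h15 : s.i 15 = 2 ^ h + l) (hl : l < 2 * P.n + 1)
    (hln : 2 * P.n + 1 ≤ 2 ^ h)
    (hE : 2 * 2 ^ h ≤ E) (hW : 2 * E ≤ W) (h0 : 0 ≤ s.r 30) (h1 : s.r 30 < s.ra 10 (2 ^ h + l)) :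
    Tri W E H ω findCol s (60 + 50 * h) fun s' =>
      ((∃ j ≤ P.m, s'.i 11 = j ∧ s.ra 10 (2 ^ h + l) * P.cw (l / 2) j ≤ s.r 30 ∧
        s.r 30 < s.ra 10 (2 ^ h + l) * P.cw (l / 2) (j + 1)) ∨
      (s'.i 11 = s.i 11 ∧ s.ra 10 (2 ^ h + l) * P.cw (l / 2) (P.m + 1) ≤ s.r 30)) := by
  have hh : h < 2 ^ h := Nat.lt_two_pow_self
  have hi : l / 2 ≤ P.n := by omega
  have hb1 := hrow.bd (l / 2) (by omega)
  have hb2 := hrow.bd (l / 2 + 1) (by omega)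
  have hle := hrow.le (l / 2) hi
  have hlt := hrow.lt (l / 2) hi
  set i := l / 2 with hidef
  set rp := s.ia 1 with hrp
  set lf := s.ra 10 (2 ^ h + l) with hlf
  unfold findCol
  refine Tri.le (Tri.step (T₁ := 7) (by simp [Cmd.ok, h15]; omega) (by simp [Cmd.cost])
    (Tri.step (T₁ := 5) (by simp [Cmd.ok]) (by simp [Cmd.cost])
    (Tri.step (T₁ := 7) (by simp [Cmd.ok, Cmd.den, h5, h15]; omega) (by simp [Cmd.cost])
    (Tri.step (T₁ := 9) (by simp [Cmd.ok, Cmd.den, h5, h15]; omega) (by simp [Cmd.cost])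
    (Tri.step (T₁ := 2) (by simp [Cmd.ok]) (by simp [Cmd.cost])
    (Tri.seq (R := fun s' => (rp i ≤ s'.i 17 ∧ s'.i 17 ≤ rp (i + 1) ∧
        (s'.i 17 = rp i ∨ lf * s.ra 1 (s'.i 17 - 1) ≤ s.r 30) ∧
        (s'.i 17 = rp (i + 1) ∨ s.r 30 < lf * s.ra 1 (s'.i 17))) ∧ s'.i 20 = rp (i + 1) ∧
        s'.i 11 = s.i 11 ∧ s'.ia 2 = s.ia 2)
      (Tri.conseq (Tri.loop_frame (T := 45) h (fun k s' => (rp i ≤ s'.i 17 ∧ s'.i 17 ≤ s'.i 18 ∧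
        s'.i 18 ≤ rp (i + 1) ∧ s'.i 18 < s'.i 17 + 2 ^ (h - k) ∧
        (s'.i 17 = rp i ∨ lf * s.ra 1 (s'.i 17 - 1) ≤ s.r 30) ∧
        (s'.i 18 = rp (i + 1) ∨ s.r 30 < lf * s.ra 1 (s'.i 18))) ∧ s'.i 20 = rp (i + 1))
        (a := 15) (b := 1000) (p := 16) (q := 16) (z := false) (by decide) (by simp)
        (by simp [Cmd.den, h4]) (by omega) ?_ ?_) ?_)
      (T₂ := 20) ?_)))))) ?_
  · simp [Cmd.den, h5, h15, ← hidef, ← hrp]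
    omega
  · rintro k hk s' ⟨⟨i1, i2, i3, i4, i5, i6⟩, i7⟩ hB
    have hB1 : s'.ra 1 = s.ra 1 := hB.ra 1
    have hB30 : s'.r 30 = s.r 30 := hB.r 30
    have hB31 : s'.r 31 = lf := by
      rw [hB.r 31]
      simp [Cmd.den, h15, hlf]
    have hpow : 2 ^ (h - k) = 2 * 2 ^ (h - (k + 1)) := by
      rw [← pow_succ']
      congr 1
      omega
    rw [hpow] at i4
    refine Tri.le (Tri.ifI (T := 35) (by simp) (by simp) ?_ ?_) (by simp)
    · intro hc
      simp only [IE.eval_var, St.setI_i, Function.update_apply, Nat.reduceEqDiff, if_false] at hc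
      refine Tri.le (Tri.step (T₁ := 5) (by simp [Cmd.ok]; omega) (by simp [Cmd.cost])
        (Tri.ifR (T := 6) (by simp) ?_ ?_ ?_)) (by simp)
      · simp [Cmd.den]
        omega
      · intro hc2
        simp only [Cmd.den, RE.eval_mul, RE.eval_var, RE.eval_arr, IE.eval_var, IE.eval_half,
          IE.eval_add, St.setI_i, St.setI_r, St.setI_ra, Function.update_apply, Nat.reduceEqDiff,
          if_false, if_true, hB1, hB30, hB31] at hc2
        refine ⟨by simp [Cmd.ok], by simp [Cmd.cost], ?_⟩
        simp only [Cmd.den, IE.eval_var, IE.eval_half,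
          IE.eval_add, St.setI_i, Function.update_apply, Nat.reduceEqDiff,
          if_false, if_true]
        exact ⟨⟨i1, by omega, by omega, by omega, i5, Or.inr hc2⟩, i7⟩
      · intro hc2
        simp only [Cmd.den, RE.eval_mul, RE.eval_var, RE.eval_arr, IE.eval_var, IE.eval_half,
          IE.eval_add, St.setI_i, St.setI_r, St.setI_ra, Function.update_apply, Nat.reduceEqDiff,
          if_false, if_true, hB1, hB30, hB31, not_lt] at hc2
        refine ⟨by simp [Cmd.ok, Cmd.den]; omega, by simp [Cmd.cost], ?_⟩
        simp only [Cmd.den, IE.eval_var, IE.eval_half, IE.eval_ofNat,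
          IE.eval_add, St.setI_i, Function.update_apply, Nat.reduceEqDiff,
          if_false, if_true, Nat.add_sub_cancel]
        exact ⟨⟨by omega, by omega, by omega, by omega, Or.inr hc2, i6⟩, i7⟩
    · intro hc
      simp only [IE.eval_var, St.setI_i, Function.update_apply, Nat.reduceEqDiff, if_false] at hc
      refine ⟨trivial, by simp [Cmd.cost], ?_⟩
      simp only [Cmd.den, St.setI_i, Function.update_apply, Nat.reduceEqDiff, if_false]
      have : 1 ≤ 2 ^ (h - (k + 1)) := Nat.one_le_two_pow
      exact ⟨⟨i1, i2, i3, by omega, i5, i6⟩, i7⟩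
  · rintro s' ⟨⟨⟨i1, i2, i3, i4, i5, i6⟩, i7⟩, hB⟩
    rw [Nat.sub_self, pow_zero] at i4
    have e : s'.i 18 = s'.i 17 := by omega
    rw [e] at i3 i6
    refine ⟨⟨i1, i3, i5, i6⟩, i7, ?_, ?_⟩
    · rw [hB.i 11]
      simp [Cmd.den]
    · rw [hB.ia 2]
      simp [Cmd.den]
  · rintro s' ⟨⟨i1, i2, i3, i4⟩, i5, i6, i7⟩
    have hlf0 : 0 < lf := lt_of_le_of_lt h0 h1
    have hprev : s'.i 17 = rp i → lf * (if s'.i 17 = rp i then 0 else s.ra 1 (s'.i 17 - 1)) ≤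
        s.r 30 := fun h => by rw [if_pos h, mul_zero]; exact h0
    have hprev' : lf * (if s'.i 17 = rp i then 0 else s.ra 1 (s'.i 17 - 1)) ≤ s.r 30 := by
      by_cases h : s'.i 17 = rp i
      · exact hprev h
      · rw [if_neg h]
        exact i3.resolve_left h
    refine Tri.le (Tri.ifI (T := 8) (by simp) (by simp) ?_ ?_) (by simp)
    · intro hc
      simp only [IE.eval_var, i5] at hc
      refine ⟨by simp [Cmd.ok]; omega, by simp [Cmd.cost], Or.inl ⟨s.ia 2 (s'.i 17), ?_, ?_, ?_, ?_⟩⟩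
      · exact hrow.col i hi _ i1 hc
      · simp [Cmd.den, i7]
      · rw [← hrow.prev i hi _ i1 hc]
        exact hprev'
      · rw [← hrow.pw i hi _ i1 hc]
        exact i4.resolve_left (by omega)
    · intro hc
      simp only [IE.eval_var, i5] at hc
      refine ⟨trivial, by simp [Cmd.cost], Or.inr ⟨i6, ?_⟩⟩
      rw [← hrow.last i hi]
      have : s'.i 17 = rp (i + 1) := by omega
      rwa [this] at hprev'
  · simp only [IE.cost_var]
    omega

lemma findCmd_spec {P : Inst} {G : ℝ} (hP : P.Good G) {s : St} {h : ℕ} {leaf : ℕ → ℝ} {u : ℝ}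
    (hrow : RowOK P h E (s.ia 1) (s.ia 2) (s.ra 1)) (hleaf : LeafOK P h leaf (s.ra 10))
    (h0 : ∀ l < 2 * P.n + 1, 0 ≤ leaf l) (hT : 0 < P.tot leaf) (hu : s.r 23 = u) (hu0 : 0 ≤ u)
    (hu1 : u ≤ 1) (hm : s.i 1 = P.m) (h4 : s.i 4 = h) (h5 : s.i 5 = 2 ^ h)
    (hh : 2 * P.n + P.m + 3 ≤ 2 ^ h) (hE : 2 * 2 ^ h ≤ E) (hW : 2 * E ≤ W) :
    Tri W E H ω findCmd s (110 + 100 * h) fun s' => s'.i 11 = P.pick leaf u ∧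
      Below 11 30 16 16 false s s' := by
  refine Tri.frame ?_ (by decide)
  have hroot := hleaf.root (by omega)
  unfold findCmd
  refine Tri.le (Tri.step (T₁ := 4) (by simp [Cmd.ok, hm]; omega) (by simp [Cmd.cost])
    (Tri.ifR (T := 90 + 100 * h) (by simp) (by simp) ?_ ?_)) (by simp; omega)
  · intro hc
    simp only [Cmd.den, RE.eval_var, St.setI_r, RE.eval_ofNat, hu, Nat.cast_one] at hc
    have hXT : u * P.tot leaf < P.tot leaf := by nlinarith
    refine Tri.le (Tri.seq (findLeaf_spec (h := h) ?_ ?_ hE (by omega) ?_ ?_)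
      (T₂ := 60 + 50 * h) ?_) (by omega)
    · exact hleaf.tree
    · simpa [Cmd.den] using h4
    · simp only [Cmd.den, St.setI_r, St.setI_ra, hroot, hu]
      positivity
    · simpa only [Cmd.den, St.setI_r, St.setI_ra, hroot, hu] using hXT
    · rintro s' ⟨⟨l, hl, i1, i2, i3, i4⟩, hB⟩
      simp only [Cmd.den, St.setI_r, St.setI_ra, hroot, hu] at i2 i4
      have hl' : l < 2 * P.n + 1 := by
        by_contra hcon
        rw [hleaf.rest l hl (by omega)] at i4
        linarith
      have h10 : s'.ra 10 = s.ra 10 := hB.ra 10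
      rw [hleaf.pre' hl'.le] at i2
      refine (findCol_spec (P := P) (h := h) (l := l) ?_ ?_ ?_ i1 hl' (by omega) hE hW i3
        (by rw [h10]; exact i4)).conseq ?_
      · rw [hB.ia 1, hB.ia 2, hB.ra 1]
        exact hrow
      · rw [hB.i 4]
        simpa [Cmd.den] using h4
      · rw [hB.i 5]
        simpa [Cmd.den] using h5
      · rw [h10, hleaf.leaf l hl'] at *
        have hpre : Inst.pre' leaf l ≤ u * P.tot leaf ∧
            u * P.tot leaf < Inst.pre' leaf (l + 1) := by
          rw [Inst.pre'_succ]
          exact ⟨by linarith, by linarith⟩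
        rintro s'' (⟨j, hj, j1, j2, j3⟩ | ⟨j1, j2⟩)
        · rw [j1, Inst.pick_eq hP h0 ⟨hj, l, hl', by linarith, by linarith⟩]
        · rw [j1, hB.i 11, Inst.pick_eq_none]
          · simp [Cmd.den, hm]
          · rintro j ⟨hj, l', hl2, hcell⟩
            obtain rfl := Inst.leaf_unique h0 hl2 hl' (hcell.pre hP h0 hl2 hj) hpre
            have := mul_le_mul_of_nonneg_left
              (Inst.cw_mono (P := P) (l' / 2) (show j + 1 ≤ P.m + 1 by omega)) (h0 l' hl2)
            linarith [hcell.2]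
  · intro hc
    simp only [Cmd.den, RE.eval_var, St.setI_r, RE.eval_ofNat, hu, Nat.cast_one, not_lt] at hc
    have hu' : u = 1 := le_antisymm hu1 hc
    refine ⟨trivial, by simp [Cmd.cost]; omega, ?_⟩
    rw [Inst.pick_eq_none]
    · simp [Cmd.den, hm]
    · rintro j ⟨hj, l, hl, hcell⟩
      have h2 := (hcell.pre hP h0 hl hj).2
      have h3 := Inst.pre'_mono h0 (show l + 1 ≤ 2 * P.n + 1 from hl) le_rfl
      rw [hu', one_mul] at h2
      change _ ≤ P.tot leaf at h3
      linarith

end Loop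

/-! ### One step of the method -/

namespace Loop

open Finset Regr

/-- The data prepared before the runs. -/
structure Env (P : Inst) (h E W : ℕ) (s : St) : Prop where
  n : s.i 0 = P.n
  m : s.i 1 = P.m
  B0 : s.i 3 = P.B0
  ht : s.i 4 = h
  H : s.i 5 = 2 ^ h
  T0 : s.r 4 = P.T0
  τ : s.r 6 = P.τ
  μ : s.r 7 = P.μ
  t : s.r 8 = P.t
  θ : s.r 9 = P.θ
  zb : s.r 10 = P.zb
  cap : s.r 11 = P.cap
  inv : s.r 13 = 1 / (2 * P.n)
  row : RowOK P h E (s.ia 1) (s.ia 2) (s.ra 1)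
  col : ColOK P E (s.ia 3) (s.ia 4) (s.ra 2)
  w : ∀ j ≤ P.m, s.ra 3 j = P.w j
  β : ∀ r < 2 * P.n, s.ra 4 r = P.β r
  hh : 2 * P.n + P.m + 3 ≤ 2 ^ h
  hE : 2 * 2 ^ h ≤ E
  hW : 2 * E ≤ W

lemma Env.congr {P : Inst} {h E W : ℕ} {s s' : St} {z : Bool} (e : Env P h E W s)
    (b : Below 7 20 5 6 z s s') : Env P h E W s' where
  n := by rw [b.i 0, e.n]
  m := by rw [b.i 1, e.m]
  B0 := by rw [b.i 3, e.B0]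
  ht := by rw [b.i 4, e.ht]
  H := by rw [b.i 5, e.H]
  T0 := by rw [b.r 4, e.T0]
  τ := by rw [b.r 6, e.τ]
  μ := by rw [b.r 7, e.μ]
  t := by rw [b.r 8, e.t]
  θ := by rw [b.r 9, e.θ]
  zb := by rw [b.r 10, e.zb]
  cap := by rw [b.r 11, e.cap]
  inv := by rw [b.r 13, e.inv]
  row := by rw [b.ia 1, b.ia 2, b.ra 1]; exact e.row
  col := by rw [b.ia 3, b.ia 4, b.ra 2]; exact e.col
  w := by rw [b.ra 3]; exact e.w
  β := by rw [b.ra 4]; exact e.β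
  hh := e.hh
  hE := e.hE
  hW := e.hW

lemma Below.mono {a b p q a' b' p' q' : ℕ} {z z' : Bool} {s s' : St} (h : Below a b p q z s s')
    (hz : z' = false → z = false) (ha : a' ≤ a := by norm_num) (hb : b' ≤ b := by norm_num)
    (hp : p' ≤ p := by norm_num) (hq : q' ≤ q := by norm_num) :
    Below a' b' p' q' z' s s' :=
  ⟨fun v hv => h.i v (by omega), fun v hv => h.r v (by omega), fun v hv => h.ia v (by omega),
    fun v hv => h.ra v (by omega), fun hz' => h.pos (hz hz')⟩

/-- The state of the method is stored in the machine. -/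
structure Run (P : Inst) (h : ℕ) (as : AS) (s : St) : Prop where
  x : ∀ j ≤ P.m, s.ra 7 j = as.x j
  v : ∀ r < 2 * P.n, s.ra 8 r = as.v r
  ρ : ∀ r < 2 * P.n, s.ra 9 r = as.ρ r
  leaf : LeafOK P h as.leaf (s.ra 10)
  κ : s.r 21 = as.κ
  cnt : s.r 22 = as.cnt
  frz : (s.i 7 = 0 ∧ ¬ as.frz) ∨ (s.i 7 = 1 ∧ as.frz)

/-- Gradient and probability of the column in word variable `11`. -/
def gradCmd : Cmd :=
  .ifI (.var 11) (.var 1) (.rset 24 0) (.rset 24 3) ;;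
  .rset 25 0 ;;
  .iset 12 (.arr 3 (.var 11)) ;;
  .loop 13 (.arr 3 (.var 11 + 1) - .var 12) (
    .iset 14 (.arr 4 (.var 12 + .var 13)) ;;
    .rset 28 (.arr 2 (.var 12 + .var 13)) ;;
    .rset 24 (.var 24 +
      .var 28 * .exp ((.arr 8 (.var 14) + .var 21 * .arr 9 (.var 14)) / .var 8)) ;;
    .rset 25 (.var 25 + .arr 10 (.var 5 + .var 14) * .max (.var 28) (0 - .var 28))) ;;
  .ifI (.var 11) (.var 1) (.rset 25 ((.var 25 + 1 / .cast (.var 1)) / .arr 10 1))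
    (.rset 25 (1 / .cast (.var 3) / .arr 10 1))

/-- New value of the coordinate. -/
def proxCmd : Cmd :=
  .rset 30 (.var 25 * .arr 3 (.var 11) / .var 6) ;;
  .rset 30 ((.var 30 * .arr 7 (.var 11) - .var 24) / (.var 30 + .var 7 * .arr 3 (.var 11))) ;;
  .rset 27 (.max (0 - 1) (0 - .max (0 - 1) (0 - .var 30))) ;;
  .rset 26 (.var 27 - .arr 7 (.var 11)) ;;
  .rput 7 (.var 11) (.var 27)

/-- Update of the rows that meet the column. -/
def updCmd : Cmd :=
  .rset 32 (.var 21 * (1 - .var 9)) ;;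
  .iset 12 (.arr 3 (.var 11)) ;;
  .loop 13 (.arr 3 (.var 11 + 1) - .var 12) (
    .iset 14 (.arr 4 (.var 12 + .var 13)) ;;
    .rset 28 (.arr 2 (.var 12 + .var 13)) ;;
    .rput 8 (.var 14) (.arr 8 (.var 14) + .var 28 * .var 26) ;;
    .rput 9 (.var 14)
      (.arr 9 (.var 14) + .var 28 * .var 26 * (.var 9 / .var 25 - 1) / .var 21) ;;
    .rset 29 (.max (.exp ((.arr 8 (.var 14) + .var 32 * .arr 9 (.var 14)) / .var 8)) (.var 13)) ;;
    setLeaf)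

variable {P : Inst} {h W E H : ℕ} {ω : Tape}

lemma ColOK.sum {ap er : ℕ → ℕ} {ev : ℕ → ℝ} (hc : ColOK P E ap er ev) {j : ℕ} (hj : j ≤ P.m)
    (f : ℕ → ℝ → ℝ) (hf : ∀ r, f r 0 = 0) :
    ∑ k ∈ range (ap (j + 1) - ap j), f (er (ap j + k)) (ev (ap j + k)) =
      ∑ r ∈ range (2 * P.n), f r (P.a r j) := by
  have hmem : ∀ k ∈ range (ap (j + 1) - ap j), ap j ≤ ap j + k ∧ ap j + k < ap (j + 1) :=
    fun k hk => ⟨by omega, by have := mem_range.1 hk; omega⟩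
  rw [← sum_subset (s₁ := (range (ap (j + 1) - ap j)).image fun k => er (ap j + k))
    (s₂ := range (2 * P.n)) (f := fun r => f r (P.a r j))]
  · rw [sum_image]
    · exact sum_congr rfl fun k hk => by rw [hc.val j hj _ (hmem k hk).1 (hmem k hk).2]
    · intro k hk k' hk' he
      have h1 := hmem k hk
      have h2 := hmem k' hk'
      have := hc.inj j hj _ _ h1.1 h1.2 h2.1 h2.2 he
      omega
  · intro r hr
    obtain ⟨k, hk, rfl⟩ := mem_image.1 hr
    exact mem_range.2 (hc.row j hj _ (hmem k hk).1 (hmem k hk).2)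
  · intro r _ hr
    by_cases ha : P.a r j = 0
    · rw [ha, hf]
    · obtain ⟨e, h1, h2, h3⟩ := hc.cov j hj r ha
      refine absurd (mem_image.2 ⟨e - ap j, mem_range.2 (by omega), ?_⟩) hr
      rw [Nat.add_sub_cancel' h1, h3]

lemma gradCmd_spec {G : ℝ} (hP : P.Good G) {s : St} {as : AS} {a j : ℕ} (he : Env P h E W s)
    (hr : Run P h as s) (hi : P.Inv a as) (hj : j ≤ P.m) (h11 : s.i 11 = j) :
    Tri W E H ω gradCmd s (80 + 100 * (s.ia 3 (j + 1) - s.ia 3 j)) fun s' =>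
      (s'.r 24 = P.g as j ∧ s'.r 25 = P.q as.leaf j) ∧ Below 12 24 16 16 false s s' := by
  refine Tri.frame ?_ (by decide)
  have hhh := he.hh
  have hE := he.hE
  have hW := he.hW
  have hb1 := he.col.bd j (by omega)
  have hb2 := he.col.bd (j + 1) (by omega)
  have hle := he.col.le j hj
  have hroot := hr.leaf.root (by omega)
  set len := s.ia 3 (j + 1) - s.ia 3 j with hlen
  unfold gradCmd
  refine Tri.le (Tri.seq (R := fun s' => s'.r 24 = P.c j ∧ Below 12 24 16 16 false s s')
    (T₂ := 73 + 100 * len) (Tri.ifI (T := 2) (by simp) (by simp) ?_ ?_) fun s1 hs1 => ?_) ?_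
  · intro hc
    simp only [IE.eval_var, h11, he.m] at hc
    refine ⟨trivial, by simp [Cmd.cost], ?_, Cmd.den_below (by decide) _⟩
    simp [Cmd.den, Inst.c, hc.ne]
  · intro hc
    simp only [IE.eval_var, h11, he.m] at hc
    refine ⟨trivial, by simp [Cmd.cost], ?_, Cmd.den_below (by decide) _⟩
    simp [Cmd.den, Inst.c, show j = P.m by omega]
  · obtain ⟨h24, hB⟩ := hs1
    have f11 : s1.i 11 = j := by rw [hB.i 11, h11]
    have f3 : s1.ia 3 = s.ia 3 := hB.ia 3
    refine Tri.le (Tri.step (T₁ := 2) (by simp [Cmd.ok]) (by simp [Cmd.cost])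
      (Tri.step (T₁ := 7) (by simp [Cmd.ok, Cmd.den, f11]; omega) (by simp [Cmd.cost])
      (Tri.seq (T₂ := 30) (Tri.loop_frame (T := 70) len (fun k s' =>
        s'.r 24 = P.c j + ∑ k' ∈ range k, s.ra 2 (s.ia 3 j + k') *
          Real.exp (P.z as (s.ia 4 (s.ia 3 j + k'))) ∧
        s'.r 25 = ∑ k' ∈ range k, as.leaf (s.ia 4 (s.ia 3 j + k')) *
          |s.ra 2 (s.ia 3 j + k')|) (a := 13) (b := 24) (p := 16) (q := 16) (z := false)
        (by decide) ?_ ?_ ?_ ?_ ?_) fun s2 hs2 => ?_))) ?_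
    · simp [Cmd.den, f11, f3]
      omega
    · simp [Cmd.den, f11, f3, hlen]
    · omega
    · simp [Cmd.den, h24]
    · rintro k hk s' ⟨i1, i2⟩ hB2
      have hB1 : Below 12 24 16 16 false s s' :=
        hB.trans (((Below.setR (by norm_num) _).trans (Below.setI (by norm_num) _)).trans
          (hB2.mono id))
      have f12 : s'.i 12 = s.ia 3 j := by
        rw [hB2.i 12]
        simp [Cmd.den, f11, f3]
      have f4 : s'.ia 4 = s.ia 4 := hB1.ia 4
      have f2 : s'.ra 2 = s.ra 2 := hB1.ra 2
      have f8 : s'.ra 8 = s.ra 8 := hB1.ra 8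
      have f9 : s'.ra 9 = s.ra 9 := hB1.ra 9
      have f10 : s'.ra 10 = s.ra 10 := hB1.ra 10
      have f5 : s'.i 5 = 2 ^ h := by rw [hB1.i 5, he.H]
      have f21 : s'.r 21 = as.κ := by rw [hB1.r 21, hr.κ]
      have ft : s'.r 8 = P.t := by rw [hB1.r 8, he.t]
      have hrow := he.col.row j hj (s.ia 3 j + k) (by omega) (by omega)
      refine ⟨?_, by simp [Cmd.cost], ?_, ?_⟩
      · simp [Cmd.ok, Cmd.den, f12, f4, f5]
        omega
      · simp [Cmd.den, f12, f4, f2, f8, f9, f21, ft, i1, hr.v _ hrow, hr.ρ _ hrow, Inst.z,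
          sum_range_succ, add_assoc]
      · have hlf := hr.leaf.leaf (s.ia 4 (s.ia 3 j + k)) (by omega)
        simp only [Cmd.den]
        simp [f12, f4, f2, f10, f5, i2, hlf, sum_range_succ, abs_eq_max_neg]
    · obtain ⟨⟨i1, i2⟩, hB2⟩ := hs2
      have hB1 : Below 12 24 16 16 false s s2 :=
        hB.trans (((Below.setR (by norm_num) _).trans (Below.setI (by norm_num) _)).trans
          (hB2.mono id))
      have f11 : s2.i 11 = j := by rw [hB1.i 11, h11]
      have fm : s2.i 1 = P.m := by rw [hB1.i 1, he.m]
      have f3 : s2.i 3 = P.B0 := by rw [hB1.i 3, he.B0]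
      have f10 : s2.ra 10 = s.ra 10 := hB1.ra 10
      have hg : s2.r 24 = P.g as j := by
        rw [i1, he.col.sum hj (fun r a => a * Real.exp (P.z as r)) (by simp)]
        rfl
      refine Tri.le (Tri.ifI (T := 25) (by simp) (by simp) ?_ ?_) (by simp)
      · intro hc
        simp only [IE.eval_var, f11, fm] at hc
        refine ⟨by simp [Cmd.ok]; omega, by simp [Cmd.cost], by simpa [Cmd.den] using hg, ?_⟩
        rw [Inst.q_lt hP hi hc, ← he.col.sum hj (fun r a => as.leaf r * |a|) (by simp), ← hlen]
        simp [Cmd.den, fm, f10, hroot, i2]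
      · intro hc
        simp only [IE.eval_var, f11, fm] at hc
        refine ⟨by simp [Cmd.ok]; omega, by simp [Cmd.cost], by simpa [Cmd.den] using hg, ?_⟩
        rw [show j = P.m by omega, Inst.q_m hP hi]
        simp [Cmd.den, f3, f10, hroot]
    · simp only [IE.cost_var, IE.cost_sub, IE.cost_arr, IE.cost_add, IE.cost_ofNat]
      omega
  · simp only [IE.cost_var]
    omega

lemma proxCmd_spec {s : St} {as : AS} {j : ℕ} (he : Env P h E W s)
    (hr : Run P h as s) (hj : j ≤ P.m) (h11 : s.i 11 = j) (h24 : s.r 24 = P.g as j)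
    (h25 : s.r 25 = P.q as.leaf j) :
    Tri W E H ω proxCmd s 80 fun s' =>
      (s'.r 26 = P.xh as j - as.x j ∧ s'.ra 7 = Function.update (s.ra 7) j (P.xh as j) ∧
      (∀ q, q ≠ 7 → s'.ra q = s.ra q) ∧ s'.r 25 = s.r 25) ∧ Below 1000 26 16 7 false s s' := by
  refine Tri.frame ?_ (by decide)
  have hhh := he.hh
  have hE := he.hE
  have e1 : ∀ y : ℝ, max (0 - 1) (0 - max (0 - 1) (0 - y)) = max (-1) (min 1 y) := by
    intro y
    simp only [zero_sub]
    rw [max_neg_neg 1 y, neg_neg]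
  unfold proxCmd
  refine ⟨?_, by simp [Cmd.cost], ?_, ?_, ?_, ?_⟩
  · simp [Cmd.ok, Cmd.den, h11]
    omega
  · simp only [Cmd.den]
    simp [h11, h24, h25, he.τ, he.μ, he.w j hj, hr.x j hj, -zero_sub, e1, Inst.xh]
  · simp only [Cmd.den]
    simp [h11, h24, h25, he.τ, he.μ, he.w j hj, hr.x j hj, -zero_sub, e1, Inst.xh]
  · intro q hq
    simp [Cmd.den, hq]
  · simp [Cmd.den]

end Loop

namespace Loop

open Finset Regr

variable {P : Inst} {h W E H : ℕ} {ω : Tape}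

lemma St.putR_ra_apply (s : St) (a e : ℕ) (y : ℝ) (b k : ℕ) :
    (s.putR a e y).ra b k = if b = a ∧ k = e then y else s.ra b k := by
  by_cases h1 : b = a
  · subst h1
    by_cases h2 : k = e <;> simp [h2]
  · simp [h1]

lemma St.putI_ia_apply (s : St) (a e x : ℕ) (b k : ℕ) :
    (s.putI a e x).ia b k = if b = a ∧ k = e then x else s.ia b k := by
  by_cases h1 : b = a
  · subst h1
    by_cases h2 : k = e <;> simp [h2]
  · simp [h1]

lemma LeafOK.set {leaf tr tr' : ℕ → ℝ} (hl : LeafOK P h leaf tr) {r0 : ℕ} {y : ℝ}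
    (hr : r0 < 2 * P.n + 1) (ht : TreeOK h tr') (hh : 2 * P.n + 1 ≤ 2 ^ h)
    (hy : ∀ l < 2 ^ h, tr' (2 ^ h + l) = if l = r0 then y else tr (2 ^ h + l)) :
    LeafOK P h (fun r => if r = r0 then y else leaf r) tr' where
  tree := ht
  leaf l hl' := by rw [hy l (by omega), hl.leaf l hl']
  rest l h1 h2 := by rw [hy l h1, if_neg (by omega), hl.rest l h1 h2]

lemma LeafOK.congr {leaf leaf' tr : ℕ → ℝ} (hl : LeafOK P h leaf tr)
    (he : ∀ r < 2 * P.n + 1, leaf r = leaf' r) : LeafOK P h leaf' tr where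
  tree := hl.tree
  leaf l hl' := by rw [hl.leaf l hl', he l hl']
  rest := hl.rest

lemma updCmd_spec {s : St} {as : AS} {j : ℕ} (he : Env P h E W s)
    (hv : ∀ r < 2 * P.n, s.ra 8 r = as.v r) (hρ : ∀ r < 2 * P.n, s.ra 9 r = as.ρ r)
    (hleaf : LeafOK P h as.leaf (s.ra 10)) (hκ : s.r 21 = as.κ) (hj : j ≤ P.m)
    (h11 : s.i 11 = j) (h26 : s.r 26 = P.xh as j - as.x j) (h25 : s.r 25 = P.q as.leaf j) :
    Tri W E H ω updCmd s (50 + (104 + 50 * h) * (s.ia 3 (j + 1) - s.ia 3 j)) fun s' =>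
      ((∀ r < 2 * P.n, s'.ra 8 r = (P.core as j).v r) ∧
      (∀ r < 2 * P.n, s'.ra 9 r = (P.core as j).ρ r) ∧
      LeafOK P h (P.core as j).leaf (s'.ra 10) ∧ s'.r 32 = (P.core as j).κ) ∧
      Below 12 27 16 8 false s s' := by
  classical
  refine Tri.frame ?_ (by decide)
  have hhh := he.hh
  have hE := he.hE
  have hW := he.hW
  have hb1 := he.col.bd j (by omega)
  have hb2 := he.col.bd (j + 1) (by omega)
  have hle := he.col.le j hj
  have hcol := he.col
  obtain ⟨ap, hap⟩ : ∃ ap, ap = s.ia 3 := ⟨_, rfl⟩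
  obtain ⟨er, her⟩ : ∃ er, er = s.ia 4 := ⟨_, rfl⟩
  rw [← hap, ← her] at hcol
  rw [← hap] at hb1 hb2 hle ⊢
  obtain ⟨len, hlen⟩ : ∃ len, len = ap (j + 1) - ap j := ⟨_, rfl⟩
  rw [← hlen]
  set ac := P.core as j with hac
  let D : ℕ → ℕ → Prop := fun k r => ∃ k' < k, er (ap j + k') = r
  unfold updCmd
  refine Tri.le (Tri.step (T₁ := 6) (by simp [Cmd.ok]) (by simp [Cmd.cost])
    (Tri.step (T₁ := 7) (by simp [Cmd.ok, Cmd.den, h11]; omega) (by simp [Cmd.cost])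
    ((Tri.loop_frame (T := 100 + 50 * h) len (fun k s' =>
      (∀ r < 2 * P.n, s'.ra 8 r = if D k r then ac.v r else as.v r) ∧
      (∀ r < 2 * P.n, s'.ra 9 r = if D k r then ac.ρ r else as.ρ r) ∧
      LeafOK P h (fun r => if D k r then ac.leaf r else as.leaf r) (s'.ra 10) ∧
      s'.r 32 = ac.κ) (a := 13) (b := 28) (p := 16) (q := 8) (z := false) (by decide)
      ?_ ?_ ?_ ?_ ?_).conseq ?_))) ?_
  · simp [Cmd.den, h11, ← hap]
    omega
  · simp [Cmd.den, h11, hlen, ← hap]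
  · omega
  · simp only [Cmd.den]
    simp only [St.setI_ra, St.setR_ra, D, not_lt_zero, false_and, exists_false, if_false]
    refine ⟨hv, hρ, hleaf, ?_⟩
    simp [hκ, he.θ, hac, Inst.core]
  · rintro k hk s' ⟨i1, i2, i3, i4⟩ hB2
    have hB : Below 12 27 16 8 false s s' := by
      refine Below.trans ?_ (hB2.mono id)
      exact (Below.setR (by norm_num) _).trans (Below.setI (by norm_num) _)
    have f12 : s'.i 12 = ap j := by
      rw [hB2.i 12]
      simp [Cmd.den, h11, hap]
    have f4 : s'.ia 4 = er := (hB.ia 4).trans her.symm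
    have f2 : s'.ra 2 = s.ra 2 := hB.ra 2
    have f5 : s'.i 5 = 2 ^ h := by rw [hB.i 5, he.H]
    have fh : s'.i 4 = h := by rw [hB.i 4, he.ht]
    have f21 : s'.r 21 = as.κ := by rw [hB.r 21, hκ]
    have f25 : s'.r 25 = P.q as.leaf j := by rw [hB.r 25, h25]
    have f26 : s'.r 26 = P.xh as j - as.x j := by rw [hB.r 26, h26]
    have ft : s'.r 8 = P.t := by rw [hB.r 8, he.t]
    have fθ : s'.r 9 = P.θ := by rw [hB.r 9, he.θ]
    have f13 : s'.r 13 = 1 / (2 * P.n) := by rw [hB.r 13, he.inv]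
    have hrow := hcol.row j hj (ap j + k) (by omega) (by omega)
    have hval := hcol.val j hj (ap j + k) (by omega) (by omega)
    have hne := hcol.ne j hj (ap j + k) (by omega) (by omega)
    have hnD : ¬ D k (er (ap j + k)) := by
      rintro ⟨k', hk', h'⟩
      have := hcol.inj j hj (ap j + k') (ap j + k) (by omega) (by omega) (by omega) (by omega) h'
      omega
    have hD : ∀ r, D (k + 1) r ↔ D k r ∨ r = er (ap j + k) := by
      intro r
      constructor
      · rintro ⟨k', hk', rfl⟩
        rcases (Nat.lt_succ_iff.1 hk').lt_or_eq with h' | h'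
        · exact Or.inl ⟨k', h', rfl⟩
        · exact Or.inr (by rw [h'])
      · rintro (⟨k', hk', rfl⟩ | rfl)
        · exact ⟨k', by omega, rfl⟩
        · exact ⟨k, by omega, rfl⟩
    set r0 := er (ap j + k) with hr0
    have j1 := i1 r0 hrow
    have j2 := i2 r0 hrow
    rw [if_neg hnD] at j1 j2
    have hv' : as.v r0 + P.a r0 j * (P.xh as j - as.x j) = ac.v r0 := rfl
    have hρ' : as.ρ r0 + P.a r0 j * (P.xh as j - as.x j) * (P.θ / P.q as.leaf j - 1) / as.κ =
      ac.ρ r0 := rfl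
    have hl' : max (Real.exp ((ac.v r0 + ac.κ * ac.ρ r0) / P.t)) (1 / (2 * P.n)) = ac.leaf r0 := by
      rw [hval] at hne
      simp [hac, Inst.core, hne, Inst.newLeaf]
    refine Tri.le (Tri.step (T₁ := 9) (by simp [Cmd.ok, f12]; omega) (by simp [Cmd.cost])
      (Tri.step (T₁ := 9) (by simp [Cmd.ok, Cmd.den, f12]; omega) (by simp [Cmd.cost])
      (Tri.step (T₁ := 16) (by simp [Cmd.ok, Cmd.den, f12, f4, ← hr0]; omega) (by simp [Cmd.cost])
      (Tri.step (T₁ := 24) (by simp [Cmd.ok, Cmd.den, f12, f4, ← hr0]; omega) (by simp [Cmd.cost])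
      (Tri.step (T₁ := 22) (by simp [Cmd.ok, Cmd.den, f12, f4, ← hr0]; omega) (by simp [Cmd.cost])
      ((setLeaf_spec (h := h) (r := r0) ?_ ?_ ?_ ?_ (by omega) hE (by omega)).conseq ?_)))))) ?_
    · simpa [Cmd.den] using i3.tree
    · simpa [Cmd.den] using fh
    · simpa [Cmd.den] using f5
    · simp [Cmd.den, f12, f4, hr0]
    · rintro s'' ⟨⟨t1, t2⟩, hB3⟩
      refine ⟨fun r hr => ?_, fun r hr => ?_, ?_, ?_⟩
      · rw [hB3.ra 8]
        simp only [Cmd.den]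
        simp [-St.putR_ra, St.putR_ra_apply, f12, f4, f2, f26, ← hr0, hval, j1, hv']
        by_cases h1 : r = r0
        · simp [h1, hD]
        · simp [h1, hD, i1 r hr]
      · rw [hB3.ra 9]
        simp only [Cmd.den]
        simp [-St.putR_ra, St.putR_ra_apply, f12, f4, f2, f26, f25, f21, fθ, ← hr0, hval, j2, hρ']
        by_cases h1 : r = r0
        · simp [h1, hD]
        · simp [h1, hD, i2 r hr]
      · refine (LeafOK.set i3 (r0 := r0) (by omega) t1 (by omega) (y := ac.leaf r0) ?_).congr ?_
        · intro l hl
          rw [t2 l hl, ← hl']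
          simp only [Cmd.den]
          simp [-St.putR_ra, St.putR_ra_apply, f12, f4, f2, f26, f25, f21, fθ, ft, f13, i4, ← hr0,
            hval, j1, j2, hρ', hv']
        · intro r _
          by_cases h1 : r = r0
          · simp [h1, hD]
          · simp [h1, hD]
      · rw [hB3.r 32]
        simpa [Cmd.den] using i4
    · omega
  · rintro s' ⟨⟨i1, i2, i3, i4⟩, -⟩
    have hD : ∀ r, P.a r j ≠ 0 ↔ D len r := by
      intro r
      constructor
      · intro hr
        obtain ⟨e, h1, h2, h3⟩ := hcol.cov j hj r hr
        exact ⟨e - ap j, by omega, by rw [Nat.add_sub_cancel' h1]; exact h3⟩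
      · rintro ⟨k, hk, rfl⟩
        have hval := hcol.val j hj (ap j + k) (by omega) (by omega)
        have hne := hcol.ne j hj (ap j + k) (by omega) (by omega)
        rwa [hval] at hne
    refine ⟨fun r hr => ?_, fun r hr => ?_, i3.congr fun r hr => ?_, i4⟩
    · rw [i1 r hr]
      split_ifs with h1
      · rfl
      · rw [← hD, not_not] at h1
        simp [hac, Inst.core, h1]
    · rw [i2 r hr]
      split_ifs with h1
      · rfl
      · rw [← hD, not_not] at h1
        simp [hac, Inst.core, h1]
    · split_ifs with h1
      · rfl
      · rw [← hD, not_not] at h1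
        simp [hac, Inst.core, h1]
  · simp only [IE.cost_var, IE.cost_sub, IE.cost_arr, IE.cost_add, IE.cost_ofNat]
    have : len * (100 + 50 * h + 4) = (104 + 50 * h) * len := by ring
    omega

end Loop

namespace Loop

open Finset Regr

/-- One step in the column in word variable `11`. -/
def coreCmd : Cmd :=
  gradCmd ;; proxCmd ;; updCmd ;; .rset 21 (.var 32) ;;
  .ifI (.var 11) (.var 1) .skip (.rset 22 (.var 22 + 1))

/-- One step of the method. -/
def iterCmd : Cmd :=
  .rand 23 ;;
  .ifI 0 (.var 7) .skip
    (.ifR (.var 4) (.arr 10 1) (.iset 7 1)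
      (.ifR (.var 11) (.var 22) (.iset 7 1)
        (findCmd ;; .ifI (.var 11) (.var 1 + 1) coreCmd (.rset 21 (.var 21 * (1 - .var 9))))))

/-- Recompute the leaves. -/
def refreshCmd : Cmd :=
  .loop 14 (.var 0 + .var 0)
    (.rset 29 (.max (.exp ((.arr 8 (.var 14) + .var 21 * .arr 9 (.var 14)) / .var 8)) (.var 13)) ;;
      setLeaf)

variable {P : Inst} {h W E H : ℕ} {ω : Tape}

lemma coreCmd_spec {G : ℝ} (hP : P.Good G) {s : St} {as : AS} {a j : ℕ} (he : Env P h E W s)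
    (hr : Run P h as s) (hi : P.Inv a as) (hj : j ≤ P.m) (h11 : s.i 11 = j) :
    Tri W E H ω coreCmd s (230 + (204 + 50 * h) * (s.ia 3 (j + 1) - s.ia 3 j)) fun s' =>
      Run P h (P.core as j) s' ∧ Below 12 21 16 7 false s s' := by
  refine Tri.frame ?_ (by decide)
  unfold coreCmd
  obtain ⟨y, hy⟩ : ∃ y, y = s.ia 3 (j + 1) - s.ia 3 j := ⟨_, rfl⟩
  refine Tri.le (Tri.seq (gradCmd_spec hP he hr hi hj h11)
    (T₂ := 80 + ((50 + (104 + 50 * h) * y) + 20)) fun s1 hs1 => ?_) ?_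
  swap
  · rw [← hy]
    have : (204 + 50 * h) * y = (104 + 50 * h) * y + 100 * y := by ring
    omega
  obtain ⟨⟨a1, a2⟩, hB1⟩ := hs1
  have he1 := he.congr (hB1.mono id)
  refine Tri.seq (proxCmd_spec (P := P) (h := h) (as := as) (j := j) he1 ?_ hj ?_ a1 a2)
    fun s2 hs2 => ?_
  rotate_left 2
  · obtain ⟨⟨b1, b2, b3, b4⟩, hB2⟩ := hs2
    have h3 : s2.ia 3 = s.ia 3 := by rw [hB2.ia 3, hB1.ia 3]
    refine Tri.seq (Tri.le (updCmd_spec (P := P) (h := h) (as := as) (j := j) (s := s2)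
      ?_ ?_ ?_ ?_ ?_ hj ?_ b1 (b4.trans a2)) (by rw [h3, ← hy])) fun s3 hs3 => ?_
    · exact he1.congr
        (hB2.mono id)
    · rw [b3 8 (by norm_num), hB1.ra 8]; exact hr.v
    · rw [b3 9 (by norm_num), hB1.ra 9]; exact hr.ρ
    · rw [b3 10 (by norm_num), hB1.ra 10]; exact hr.leaf
    · rw [hB2.r 21, hB1.r 21]; exact hr.κ
    · rw [hB2.i 11, hB1.i 11, h11]
    · obtain ⟨⟨c1, c2, c3, c4⟩, hB3⟩ := hs3
      have f11 : s3.i 11 = j := by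
        rw [hB3.i 11, hB2.i 11, hB1.i 11, h11]
      have f1 : s3.i 1 = P.m := by
        rw [hB3.i 1, hB2.i 1, hB1.i 1, he.m]
      have f7 : s3.i 7 = s.i 7 := by
        rw [hB3.i 7, hB2.i 7, hB1.i 7]
      have f22 : s3.r 22 = as.cnt := by
        rw [hB3.r 22, hB2.r 22, hB1.r 22, hr.cnt]
      have fx : s3.ra 7 = Function.update (s.ra 7) j (P.xh as j) := by
        rw [hB3.ra 7, b2, hB1.ra 7]
      refine Tri.step (T₁ := 2) (T₂ := 18) (by simp [Cmd.ok]) (by simp [Cmd.cost]) ?_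
      refine Tri.le (Tri.ifI (T := 5) (by simp) (by simp) ?_ ?_) (by simp)
      · intro hc
        simp only [Cmd.den, IE.eval_var, St.setR_i, f11, f1] at hc
        refine ⟨trivial, by simp [Cmd.cost], ?_⟩
        refine ⟨fun i hi => ?_, c1, c2, c3, by simpa [Cmd.den] using c4, ?_, ?_⟩
        · simp only [Cmd.den, St.setR_ra, fx, Inst.core, if_pos hj, Function.update_apply, hr.x i hi]
        · simpa [Cmd.den, Inst.core, hc.ne] using f22
        · have := hr.frz
          rw [← f7] at this
          exact this
      · intro hc
        simp only [Cmd.den, IE.eval_var, St.setR_i, f11, f1] at hc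
        refine ⟨by simp [Cmd.ok], by simp [Cmd.cost], ?_⟩
        refine ⟨fun i hi => ?_, c1, c2, c3, by simpa [Cmd.den] using c4, ?_, ?_⟩
        · simp only [Cmd.den, St.setR_ra, fx, Inst.core, if_pos hj, Function.update_apply, hr.x i hi]
        · simpa [Cmd.den, Inst.core, show j = P.m by omega] using f22
        · have := hr.frz
          rw [← f7] at this
          exact this
  · refine ⟨?_, ?_, ?_, ?_, ?_, ?_, ?_⟩
    · rw [hB1.ra 7]; exact hr.x
    · rw [hB1.ra 8]; exact hr.v
    · rw [hB1.ra 9]; exact hr.ρ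
    · rw [hB1.ra 10]; exact hr.leaf
    · rw [hB1.r 21]; exact hr.κ
    · rw [hB1.r 22]; exact hr.cnt
    · rw [hB1.i 7]; exact hr.frz
  · rw [hB1.i 11, h11]

lemma Run.frz_of {as : AS} {s s' : St} {b : Prop} (hr : Run P h as s) (h7 : s'.i 7 = 1) (hb : b)
    (hB : Below 0 23 16 16 true s s') : Run P h { as with frz := b } s' := by
  refine ⟨?_, ?_, ?_, ?_, ?_, ?_, Or.inr ⟨h7, hb⟩⟩
  · rw [hB.ra 7]; exact hr.x
  · rw [hB.ra 8]; exact hr.v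
  · rw [hB.ra 9]; exact hr.ρ
  · rw [hB.ra 10]; exact hr.leaf
  · rw [hB.r 21]; exact hr.κ
  · rw [hB.r 22]; exact hr.cnt

lemma Run.congr {as : AS} {s s' : St} (hr : Run P h as s) {z : Bool}
    (hB : Below 8 23 16 16 z s s') : Run P h as s' := by
  refine ⟨?_, ?_, ?_, ?_, ?_, ?_, ?_⟩
  · rw [hB.ra 7]; exact hr.x
  · rw [hB.ra 8]; exact hr.v
  · rw [hB.ra 9]; exact hr.ρ
  · rw [hB.ra 10]; exact hr.leaf
  · rw [hB.r 21]; exact hr.κ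
  · rw [hB.r 22]; exact hr.cnt
  · rw [hB.i 7]; exact hr.frz

/-- Bounds for the lengths of the columns. -/
structure LenOK (P : Inst) (c : ℕ) (ap : ℕ → ℕ) : Prop where
  lt : ∀ j < P.m, ap (j + 1) - ap j ≤ 2 * c
  last : ap (P.m + 1) - ap P.m ≤ 2 * P.n

lemma step_cnt (as : AS) (j : ℕ) : ∃ d : ℕ, (d = 0 ∨ as.cnt ≤ P.cap) ∧ d ≤ 1 ∧
    (P.step as j).cnt = as.cnt + d := by
  classical
  unfold Inst.step
  split_ifs with h1 h2 h3
  · exact ⟨0, by simp, by simp, by simp⟩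
  · exact ⟨0, by simp, by simp, by simp⟩
  · exact ⟨0, by simp, by simp, by simp⟩
  · exact ⟨if j = P.m then 1 else 0, Or.inr (not_lt.1 h3), by split_ifs <;> simp,
      by simp [Inst.core]⟩

lemma iterCmd_spec {G : ℝ} (hP : P.Good G) {s : St} {as : AS} {a c d : ℕ} (he : Env P h E W s)
    (hl : LenOK P c (s.ia 3)) (hr : Run P h as s) (hi : P.Inv a as)
    (hd : (P.step as (P.pick as.leaf (ω s.pos : ℝ))).cnt = as.cnt + d) :
    Tri W E H ω iterCmd s (420 + 100 * h + (204 + 50 * h) * (2 * c + 2 * P.n * d)) fun s' =>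
      (Run P h (P.step as (P.pick as.leaf (ω s.pos : ℝ))) s' ∧ s'.pos = s.pos + 1) ∧
      Below 7 21 16 7 true s s' := by
  obtain ⟨u, hu⟩ : ∃ u : ℝ, u = ω s.pos := ⟨_, rfl⟩
  rw [← hu] at hd ⊢
  have hhh := he.hh
  have hE := he.hE
  have hW := he.hW
  obtain ⟨A, hA⟩ : ∃ A, A = (204 + 50 * h) * (2 * c + 2 * P.n * d) := ⟨_, rfl⟩
  refine Tri.frame ?_ (by decide)
  rw [← hA]
  unfold iterCmd
  refine Tri.le (Tri.seq (T₁ := 1) (T₂ := 410 + 100 * h + A) (R := fun s' => s'.r 23 = u ∧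
    s'.pos = s.pos + 1 ∧ Below 1000 23 16 16 true s s')
    ⟨trivial, by simp [Cmd.cost], by simp [Cmd.den, hu], rfl, Cmd.den_below (by decide) _⟩
    fun s1 hs1 => ?_) (by omega)
  obtain ⟨h23, hpos, hB1⟩ := hs1
  have hr1 := hr.congr (hB1.mono id)
  have he1 := he.congr (hB1.mono id)
  have hroot := hr1.leaf.root (by omega)
  refine Tri.le (Tri.ifI (T := 400 + 100 * h + A) (by simp; omega) (by simp) ?_ ?_)
    (by simp; omega)
  · intro h7
    simp only [IE.eval_var, IE.eval_ofNat] at h7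
    have hf : as.frz := hr1.frz.elim (fun h' => by omega) And.right
    exact ⟨trivial, by simp [Cmd.cost]; omega, by simpa [Inst.step, hf, Cmd.den] using hr1,
      by simpa [Cmd.den] using hpos⟩
  intro h7
  simp only [IE.eval_var, IE.eval_ofNat] at h7
  have hf : ¬ as.frz := hr1.frz.elim And.right (fun h' => by omega)
  refine Tri.le (Tri.ifR (T := 390 + 100 * h + A) (by simp) (by simp; omega) ?_ ?_)
    (by simp; omega)
  · intro hc
    simp only [RE.eval_var, RE.eval_arr, IE.eval_ofNat, hroot, he1.T0] at hc
    refine ⟨by simp [Cmd.ok]; omega, by simp [Cmd.cost]; omega, ?_, by simpa [Cmd.den] using hpos⟩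
    simp only [Inst.step, hf, if_false, if_pos hc]
    exact hr1.frz_of (by simp [Cmd.den]) trivial (Cmd.den_below (by decide) _)
  intro hT
  simp only [RE.eval_var, RE.eval_arr, IE.eval_ofNat, hroot, he1.T0] at hT
  refine Tri.le (Tri.ifR (T := 385 + 100 * h + A) (by simp) (by simp) ?_ ?_)
    (by simp; omega)
  · intro hc
    simp only [RE.eval_var, hr1.cnt, he1.cap] at hc
    refine ⟨by simp [Cmd.ok]; omega, by simp [Cmd.cost]; omega, ?_, by simpa [Cmd.den] using hpos⟩
    simp only [Inst.step, hf, if_false, if_neg hT, if_pos hc]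
    exact hr1.frz_of (by simp [Cmd.den]) trivial (Cmd.den_below (by decide) _)
  intro hcap
  simp only [RE.eval_var, hr1.cnt, he1.cap] at hcap
  have hstep : P.step as (P.pick as.leaf u) = P.core as (P.pick as.leaf u) := by
    simp [Inst.step, hf, hT, hcap]
  rw [hstep] at hd ⊢
  have h2 := Inst.Inv.two_le_tot hi
  refine Tri.le (Tri.seq (findCmd_spec hP he1.row hr1.leaf (fun l hl => hi.leaf_nonneg hl)
    (by linarith) h23 (by rw [hu]; exact (ω s.pos).2.1) (by rw [hu]; exact (ω s.pos).2.2) he1.m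
    he1.ht he1.H he1.hh he1.hE he1.hW) (T₂ := 250 + A) fun s2 hs2 => ?_) (by omega)
  obtain ⟨h11, hB2⟩ := hs2
  obtain ⟨j, hj⟩ : ∃ j, j = P.pick as.leaf u := ⟨_, rfl⟩
  rw [← hj] at h11 hd ⊢
  have hr2 := hr1.congr (hB2.mono id)
  have he2 := he1.congr (hB2.mono id)
  have hpos2 : s2.pos = s.pos + 1 := by rw [hB2.pos rfl, hpos]
  have h3 : s2.ia 3 = s.ia 3 := by rw [hB2.ia 3, hB1.ia 3]
  refine Tri.le (Tri.ifI (T := 240 + A) (by simp) (by simp [he2.m]; omega) ?_ ?_)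
    (by simp; omega)
  · intro hc
    simp only [IE.eval_var, IE.eval_add, IE.eval_ofNat, h11, he2.m] at hc
    refine ((coreCmd_spec hP he2 hr2 hi (by omega) h11).conseq ?_).le ?_
    · rintro s3 ⟨hr3, hB3⟩
      exact ⟨hr3, by rw [hB3.pos rfl, hpos2]⟩
    · rw [h3]
      have : (204 + 50 * h) * (s.ia 3 (j + 1) - s.ia 3 j) ≤ A := by
        rw [hA]
        refine Nat.mul_le_mul_left _ ?_
        rcases (Nat.lt_succ_iff.1 hc).lt_or_eq with h' | h'
        · exact (hl.lt j h').trans (Nat.le_add_right _ _)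
        · rw [h'] at hd ⊢
          obtain rfl : d = 1 := by simpa [Inst.core, eq_comm] using hd
          have := hl.last
          omega
      omega
  · intro hc
    simp only [IE.eval_var, IE.eval_add, IE.eval_ofNat, h11, he2.m] at hc
    have hja : ∀ r, P.a r j = 0 := fun r => hP.a_out r j (by omega)
    refine ⟨by simp [Cmd.ok], by simp [Cmd.cost]; omega, ?_, by simpa [Cmd.den] using hpos2⟩
    refine ⟨fun i hi => ?_, fun r hr => ?_, fun r hr => ?_, ?_, ?_, ?_, hr2.frz⟩
    · simpa [Cmd.den, Inst.core, show ¬ j ≤ P.m by omega] using hr2.x i hi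
    · simpa [Cmd.den, Inst.core, hja] using hr2.v r hr
    · simpa [Cmd.den, Inst.core, hja] using hr2.ρ r hr
    · simpa [Cmd.den, Inst.core, hja] using hr2.leaf
    · simp [Cmd.den, Inst.core, hr2.κ, he2.θ]
    · simpa [Cmd.den, Inst.core, show j ≠ P.m by omega] using hr2.cnt

end Loop

/-! ### One run -/

namespace Loop

open Finset Regr

/-- The initial state of a run. -/
def initCmd : Cmd :=
  .loop 13 (.var 1 + 1) (.rput 7 (.var 13) 0) ;;
  .loop 14 (.var 0 + .var 0)
    (.rput 8 (.var 14) (.arr 4 (.var 14)) ;;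
      .rput 9 (.var 14) (0 - .var 8 * .log (2 * .cast (.var 0)) - .arr 4 (.var 14)) ;;
      .rset 29 0 ;; setLeaf) ;;
  .iset 14 (.var 0 + .var 0) ;; .rset 29 2 ;; setLeaf ;;
  .rset 21 (1 - .var 9) ;; .rset 22 0 ;; .iset 7 0

/-- One run of the method. -/
def runCmd : Cmd :=
  initCmd ;; .rep (.var 10) (refreshCmd ;; .loop 8 (.var 3) iterCmd)

variable {P : Inst} {h W E H : ℕ} {ω : Tape}

lemma refreshCmd_spec {s : St} {as : AS} (he : Env P h E W s) (hr : Run P h as s) :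
    Tri W E H ω refreshCmd s (10 + 2 * P.n * (50 + 50 * h)) fun s' =>
      Run P h (P.refresh as) s' ∧ Below 14 29 16 10 false s s' := by
  refine Tri.frame ?_ (by decide)
  have hhh := he.hh
  have hE := he.hE
  have hW := he.hW
  unfold refreshCmd
  refine Tri.le ((Tri.loop_frame (T := 46 + 50 * h) (2 * P.n) (fun k s' => LeafOK P h (fun r =>
    if r < k then P.newLeaf (as.v r) (as.ρ r) as.κ else as.leaf r) (s'.ra 10))
    (a := 14) (b := 29) (p := 16) (q := 10) (z := false) (by decide) ?_ ?_ ?_ ?_ ?_).conseq ?_) ?_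
  · simp [he.n]
    omega
  · simp [he.n]
    omega
  · omega
  · simpa using hr.leaf
  · intro k hk s' i1 hB
    have f5 : s'.i 5 = 2 ^ h := by rw [hB.i 5, he.H]
    have fh : s'.i 4 = h := by rw [hB.i 4, he.ht]
    have f21 : s'.r 21 = as.κ := by rw [hB.r 21, hr.κ]
    have ft : s'.r 8 = P.t := by rw [hB.r 8, he.t]
    have f13 : s'.r 13 = 1 / (2 * P.n) := by rw [hB.r 13, he.inv]
    have f8 : s'.ra 8 k = as.v k := by rw [hB.ra 8, hr.v k hk]
    have f9 : s'.ra 9 k = as.ρ k := by rw [hB.ra 9, hr.ρ k hk]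
    refine Tri.le (Tri.step (T₁ := 22) (by simp [Cmd.ok]; omega) (by simp [Cmd.cost])
      ((setLeaf_spec (h := h) (r := k) ?_ ?_ ?_ ?_ (by omega) hE (by omega)).conseq ?_)) (by omega)
    · simpa [Cmd.den] using i1.tree
    · simpa [Cmd.den] using fh
    · simpa [Cmd.den] using f5
    · simp [Cmd.den]
    · rintro s'' ⟨⟨t1, t2⟩, -⟩
      refine (LeafOK.set i1 (r0 := k) (by omega) t1 (by omega)
        (y := P.newLeaf (as.v k) (as.ρ k) as.κ) ?_).congr ?_
      · intro l hl
        rw [t2 l hl]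
        simp [Cmd.den, f8, f9, f21, ft, f13, Inst.newLeaf]
      · intro r _
        rcases lt_trichotomy r k with h' | rfl | h'
        · simp [h', h'.ne, Nat.lt_succ_of_lt h']
        · simp
        · simp [show ¬ r < k by omega, show ¬ r < k + 1 by omega, show r ≠ k by omega]
  · rintro s' ⟨i1, hB⟩
    refine ⟨?_, ?_, ?_, i1, ?_, ?_, ?_⟩
    · rw [hB.ra 7]; exact hr.x
    · rw [hB.ra 8]; exact hr.v
    · rw [hB.ra 9]; exact hr.ρ
    · rw [hB.r 21]; exact hr.κ
    · rw [hB.r 22]; exact hr.cnt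
    · rw [hB.i 7]; exact hr.frz
  · simp
    have : 2 * P.n * (46 + 50 * h + 4) = 2 * P.n * (50 + 50 * h) := by ring
    omega

lemma initCmd_spec {s : St} {leaf : ℕ → ℝ} (he : Env P h E W s)
    (hr : LeafOK P h leaf (s.ra 10)) :
    Tri W E H ω initCmd s (60 + 50 * h + 20 * (P.m + 1) + 2 * P.n * (74 + 50 * h)) fun s' =>
      Run P h P.init s' ∧ Below 7 21 16 7 false s s' := by
  refine Tri.frame ?_ (by decide)
  have hhh := he.hh
  have hE := he.hE
  have hW := he.hW
  unfold initCmd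
  refine Tri.le (Tri.seq (Tri.loop_frame (T := 16) (P.m + 1) (fun k s' => (∀ j < k, s'.ra 7 j = 0) ∧
      s'.ra 10 = s.ra 10)
    (a := 13) (b := 1000) (p := 16) (q := 7) (z := false) (by decide) ?_ ?_ ?_ ?_ ?_)
    (T₂ := 50 + 50 * h + 2 * P.n * (74 + 50 * h)) fun s1 hs1 => ?_) ?_
  · simp [he.m]; omega
  · simp [he.m]
  · omega
  · simp
  · rintro k hk s' ⟨i1, i2⟩ hB
    refine ⟨by simp [Cmd.ok]; omega, by simp [Cmd.cost], fun j hj => ?_, by simpa [Cmd.den] using i2⟩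
    simp only [Cmd.den]
    simp only [St.putR_ra_apply]
    simp
    intro hjk
    exact i1 j (by omega)
  swap
  · simp
    omega
  obtain ⟨⟨x1, x2⟩, hB1⟩ := hs1
  have he1 := he.congr (hB1.mono id)
  refine Tri.le (Tri.seq (Tri.loop_frame (T := 70 + 50 * h) (2 * P.n) (fun k s' =>
    LeafOK P h (fun r => if r < k then 0 else leaf r) (s'.ra 10) ∧
    (∀ r < k, s'.ra 8 r = P.β r) ∧ (∀ r < k, s'.ra 9 r = P.init.ρ r))
    (a := 14) (b := 29) (p := 16) (q := 8) (z := false) (by decide) ?_ ?_ ?_ ?_ ?_)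
    (T₂ := 40 + 50 * h) fun s2 hs2 => ?_) ?_
  · simp [he1.n]; omega
  · simp [he1.n]; omega
  · omega
  · simpa [x2] using hr
  · rintro k hk s' ⟨j1, j2, j3⟩ hB
    have f0 : s'.i 0 = P.n := by rw [hB.i 0, he1.n]
    have f5 : s'.i 5 = 2 ^ h := by rw [hB.i 5, he1.H]
    have fh : s'.i 4 = h := by rw [hB.i 4, he1.ht]
    have ft : s'.r 8 = P.t := by rw [hB.r 8, he1.t]
    have f4 : s'.ra 4 k = P.β k := by rw [hB.ra 4, he1.β k hk]
    refine Tri.le (Tri.step (T₁ := 14) (by simp [Cmd.ok]; omega) (by simp [Cmd.cost])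
      (Tri.step (T₁ := 26) (by simp [Cmd.ok, Cmd.den]; omega) (by simp [Cmd.cost])
      (Tri.step (T₁ := 2) (by simp [Cmd.ok]) (by simp [Cmd.cost])
      ((setLeaf_spec (h := h) (r := k) ?_ ?_ ?_ ?_ (by omega) hE (by omega)).conseq ?_))))
      (by omega)
    · simpa [Cmd.den] using j1.tree
    · simpa [Cmd.den] using fh
    · simpa [Cmd.den] using f5
    · simp [Cmd.den]
    · rintro s'' ⟨⟨t1, t2⟩, hB3⟩
      refine ⟨(LeafOK.set j1 (r0 := k) (by omega) t1 (by omega) (y := 0) ?_).congr ?_,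
        fun r hr => ?_, fun r hr => ?_⟩
      · intro l hl
        rw [t2 l hl]
        simp [Cmd.den]
      · intro r _
        rcases lt_trichotomy r k with h' | rfl | h'
        · simp [h', h'.ne, Nat.lt_succ_of_lt h']
        · simp
        · simp [show ¬ r < k by omega, show ¬ r < k + 1 by omega, show r ≠ k by omega]
      · rw [hB3.ra 8]
        simp only [Cmd.den]
        simp only [St.setR_ra, St.putR_ra_apply, St.setI_ra]
        by_cases h1 : r = k
        · simp [h1, f4]
        · simp [h1, j2 r (by omega)]
      · rw [hB3.ra 9]
        simp only [Cmd.den]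
        simp only [St.setR_ra, St.putR_ra_apply, St.setI_ra]
        by_cases h1 : r = k
        · simp [h1, f4, ft, f0, Inst.init]
        · simp [h1, j3 r (by omega)]
  swap
  · simp
    have : 2 * P.n * (70 + 50 * h + 4) = 2 * P.n * (74 + 50 * h) := by ring
    omega
  obtain ⟨⟨j1, j2, j3⟩, hB2⟩ := hs2
  have he2 := he1.congr (hB2.mono id)
  refine Tri.le (Tri.step (T₁ := 4) (by simp [Cmd.ok, he2.n]; omega) (by simp [Cmd.cost])
    (Tri.step (T₁ := 2) (by simp [Cmd.ok]) (by simp [Cmd.cost])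
    (Tri.seq (setLeaf_spec (h := h) (r := 2 * P.n) ?_ ?_ ?_ ?_ (by omega) hE (by omega))
      (T₂ := 10) fun s3 hs3 => ?_))) (by omega)
  · simpa [Cmd.den] using j1.tree
  · simpa [Cmd.den] using he2.ht
  · simpa [Cmd.den] using he2.H
  · simp [Cmd.den, he2.n, two_mul]
  · obtain ⟨⟨t1, t2⟩, hB3⟩ := hs3
    refine ⟨by simp [Cmd.ok]; omega, by simp [Cmd.cost], ?_⟩
    refine ⟨fun j hj => ?_, fun r hr => ?_, fun r hr => ?_, ?_, ?_, ?_, ?_⟩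
    · simp only [Cmd.den]
      simp only [St.setI_ra, St.setR_ra]
      rw [hB3.ra 7]
      change s2.ra 7 j = 0
      rw [hB2.ra 7, x1 j (by omega)]
    · simp only [Cmd.den]
      simp only [St.setI_ra, St.setR_ra]
      rw [hB3.ra 8]
      exact j2 r hr
    · simp only [Cmd.den]
      simp only [St.setI_ra, St.setR_ra]
      rw [hB3.ra 9]
      exact j3 r hr
    · refine (LeafOK.set j1 (tr' := s3.ra 10) (r0 := 2 * P.n) (by omega) t1 (by omega) (y := 2)
        ?_).congr ?_
      · intro l hl
        rw [t2 l hl]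
        simp [Cmd.den]
      · intro r hr
        by_cases h1 : r = 2 * P.n
        · simp [h1, Inst.init]
        · simp [h1, Inst.init, show r < 2 * P.n by omega]
    · have : s3.r 9 = P.θ := by
        rw [hB3.r 9]
        exact he2.θ
      simp [Cmd.den, this, Inst.init]
    · simp [Cmd.den, Inst.init]
    · exact Or.inl ⟨by simp [Cmd.den], not_false⟩

/-- One run computes the chain of the method. -/
lemma runCmd_spec {G : ℝ} (hP : P.Good G) {s : St} {leaf : ℕ → ℝ} {c : ℕ} (he : Env P h E W s)
    (hl : LenOK P c (s.ia 3)) (hr : LeafOK P h leaf (s.ra 10)) :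
    ∃ T : ℕ, (T : ℝ) ≤ 1000 * (1 + h) * (P.n + P.m + P.Nb * (P.n + P.B0 * (c + 1)) +
      P.n * (P.cap + 1)) ∧
    Tri W E H ω runCmd s T fun s' => (Run P h (chain P.init
      (fun k s (u : unitInterval) => P.ustep k s u) s.pos ω P.N) s' ∧ s'.pos = s.pos + P.N) ∧
      Below 7 21 16 7 true s s' := by
  set ch := chain P.init (fun k s (u : unitInterval) => P.ustep k s u) s.pos ω with hch
  have hinv : ∀ k, P.Inv (k % P.B0) (P.pre k (ch k)) := by
    intro k
    induction k with
    | zero => exact Inst.inv_init hP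
    | succ k ih => exact Inst.inv_ustep hP ih _
  have hB0 := Inst.one_le_B0 hP
  have hhh := he.hh
  have hE := he.hE
  have hW := he.hW
  have hB0m : P.B0 ≤ P.m := min_le_right _ _
  have hchs : ∀ k, ch (k + 1) = P.step (P.pre k (ch k))
    (P.pick (P.pre k (ch k)).leaf (ω (s.pos + k) : ℝ)) := fun k => rfl
  obtain ⟨D, hD⟩ : ∃ D : ℕ → ℕ, ∀ k, (ch k).cnt = D k := by
    have : ∀ k, ∃ d : ℕ, (ch k).cnt = d := by
      intro k
      induction k with
      | zero => exact ⟨0, by simp [hch, chain, Inst.init]⟩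
      | succ k ih =>
        obtain ⟨d, hd⟩ := ih
        obtain ⟨d', -, -, h'⟩ := step_cnt (P := P) (P.pre k (ch k))
          (P.pick (P.pre k (ch k)).leaf (ω (s.pos + k) : ℝ))
        exact ⟨d + d', by rw [hchs, h', Inst.pre_cnt, hd, Nat.cast_add]⟩
    exact ⟨fun k => (this k).choose, fun k => (this k).choose_spec⟩
  have hD0 : D 0 = 0 := by
    have := hD 0
    simpa [hch, chain, Inst.init, eq_comm] using this
  have hDs : ∀ k, D k ≤ D (k + 1) ∧ (D (k + 1) = D k ∨ (D (k + 1) = D k + 1 ∧ D k ≤ P.cap)) := by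
    intro k
    obtain ⟨d', h1, h2, h'⟩ := step_cnt (P := P) (P.pre k (ch k))
      (P.pick (P.pre k (ch k)).leaf (ω (s.pos + k) : ℝ))
    rw [← hchs, Inst.pre_cnt, hD, hD] at h'
    have h3 : D (k + 1) = D k + d' := by exact_mod_cast h'
    rw [Inst.pre_cnt, hD] at h1
    refine ⟨by omega, ?_⟩
    rcases h1 with rfl | h1
    · exact Or.inl h3
    · rcases Nat.le_one_iff_eq_zero_or_eq_one.1 h2 with rfl | rfl
      · exact Or.inl h3
      · exact Or.inr ⟨h3, h1⟩
  have hDcap : ∀ k, (D k : ℝ) ≤ P.cap + 1 := by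
    intro k
    induction k with
    | zero => rw [hD0]; have := Inst.cap_pos hP; push_cast; linarith
    | succ k ih =>
      rcases (hDs k).2 with h1 | ⟨h1, h2⟩
      · rwa [h1]
      · rw [h1]; push_cast; linarith
  obtain ⟨A, hA⟩ : ∃ A, A = 424 + 100 * h + (204 + 50 * h) * (2 * c) := ⟨_, rfl⟩
  obtain ⟨B, hB⟩ : ∃ B, B = (204 + 50 * h) * (2 * P.n) := ⟨_, rfl⟩
  obtain ⟨RT, hRT⟩ : ∃ RT, RT = 10 + 2 * P.n * (50 + 50 * h) := ⟨_, rfl⟩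
  refine ⟨(60 + 50 * h + 20 * (P.m + 1) + 2 * P.n * (74 + 50 * h)) +
    (3 + (P.Nb * (RT + P.B0 * A + 6) + B * D P.N)), ?_, Tri.frame ?_ (by decide)⟩
  · have h1 := hDcap P.N
    have hn : (1 : ℝ) ≤ P.n := by exact_mod_cast hP.hn
    rw [hA, hB, hRT]
    generalize P.B0 = B0
    push_cast
    have e1 : ((204 + 50 * h) * (2 * P.n) : ℝ) * D P.N ≤
        1000 * (1 + h) * (P.n * (P.cap + 1)) := by
      have : ((204 + 50 * h) * (2 * P.n) : ℝ) ≤ 1000 * (1 + h) * P.n := by nlinarith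
      calc _ ≤ (1000 * (1 + h) * P.n) * (P.cap + 1) := by gcongr
        _ = _ := by ring
    have e2 : ((10 + 2 * P.n * (50 + 50 * h)) + B0 * (424 + 100 * h + (204 + 50 * h) * (2 * c))
        + 6 : ℝ) ≤ 1000 * (1 + h) * (P.n + B0 * (c + 1)) := by
      have : (424 + 100 * h + (204 + 50 * h) * (2 * c) : ℝ) ≤ 1000 * (1 + h) * (c + 1) := by
        nlinarith
      have h2 := mul_le_mul_of_nonneg_left this (Nat.cast_nonneg (α := ℝ) B0)
      nlinarith
    have e3 := mul_le_mul_of_nonneg_left e2 (Nat.cast_nonneg (α := ℝ) P.Nb)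
    have e4 : (60 + 50 * h + 20 * (P.m + 1) + 2 * P.n * (74 + 50 * h) + 3 : ℝ) ≤
        1000 * (1 + h) * (P.n + P.m) := by
      nlinarith
    linarith
  unfold runCmd
  refine Tri.seq (initCmd_spec he hr) fun s1 hs1 => ?_
  obtain ⟨hr1, hB1⟩ := hs1
  have he1 := he.congr (hB1.mono id)
  refine Tri.le (Tri.rep_acc P.Nb (fun b t s' => Run P h (ch (b * P.B0)) s' ∧
    s'.pos = s.pos + b * P.B0 ∧ Below 7 21 16 7 true s s' ∧
    t = b * (RT + P.B0 * A + 6) + B * D (b * P.B0)) (by simp) (by simp [he1.zb, Inst.Nb]) ?_ ?_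
    (T := P.Nb * (RT + P.B0 * A + 6) + B * D P.N) ?_) (by simp)
  · refine ⟨by simpa [hch, chain] using hr1, by simpa using hB1.pos rfl,
      hB1.mono (by simp), by simp [hD0]⟩
  · rintro b hb t s2 ⟨hr2, hp2, hB2, rfl⟩
    have he2 := he.congr (hB2.mono id)
    have hmono : ∀ i, D (b * P.B0) ≤ D (b * P.B0 + i) := by
      intro i
      induction i with
      | zero => exact le_rfl
      | succ i ih => exact ih.trans (hDs _).1
    refine ⟨RT + (3 + (P.B0 * A + B * (D ((b + 1) * P.B0) - D (b * P.B0)))),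
      Tri.seq ((refreshCmd_spec he2 hr2).le hRT.ge) fun s3 hs3 => ?_⟩
    obtain ⟨hr3, hB3⟩ := hs3
    have hB3' := hB2.trans (hB3.mono (by simp))
    refine Tri.loop_acc P.B0 (fun i t s' => Run P h (if i = 0 then P.refresh (ch (b * P.B0)) else
      ch (b * P.B0 + i)) s' ∧ s'.pos = s.pos + b * P.B0 + i ∧ Below 7 21 16 7 true s s' ∧
      t = i * A + B * (D (b * P.B0 + i) - D (b * P.B0))) (by simp) ?_ (by omega) ?_ ?_ ?_
    · exact (he.congr (hB3'.mono id)).B0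
    · exact ⟨by simpa using hr3, by rw [hB3.pos rfl, hp2]; simp, hB3', by simp⟩
    · rintro i hi t s4 ⟨hr4, hp4, hB4, rfl⟩
      have hB5 : Below 7 21 16 7 true s (s4.setI 8 i) := hB4.trans (Below.setI (by norm_num) _)
      have he5 := he.congr (hB5.mono id)
      have hpre : (if i = 0 then P.refresh (ch (b * P.B0)) else ch (b * P.B0 + i)) =
          P.pre (b * P.B0 + i) (ch (b * P.B0 + i)) := by
        unfold Inst.pre
        have : P.B0 ∣ b * P.B0 + i ↔ i = 0 := by
          rw [Nat.dvd_add_right (Dvd.intro_left b rfl)]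
          exact ⟨fun h' => Nat.eq_zero_of_dvd_of_lt h' hi, fun h' => h' ▸ dvd_zero _⟩
        by_cases h0 : i = 0
        · simp [h0]
        · simp [h0, this]
      rw [hpre] at hr4
      have hr5 : Run P h (P.pre (b * P.B0 + i) (ch (b * P.B0 + i))) (s4.setI 8 i) :=
        hr4.congr (Below.setI (a := 8) (b := 23) (p := 16) (q := 16) (z := true) le_rfl i)
      have hpos : (s4.setI 8 i).pos = s.pos + (b * P.B0 + i) := by
        rw [St.setI_pos, hp4, add_assoc]
      obtain ⟨d, hd⟩ : ∃ d, D (b * P.B0 + i + 1) = D (b * P.B0 + i) + d :=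
        ⟨_, (Nat.add_sub_cancel' (hDs _).1).symm⟩
      have hstep : P.step (P.pre (b * P.B0 + i) (ch (b * P.B0 + i)))
          (P.pick (P.pre (b * P.B0 + i) (ch (b * P.B0 + i))).leaf
            (ω (s4.setI 8 i).pos : ℝ)) = ch (b * P.B0 + (i + 1)) := by
        rw [hpos, ← hchs, add_assoc]
      refine ⟨_, (iterCmd_spec (c := c) (d := d) hP he5 ?_ hr5 (hinv _) ?_).conseq ?_⟩
      · rw [hB5.ia 3]
        exact hl
      · rw [hstep, hD, ← add_assoc, hd, Inst.pre_cnt, hD, Nat.cast_add]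
      · rintro s6 ⟨⟨hr6, hp6⟩, hB6⟩
        rw [hstep] at hr6
        refine ⟨by simpa using hr6, by rw [hp6, hpos]; ring, hB5.trans hB6, ?_⟩
        rw [show D (b * P.B0 + (i + 1)) = _ from hd, Nat.sub_add_comm (hmono i), hA, hB]
        ring
    · rintro t s4 ⟨hr4, hp4, hB4, rfl⟩
      have e1 : b * P.B0 + P.B0 = (b + 1) * P.B0 := by ring
      rw [if_neg (by omega), e1] at hr4
      rw [e1]
      refine ⟨le_rfl, hr4, by rw [hp4]; ring, hB4, ?_⟩
      have := hmono P.B0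
      rw [e1] at this
      obtain ⟨d, hd⟩ := Nat.exists_eq_add_of_le this
      rw [hd, Nat.add_sub_cancel_left]
      ring
  · rintro t s2 ⟨hr2, hp2, hB2, rfl⟩
    exact ⟨le_rfl, hr2, hp2⟩

end Loop

/-! ### Repeated runs -/

namespace Loop

open Finset Regr

/-- Largest row. -/
def objCmd : Cmd :=
  .rset 30 (.arr 8 0) ;;
  .loop 14 (.var 0 + .var 0) (.rset 30 (.max (.var 30) (.arr 8 (.var 14)))) ;;
  .rset 30 (.var 30 + 3 * .arr 7 (.var 1))

/-- Keep the best solution. -/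
def keepCmd : Cmd :=
  .ifR (.var 30) (.var 20)
    (.rset 20 (.var 30) ;; .loop 13 (.var 1) (.rput 6 (.var 13) (.arr 7 (.var 13)))) .skip

/-- Repeated runs, and output of the best solution. -/
def mainCmd : Cmd :=
  .rset 20 9 ;; .rep (.var 12) (runCmd ;; objCmd ;; keepCmd) ;;
  .loop 13 (.var 1) (.rput 0 (.var 13) (.arr 6 (.var 13)))

/-- Bound for the time of a run, up to a constant. -/
noncomputable def runTime (P : Inst) (h c : ℕ) : ℝ :=
  (1 + h) * (P.n + P.m + P.Nb * (P.n + P.B0 * (c + 1)) + P.n * (P.cap + 1))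

/-- The result of the run that reads the tape from position `o`. -/
noncomputable def result (P : Inst) (o : ℕ) (ω : Tape) : AS :=
  chain P.init (fun k s (u : unitInterval) => P.ustep k s u) o ω P.N

variable {P : Inst} {h W E H : ℕ} {ω : Tape}

lemma objCmd_spec {G : ℝ} (hP : P.Good G) {s : St} {as : AS} (he : Env P h E W s)
    (hr : Run P h as s) (hi : ∀ r < 2 * P.n, as.v r = P.val as.x r) :
    Tri W E H ω objCmd s (40 + 40 * P.n) fun s' => ((∀ r < 2 * P.n, P.row as.x r ≤ s'.r 30) ∧
      ∃ r < 2 * P.n, P.row as.x r = s'.r 30) ∧ Below 14 30 16 16 false s s' := by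
  refine Tri.frame ?_ (by decide)
  have hhh := he.hh
  have hE := he.hE
  have hW := he.hW
  have hn := hP.hn
  unfold objCmd
  refine Tri.le (Tri.step (T₁ := 7) (by simp [Cmd.ok]; omega) (by simp [Cmd.cost])
    (Tri.seq (Tri.loop_frame (T := 11) (2 * P.n) (fun k s' => (∀ r < k, as.v r ≤ s'.r 30) ∧
      ∃ r < 2 * P.n, as.v r = s'.r 30) (a := 14) (b := 30) (p := 16) (q := 16) (z := false)
      (by decide) ?_ ?_ ?_ ?_ ?_) (T₂ := 13) fun s1 hs1 => ?_)) ?_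
  · simp [Cmd.den, he.n]; omega
  · simp [Cmd.den, he.n]; omega
  · omega
  · exact ⟨by simp, 0, by omega, by simp [Cmd.den, hr.v 0 (by omega)]⟩
  · rintro k hk s' ⟨i1, r, hr', i2⟩ hB
    have f8 : s'.ra 8 k = as.v k := by
      rw [hB.ra 8]
      exact hr.v k hk
    refine ⟨by simp [Cmd.ok]; omega, by simp [Cmd.cost], fun r hr => ?_, ?_⟩
    · simp only [Cmd.den]
      simp only [RE.eval_max, RE.eval_var, RE.eval_arr, IE.eval_var, St.setI_i, St.setI_r,
        St.setI_ra, Function.update_self, St.setR_r, f8]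
      rcases (Nat.lt_succ_iff.1 hr).lt_or_eq with h' | rfl
      · exact le_max_of_le_left (i1 r h')
      · exact le_max_right _ _
    · simp only [Cmd.den]
      simp only [RE.eval_max, RE.eval_var, RE.eval_arr, IE.eval_var, St.setI_i, St.setI_r,
        St.setI_ra, Function.update_self, St.setR_r, f8]
      rcases le_total (s'.r 30) (as.v k) with h' | h'
      · exact ⟨k, hk, (max_eq_right h').symm⟩
      · exact ⟨r, hr', by rw [max_eq_left h', i2]⟩
  · obtain ⟨⟨i1, r, hr', i2⟩, hB⟩ := hs1
    have fm : s1.i 1 = P.m := by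
      rw [hB.i 1]
      exact he.m
    have f7 : s1.ra 7 P.m = as.x P.m := by
      rw [hB.ra 7]
      exact hr.x _ le_rfl
    have hv : ∀ r < 2 * P.n, P.row as.x r = as.v r + 3 * as.x P.m := fun r hr => by
      rw [hi r hr, Inst.val_eq hP _ hr]
      ring
    refine ⟨by simp [Cmd.ok, fm]; omega, by simp [Cmd.cost], fun r hr => ?_, r, hr', ?_⟩
    · simp [Cmd.den, fm, f7, hv r hr, i1 r hr]
    · simp [Cmd.den, fm, f7, hv r hr', i2]
  · simp; omega

lemma keepCmd_spec {s : St} (he : Env P h E W s) :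
    Tri W E H ω keepCmd s (20 + 20 * P.m) fun s' => ((s.r 30 < s.r 20 → s'.r 20 = s.r 30 ∧
      ∀ j < P.m, s'.ra 6 j = s.ra 7 j) ∧ (¬ s.r 30 < s.r 20 → s'.r 20 = s.r 20 ∧
      s'.ra 6 = s.ra 6) ∧ s'.ra 10 = s.ra 10) ∧ Below 13 20 16 6 false s s' := by
  refine Tri.frame ?_ (by decide)
  have hhh := he.hh
  have hE := he.hE
  have hW := he.hW
  unfold keepCmd
  refine Tri.le (Tri.ifR (T := 10 + 20 * P.m) (by simp) (by simp) ?_ ?_) (by simp; omega)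
  · intro hc
    simp only [RE.eval_var] at hc
    refine Tri.le (Tri.step (T₁ := 2) (by simp [Cmd.ok]) (by simp [Cmd.cost])
      ((Tri.loop_frame (T := 14) P.m (fun k s' => (∀ j < k, s'.ra 6 j = s.ra 7 j) ∧
        s'.ra 7 = s.ra 7 ∧ s'.ra 10 = s.ra 10) (a := 13) (b := 1000) (p := 16) (q := 6)
        (z := false) (by decide) ?_ ?_ ?_ ?_ ?_).conseq ?_)) ?_
    · simp
    · simp [Cmd.den, he.m]
    · omega
    · simp [Cmd.den]
    · rintro k hk s' ⟨i1, i2, i3⟩ -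
      refine ⟨by simp [Cmd.ok]; omega, by simp [Cmd.cost], fun j hj => ?_, by simpa [Cmd.den],
        by simpa [Cmd.den]⟩
      simp only [Cmd.den]
      simp only [St.putR_ra_apply]
      by_cases h1 : j = k
      · simp [h1, i2]
      · simp [h1, i1 j (by omega)]
    · rintro s' ⟨⟨i1, i2, i3⟩, hB⟩
      refine ⟨fun _ => ⟨?_, i1⟩, fun h' => absurd hc h', i3⟩
      rw [hB.r 20]
      simp [Cmd.den]
    · simp; omega
  · intro hc
    simp only [RE.eval_var] at hc
    exact ⟨trivial, by simp [Cmd.cost]; omega, fun h' => absurd h' hc, fun _ => ⟨rfl, rfl⟩, rfl⟩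

lemma mainCmd_spec {G : ℝ} (hP : P.Good G) {s : St} {leaf : ℕ → ℝ} {c : ℕ} (he : Env P h E W s)
    (hl : LenOK P c (s.ia 3)) (hr : LeafOK P h leaf (s.ra 10)) {R : ℕ} (hR : 0 < R)
    (h12 : ⌈s.r 12⌉₊ = R) (hH : P.m ≤ H) :
    ∃ T : ℕ, (T : ℝ) ≤ 2000 * (R + 1) * runTime P h c ∧
    Tri W E H ω mainCmd s T fun s' => ∃ x : ℕ → ℝ, (∀ j, x j ∈ Set.Icc (-1 : ℝ) 1) ∧
      (∀ j < P.m, s'.ra 0 j = x j) ∧ ∀ r < R, ∃ i < 2 * P.n, ∀ i' < 2 * P.n,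
        P.row x i' ≤ P.row (result P (s.pos + r * P.N) ω).x i := by
  have hhh := he.hh
  have hE := he.hE
  have hW := he.hW
  have hn := hP.hn
  have hcap := Inst.cap_pos hP
  have hinv : ∀ o, ∀ r < 2 * P.n, (result P o ω).v r = P.val (result P o ω).x r := by
    intro o r hr'
    have : ∀ k, P.Inv (k % P.B0) (P.pre k (chain P.init
        (fun k s (u : unitInterval) => P.ustep k s u) o ω k)) := by
      intro k
      induction k with
      | zero => exact Inst.inv_init hP
      | succ k ih => exact Inst.inv_ustep hP ih _
    have := (this P.N).v r hr'
    unfold Inst.pre at this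
    split_ifs at this <;> exact this
  obtain ⟨T1, hT1⟩ : ∃ T1, T1 = ⌊1000 * runTime P h c⌋₊ := ⟨_, rfl⟩
  refine ⟨4 + (2 + R * (T1 + (60 + 40 * P.n + 20 * P.m + 3)) + (10 + P.m * 20)), ?_, ?_⟩
  · have h1 : (T1 : ℝ) ≤ 1000 * runTime P h c := by
      rw [hT1]
      refine Nat.floor_le ?_
      unfold runTime
      positivity
    have h2 : (P.n + P.m : ℝ) ≤ runTime P h c := by
      unfold runTime
      have h3 : (0 : ℝ) ≤ P.Nb * (P.n + P.B0 * (c + 1)) + P.n * (P.cap + 1) := by positivity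
      nlinarith [(Nat.cast_nonneg h : (0 : ℝ) ≤ h), (Nat.cast_nonneg P.n : (0 : ℝ) ≤ P.n),
        (Nat.cast_nonneg P.m : (0 : ℝ) ≤ P.m)]
    have h4 : (1 : ℝ) ≤ P.n := by exact_mod_cast hn
    have h5 : (0 : ℝ) ≤ P.m := Nat.cast_nonneg _
    push_cast
    have h6 : (T1 + (60 + 40 * P.n + 20 * P.m + 3) : ℝ) ≤ 2000 * runTime P h c := by linarith
    have h7 := mul_le_mul_of_nonneg_left h6 (Nat.cast_nonneg (α := ℝ) R)
    linarith
  unfold mainCmd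
  refine Tri.le (Tri.step (T₁ := 2) (by simp [Cmd.ok]) (by simp [Cmd.cost])
    (Tri.seq (Tri.rep_acc R (fun k t s' => t = k * (T1 + (60 + 40 * P.n + 20 * P.m + 3)) ∧
      Below 7 20 5 6 true s s' ∧ s'.pos = s.pos + k * P.N ∧ (∃ leaf, LeafOK P h leaf (s'.ra 10)) ∧
      (∀ r < k, ∃ i < 2 * P.n, s'.r 20 ≤ P.row (result P (s.pos + r * P.N) ω).x i) ∧
      ((k = 0 ∧ s'.r 20 = 9) ∨ ∃ x : ℕ → ℝ, (∀ j, x j ∈ Set.Icc (-1 : ℝ) 1) ∧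
        (∀ j < P.m, s'.ra 6 j = x j) ∧ ∀ i < 2 * P.n, P.row x i ≤ s'.r 20))
      ?_ ?_ ?_ ?_ (T := R * (T1 + (60 + 40 * P.n + 20 * P.m + 3))) (Q := fun s' =>
      Below 7 20 5 6 true s s' ∧ 
      (∀ r < R, ∃ i < 2 * P.n, s'.r 20 ≤ P.row (result P (s.pos + r * P.N) ω).x i) ∧
      (∃ x : ℕ → ℝ, (∀ j, x j ∈ Set.Icc (-1 : ℝ) 1) ∧
        (∀ j < P.m, s'.ra 6 j = x j) ∧ ∀ i < 2 * P.n, P.row x i ≤ s'.r 20)) ?_)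
      (T₂ := 10 + P.m * 20) fun s1 hs1 => ?_)) ?_
  · simp
  · simpa [Cmd.den] using h12
  · refine ⟨by simp, ?_, by simp [Cmd.den], ⟨leaf, by simpa [Cmd.den] using hr⟩, by simp,
      Or.inl ⟨rfl, by simp [Cmd.den]⟩⟩
    exact Below.setR (by norm_num) _
  · rintro k hk t s1 ⟨rfl, hB1, hp1, ⟨lf, hlf⟩, i1, i2⟩
    have he1 := he.congr hB1
    obtain ⟨T, hT, htri⟩ := runCmd_spec (H := H) (ω := ω) (c := c) hP he1
      (by rw [hB1.ia 3]; exact hl) hlf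
    rw [hp1] at htri
    have hTT : T ≤ T1 := by
      rw [hT1]
      refine Nat.le_floor (hT.trans_eq ?_)
      unfold runTime
      ring
    refine ⟨T1 + ((40 + 40 * P.n) + (20 + 20 * P.m)), Tri.seq (htri.le hTT) fun s2 hs2 => ?_⟩
    obtain ⟨⟨hr2, hp2⟩, hB2⟩ := hs2
    have he2 := he1.congr (hB2.mono id)
    refine Tri.seq (objCmd_spec hP he2 hr2 (hinv _)) fun s3 hs3 => ?_
    obtain ⟨⟨o1, o2⟩, hB3⟩ := hs3
    have hB23 := hB2.trans (hB3.mono (by simp))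
    have he3 := he1.congr (hB23.mono id)
    refine (keepCmd_spec he3).conseq ?_
    rintro s4 ⟨⟨k1, k2, k3⟩, hB4⟩
    have f20 : s3.r 20 = s1.r 20 := hB23.r 20
    have f6 : s3.ra 6 = s1.ra 6 := hB23.ra 6
    have f7 : s3.ra 7 = s2.ra 7 := hB3.ra 7
    have hpos : s4.pos = s.pos + k * P.N + P.N := by
      rw [hB4.pos rfl, hB3.pos rfl, hp2]
    have h9 : ∀ i < 2 * P.n, P.row (result P (s.pos + k * P.N) ω).x i ≤ 1 := by
      intro i hi
      have e1 := abs_le.1 (Inst.abs_row_le hP (x := (result P (s.pos + k * P.N) ω).x)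
        (fun j => Inst.box_chain hP _ _ _ j) hi)
      have e2 := hP.β_le i hi
      unfold Inst.row
      linarith
    refine ⟨by ring, hB1.trans ((hB23.mono id).trans
      (hB4.mono (by simp))),
      by rw [hpos]; ring,
      ⟨(result P (s.pos + k * P.N) ω).leaf, ?_⟩, ?_, Or.inr ?_⟩
    · rw [k3, hB3.ra 10]
      exact hr2.leaf
    · obtain ⟨i, hi, hi'⟩ := o2
      have hle : s4.r 20 ≤ s3.r 30 ∧ s4.r 20 ≤ s1.r 20 := by
        by_cases hc : s3.r 30 < s3.r 20
        · rw [(k1 hc).1]; exact ⟨le_rfl, by linarith⟩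
        · rw [(k2 hc).1]; exact ⟨by linarith, f20.le⟩
      intro r hr
      rcases (Nat.lt_succ_iff.1 hr).lt_or_eq with h' | rfl
      · obtain ⟨i, hi, hi'⟩ := i1 r h'
        exact ⟨i, hi, hle.2.trans hi'⟩
      · exact ⟨i, hi, hle.1.trans hi'.ge⟩
    · by_cases hc : s3.r 30 < s3.r 20
      · refine ⟨(result P (s.pos + k * P.N) ω).x, fun j => Inst.box_chain hP _ _ _ j,
          fun j hj => ?_, fun i hi => ?_⟩
        · rw [(k1 hc).2 j hj, f7]
          exact hr2.x j hj.le
        · rw [(k1 hc).1]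
          exact o1 i hi
      · rcases i2 with ⟨-, i2⟩ | ⟨x, x1, x2, x3⟩
        · obtain ⟨i, hi, hi'⟩ := o2
          have := h9 i hi
          unfold result at this
          linarith
        · exact ⟨x, x1, fun j hj => by rw [(k2 hc).2, f6]; exact x2 j hj,
            fun i hi => by rw [(k2 hc).1, f20]; exact x3 i hi⟩
  · rintro t s1 ⟨rfl, hB1, -, -, i1, i2⟩
    refine ⟨le_rfl, hB1, i1, i2.resolve_left (by omega)⟩
  · obtain ⟨hB1, i1, x, x1, x2, x3⟩ := hs1
    have he1 := he.congr hB1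
    refine Tri.le ((Tri.loop_frame (T := 16) P.m (fun k s' => (∀ j < k, s'.ra 0 j = x j) ∧
      s'.ra 6 = s1.ra 6) (a := 13) (b := 1000) (p := 16) (q := 0) (z := false) (by decide)
      ?_ ?_ ?_ ?_ ?_).conseq ?_) ?_
    · simp
    · simp [he1.m]
    · omega
    · simp
    · rintro k hk s' ⟨j1, j2⟩ -
      refine ⟨by simp [Cmd.ok]; omega, by simp [Cmd.cost], fun j hj => ?_, by simpa [Cmd.den]⟩
      simp only [Cmd.den]
      simp only [St.putR_ra_apply]
      by_cases h1 : j = k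
      · simp [h1, j2, x2 k hk]
      · simp [h1, j1 j (by omega)]
    · rintro s' ⟨⟨j1, -⟩, -⟩
      refine ⟨x, x1, j1, fun r hr => ?_⟩
      obtain ⟨i, hi, hi'⟩ := i1 r hr
      exact ⟨i, hi, fun i' hi'' => (x3 i' hi'').trans hi'⟩
    · simp
  · simp; omega

end Loop

/-! ### Normalisation of the input -/

namespace Regr

open Finset

/-- Running maximum, starting from `0`. -/
noncomputable def runMax (f : ℕ → ℝ) : ℕ → ℝ
  | 0 => 0
  | k + 1 => max (runMax f k) (f k)

lemma runMax_nonneg (f : ℕ → ℝ) (k : ℕ) : 0 ≤ runMax f k := by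
  induction k with
  | zero => exact le_rfl
  | succ k ih => exact le_max_of_le_left ih

lemma le_runMax (f : ℕ → ℝ) {k i : ℕ} (hi : i < k) : f i ≤ runMax f k := by
  induction k with
  | zero => omega
  | succ k ih =>
    rcases (Nat.lt_succ_iff.1 hi).lt_or_eq with h | rfl
    · exact le_max_of_le_left (ih h)
    · exact le_max_right _ _

lemma runMax_le {f : ℕ → ℝ} {k : ℕ} {y : ℝ} (h0 : 0 ≤ y) (h : ∀ i < k, f i ≤ y) :
    runMax f k ≤ y := by
  induction k with
  | zero => exact h0
  | succ k ih => exact max_le (ih fun i hi => h i (by omega)) (h k (by omega))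

/-- A regression problem in compressed sparse column format. -/
structure Csc where
  n : ℕ
  m : ℕ
  A : ℕ → ℕ → ℝ
  b : ℕ → ℝ
  ε : ℝ
  δ : ℝ
  s : ℝ
  cp : ℕ → ℕ
  row : ℕ → ℕ
  val : ℕ → ℝ

namespace Csc
variable (D : Csc)

/-- Number of nonzero entries. -/
def nz : ℕ := D.cp D.m

/-- The `ℓ₁` norm of a row. -/
def rowAbs (i : ℕ) : ℝ := ∑ j ∈ range D.m, |D.A i j|

/-- The `ℓ₁` norm of a column. -/
def colAbs (j : ℕ) : ℝ := ∑ i ∈ range D.n, |D.A i j|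

/-- Norm of the matrix. -/
noncomputable def nA : ℝ := runMax D.rowAbs D.n

/-- Norm of the right-hand side. -/
noncomputable def bn : ℝ := runMax (fun i => |D.b i|) D.n

/-- Residual. -/
def res (x : ℕ → ℝ) (i : ℕ) : ℝ := ∑ j ∈ range D.m, D.A i j * x j - D.b i

/-- Relative accuracy. -/
noncomputable def e : ℝ := D.ε / D.nA

/-- Bound for the weighted norm of a minimizer. -/
noncomputable def S : ℝ := open Classical in if (D.n : ℝ) < D.s then 2 * D.n else D.s

/-- The normalised instance. -/
noncomputable def inst : Inst where
  n := D.n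
  m := D.m
  a r j := if r < 2 * D.n then
      if j < D.m then if r % 2 = 0 then D.A (r / 2) j / D.nA else 0 - D.A (r / 2) j / D.nA
      else if j = D.m then -3 else 0
    else 0
  β r := if r % 2 = 0 then max (0 - D.b (r / 2) / D.nA - D.bn / D.nA) (-4)
    else max (D.b (r / 2) / D.nA - D.bn / D.nA) (-4)
  w j := open Classical in
    if j < D.m then if (D.n : ℝ) < D.s then D.colAbs j / D.nA + D.n / D.m else 1
    else pW D.n D.m D.e D.S
  e := D.e
  S := D.S

/-- Correctness of the sparse format. -/
structure OK (c : ℕ) : Prop where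
  hn : 0 < D.n
  hm : 0 < D.m
  hε : 0 < D.ε
  zero : D.cp 0 = 0
  mono : ∀ j < D.m, D.cp j ≤ D.cp (j + 1)
  len : ∀ j < D.m, D.cp (j + 1) - D.cp j ≤ c
  row : ∀ e < D.nz, D.row e < D.n
  val : ∀ j < D.m, ∀ e, D.cp j ≤ e → e < D.cp (j + 1) → D.val e = D.A (D.row e) j
  ne : ∀ e < D.nz, D.val e ≠ 0
  inj : ∀ j < D.m, ∀ e e', D.cp j ≤ e → e < D.cp (j + 1) → D.cp j ≤ e' → e' < D.cp (j + 1) →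
    D.row e = D.row e' → e = e'
  cov : ∀ j < D.m, ∀ i < D.n, D.A i j ≠ 0 → ∃ e, D.cp j ≤ e ∧ e < D.cp (j + 1) ∧ D.row e = i

/-- The optimal value, attained by a point of small norm. -/
structure Opt (opt : ℝ) : Prop where
  le : ∃ x : ℕ → ℝ, (∀ j, x j ∈ Set.Icc (-1 : ℝ) 1) ∧ ∑ j ∈ range D.m, x j ^ 2 ≤ D.s ∧
    ∀ i < D.n, |D.res x i| ≤ opt
  ge : ∀ x : ℕ → ℝ, (∀ j, x j ∈ Set.Icc (-1 : ℝ) 1) → ∃ i < D.n, opt ≤ |D.res x i|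

variable {D} {c : ℕ} {opt : ℝ}

lemma rowAbs_le {i : ℕ} (hi : i < D.n) : D.rowAbs i ≤ D.nA := le_runMax _ hi

lemma abs_b_le {i : ℕ} (hi : i < D.n) : |D.b i| ≤ D.bn := le_runMax (fun i => |D.b i|) hi

lemma sum_colAbs_le : ∑ j ∈ range D.m, D.colAbs j ≤ D.n * D.nA := by
  unfold colAbs
  rw [sum_comm]
  calc _ ≤ ∑ _i ∈ range D.n, D.nA := sum_le_sum fun i hi => rowAbs_le (mem_range.1 hi)
    _ = _ := by simp

lemma abs_mul_le {x : ℕ → ℝ} (hx : ∀ j, x j ∈ Set.Icc (-1 : ℝ) 1) (i : ℕ) :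
    |∑ j ∈ range D.m, D.A i j * x j| ≤ D.rowAbs i := by
  refine (abs_sum_le_sum_abs _ _).trans (sum_le_sum fun j _ => ?_)
  rw [abs_mul]
  exact mul_le_of_le_one_right (abs_nonneg _) (abs_le.2 (hx j))

lemma inst_sum {r : ℕ} (hr : r < 2 * D.n) (x : ℕ → ℝ) :
    ∑ j ∈ range D.m, D.inst.a r j * x j =
      if r % 2 = 0 then (∑ j ∈ range D.m, D.A (r / 2) j * x j) / D.nA
      else - ((∑ j ∈ range D.m, D.A (r / 2) j * x j) / D.nA) := by
  split_ifs with h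
  · rw [sum_div]
    refine sum_congr rfl fun j hj => ?_
    simp only [inst, if_pos hr, if_pos (mem_range.1 hj), if_pos h]
    ring
  · rw [sum_div, ← sum_neg_distrib]
    refine sum_congr rfl fun j hj => ?_
    simp only [inst, if_pos hr, if_pos (mem_range.1 hj), if_neg h]
    ring

lemma abs_inst_a {r j : ℕ} (hr : r < 2 * D.n) (hj : j < D.m) :
    |D.inst.a r j| = |D.A (r / 2) j| / D.nA := by
  have : |D.A (r / 2) j / D.nA| = |D.A (r / 2) j| / D.nA := by
    rw [abs_div, abs_of_nonneg (show 0 ≤ D.nA from runMax_nonneg _ _)]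
  simp only [inst, if_pos hr, if_pos hj]
  split_ifs
  · exact this
  · rw [zero_sub, abs_neg, this]

/-- A point with small rows has a small residual. -/
lemma res_le_of_row (hA : 0 < D.nA) {x : ℕ → ℝ} {y : ℝ}
    (h : ∀ r < 2 * D.n, D.inst.row x r ≤ y / D.nA - D.bn / D.nA) {i : ℕ} (hi : i < D.n) :
    |D.res x i| ≤ y := by
  have h0 := h (2 * i) (by omega)
  have h1 := h (2 * i + 1) (by omega)
  unfold Inst.row at h0 h1
  rw [show D.inst.m = D.m from rfl, inst_sum (by omega)] at h0 h1
  simp only [inst, show 2 * i % 2 = 0 by omega, show 2 * i / 2 = i by omega,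
    show ¬ (2 * i + 1) % 2 = 0 by omega, show (2 * i + 1) / 2 = i by omega, if_true, if_false] at h0 h1
  have m0 := le_max_left (0 - D.b i / D.nA - D.bn / D.nA) (-4)
  have m1 := le_max_left (D.b i / D.nA - D.bn / D.nA) (-4)
  have e0 : D.res x i / D.nA ≤ y / D.nA := by
    unfold res
    rw [sub_div]
    linarith
  have e1 : - D.res x i / D.nA ≤ y / D.nA := by
    unfold res
    rw [neg_sub, sub_div]
    linarith
  rw [div_le_div_iff_of_pos_right hA] at e0 e1
  exact abs_le.2 ⟨by linarith, e0⟩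

lemma row_le_of_res (hA : 0 < D.nA) {x : ℕ → ℝ} (hx : ∀ j, x j ∈ Set.Icc (-1 : ℝ) 1) {y : ℝ}
    (hy : -1 ≤ y / D.nA - D.bn / D.nA) {r : ℕ} (hr : r < 2 * D.n)
    (h : |D.res x (r / 2)| ≤ y) : D.inst.row x r ≤ y / D.nA - D.bn / D.nA := by
  have hs : |(∑ j ∈ range D.m, D.A (r / 2) j * x j) / D.nA| ≤ 1 := by
    rw [abs_div, abs_of_pos hA, div_le_one hA]
    exact (abs_mul_le hx _).trans (rowAbs_le (by omega))
  rw [abs_le] at hs h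
  have e0 := (div_le_div_iff_of_pos_right hA).2 h.2
  have e1 := (div_le_div_iff_of_pos_right hA).2 h.1
  unfold res at e0 e1
  rw [sub_div] at e0 e1
  rw [neg_div] at e1
  unfold Inst.row
  rw [show D.inst.m = D.m from rfl, inst_sum hr]
  simp only [inst]
  split_ifs
  · rw [← max_add_add_left]
    exact max_le (by linarith) (by linarith)
  · rw [← max_add_add_left]
    exact max_le (by linarith) (by linarith)

theorem good (hD : D.OK c) (ho : D.Opt opt) (hεA : D.ε < D.nA) :
    D.inst.Good (opt / D.nA - D.bn / D.nA) := by
  have hA : 0 < D.nA := hD.hε.trans hεA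
  have hn := hD.hn
  have hm := hD.hm
  have hn' : (0 : ℝ) < D.n := by exact_mod_cast hn
  have hm' : (0 : ℝ) < D.m := by exact_mod_cast hm
  obtain ⟨xo, xo1, xo2, xo3⟩ := ho.le
  have hs : 0 ≤ D.s := le_trans (sum_nonneg fun _ _ => sq_nonneg _) xo2
  have hG1 : -1 ≤ opt / D.nA - D.bn / D.nA := by
    rw [← sub_div, le_div_iff₀ hA]
    have : D.bn ≤ opt + D.nA := by
      refine runMax_le ?_ fun i hi => ?_
      · have := (abs_nonneg _).trans (xo3 0 hn)
        linarith
      · have h1 := xo3 i hi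
        have h2 := (abs_mul_le xo1 i).trans (rowAbs_le hi)
        unfold res at h1
        rw [abs_le] at h1 h2
        exact abs_le.2 ⟨by linarith [h1.1, h2.1], by linarith [h1.2, h2.2]⟩
    linarith
  have hcol : ∀ j, 0 ≤ D.colAbs j := fun j => sum_nonneg fun _ _ => abs_nonneg _
  refine
    { hn := hn, hm := hm, he := div_pos hD.hε hA, he1 := (div_lt_one hA).2 hεA,
      hS := ?_, hS2 := ?_, row_le := ?_, a_m := ?_, a_out := ?_, w_pos := ?_, w_m := ?_,
      a_le := ?_, a_pair := ?_, β_le := ?_, β_ge := ?_, opt := ?_, lower := ?_, G_ge := hG1,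
      G_le := ?_ }
  · change 0 ≤ D.S
    unfold S
    split_ifs <;> positivity
  · change D.S ≤ 2 * D.n
    unfold S
    split_ifs <;> linarith
  · intro r hr
    change ∑ j ∈ range D.m, |D.inst.a r j| ≤ 1
    rw [sum_congr rfl fun j hj => abs_inst_a hr (mem_range.1 hj), ← sum_div, div_le_one hA]
    exact rowAbs_le (by change r < 2 * D.n at hr; omega)
  · intro r hr
    simp only [inst] at hr ⊢
    simp [hr]
  · intro r j h
    simp only [inst] at h ⊢
    split_ifs <;> first | rfl | (exfalso; omega)
  · intro j hj
    change j < D.m at hj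
    simp only [inst, if_pos hj]
    split_ifs
    · have := hcol j
      positivity
    · exact one_pos
  · simp [inst]
  · intro r hr j hj
    rw [abs_inst_a hr hj]
    change r < 2 * D.n at hr
    change j < D.m at hj
    simp only [inst, if_pos hj]
    split_ifs
    · have h1 : |D.A (r / 2) j| ≤ D.colAbs j :=
        single_le_sum (f := fun i => |D.A i j|) (fun _ _ => abs_nonneg _) (mem_range.2 (by omega))
      have h2 := (div_le_div_iff_of_pos_right hA).2 h1
      have h3 : (0 : ℝ) ≤ D.n / D.m := by positivity
      linarith
    · rw [div_le_one hA]
      refine le_trans ?_ (rowAbs_le (D := D) (i := r / 2) (by omega))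
      exact single_le_sum (f := fun j => |D.A (r / 2) j|) (fun _ _ => abs_nonneg _)
        (mem_range.2 hj)
  · intro r hr j hj
    change r < 2 * D.n at hr
    rw [abs_inst_a (by omega) hj, abs_inst_a hr hj]
    congr 3
    omega
  · intro r hr
    change r < 2 * D.n at hr
    have h1 := abs_le.1 (abs_b_le (D := D) (i := r / 2) (by omega))
    have e0 := (div_le_div_iff_of_pos_right hA).2 h1.1
    have e1 := (div_le_div_iff_of_pos_right hA).2 h1.2
    rw [neg_div] at e0
    simp only [inst]
    split_ifs
    · exact max_le (by linarith) (by norm_num)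
    · exact max_le (by linarith) (by norm_num)
  · intro r _
    simp only [inst]
    split_ifs <;> exact le_max_right _ _
  · refine ⟨xo, xo1, ?_, fun r hr => ?_⟩
    · change ∑ j ∈ range D.m, _ ≤ D.S
      by_cases hns : (D.n : ℝ) < D.s
      · have h1 : ∀ j ∈ range D.m, D.inst.w j * xo j ^ 2 ≤ D.colAbs j / D.nA + D.n / D.m := by
          intro j hj
          simp only [inst, if_pos (mem_range.1 hj), if_pos hns]
          have := hcol j
          refine mul_le_of_le_one_right (by positivity) ?_
          have := xo1 j
          exact (sq_le_one_iff_abs_le_one _).2 (abs_le.2 this)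
        refine (sum_le_sum h1).trans ?_
        rw [sum_add_distrib, ← sum_div]
        have h2 : (∑ j ∈ range D.m, D.colAbs j) / D.nA ≤ D.n := by
          rw [div_le_iff₀ hA]
          exact sum_colAbs_le
        have h3 : ∑ _j ∈ range D.m, (D.n : ℝ) / D.m = D.n := by
          rw [sum_const, card_range, nsmul_eq_mul]
          field_simp
        unfold S
        rw [if_pos hns, h3]
        linarith
      · refine le_trans (le_of_eq ?_) (xo2.trans_eq ?_)
        · refine sum_congr rfl fun j hj => ?_
          simp only [inst, if_pos (mem_range.1 hj), if_neg hns, one_mul]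
        · unfold S
          rw [if_neg hns]
    · change r < 2 * D.n at hr
      exact row_le_of_res hA xo1 hG1 hr (xo3 _ (by omega))
  · intro x hx
    obtain ⟨i, hi, h⟩ := ho.ge x hx
    by_contra! hcon
    have hbound : ∃ y < opt, ∀ r < 2 * D.n, D.inst.row x r ≤ y / D.nA - D.bn / D.nA := by
      obtain ⟨r0, hr0, hmax⟩ := exists_max_image (range (2 * D.n)) (D.inst.row x)
        ⟨0, mem_range.2 (by omega)⟩
      refine ⟨(D.inst.row x r0 + D.bn / D.nA) * D.nA, ?_, fun r hr => ?_⟩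
      · have := hcon r0 (mem_range.1 hr0)
        rw [← lt_div_iff₀ hA]
        linarith
      · rw [mul_div_assoc, div_self hA.ne', mul_one, add_sub_cancel_right]
        exact hmax r (mem_range.2 hr)
    obtain ⟨y, hy, hrow⟩ := hbound
    linarith [res_le_of_row hA hrow hi]
  · obtain ⟨i, hi, h⟩ := ho.ge (fun _ => 0) (fun _ => by norm_num)
    have : opt ≤ D.bn := by
      refine h.trans (le_trans (le_of_eq ?_) (abs_b_le hi))
      simp [res]
    have := (div_le_div_iff_of_pos_right hA).2 this
    linarith

end Csc

end Regr

/-! ### Row and column structures -/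

namespace Regr

open Finset

namespace Csc
variable (D : Csc)

/-- Number of entries in row `i` among the first `e` entries. -/
def occ (e i : ℕ) : ℕ := ∑ e' ∈ range e, if D.row e' = i then 1 else 0

/-- Beginning of row `i` of the sampler. -/
def rp (i : ℕ) : ℕ := if i ≤ D.n then ∑ i' ∈ range i, D.occ D.nz i' else D.nz + D.m + 1

variable {D} {c : ℕ}

lemma occ_succ (e i : ℕ) : D.occ (e + 1) i = D.occ e i + if D.row e = i then 1 else 0 :=
  sum_range_succ _ _

lemma occ_mono {e e' : ℕ} (h : e ≤ e') (i : ℕ) : D.occ e i ≤ D.occ e' i :=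
  sum_le_sum_of_subset (range_mono h)

lemma occ_lt {e e' : ℕ} (h : e < e') : D.occ e (D.row e) < D.occ e' (D.row e) :=
  lt_of_lt_of_le (by rw [occ_succ, if_pos rfl]; omega) (occ_mono (show e + 1 ≤ e' from h) _)

lemma rp_succ {i : ℕ} (hi : i < D.n) : D.rp (i + 1) = D.rp i + D.occ D.nz i := by
  unfold rp
  rw [if_pos (by omega), if_pos hi.le, sum_range_succ]

lemma rp_n (hD : D.OK c) : D.rp D.n = D.nz := by
  unfold rp occ
  rw [if_pos le_rfl, sum_comm]
  have : ∀ e ∈ range D.nz, (∑ i ∈ range D.n, if D.row e = i then 1 else 0) = 1 := by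
    intro e he
    rw [sum_ite_eq, if_pos (mem_range.2 (hD.row e (mem_range.1 he)))]
  rw [sum_congr rfl this]
  simp

lemma rp_succ_n : D.rp (D.n + 1) = D.nz + D.m + 1 := by simp [rp]

lemma rp_le_succ (hD : D.OK c) {i : ℕ} (hi : i ≤ D.n) : D.rp i ≤ D.rp (i + 1) := by
  rcases hi.lt_or_eq with h | rfl
  · rw [rp_succ h]; omega
  · rw [rp_n hD, rp_succ_n]; omega

lemma rp_mono (hD : D.OK c) {i i' : ℕ} (h : i ≤ i') (h' : i' ≤ D.n + 1) : D.rp i ≤ D.rp i' := by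
  induction i' with
  | zero => rw [Nat.le_zero.1 h]
  | succ k ih =>
    rcases h.lt_or_eq with h1 | rfl
    · exact (ih (by omega) (by omega)).trans (rp_le_succ hD (by omega))
    · exact le_rfl

lemma rp_le (hD : D.OK c) {i : ℕ} (h : i ≤ D.n + 1) : D.rp i ≤ D.nz + D.m + 1 := by
  rw [← rp_succ_n]
  exact rp_mono hD h le_rfl

lemma cp_mono (hD : D.OK c) {j j' : ℕ} (h : j ≤ j') (h' : j' ≤ D.m) : D.cp j ≤ D.cp j' := by
  induction j' with
  | zero => rw [Nat.le_zero.1 h]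
  | succ k ih =>
    rcases h.lt_or_eq with h1 | rfl
    · exact (ih (by omega) (by omega)).trans (hD.mono k (by omega))
    · exact le_rfl

lemma cp_le (hD : D.OK c) {j : ℕ} (h : j ≤ D.m) : D.cp j ≤ D.nz := cp_mono hD h le_rfl

lemma sum_entries (hD : D.OK c) (f : ℕ → ℝ) {j : ℕ} (hj : j ≤ D.m) :
    ∑ e ∈ range (D.cp j), f e =
      ∑ j' ∈ range j, ∑ k ∈ range (D.cp (j' + 1) - D.cp j'), f (D.cp j' + k) := by
  induction j with
  | zero => simp [hD.zero]
  | succ j ih =>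
    rw [sum_range_succ, ← ih (by omega), ← sum_range_add, Nat.add_sub_cancel' (hD.mono j hj)]

lemma sum_col (hD : D.OK c) {j : ℕ} (hj : j < D.m) (f : ℕ → ℝ → ℝ) (hf : ∀ i, f i 0 = 0) :
    ∑ k ∈ range (D.cp (j + 1) - D.cp j), f (D.row (D.cp j + k)) (D.val (D.cp j + k)) =
      ∑ i ∈ range D.n, f i (D.A i j) := by
  have hle := cp_le hD (show j + 1 ≤ D.m from hj)
  have hmem : ∀ k ∈ range (D.cp (j + 1) - D.cp j), D.cp j ≤ D.cp j + k ∧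
    D.cp j + k < D.cp (j + 1) := fun k hk => ⟨by omega, by have := mem_range.1 hk; omega⟩
  rw [← sum_subset (s₁ := (range (D.cp (j + 1) - D.cp j)).image fun k => D.row (D.cp j + k))
    (s₂ := range D.n) (f := fun i => f i (D.A i j))]
  · rw [sum_image]
    · exact sum_congr rfl fun k hk => by rw [hD.val j hj _ (hmem k hk).1 (hmem k hk).2]
    · intro k hk k' hk' he
      have h1 := hmem k hk
      have h2 := hmem k' hk'
      have := hD.inj j hj _ _ h1.1 h1.2 h2.1 h2.2 he
      omega
  · intro r hr
    obtain ⟨k, hk, rfl⟩ := mem_image.1 hr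
    exact mem_range.2 (hD.row _ ((hmem k hk).2.trans_le hle))
  · intro r hr' hr
    by_cases ha : D.A r j = 0
    · rw [ha, hf]
    · obtain ⟨e, h1, h2, h3⟩ := hD.cov j hj r (mem_range.1 hr') ha
      refine absurd (mem_image.2 ⟨e - D.cp j, mem_range.2 (by omega), ?_⟩) hr
      rw [Nat.add_sub_cancel' h1, h3]

lemma sum_abs_row (hD : D.OK c) {i : ℕ} (hi : i < D.n) :
    (∑ e ∈ range D.nz, if D.row e = i then |D.val e| else 0) = D.rowAbs i := by
  unfold nz rowAbs
  rw [sum_entries hD (fun e => if D.row e = i then |D.val e| else 0) le_rfl]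
  refine sum_congr rfl fun j hj => ?_
  rw [sum_col hD (mem_range.1 hj) (fun i' y => if i' = i then |y| else 0) (by simp)]
  simp [hi]

lemma sum_abs_col (hD : D.OK c) {j : ℕ} (hj : j < D.m) :
    ∑ k ∈ range (D.cp (j + 1) - D.cp j), |D.val (D.cp j + k)| / D.nA = D.colAbs j / D.nA := by
  unfold colAbs
  rw [← sum_div, sum_col hD hj (fun _ y => |y|) (by simp)]

end Csc

/-- The rows of the sampler are filled up to column `F`. -/
structure Filled (D : Csc) (F cur cj : ℕ → ℕ) (pw rs : ℕ → ℝ) : Prop where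
  ge : ∀ i ≤ D.n, D.rp i ≤ cur i
  le : ∀ i ≤ D.n, cur i ≤ D.rp (i + 1)
  col : ∀ i ≤ D.n, ∀ p, D.rp i ≤ p → p < cur i → cj p ≤ D.m
  prev : ∀ i ≤ D.n, ∀ p, D.rp i ≤ p → p < cur i →
    (if p = D.rp i then 0 else pw (p - 1)) = D.inst.cw i (cj p)
  sum : ∀ i ≤ D.n, ∀ p, D.rp i ≤ p → p < cur i → pw p = D.inst.cw i (cj p + 1)
  last : ∀ i ≤ D.n, (if cur i = D.rp i then 0 else pw (cur i - 1)) = D.inst.cw i (F i)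
  rs : ∀ i ≤ D.n, rs i = D.inst.cw i (F i)

namespace Filled
variable {D : Csc} {c : ℕ} {F F' cur cj : ℕ → ℕ} {pw rs : ℕ → ℝ}

lemma congr (h : Filled D F cur cj pw rs)
    (hF : ∀ i ≤ D.n, D.inst.cw i (F' i) = D.inst.cw i (F i)) : Filled D F' cur cj pw rs where
  ge := h.ge
  le := h.le
  col := h.col
  prev := h.prev
  sum := h.sum
  last i hi := by rw [h.last i hi, hF i hi]
  rs i hi := by rw [h.rs i hi, hF i hi]

lemma append (hD : D.OK c) (h : Filled D F cur cj pw rs) {i j : ℕ} {y : ℝ} (hi : i ≤ D.n)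
    (hF : F i = j) (hj : j ≤ D.m) (hlt : cur i < D.rp (i + 1)) (hy : y = D.inst.wt i j) :
    Filled D (Function.update F i (j + 1)) (Function.update cur i (cur i + 1))
      (Function.update cj (cur i) j) (Function.update pw (cur i) (rs i + y))
      (Function.update rs i (rs i + y)) := by
  have hge := h.ge i hi
  have hcw : rs i + y = D.inst.cw i (j + 1) := by
    rw [h.rs i hi, hF, hy]
    exact (sum_range_succ _ _).symm
  have hout : ∀ i' ≤ D.n, i' ≠ i → ∀ p, D.rp i' ≤ p → p < D.rp (i' + 1) → p ≠ cur i := by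
    rintro i' hi' hne p h1 h2 rfl
    rcases hne.lt_or_gt with h3 | h3
    · have := Csc.rp_mono hD (show i' + 1 ≤ i from h3) (by omega)
      omega
    · have := Csc.rp_mono hD (show i + 1 ≤ i' from h3) (by omega)
      omega
  have hif : ∀ i' ≤ D.n, ∀ p, D.rp i' ≤ p → p ≤ cur i' → p < D.rp (i' + 1) ∨ i' ≠ i →
      (if p = D.rp i' then 0 else Function.update pw (cur i) (rs i + y) (p - 1)) =
        if p = D.rp i' then 0 else pw (p - 1) := by
    intro i' hi' p h1 h2 h3
    have hle := h.le i' hi'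
    split_ifs with h4
    · rfl
    · rw [Function.update_of_ne]
      by_cases hii : i' = i
      · subst hii; omega
      · exact hout i' hi' hii _ (by omega) (by omega)
  refine ⟨fun i' hi' => ?_, fun i' hi' => ?_, fun i' hi' p h1 h2 => ?_, fun i' hi' p h1 h2 => ?_,
    fun i' hi' p h1 h2 => ?_, fun i' hi' => ?_, fun i' hi' => ?_⟩
  · have := h.ge i' hi'
    by_cases hii : i' = i
    · subst hii; rw [Function.update_self]; omega
    · rwa [Function.update_of_ne hii]
  · have := h.le i' hi'
    by_cases hii : i' = i
    · subst hii; rw [Function.update_self]; omega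
    · rwa [Function.update_of_ne hii]
  · by_cases hii : i' = i
    · subst hii
      rw [Function.update_self] at h2
      by_cases hp : p = cur i'
      · rw [hp, Function.update_self]; exact hj
      · rw [Function.update_of_ne hp]; exact h.col i' hi' p h1 (by omega)
    · rw [Function.update_of_ne hii] at h2
      rw [Function.update_of_ne (hout i' hi' hii p h1 (h2.trans_le (h.le i' hi')))]
      exact h.col i' hi' p h1 h2
  · by_cases hii : i' = i
    · subst hii
      rw [Function.update_self] at h2
      rw [hif i' hi' p h1 (by omega) (Or.inl (by omega))]
      by_cases hp : p = cur i'
      · rw [hp, Function.update_self, h.last i' hi', hF]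
      · rw [Function.update_of_ne hp]; exact h.prev i' hi' p h1 (by omega)
    · rw [Function.update_of_ne hii] at h2
      rw [hif i' hi' p h1 h2.le (Or.inr hii),
        Function.update_of_ne (hout i' hi' hii p h1 (h2.trans_le (h.le i' hi')))]
      exact h.prev i' hi' p h1 h2
  · by_cases hii : i' = i
    · subst hii
      rw [Function.update_self] at h2
      by_cases hp : p = cur i'
      · rw [hp, Function.update_self, Function.update_self, hcw]
      · rw [Function.update_of_ne hp, Function.update_of_ne hp]
        exact h.sum i' hi' p h1 (by omega)
    · rw [Function.update_of_ne hii] at h2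
      rw [Function.update_of_ne (hout i' hi' hii p h1 (h2.trans_le (h.le i' hi'))),
        Function.update_of_ne (hout i' hi' hii p h1 (h2.trans_le (h.le i' hi')))]
      exact h.sum i' hi' p h1 h2
  · by_cases hii : i' = i
    · subst hii
      rw [Function.update_self, Function.update_self, if_neg (by omega), Nat.add_sub_cancel,
        Function.update_self, hcw]
    · rw [Function.update_of_ne hii, Function.update_of_ne hii,
        hif i' hi' _ (h.ge i' hi') le_rfl (Or.inr hii), h.last i' hi']
  · by_cases hii : i' = i
    · subst hii
      rw [Function.update_self, Function.update_self, hcw]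
    · rw [Function.update_of_ne hii, Function.update_of_ne hii, h.rs i' hi']

lemma rowOK (hD : D.OK c) (h : Filled D F cur cj pw rs) {H E : ℕ}
    (hcur : ∀ i ≤ D.n, cur i = D.rp (i + 1))
    (hF : ∀ i ≤ D.n, F i = D.m + 1) (hH : D.nz + D.m + 2 ≤ 2 ^ H) (hE : 2 ^ H ≤ E) {rp : ℕ → ℕ}
    (hrp : ∀ i ≤ D.n + 1, rp i = D.rp i) : Loop.RowOK D.inst H E rp cj pw := by
  have e : D.inst.n = D.n := rfl
  refine ⟨fun i hi => ?_, fun i hi => ?_, fun i hi => ?_, fun i hi p h1 h2 => ?_,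
    fun i hi p h1 h2 => ?_, fun i hi => ?_, fun i hi p h1 h2 => ?_⟩
  all_goals rw [e] at hi
  · rw [hrp i (by omega), hrp (i + 1) (by omega)]
    exact Csc.rp_le_succ hD hi
  · rw [hrp i (by omega), hrp (i + 1) (by omega)]
    have := Csc.rp_le hD (show i + 1 ≤ D.n + 1 by omega)
    omega
  · rw [hrp i hi]
    have := Csc.rp_le hD hi
    omega
  · rw [hrp i (by omega)] at h1
    rw [hrp (i + 1) (by omega), ← hcur i hi] at h2
    exact h.col i hi p h1 h2
  · rw [hrp i (by omega)] at h1 ⊢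
    rw [hrp (i + 1) (by omega), ← hcur i hi] at h2
    exact h.prev i hi p h1 h2
  · rw [hrp i (by omega), hrp (i + 1) (by omega), ← hcur i hi, h.last i hi, hF i hi]
    rfl
  · rw [hrp i (by omega)] at h1
    rw [hrp (i + 1) (by omega), ← hcur i hi] at h2
    exact h.sum i hi p h1 h2

end Filled

/-- The first `e` entries are stored in the columns. -/
structure Entries (D : Csc) (e : ℕ) (er : ℕ → ℕ) (ev : ℕ → ℝ) : Prop where
  r0 : ∀ k < e, er (2 * k) = 2 * D.row k
  r1 : ∀ k < e, er (2 * k + 1) = 2 * D.row k + 1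
  v0 : ∀ k < e, ev (2 * k) = D.val k / D.nA
  v1 : ∀ k < e, ev (2 * k + 1) = 0 - D.val k / D.nA

lemma Entries.colOK {D : Csc} {c E : ℕ} {ap er : ℕ → ℕ} {ev : ℕ → ℝ} (hD : D.OK c)
    (hA : 0 < D.nA) (h : Entries D D.nz er ev) (hap : ∀ j ≤ D.m, ap j = 2 * D.cp j)
    (hap' : ap (D.m + 1) = 2 * D.nz + 2 * D.n)
    (hl : ∀ r < 2 * D.n, er (2 * D.nz + r) = r ∧ ev (2 * D.nz + r) = -3)
    (hE : 2 * D.nz + 2 * D.n < E) : Loop.ColOK D.inst E ap er ev ∧ Loop.LenOK D.inst c ap := by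
  have em : D.inst.m = D.m := rfl
  have en : D.inst.n = D.n := rfl
  have hapm : ap D.m = 2 * D.nz := hap _ le_rfl
  have hrow : ∀ j < D.m, ∀ e, ap j ≤ e → e < ap (j + 1) → D.cp j ≤ e / 2 ∧
      e / 2 < D.cp (j + 1) ∧ e / 2 < D.nz ∧ er e = 2 * D.row (e / 2) + e % 2 ∧
      ev e = if e % 2 = 0 then D.val (e / 2) / D.nA else 0 - D.val (e / 2) / D.nA := by
    intro j hj e h1 h2
    rw [hap j hj.le] at h1
    rw [hap (j + 1) hj] at h2
    have h3 := Csc.cp_le hD (show j + 1 ≤ D.m from hj)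
    refine ⟨by omega, by omega, by omega, ?_⟩
    have h4 : e / 2 < D.nz := by omega
    rcases Nat.mod_two_eq_zero_or_one e with h5 | h5
    · have h6 : e = 2 * (e / 2) := by omega
      rw [h5, if_pos rfl, add_zero, ← h.r0 _ h4, ← h.v0 _ h4, ← h6]
      exact ⟨rfl, rfl⟩
    · have h6 : e = 2 * (e / 2) + 1 := by omega
      rw [h5, if_neg one_ne_zero, ← h.r1 _ h4, ← h.v1 _ h4, ← h6]
      exact ⟨rfl, rfl⟩
  have hlev : ∀ e, ap D.m ≤ e → e < ap (D.m + 1) → e - 2 * D.nz < 2 * D.n ∧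
      er e = e - 2 * D.nz ∧ ev e = -3 := by
    intro e h1 h2
    rw [hapm] at h1
    rw [hap'] at h2
    have := hl (e - 2 * D.nz) (by omega)
    rw [Nat.add_sub_cancel' h1] at this
    exact ⟨by omega, this.1, this.2⟩
  have ham : ∀ r < 2 * D.n, D.inst.a r D.m = -3 := fun r hr => by simp [Csc.inst, hr]
  refine ⟨⟨fun j hj => ?_, fun j hj => ?_, fun j hj e h1 h2 => ?_, fun j hj e h1 h2 => ?_,
    fun j hj e h1 h2 => ?_, fun j hj e e' h1 h2 h3 h4 h5 => ?_, fun j hj r hr => ?_⟩, ?_, ?_⟩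
  · rcases (show j ≤ D.m from hj).lt_or_eq with h1 | rfl
    · rw [hap j hj, hap (j + 1) h1]
      have := hD.mono j h1
      omega
    · rw [hapm, hap']; omega
  · rcases (show j ≤ D.m + 1 from hj).lt_or_eq with h1 | rfl
    · rw [hap j (by omega)]
      have := Csc.cp_le hD (show j ≤ D.m by omega)
      omega
    · rw [hap']; omega
  · rw [en]
    rcases (show j ≤ D.m from hj).lt_or_eq with hj | rfl
    · obtain ⟨-, -, h3, h4, -⟩ := hrow j hj e h1 h2
      have := hD.row _ h3
      omega
    · obtain ⟨h3, h4, -⟩ := hlev e h1 h2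
      omega
  · rcases (show j ≤ D.m from hj).lt_or_eq with hj | rfl
    · obtain ⟨h5, h6, h3, h4, h7⟩ := hrow j hj e h1 h2
      have h8 := hD.row _ h3
      rw [h7, h4, hD.val j hj _ h5 h6]
      simp only [Csc.inst, if_pos hj, show 2 * D.row (e / 2) + e % 2 < 2 * D.n by omega, if_true,
        show (2 * D.row (e / 2) + e % 2) % 2 = e % 2 by omega,
        show (2 * D.row (e / 2) + e % 2) / 2 = D.row (e / 2) by omega]
    · obtain ⟨h3, h4, h5⟩ := hlev e h1 h2
      rw [h5, ham _ (by omega)]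
  · rcases (show j ≤ D.m from hj).lt_or_eq with hj | rfl
    · obtain ⟨h5, h6, h3, h4, h7⟩ := hrow j hj e h1 h2
      rw [h7]
      have h8 := div_ne_zero (hD.ne _ h3) hA.ne'
      split_ifs
      · exact h8
      · rw [zero_sub]; exact neg_ne_zero.2 h8
    · obtain ⟨h3, h4, h5⟩ := hlev e h1 h2
      rw [h5]; norm_num
  · rcases (show j ≤ D.m from hj).lt_or_eq with hj | rfl
    · obtain ⟨a1, a2, a3, a4, a5⟩ := hrow j hj e h1 h2
      obtain ⟨b1, b2, b3, b4, b5⟩ := hrow j hj e' h3 h4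
      have := hD.inj j hj (e / 2) (e' / 2) a1 a2 b1 b2 (by omega)
      omega
    · obtain ⟨a1, a2, -⟩ := hlev e h1 h2
      obtain ⟨b1, b2, -⟩ := hlev e' h3 h4
      rw [hapm] at h1 h3
      omega
  · by_cases hr2 : r < 2 * D.n
    · rcases (show j ≤ D.m from hj).lt_or_eq with hj | rfl
      · have hA' : D.A (r / 2) j ≠ 0 := by
          intro h0
          apply hr
          simp [Csc.inst, hj, h0]
        obtain ⟨k, k1, k2, k3⟩ := hD.cov j hj (r / 2) (by omega) hA'
        have h5 : 2 * k + r % 2 < ap (j + 1) := by rw [hap (j + 1) hj]; omega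
        have h6 : ap j ≤ 2 * k + r % 2 := by rw [hap j hj.le]; omega
        refine ⟨2 * k + r % 2, h6, h5, ?_⟩
        rw [(hrow j hj _ h6 h5).2.2.2.1, show (2 * k + r % 2) / 2 = k by omega, k3]
        omega
      · exact ⟨2 * D.nz + r, by rw [hapm]; omega, by rw [hap']; omega, (hl r hr2).1⟩
    · exact absurd (by simp [Csc.inst, hr2]) hr
  · intro j hj
    rw [em] at hj
    rw [hap j hj.le, hap (j + 1) hj]
    have := hD.len j hj
    omega
  · rw [em, hap', hapm]
    omega

end Regr

/-! ### Preparation of the data -/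

namespace Loop

open Finset Regr

/-- The input in the machine. -/
structure Raw (D : Csc) (s : St) : Prop where
  n : s.i 0 = D.n
  m : s.i 1 = D.m
  nz : s.i 2 = D.nz
  cp : ∀ j ≤ D.m, s.ia 0 (2 + j) = D.cp j
  row : ∀ e < D.nz, s.ia 0 (3 + D.m + e) = D.row e
  ε : s.ra 0 0 = D.ε
  δ : s.ra 0 1 = D.δ
  lim : s.ra 0 2 = D.s
  b : ∀ i < D.n, s.ra 0 (3 + i) = D.b i
  val : ∀ e < D.nz, s.ra 0 (3 + D.n + e) = D.val e

lemma Raw.congr {D : Csc} {s s' : St} {z : Bool} (h : Raw D s) (hB : Below 3 0 1 1 z s s') :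
    Raw D s' where
  n := by rw [hB.i 0, h.n]
  m := by rw [hB.i 1, h.m]
  nz := by rw [hB.i 2, h.nz]
  cp := by rw [hB.ia 0]; exact h.cp
  row := by rw [hB.ia 0]; exact h.row
  ε := by rw [hB.ra 0, h.ε]
  δ := by rw [hB.ra 0, h.δ]
  lim := by rw [hB.ra 0, h.lim]
  b := by rw [hB.ra 0]; exact h.b
  val := by rw [hB.ra 0]; exact h.val

/-- Number of memory cells in use, up to a constant. -/
def size (D : Csc) : ℕ := 2 * D.n + D.m + D.nz + 3

/-- The machine is large enough. -/
structure Big (D : Csc) (W E H : ℕ) : Prop where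
  hE : E = 4 * size D
  hH : H = D.n + D.m + D.nz + 5
  hW : 2 * E ≤ W

/-- Norms of the rows and numbers of entries. -/
def normCmd : Cmd :=
  .loop 13 (.var 2) (
    .iset 14 (.arr 0 (3 + .var 1 + .var 13)) ;;
    .rset 28 (.arr 0 (3 + .var 0 + .var 13)) ;;
    .rput 11 (.var 14) (.arr 11 (.var 14) + .max (.var 28) (0 - .var 28)) ;;
    .iput 1 (.var 14 + 1) (.arr 1 (.var 14 + 1) + 1)) ;;
  .rset 0 0 ;; .rset 1 0 ;;
  .loop 13 (.var 0) (
    .rset 0 (.max (.var 0) (.arr 11 (.var 13))) ;;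
    .rset 28 (.arr 0 (3 + .var 13)) ;;
    .rset 1 (.max (.var 1) (.max (.var 28) (0 - .var 28))))

variable {D : Csc} {c W E H : ℕ} {ω : Tape}

lemma normCmd_spec {s : St} (hD : D.OK c) (hb : Big D W E H) (hr : Raw D s)
    (h11 : ∀ e, s.ra 11 e = 0) (h1 : ∀ e, s.ia 1 e = 0) :
    Tri W E H ω normCmd s (30 + 80 * size D) fun s' => (s'.r 0 = D.nA ∧ s'.r 1 = D.bn ∧
      s'.ia 1 0 = 0 ∧ ∀ i < D.n, s'.ia 1 (i + 1) = D.occ D.nz i) ∧ Below 13 0 1 11 false s s' := by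
  refine Tri.frame ?_ (by decide)
  have hE := hb.hE
  have hH := hb.hH
  have hW := hb.hW
  unfold size at *
  unfold normCmd
  refine Tri.le (Tri.seq (Tri.loop_frame (T := 70) D.nz (fun e s' => (∀ i, s'.ra 11 i =
      ∑ e' ∈ range e, if D.row e' = i then |D.val e'| else 0) ∧ s'.ia 1 0 = 0 ∧
      ∀ i, s'.ia 1 (i + 1) = D.occ e i) (a := 13) (b := 0) (p := 1) (q := 11) (z := false)
      (by decide) ?_ ?_ ?_ ?_ ?_) (T₂ := 10 + 40 * D.n) fun s1 hs1 => ?_) ?_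
  · simp
  · simp [hr.nz]
  · omega
  · exact ⟨by simpa using h11, h1 0, fun i => by simp [h1, Csc.occ]⟩
  · rintro k hk s' ⟨i1, i2, i3⟩ hB
    have hr' := hr.congr (hB.mono id)
    have frow := hr'.row k hk
    have fval := hr'.val k hk
    have hlt := hD.row k hk
    have focc : D.occ k (D.row k) ≤ k := by
      refine (sum_le_card_nsmul _ _ 1 fun e' _ => ?_).trans (by simp)
      split_ifs <;> simp
    refine ⟨?_, by simp [Cmd.cost], fun i => ?_, ?_, fun i => ?_⟩
    · simp [Cmd.ok, Cmd.den, hr'.n, hr'.m, frow, i3]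
      omega
    · simp only [Cmd.den]
      simp only [St.putI_ra]
      simp only [St.putR_ra_apply]
      rw [sum_range_succ, ← i1]
      by_cases h : D.row k = i
      · simp [hr'.n, hr'.m, frow, fval, h, abs_eq_max_neg]
      · simp [hr'.n, hr'.m, frow, fval, h, Ne.symm h]
    · simp only [Cmd.den]
      simp only [St.putI_ia_apply]
      simp [i2]
    · simp only [Cmd.den]
      simp only [St.putI_ia_apply]
      rw [Csc.occ_succ]
      by_cases h : D.row k = i
      · simp [hr'.n, hr'.m, frow, h, i3]
      · simp [hr'.n, hr'.m, frow, h, Ne.symm h, i3]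
  · obtain ⟨⟨i1, i2, i3⟩, hB⟩ := hs1
    have hr1 := hr.congr (hB.mono id)
    refine Tri.le (Tri.step (T₁ := 2) (by simp [Cmd.ok]) (by simp [Cmd.cost])
      (Tri.step (T₁ := 2) (by simp [Cmd.ok]) (by simp [Cmd.cost])
      ((Tri.loop_frame (T := 36) D.n (fun k s' => s'.r 0 = runMax D.rowAbs k ∧
        s'.r 1 = runMax (fun i => |D.b i|) k) (a := 13) (b := 0) (p := 16) (q := 16) (z := false)
        (by decide) ?_ ?_ ?_ ?_ ?_).conseq ?_))) ?_
    · simp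
    · simp [Cmd.den, hr1.n]
    · omega
    · simp [Cmd.den, runMax]
    · rintro k hk s' ⟨j1, j2⟩ hB2
      have f11 : s'.ra 11 k = D.rowAbs k := by
        rw [hB2.ra 11, ← Csc.sum_abs_row hD hk]
        exact i1 k
      have f0 : s'.ra 0 (3 + k) = D.b k := by
        rw [hB2.ra 0]
        exact hr1.b k hk
      refine ⟨?_, by simp [Cmd.cost], ?_, ?_⟩
      · simp [Cmd.ok, Cmd.den]
        omega
      · simp [Cmd.den, j1, f11, runMax]
      · simp [Cmd.den, j2, f0, runMax, abs_eq_max_neg]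
    · rintro s' ⟨⟨j1, j2⟩, hB2⟩
      refine ⟨j1, j2, ?_, fun i _ => ?_⟩
      · rw [hB2.ia 1]
        exact i2
      · rw [hB2.ia 1]
        exact i3 i
    · simp; omega
  · simp; omega

/-- Height of the sampling tree. -/
def heightCmd : Cmd :=
  .iset 9 (.var 0 + .var 0 + .var 1 + .var 2 + 3) ;; .iset 4 0 ;; .iset 5 1 ;;
  .loop 13 (.var 9) (.ifI (.var 5) (.var 9)
    (.iset 5 (.var 5 + .var 5) ;; .iset 4 (.var 4 + 1)) .skip)

/-- Clear the sampling tree. -/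
def treeCmd : Cmd := .loop 13 (.var 5 + .var 5) (.rput 10 (.var 13) 0)

/-- The sizes that are stored in the machine. -/
structure Height (D : Csc) (h : ℕ) (s : St) : Prop where
  i4 : s.i 4 = h
  i5 : s.i 5 = 2 ^ h
  ge : size D ≤ 2 ^ h
  lt : 2 ^ h < 2 * size D

lemma heightCmd_spec {s : St} (hb : Big D W E H) (hr : Raw D s) :
    Tri W E H ω heightCmd s (30 + 30 * size D) fun s' => (∃ h, Height D h s') ∧
      Below 4 1000 16 16 false s s' := by
  refine Tri.frame ?_ (by decide)
  have hE := hb.hE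
  have hW := hb.hW
  have hsz : size D = 2 * D.n + D.m + D.nz + 3 := rfl
  unfold heightCmd
  refine Tri.le (Tri.step (T₁ := 10) (by simp [Cmd.ok, hr.n, hr.m, hr.nz]; omega)
    (by simp [Cmd.cost]) (Tri.step (T₁ := 2) (by simp [Cmd.ok]; omega) (by simp [Cmd.cost])
    (Tri.step (T₁ := 2) (by simp [Cmd.ok]; omega) (by simp [Cmd.cost])
    ((Tri.loop_frame (T := 14) (size D) (fun k s' => ∃ h, s'.i 9 = size D ∧ s'.i 4 = h ∧ s'.i 5 = 2 ^ h ∧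
      2 ^ h < 2 * size D ∧ h ≤ k ∧ (size D ≤ 2 ^ h ∨ h = k)) (a := 4) (b := 1000) (p := 16)
      (q := 16) (z := false) (by decide) ?_ ?_ ?_ ?_ ?_).conseq ?_)))) ?_
  · simp
  · simp [Cmd.den, hr.n, hr.m, hr.nz, hsz]
    omega
  · omega
  · exact ⟨0, by simp [Cmd.den, hr.n, hr.m, hr.nz, hsz]; omega⟩
  · rintro k hk s' ⟨h, h0, h1, h2, h3, h4, h5⟩ -
    refine (Tri.ifI (by simp) (by simp) (T := 9) (fun hlt => ?_) fun hlt => ?_).le (by simp)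
    · have hlt' : 2 ^ h < size D := by simpa [h0, h2] using hlt
      refine ⟨?_, by simp [Cmd.cost], h + 1, ?_, ?_, ?_, ?_, by omega, ?_⟩
      · simp [Cmd.ok, Cmd.den, h1, h2]
        omega
      · simp [Cmd.den, h0]
      · simp [Cmd.den, h1]
      · simp [Cmd.den, h2]
        ring
      · rw [pow_succ]; omega
      · right
        rcases h5 with h5 | h5 <;> omega
    · have hlt' : ¬ 2 ^ h < size D := by simpa [h0, h2] using hlt
      exact ⟨trivial, by simp [Cmd.cost], h, by simp [Cmd.den, h0], by simp [Cmd.den, h1],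
        by simp [Cmd.den, h2], h3, by omega, by omega⟩
  · rintro s' ⟨⟨h, -, h1, h2, h3, -, h4⟩, -⟩
    refine ⟨h, h1, h2, ?_, h3⟩
    rcases h4 with h4 | rfl
    · exact h4
    · exact Nat.lt_two_pow_self.le
  · simp; omega

lemma treeCmd_spec {s : St} {h : ℕ} (hb : Big D W E H) (hh : Height D h s) :
    Tri W E H ω treeCmd s (10 + 100 * size D) fun s' => LeafOK D.inst h (fun _ => 0) (s'.ra 10) ∧
      Below 13 1000 16 10 false s s' := by
  refine Tri.frame ?_ (by decide)
  have hE := hb.hE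
  have hW := hb.hW
  have hH := hh.i5
  have hlt := hh.lt
  unfold treeCmd
  refine Tri.le ((Tri.loop_frame (T := 10) (2 * 2 ^ h) (fun k s' => ∀ e < k, s'.ra 10 e = 0)
    (a := 13) (b := 1000) (p := 16) (q := 10) (z := false) (by decide) ?_ ?_ ?_ ?_ ?_).conseq ?_) ?_
  · simp [hH]; omega
  · simp [hH]; omega
  · omega
  · simp
  · rintro k hk s' i1 -
    refine ⟨by simp [Cmd.ok]; omega, by simp [Cmd.cost], fun e he => ?_⟩
    simp only [Cmd.den]
    simp only [St.putR_ra_apply]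
    by_cases h1 : e = k
    · simp [h1]
    · simp [h1, i1 e (by omega)]
  · rintro s' ⟨i1, -⟩
    have hn : D.inst.n = D.n := rfl
    have hge := hh.ge
    have hsz : size D = 2 * D.n + D.m + D.nz + 3 := rfl
    refine ⟨fun a ha hah => ?_, fun l hl => ?_, fun l hl _ => i1 _ (by omega)⟩
    · rw [i1 _ (by omega), i1 _ (by omega), i1 _ (by omega), add_zero]
    · rw [hn] at hl
      exact i1 _ (by omega)
  · simp; omega

/-- Beginnings of the rows. -/
def rowsCmd : Cmd :=
  .iput 5 0 0 ;; .rput 5 0 0 ;;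
  .loop 13 (.var 0) (
    .iput 1 (.var 13 + 1) (.arr 1 (.var 13) + .arr 1 (.var 13 + 1)) ;;
    .iput 5 (.var 13 + 1) (.arr 1 (.var 13 + 1)) ;;
    .rput 5 (.var 13 + 1) 0) ;;
  .iput 1 (.var 0 + 1) (.var 2 + .var 1 + 1)

lemma rowsCmd_spec {s : St} (hD : D.OK c) (hb : Big D W E H) (hr : Raw D s) (h0 : s.ia 1 0 = 0)
    (h1 : ∀ i < D.n, s.ia 1 (i + 1) = D.occ D.nz i) :
    Tri W E H ω rowsCmd s (40 + 60 * size D) fun s' => ((∀ i ≤ D.n + 1, s'.ia 1 i = D.rp i) ∧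
      ∀ i ≤ D.n, s'.ia 5 i = D.rp i ∧ s'.ra 5 i = 0) ∧ Below 13 1000 1 5 false s s' := by
  refine Tri.frame ?_ (by decide)
  have hE := hb.hE
  have hW := hb.hW
  have hsz : size D = 2 * D.n + D.m + D.nz + 3 := rfl
  have hrp0 : D.rp 0 = 0 := by simp [Csc.rp]
  unfold rowsCmd
  refine Tri.le (Tri.step (T₁ := 7) (by simp [Cmd.ok]; omega) (by simp [Cmd.cost])
    (Tri.step (T₁ := 7) (by simp [Cmd.ok]; omega) (by simp [Cmd.cost])
    (Tri.seq (Tri.loop_frame (T := 50) D.n (fun k s' => (∀ i ≤ k, s'.ia 1 i = D.rp i ∧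
      s'.ia 5 i = D.rp i ∧ s'.ra 5 i = 0) ∧ ∀ i, k ≤ i → i < D.n → s'.ia 1 (i + 1) = D.occ D.nz i)
      (a := 13) (b := 1000) (p := 1) (q := 5)
      (z := false) (by decide) ?_ ?_ ?_ ?_ ?_) (T₂ := 14) fun s1 hs1 => ?_))) ?_
  · simp
  · simp [Cmd.den, hr.n]
  · omega
  · refine ⟨fun i hi => ?_, fun i _ hi => ?_⟩
    · obtain rfl : i = 0 := by omega
      simp [Cmd.den, h0, hrp0]
    · simpa [Cmd.den] using h1 i hi
  · rintro k hk s' ⟨i1, i2⟩ hB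
    have e1 := (i1 k le_rfl).1
    have e2 := i2 k le_rfl hk
    have e3 := Csc.rp_succ hk
    have e4 := Csc.rp_le hD (show k + 1 ≤ D.n + 1 by omega)
    refine ⟨?_, by simp [Cmd.cost], fun i hi => ?_, fun i hi hi' => ?_⟩
    · simp [Cmd.ok, Cmd.den, e1, e2]
      omega
    · simp only [Cmd.den]
      simp only [St.putR_ra_apply, St.putR_ia, St.putI_ia_apply, St.putI_ra]
      by_cases h : i = k + 1
      · simp [h, e1, e2, e3]
      · simpa [h] using i1 i (by omega)
    · simp only [Cmd.den]
      simp only [St.putR_ia, St.putI_ia_apply]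
      simpa [show i ≠ k by omega] using i2 i (by omega) hi'
  · obtain ⟨⟨i1, -⟩, hB⟩ := hs1
    have hr1 := hr.congr ((((Cmd.den_below (a := 13) (b := 1000) (p := 1) (q := 1) (z := false)
      (c := .iput 5 0 0) (ω := ω) (by decide) s).trans (Cmd.den_below (c := .rput 5 0 0) (ω := ω)
      (by decide) _)).trans (hB.mono id)).mono id)
    refine ⟨?_, by simp [Cmd.cost], fun i hi => ?_, fun i hi => ?_⟩
    · simp [Cmd.ok, hr1.n, hr1.m, hr1.nz]
      omega
    · simp only [Cmd.den]
      simp only [St.putI_ia_apply]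
      by_cases h : i = D.n + 1
      · simp [h, hr1.n, hr1.m, hr1.nz, Csc.rp_succ_n]
      · simpa [h, hr1.n] using (i1 i (by omega)).1
    · simp only [Cmd.den]
      simp only [St.putI_ia_apply, St.putI_ra]
      simpa using (i1 i hi).2
  · simp; omega

end Loop

/-! ### Parameters and columns -/

namespace Loop

open Finset Regr

/-- The parameters are stored in the machine. -/
structure Params (D : Csc) (s : St) : Prop where
  nA : s.r 0 = D.nA
  bn : s.r 1 = D.bn
  e : s.r 2 = D.e
  B0 : s.i 3 = D.inst.B0
  T0 : s.r 4 = D.inst.T0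
  τ : s.r 6 = D.inst.τ
  μ : s.r 7 = D.inst.μ
  t : s.r 8 = D.inst.t
  θ : s.r 9 = D.inst.θ
  zb : s.r 10 = D.inst.zb
  cap : s.r 11 = D.inst.cap
  runs : s.r 12 = 1 + 2 * Real.log (1 / D.δ)
  inv : s.r 13 = 1 / (2 * D.inst.n)
  pW : s.r 14 = D.inst.w D.m

lemma Params.congr {D : Csc} {z : Bool} {s s' : St} (h : Params D s)
    (hB : Below 4 15 0 0 z s s') : Params D s' where
  nA := by rw [hB.r 0, h.nA]
  bn := by rw [hB.r 1, h.bn]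
  e := by rw [hB.r 2, h.e]
  B0 := by rw [hB.i 3, h.B0]
  T0 := by rw [hB.r 4, h.T0]
  τ := by rw [hB.r 6, h.τ]
  μ := by rw [hB.r 7, h.μ]
  t := by rw [hB.r 8, h.t]
  θ := by rw [hB.r 9, h.θ]
  zb := by rw [hB.r 10, h.zb]
  cap := by rw [hB.r 11, h.cap]
  runs := by rw [hB.r 12, h.runs]
  inv := by rw [hB.r 13, h.inv]
  pW := by rw [hB.r 14, h.pW]

/-- Parameters of the method. -/
def paramCmd : Cmd :=
  .rset 2 (.arr 0 0 / .var 0) ;;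
  .ifR (.cast (.var 0)) (.arr 0 2) (.rset 3 (2 * .cast (.var 0))) (.rset 3 (.arr 0 2)) ;;
  .ifI (.var 0) (.var 1) (.iset 3 (.var 0)) (.iset 3 (.var 1)) ;;
  .rset 20 (1 + .log (2 * .cast (.var 0))) ;;
  .rset 4 (1000 * .var 20) ;;
  .rset 5 (.cast (.var 3) + .var 2 * .cast (.var 1) +
    .exp (.log (.cast (.var 1) * .var 3) / 2)) ;;
  .rset 30 (1 / (1000 * .var 4 * .var 5)) ;;
  .rset 6 (1 / (3 * .var 4 * .var 4 * .cast (.var 1) * .var 30)) ;;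
  .rset 7 (.var 2 * .cast (.var 1) / (400 * .var 4 * .var 5 * .var 5)) ;;
  .rset 8 (.var 2 / (20 * .var 20)) ;;
  .rset 9 (.var 30 * .var 8) ;;
  .rset 10 (2 * .log (1000000 * .cast (.var 1 + .var 0) / .var 2) / (.var 9 * .cast (.var 3))) ;;
  .rset 11 (4 * (.var 10 + 1)) ;;
  .rset 12 (1 + 2 * .log (1 / .arr 0 1)) ;;
  .rset 13 (1 / (2 * .cast (.var 0))) ;;
  .rset 14 (36 * .var 4 * .var 5 * .var 5 / .cast (.var 1))

variable {D : Csc} {c W E H : ℕ} {ω : Tape}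

lemma paramCmd_spec {s : St} (hb : Big D W E H) (hr : Raw D s) (h0 : s.r 0 = D.nA)
    (h1 : s.r 1 = D.bn) :
    Tri W E H ω paramCmd s 300 fun s' => Params D s' ∧ Below 3 0 16 16 false s s' := by
  refine Tri.frame ?_ (by decide)
  have hE := hb.hE
  have hH := hb.hH
  have hW := hb.hW
  have hsz : size D = 2 * D.n + D.m + D.nz + 3 := rfl
  unfold paramCmd
  refine Tri.le (Tri.step (T₁ := 10) (by simp [Cmd.ok]; omega) (by simp [Cmd.cost])
    (Tri.seq (T₁ := 20) (R := fun s' => s'.r 3 = D.S ∧ s'.r 0 = D.nA ∧ s'.r 1 = D.bn ∧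
      s'.r 2 = D.e ∧ s'.i = s.i ∧ s'.ra = s.ra) ?_ (T₂ := 270)
    fun s1 hs1 => Tri.le (Tri.seq (T₁ := 10) (R := fun s' => s'.r 3 = D.S ∧ s'.r 0 = D.nA ∧
      s'.r 1 = D.bn ∧ s'.r 2 = D.e ∧ s'.i 0 = D.n ∧ s'.i 1 = D.m ∧ s'.i 3 = D.inst.B0 ∧
      s'.ra = s.ra) ?_ (T₂ := 260) fun s2 hs2 => ?_) ?_)) ?_
  · refine (Tri.ifR (by simp) (by simp; omega) (T := 8) (fun h => ?_) fun h => ?_).le (by simp)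
    · refine ⟨by simp [Cmd.ok], by simp [Cmd.cost], ?_⟩
      simp only [Cmd.den, RE.eval_cast, RE.eval_arr, IE.eval_var, IE.eval_ofNat, St.setR_i,
        St.setR_ra, hr.n, hr.lim] at h
      simp [Cmd.den, hr.n, Csc.S, Csc.e, if_pos h, h0, h1, hr.ε]
    · refine ⟨?_, by simp [Cmd.cost], ?_⟩
      · simp [Cmd.ok]; omega
      simp only [Cmd.den, RE.eval_cast, RE.eval_arr, IE.eval_var, IE.eval_ofNat, St.setR_i,
        St.setR_ra, hr.n, hr.lim] at h
      simp [Cmd.den, hr.lim, Csc.S, Csc.e, if_neg h, h0, h1, hr.ε]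
  · obtain ⟨a1, a2, a3, a4, a5, a6⟩ := hs1
    refine (Tri.ifI (by simp) (by simp) (T := 4) (fun h => ?_) fun h => ?_).le (by simp)
    · refine ⟨trivial, by simp [Cmd.cost], ?_⟩
      simp only [IE.eval_var, a5, hr.n, hr.m] at h
      simp [Cmd.den, a1, a2, a3, a4, a5, a6, hr.n, hr.m, Csc.inst, min_eq_left h.le]
    · refine ⟨trivial, by simp [Cmd.cost], ?_⟩
      simp only [IE.eval_var, a5, hr.n, hr.m] at h
      simp [Cmd.den, a1, a2, a3, a4, a5, a6, hr.n, hr.m, Csc.inst, min_eq_right (not_lt.1 h)]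
  · obtain ⟨a1, a2, a3, a4, a5, a6, a7, a8⟩ := hs2
    refine ⟨?_, by simp [Cmd.cost], ?_⟩
    · simp [Cmd.ok, Cmd.den, a5, a6]
      omega
    · have en : D.inst.n = D.n := rfl
      have em : D.inst.m = D.m := rfl
      have ee : D.inst.e = D.e := rfl
      have eS : D.inst.S = D.S := rfl
      have eB : D.inst.B0 = min D.n D.m := rfl
      have eW : D.inst.w D.m = pW D.n D.m D.e D.S := by simp [Csc.inst]
      rw [eB] at a7
      constructor
      case pW => rw [eW]; simp [Cmd.den, a1, a4, a5, a6, a7, pW, pB, pT, pL]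
      case nA => simp [Cmd.den, a2]
      case bn => simp [Cmd.den, a3]
      case e => simp [Cmd.den, a4]
      case B0 => simp [Cmd.den, a7, eB]
      case T0 => simp [Cmd.den, a5, Inst.T0, pT, pL, en]
      case τ => simp [Cmd.den, a1, a4, a5, a6, a7, Inst.τ, pτ, pσ, pB, pT, pL, en, em, ee, eS]
      case μ => simp [Cmd.den, a1, a4, a5, a6, a7, Inst.μ, pμ, pB, pT, pL, en, em, ee, eS]
      case t => simp [Cmd.den, a4, a5, Inst.t, pt, pL, en, ee]
      case θ => simp [Cmd.den, a1, a4, a5, a6, a7, Inst.θ, pθ, pσ, pB, pT, pL, pt, en, em, ee, eS]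
      case zb => simp [Cmd.den, a1, a4, a5, a6, a7, Inst.zb, pθ, pσ, pB, pT, pL, pt, en, em, ee, eS]
      case cap =>
        simp [Cmd.den, a1, a4, a5, a6, a7, Inst.cap, Inst.zb, pθ, pσ, pB, pT, pL, pt, en, em, ee,
          eS]
      case runs => simp [Cmd.den, a8, hr.δ]
      case inv => simp [Cmd.den, a5, en]
  · norm_num
  · norm_num

/-- Append the column in word variable `11`, with the probability in real variable `28`, to the row
in word variable `14`. -/
def appendCmd : Cmd :=
  .iset 15 (.arr 5 (.var 14)) ;;
  .iput 2 (.var 15) (.var 11) ;;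
  .rput 5 (.var 14) (.arr 5 (.var 14) + .var 28) ;;
  .rput 1 (.var 15) (.arr 5 (.var 14)) ;;
  .iput 5 (.var 14) (.var 15 + 1)

lemma appendCmd_spec {s : St} (hD : D.OK c) (hb : Big D W E H) {i j : ℕ} {F : ℕ → ℕ} {y : ℝ}
    (hF : Filled D F (s.ia 5) (s.ia 2) (s.ra 1) (s.ra 5)) (hi : i ≤ D.n) (hFi : F i = j)
    (hj : j ≤ D.m) (hlt : s.ia 5 i < D.rp (i + 1)) (hy : y = D.inst.wt i j) (h14 : s.i 14 = i)
    (h11 : s.i 11 = j) (h28 : s.r 28 = y) :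
    Tri W E H ω appendCmd s 60 fun s' => (Filled D (Function.update F i (j + 1)) (s'.ia 5)
      (s'.ia 2) (s'.ra 1) (s'.ra 5) ∧ s'.ia 5 = Function.update (s.ia 5) i (s.ia 5 i + 1) ∧
      s'.ia 3 = s.ia 3 ∧ s'.ia 4 = s.ia 4 ∧ s'.ra 2 = s.ra 2 ∧ s'.ra 3 = s.ra 3 ∧
      s'.ra 4 = s.ra 4) ∧ Below 15 1000 2 1 false s s' := by
  refine Tri.frame ?_ (by decide)
  have hE := hb.hE
  have hH := hb.hH
  have hW := hb.hW
  have hsz : size D = 2 * D.n + D.m + D.nz + 3 := rfl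
  have hle := Csc.rp_le hD (show i + 1 ≤ D.n + 1 by omega)
  have key := Filled.append hD hF hi hFi hj hlt hy
  refine ⟨?_, by simp [appendCmd, Cmd.cost], ?_⟩
  · simp [appendCmd, Cmd.ok, Cmd.den, h14]
    omega
  · simpa [appendCmd, Cmd.den, h14, h11, h28] using key

/-- Store the entry whose number is the sum of word variables `12` and `13`. -/
def entryCmd : Cmd :=
  .iset 14 (.arr 0 (3 + .var 1 + (.var 12 + .var 13))) ;;
  .rset 29 (.arr 0 (3 + .var 0 + (.var 12 + .var 13)) / .var 0) ;;
  .iset 16 (.var 12 + .var 13 + (.var 12 + .var 13)) ;;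
  .iput 4 (.var 16) (.var 14 + .var 14) ;;
  .iput 4 (.var 16 + 1) (.var 14 + .var 14 + 1) ;;
  .rput 2 (.var 16) (.var 29) ;;
  .rput 2 (.var 16 + 1) (0 - .var 29) ;;
  .rset 28 (.max (.var 29) (0 - .var 29)) ;;
  .rset 30 (.var 30 + .var 28)

lemma entryCmd_spec {s : St} (hD : D.OK c) (hb : Big D W E H) (hr : Raw D s) (hp : Params D s)
    {e : ℕ} (he : s.i 12 + s.i 13 = e) (hlt : e < D.nz) (hA : 0 < D.nA)
    (hS : Entries D e (s.ia 4) (s.ra 2)) :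
    Tri W E H ω entryCmd s 150 fun s' => (Entries D (e + 1) (s'.ia 4) (s'.ra 2) ∧
      s'.i 14 = D.row e ∧ s'.r 28 = |D.val e| / D.nA ∧ s'.r 30 = s.r 30 + |D.val e| / D.nA ∧
      s'.ia 2 = s.ia 2 ∧ s'.ia 3 = s.ia 3 ∧ s'.ia 5 = s.ia 5 ∧ s'.ra 1 = s.ra 1 ∧
      s'.ra 3 = s.ra 3 ∧ s'.ra 4 = s.ra 4 ∧ s'.ra 5 = s.ra 5) ∧
      Below 14 28 2 1 false s s' := by
  refine Tri.frame ?_ (by decide)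
  have hE := hb.hE
  have hH := hb.hH
  have hW := hb.hW
  have hsz : size D = 2 * D.n + D.m + D.nz + 3 := rfl
  have hrow := hD.row e hlt
  have frow := hr.row e hlt
  have fval := hr.val e hlt
  have habs : max (D.val e / D.nA) (-(D.val e / D.nA)) = |D.val e| / D.nA := by
    rw [← abs_eq_max_neg, abs_div, abs_of_pos hA]
  refine ⟨?_, by simp [entryCmd, Cmd.cost], ?_, ?_⟩
  · simp [entryCmd, Cmd.ok, Cmd.den, he, hr.n, hr.m, frow]
    omega
  · simp only [entryCmd, Cmd.den]
    constructor
    · intro k hk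
      simp only [St.putR_ia, St.setR_ia, St.putI_ia_apply]
      by_cases h : k = e
      · simp [he, h, hr.m, frow, two_mul]
      · simp [he, show ¬ 2 * k = e + e by omega, show ¬ 2 * k = e + e + 1 by omega]
        exact hS.r0 k (by omega)
    · intro k hk
      simp only [St.putR_ia, St.setR_ia, St.putI_ia_apply]
      by_cases h : k = e
      · simp [he, h, hr.m, frow, two_mul]
      · simp [he, show ¬ 2 * k = e + e by omega, show ¬ 2 * k + 1 = e + e by omega]
        exact hS.r1 k (by omega)
    · intro k hk
      simp only [St.putI_ra, St.setR_ra, St.putR_ra_apply]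
      by_cases h : k = e
      · simp [he, h, hr.n, fval, hp.nA, two_mul]
      · simp [he, show ¬ 2 * k = e + e by omega, show ¬ 2 * k = e + e + 1 by omega]
        exact hS.v0 k (by omega)
    · intro k hk
      simp only [St.putI_ra, St.setR_ra, St.putR_ra_apply]
      by_cases h : k = e
      · simp [he, h, hr.n, fval, hp.nA, two_mul]
      · simp [he, show ¬ 2 * k = e + e by omega, show ¬ 2 * k + 1 = e + e by omega]
        simpa using hS.v1 k (by omega)
  · simp [entryCmd, Cmd.den, he, hr.n, hr.m, frow, fval, hp.nA, habs]

end Loop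

/-! ### Filling the arrays -/

namespace Loop

open Finset Regr

/-- The first `e` entries and `k` columns are stored. -/
structure Cols (D : Csc) (F : ℕ → ℕ) (e k a : ℕ) (s : St) : Prop where
  fil : Filled D F (s.ia 5) (s.ia 2) (s.ra 1) (s.ra 5)
  cur : ∀ i < D.n, s.ia 5 i = D.rp i + D.occ e i
  lev : s.ia 5 D.n = D.rp D.n + k
  ent : Entries D e (s.ia 4) (s.ra 2)
  ap : ∀ j < a, s.ia 3 j = 2 * D.cp j
  w : ∀ j < k, s.ra 3 j = D.inst.w j

/-- The entries of a column. -/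
def entriesCmd : Cmd :=
  .loop 13 (.arr 0 (3 + .var 11) - .var 12) (entryCmd ;; appendCmd)

variable {D : Csc} {c W E H : ℕ} {ω : Tape}

lemma entriesCmd_spec {s : St} (hD : D.OK c) (hb : Big D W E H) (hr : Raw D s) (hp : Params D s)
    (hA : 0 < D.nA) {j : ℕ} (hj : j < D.m) (hC : Cols D (fun _ => j) (D.cp j) j (j + 1) s)
    (h11 : s.i 11 = j) (h12 : s.i 12 = D.cp j) (h30 : s.r 30 = 0) :
    Tri W E H ω entriesCmd s (20 + 214 * (D.cp (j + 1) - D.cp j)) fun s' =>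
      (∃ F, Cols D F (D.cp (j + 1)) j (j + 1) s' ∧
        (∀ k, D.cp j ≤ k → k < D.cp (j + 1) → F (D.row k) = j + 1) ∧
        (∀ i ≤ D.n, (∀ k, D.cp j ≤ k → k < D.cp (j + 1) → D.row k ≠ i) → F i = j) ∧
        s'.r 30 = D.colAbs j / D.nA) ∧ Below 13 28 2 1 false s s' := by
  have hE := hb.hE
  have hH := hb.hH
  have hW := hb.hW
  have hsz : size D = 2 * D.n + D.m + D.nz + 3 := rfl
  have hle := Csc.cp_le hD (show j + 1 ≤ D.m from hj)
  have hmo := hD.mono j hj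
  have hcp : s.ia 0 (3 + j) = D.cp (j + 1) := by
    have := hr.cp (j + 1) hj
    rwa [show 2 + (j + 1) = 3 + j by ring] at this
  obtain ⟨len, hlen⟩ : ∃ len, len = D.cp (j + 1) - D.cp j := ⟨_, rfl⟩
  unfold entriesCmd
  refine Tri.le ((Tri.loop_frame (T := 210) len (fun k s' => ∃ F,
    Cols D F (D.cp j + k) j (j + 1) s' ∧ (∀ k' < k, F (D.row (D.cp j + k')) = j + 1) ∧
    (∀ i ≤ D.n, (∀ k' < k, D.row (D.cp j + k') ≠ i) → F i = j) ∧
    s'.r 30 = ∑ k' ∈ range k, |D.val (D.cp j + k')| / D.nA)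
    (a := 13) (b := 28) (p := 2) (q := 1) (z := false) (by decide) ?_ ?_ ?_ ?_ ?_).conseq ?_) ?_
  · simp [h11]
    omega
  · simp [h11, h12, hcp, hlen]
  · omega
  · exact ⟨fun _ => j, hC, by simp, by simp, by simp [h30]⟩
  · rintro k hk s1 ⟨F, hC1, hF1, hF2, h1⟩ hB
    have hlt : D.cp j + k < D.nz := by omega
    have hrow := hD.row _ hlt
    refine (Tri.seq (entryCmd_spec hD hb ((hr.congr (hB.mono id)).congr (Below.setI (z := false) (by norm_num) k))
      ((hp.congr (hB.mono id)).congr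
        (Below.setI (z := false) (by norm_num) k)) (e := D.cp j + k) ?_ hlt hA hC1.ent)
      (T₂ := 60) fun s2 hs2 => ?_).le (by norm_num)
    · rw [← h12, ← hB.i 12]
      simp
    · obtain ⟨⟨e1, e2, e3, e4, e5, e6, e7, e8, e9, e10, e11⟩, hB2⟩ := hs2
      have hFj : F (D.row (D.cp j + k)) = j := by
        refine hF2 _ hrow.le fun k' hk' he => ?_
        have := hD.inj j hj (D.cp j + k') (D.cp j + k) (by omega) (by omega) (by omega)
          (by omega) he
        omega
      have hwt : |D.val (D.cp j + k)| / D.nA = D.inst.wt (D.row (D.cp j + k)) j := by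
        have en : D.inst.n = D.n := rfl
        have em : D.inst.m = D.m := rfl
        rw [Inst.wt, en, em, if_pos hrow, if_pos hj, Csc.abs_inst_a (by omega) hj,
          show 2 * D.row (D.cp j + k) / 2 = D.row (D.cp j + k) by omega,
          hD.val j hj _ (by omega) (by omega)]
      simp only [St.setI_ia, St.setI_ra, St.setI_r] at e4 e5 e6 e7 e8 e9 e10 e11
      have hcur : s2.ia 5 (D.row (D.cp j + k)) =
          D.rp (D.row (D.cp j + k)) + D.occ (D.cp j + k) (D.row (D.cp j + k)) := by
        rw [e7]; exact hC1.cur _ hrow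
      refine (appendCmd_spec hD hb (F := F) ?_ hrow.le hFj hj.le ?_ hwt e2 ?_ e3).conseq ?_
      · rw [e7, e5, e8, e11]
        exact hC1.fil
      · rw [hcur, Csc.rp_succ hrow]
        have := Csc.occ_lt (D := D) hlt
        omega
      · rw [hB2.i 11, ← h11, ← hB.i 11]
        simp
      · rintro s3 ⟨⟨f1, f2, f3, f4, f5, f6, f7⟩, hB3⟩
        refine ⟨_, ⟨f1, fun i hi => ?_, ?_, ?_, ?_, ?_⟩, fun k' hk' => ?_, fun i hi hne => ?_, ?_⟩
        · rw [f2, ← add_assoc, Csc.occ_succ]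
          by_cases h : D.row (D.cp j + k) = i
          · rw [← h, Function.update_self, if_pos rfl, hcur, add_assoc]
          · rw [Function.update_of_ne (Ne.symm h), if_neg h, e7, hC1.cur i hi, add_zero]
        · rw [f2, Function.update_of_ne (by omega), e7, hC1.lev]
        · rw [f4, f5]; exact e1
        · rw [f3, e6]; exact hC1.ap
        · rw [f6, e9]; exact hC1.w
        · by_cases h : D.row (D.cp j + k') = D.row (D.cp j + k)
          · rw [h, Function.update_self]
          · rw [Function.update_of_ne h]
            refine hF1 k' ?_
            rcases (Nat.lt_succ_iff.1 hk').lt_or_eq with h' | rfl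
            · exact h'
            · exact absurd rfl h
        · rw [Function.update_of_ne (Ne.symm (hne k (by omega)))]
          exact hF2 i hi fun k' hk' => hne k' (by omega)
        · rw [hB3.r 30, e4, h1, sum_range_succ]
  · rintro s' ⟨⟨F, hC1, hF1, hF2, h1⟩, hB⟩
    refine ⟨⟨F, ?_, fun k h2 h3 => ?_, fun i hi hne => hF2 i hi fun k' hk' => ?_, ?_⟩, hB⟩
    · rwa [hlen, Nat.add_sub_cancel' hmo] at hC1
    · have := hF1 (k - D.cp j) (by omega)
      rwa [Nat.add_sub_cancel' h2] at this
    · exact hne _ (by omega) (by omega)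
    · rw [h1, hlen, Csc.sum_abs_col hD hj]
  · simp
    omega

/-- Store the column in word variable `11`. -/
def colCmd : Cmd :=
  .rset 30 0 ;; .iset 12 (.arr 0 (2 + .var 11)) ;; .iput 3 (.var 11) (.var 12 + .var 12) ;;
  entriesCmd ;;
  .iset 14 (.var 0) ;; .rset 28 (1 / (2 * .cast (.var 1))) ;; appendCmd ;;
  .ifR (.cast (.var 0)) (.arr 0 2)
    (.rput 3 (.var 11) (.var 30 + .cast (.var 0) / .cast (.var 1))) (.rput 3 (.var 11) 1)

lemma colCmd_spec {s : St} (hD : D.OK c) (hb : Big D W E H) (hr : Raw D s) (hp : Params D s)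
    (hA : 0 < D.nA) {j : ℕ} (hj : j < D.m) (hC : Cols D (fun _ => j) (D.cp j) j j s)
    (h11 : s.i 11 = j) :
    Tri W E H ω colCmd s (200 + 214 * (D.cp (j + 1) - D.cp j)) fun s' =>
      Cols D (fun _ => j + 1) (D.cp (j + 1)) (j + 1) (j + 1) s' ∧
        Below 12 28 2 1 false s s' := by
  refine Tri.frame ?_ (by decide)
  have hE := hb.hE
  have hH := hb.hH
  have hW := hb.hW
  have hsz : size D = 2 * D.n + D.m + D.nz + 3 := rfl
  have hle := Csc.cp_le hD (show j + 1 ≤ D.m from hj)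
  have hmo := hD.mono j hj
  have hcp := hr.cp j hj.le
  have en : D.inst.n = D.n := rfl
  have em : D.inst.m = D.m := rfl
  unfold colCmd
  refine Tri.le (Tri.step (T₁ := 2) (by simp [Cmd.ok]) (by simp [Cmd.cost])
    (Tri.step (T₁ := 9) (by simp [Cmd.ok, Cmd.den, h11]; omega) (by simp [Cmd.cost])
    (Tri.step (T₁ := 9) (by simp [Cmd.ok, Cmd.den, h11, hcp]; omega) (by simp [Cmd.cost])
    (Tri.seq (entriesCmd_spec hD hb (hr.congr (z := false) ?_)
      (hp.congr (z := false) ?_) hA hj ?_ ?_ ?_ ?_)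
    (T₂ := 150) fun s1 hs1 => ?_)))) ?_
  · exact (Cmd.den_below (c := .rset 30 0 ;; .iset 12 (.arr 0 (2 + .var 11)) ;;
      .iput 3 (.var 11) (.var 12 + .var 12)) (a := 3) (b := 0) (p := 1) (q := 1) (z := false)
      (by decide) s)
  · exact (Cmd.den_below (c := .rset 30 0 ;; .iset 12 (.arr 0 (2 + .var 11)) ;;
      .iput 3 (.var 11) (.var 12 + .var 12)) (a := 4) (b := 15) (p := 0) (q := 0) (z := false)
      (by decide) s)
  · refine ⟨by simpa [Cmd.den] using hC.fil, by simpa [Cmd.den] using hC.cur,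
      by simpa [Cmd.den] using hC.lev, by simpa [Cmd.den] using hC.ent, fun j' hj' => ?_,
      by simpa [Cmd.den] using hC.w⟩
    simp only [Cmd.den]
    simp only [St.putI_ia_apply]
    by_cases h : j' = j
    · simp [h, h11, hcp, two_mul]
    · simpa [h, h11] using hC.ap j' (by omega)
  · simp [Cmd.den, h11]
  · simp [Cmd.den, h11, hcp]
  · simp [Cmd.den]
  · obtain ⟨⟨F, hC1, hF1, hF2, h30⟩, hB1⟩ := hs1
    have hBs : Below 12 28 2 1 false s s1 :=
      (Cmd.den_below (c := .rset 30 0 ;; .iset 12 (.arr 0 (2 + .var 11)) ;;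
        .iput 3 (.var 11) (.var 12 + .var 12)) (ω := ω) (by decide) s).trans
        (hB1.mono id)
    have hr1 := hr.congr (hBs.mono id)
    have h11' : s1.i 11 = j := by rw [hBs.i 11, h11]
    refine (Tri.step (T₁ := 2) (by simp [Cmd.ok]) (by simp [Cmd.cost])
      (Tri.step (T₁ := 10) (by simp [Cmd.ok]) (by simp [Cmd.cost])
      (Tri.seq (appendCmd_spec hD hb (F := F) (i := D.n) (j := j) (y := 1 / (2 * D.m))
        (by simpa [Cmd.den] using hC1.fil) le_rfl (hF2 _ le_rfl fun k h1 h2 => ?_) hj.le ?_ ?_ ?_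
        ?_ ?_) (T₂ := 60) fun s2 hs2 => ?_))).le (by norm_num)
    · exact (hD.row k (by omega)).ne
    · simp [Cmd.den, hC1.lev, Csc.rp_succ_n, Csc.rp_n hD]
      omega
    · rw [Inst.wt, en, em, if_neg (lt_irrefl _), if_pos hj]
    · simp [Cmd.den, hr1.n]
    · simp [Cmd.den, h11']
    · simp [Cmd.den, hr1.m]
    · obtain ⟨⟨f1, f2, f3, f4, f5, f6, f7⟩, hB2⟩ := hs2
      simp only [Cmd.den, St.setR_ia, St.setR_ra, St.setI_ia, St.setI_ra] at f2 f3 f4 f5 f6 f7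
      have f0 : s2.i 0 = D.n := by
        rw [hB2.i 0]; simp [Cmd.den, hr1.n]
      have f01 : s2.i 1 = D.m := by
        rw [hB2.i 1]; simp [Cmd.den, hr1.m]
      have f11 : s2.i 11 = j := by
        rw [hB2.i 11]; simp [Cmd.den, h11']
      have f30 : s2.r 30 = D.colAbs j / D.nA := by
        rw [hB2.r 30]; simp [Cmd.den, h30]
      have fl : s2.ra 0 2 = D.s := by
        rw [hB2.ra 0]; simp [Cmd.den, hr1.lim]
      have key : ∀ y, y = D.inst.w j → Cols D (fun _ => j + 1) (D.cp (j + 1)) (j + 1) (j + 1)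
          (s2.putR 3 j y) := by
        intro y hy
        have hfil : Filled D (fun _ => j + 1) (s2.ia 5) (s2.ia 2) (s2.ra 1) (s2.ra 5) := by
          refine f1.congr fun i hi => ?_
          by_cases hn : i = D.n
          · rw [hn, Function.update_self]
          · rw [Function.update_of_ne hn]
            by_cases hk : ∀ k, D.cp j ≤ k → k < D.cp (j + 1) → D.row k ≠ i
            · rw [hF2 i hi hk, Inst.cw, sum_range_succ]
              have h0 : D.inst.wt i j = 0 := by
                rw [Inst.wt, en, em, if_pos (by omega), if_pos hj, Csc.abs_inst_a (by omega) hj,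
                  show 2 * i / 2 = i by omega]
                by_contra h0
                have hA0 : D.A i j ≠ 0 := fun h => h0 (by simp [h])
                obtain ⟨k, k1, k2, k3⟩ := hD.cov j hj i (by omega) hA0
                exact hk k k1 k2 k3
              rw [h0, add_zero, Inst.cw]
            · push Not at hk
              obtain ⟨k, k1, k2, rfl⟩ := hk
              rw [hF1 k k1 k2]
        refine ⟨by simpa using hfil, fun i hi => ?_, ?_, ?_, ?_, fun j' hj' => ?_⟩
        · simp only [St.putR_ia]
          rw [f2, Function.update_of_ne (by omega)]
          exact hC1.cur i hi
        · simp only [St.putR_ia]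
          rw [f2, Function.update_self, hC1.lev, add_assoc]
        · simp only [St.putR_ia, St.putR_ra, Function.update_of_ne (show 2 ≠ 3 by norm_num)]
          rw [f4, f5]; exact hC1.ent
        · simp only [St.putR_ia]
          rw [f3]; exact hC1.ap
        · rw [St.putR_ra_apply]
          by_cases h : j' = j
          · simp [h, hy]
          · simp only [h, and_false, if_false]
            rw [f6]
            exact hC1.w j' (by omega)
      refine (Tri.ifR (by simp) (by simp; omega) (T := 20) (fun h => ?_) fun h => ?_).le (by simp)
      · refine ⟨by simp [Cmd.ok, f11]; omega, by simp [Cmd.cost], ?_⟩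
        simp only [RE.eval_cast, RE.eval_arr, IE.eval_var, IE.eval_ofNat, f0, fl] at h
        simp only [Cmd.den, IE.eval_var, f11]
        refine key _ ?_
        simp [f30, f0, f01, Csc.inst, hj, h]
      · refine ⟨by simp [Cmd.ok, f11]; omega, by simp [Cmd.cost], ?_⟩
        simp only [RE.eval_cast, RE.eval_arr, IE.eval_var, IE.eval_ofNat, f0, fl] at h
        simp only [Cmd.den, IE.eval_var, f11]
        refine key _ ?_
        simp [Csc.inst, hj, h]
  · omega

/-- Store the columns. -/
def colsCmd : Cmd := .loop 11 (.var 1) colCmd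

lemma colsCmd_spec {s : St} (hD : D.OK c) (hb : Big D W E H) (hr : Raw D s) (hp : Params D s)
    (hA : 0 < D.nA) (hC : Cols D (fun _ => 0) 0 0 0 s) :
    Tri W E H ω colsCmd s (10 + 300 * size D) fun s' =>
      Cols D (fun _ => D.m) D.nz D.m D.m s' ∧ Below 11 28 2 1 false s s' := by
  refine Tri.frame ?_ (by decide)
  have hE := hb.hE
  have hW := hb.hW
  have hsz : size D = 2 * D.n + D.m + D.nz + 3 := rfl
  refine (Tri.loop_acc (T := 300 * size D) D.m (fun j t s' => t ≤ 210 * j + 214 * D.cp j ∧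
    Cols D (fun _ => j) (D.cp j) j j s' ∧ Below 11 28 2 1 false s s') (by simp) (by simp [hr.m])
    (by omega) ⟨by simp, by simpa [hD.zero] using hC, .rfl'⟩ ?_ ?_).le (by simp)
  · rintro j hj t s1 ⟨ht, h1, hB⟩
    have hmo := hD.mono j hj
    have hB' : Below 11 28 2 1 false s (s1.setI 11 j) := hB.trans (.setI le_rfl j)
    refine ⟨_, (colCmd_spec hD hb (hr.congr (hB'.mono id)) (hp.congr (hB'.mono id)) hA hj
      ⟨h1.fil, h1.cur, h1.lev, h1.ent, h1.ap, h1.w⟩ (by simp)).conseq ?_⟩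
    rintro s2 ⟨h2, hB2⟩
    exact ⟨by omega, h2, hB'.trans (hB2.mono id)⟩
  · rintro t s1 ⟨ht, h1, -⟩
    have : D.nz = D.cp D.m := rfl
    exact ⟨by omega, h1⟩

/-- The level column, and the right-hand side. -/
def levelCmd : Cmd :=
  .iset 11 (.var 1) ;; .iput 3 (.var 1) (.var 2 + .var 2) ;;
  .iput 3 (.var 1 + 1) (.var 2 + .var 2 + (.var 0 + .var 0)) ;; .rput 3 (.var 1) (.var 14) ;;
  .iset 14 (.var 0) ;; .rset 28 (1 / (2 * .cast (.var 3))) ;; appendCmd ;;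
  .loop 13 (.var 0) (
    .iset 12 (.var 2 + .var 2 + (.var 13 + .var 13)) ;;
    .iput 4 (.var 12) (.var 13 + .var 13) ;;
    .iput 4 (.var 12 + 1) (.var 13 + .var 13 + 1) ;;
    .rput 2 (.var 12) (0 - 3) ;; .rput 2 (.var 12 + 1) (0 - 3) ;;
    .rset 29 (.arr 0 (3 + .var 13) / .var 0) ;;
    .rput 4 (.var 13 + .var 13) (.max (0 - .var 29 - .var 1 / .var 0) (0 - 4)) ;;
    .rput 4 (.var 13 + .var 13 + 1) (.max (.var 29 - .var 1 / .var 0) (0 - 4)))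

lemma levelCmd_spec {s : St} (hD : D.OK c) (hb : Big D W E H) (hr : Raw D s) (hp : Params D s)
    (hA : 0 < D.nA) (hC : Cols D (fun _ => D.m) D.nz D.m D.m s) {h : ℕ} (hh : size D ≤ 2 ^ h)
    (hE' : 2 ^ h ≤ E) (hrp : ∀ i ≤ D.n + 1, s.ia 1 i = D.rp i) :
    Tri W E H ω levelCmd s (200 + 200 * size D) fun s' =>
      (RowOK D.inst h E (s'.ia 1) (s'.ia 2) (s'.ra 1) ∧ ColOK D.inst E (s'.ia 3) (s'.ia 4) (s'.ra 2) ∧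
      LenOK D.inst c (s'.ia 3) ∧ (∀ j ≤ D.m, s'.ra 3 j = D.inst.w j) ∧
      ∀ r < 2 * D.n, s'.ra 4 r = D.inst.β r) ∧ Below 11 28 2 1 false s s' := by
  refine Tri.frame ?_ (by decide)
  have hE := hb.hE
  have hH := hb.hH
  have hW := hb.hW
  have hsz : size D = 2 * D.n + D.m + D.nz + 3 := rfl
  have en : D.inst.n = D.n := rfl
  have em : D.inst.m = D.m := rfl
  unfold levelCmd
  refine Tri.le (Tri.step (T₁ := 2) (by simp [Cmd.ok]) (by simp [Cmd.cost])
    (Tri.step (T₁ := 9) (by simp [Cmd.ok, Cmd.den, hr.m, hr.nz]; omega) (by simp [Cmd.cost])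
    (Tri.step (T₁ := 16) (by simp [Cmd.ok, Cmd.den, hr.n, hr.m, hr.nz]; omega) (by simp [Cmd.cost])
    (Tri.step (T₁ := 7) (by simp [Cmd.ok, Cmd.den, hr.m]; omega) (by simp [Cmd.cost])
    (Tri.step (T₁ := 2) (by simp [Cmd.ok]) (by simp [Cmd.cost])
    (Tri.step (T₁ := 10) (by simp [Cmd.ok]) (by simp [Cmd.cost])
    (Tri.seq (appendCmd_spec hD hb (F := fun _ => D.m) (i := D.n) (j := D.m)
      (y := 1 / (2 * D.inst.B0)) (by simpa [Cmd.den] using hC.fil) le_rfl rfl le_rfl ?_ ?_ ?_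
      ?_ ?_) (T₂ := 100 + 200 * D.n) fun s1 hs1 => ?_))))))) ?_
  · simp [Cmd.den, hC.lev, Csc.rp_succ_n, Csc.rp_n hD]
  · rw [Inst.wt, en, em, if_neg (lt_irrefl _), if_neg (lt_irrefl _)]
  · simp [Cmd.den, hr.n]
  · simp [Cmd.den, hr.m]
  · simp [Cmd.den, hp.B0]
  · obtain ⟨⟨f1, f2, f3, f4, f5, f6, f7⟩, hB1⟩ := hs1
    simp only [Cmd.den] at f2 f3 f4 f5 f6 f7
    have hBs : Below 11 28 2 1 false s s1 :=
      (Cmd.den_below (c := .iset 11 (.var 1) ;; .iput 3 (.var 1) (.var 2 + .var 2) ;;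
        .iput 3 (.var 1 + 1) (.var 2 + .var 2 + (.var 0 + .var 0)) ;;
        .rput 3 (.var 1) (.var 14) ;;
        .iset 14 (.var 0) ;; .rset 28 (1 / (2 * .cast (.var 3)))) (ω := ω) (by decide) s).trans
        (hB1.mono id)
    have hr1 := hr.congr (hBs.mono id)
    have hp1 := hp.congr (hBs.mono id)
    have hap : ∀ j ≤ D.m, s1.ia 3 j = 2 * D.cp j := by
      intro j hj
      have enz : D.nz = D.cp D.m := rfl
      rw [f3]
      simp only [St.setR_ia, St.setI_ia, St.putR_ia, St.putI_ia_apply]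
      by_cases h1 : j = D.m
      · simp [h1, hr.m, hr.nz, two_mul, enz]
      · simpa [h1, hr.m, hr.nz, show j ≠ D.m + 1 by omega] using hC.ap j (by omega)
    have hap' : s1.ia 3 (D.m + 1) = 2 * D.nz + 2 * D.n := by
      rw [f3]
      simp only [St.setR_ia, St.setI_ia, St.putR_ia, St.putI_ia_apply]
      simp [hr.n, hr.m, hr.nz, two_mul]
    have hw : ∀ j ≤ D.m, s1.ra 3 j = D.inst.w j := by
      intro j hj
      rw [f6]
      simp only [St.setR_ra, St.setI_ra, St.putI_ra, St.putR_ra_apply]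
      by_cases h1 : j = D.m
      · simp [h1, hr.m, hp.pW]
      · simpa [h1, hr.m] using hC.w j (by omega)
    have hent : Entries D D.nz (s1.ia 4) (s1.ra 2) := by
      rw [f4, f5]
      simpa using hC.ent
    have hrow : RowOK D.inst h E (s1.ia 1) (s1.ia 2) (s1.ra 1) := by
      refine Filled.rowOK hD (F := fun _ => D.m + 1) (f1.congr fun i hi => ?_) (fun i hi => ?_)
        (fun _ _ => rfl) (by omega) hE' ?_
      · by_cases hn : i = D.n
        · rw [hn, Function.update_self]
        · rw [Function.update_of_ne hn, Inst.cw, sum_range_succ, Inst.cw, Inst.wt, en, em,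
            if_pos (by omega), if_neg (lt_irrefl _), add_zero]
      · rw [f2]
        rcases hi.lt_or_eq with h1 | rfl
        · rw [Function.update_of_ne h1.ne, Csc.rp_succ h1]
          simpa using hC.cur i h1
        · rw [Function.update_self, Csc.rp_succ_n]
          simp [hC.lev, Csc.rp_n hD]
      · rw [hBs.ia 1]
        exact hrp
    refine Tri.le ((Tri.loop_frame (T := 180) D.n (fun k s' => Entries D D.nz (s'.ia 4) (s'.ra 2) ∧
      (∀ r < 2 * k, s'.ia 4 (2 * D.nz + r) = r ∧ s'.ra 2 (2 * D.nz + r) = -3) ∧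
      (∀ r < 2 * k, s'.ra 4 r = D.inst.β r) ∧ s'.ia 2 = s1.ia 2 ∧ s'.ra 1 = s1.ra 1 ∧
      s'.ra 3 = s1.ra 3) (a := 12) (b := 28) (p := 4) (q := 1) (z := false) (by decide)
      ?_ ?_ ?_ ?_ ?_).conseq ?_) ?_
    · simp
    · simp [hr1.n]
    · omega
    · exact ⟨hent, by simp, by simp, rfl, rfl, rfl⟩
    · rintro k hk s2 ⟨i1, i2, i3, i4, i5, i6⟩ hB2
      have hr2 := hr1.congr (hB2.mono id)
      have hp2 := hp1.congr (hB2.mono id)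
      have fb := hr2.b k hk
      refine ⟨?_, by simp [Cmd.cost], ?_, fun r hr' => ?_, fun r hr' => ?_, ?_, ?_, ?_⟩
      · simp [Cmd.ok, Cmd.den, hr2.nz]
        omega
      · simp only [Cmd.den]
        constructor
        all_goals
          intro k' hk'
          simp only [St.putI_ia_apply, St.putR_ia, St.setR_ia, St.putI_ra, St.setR_ra,
            St.putR_ra_apply]
          simp [hr2.nz, show ¬ 2 * k' = D.nz + D.nz + (k + k) + 1 by omega,
            show ¬ 2 * k' + 1 = D.nz + D.nz + (k + k) by omega,
            show ¬ 2 * k' = D.nz + D.nz + (k + k) by omega]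
        · exact i1.r0 k' hk'
        · exact i1.r1 k' hk'
        · exact i1.v0 k' hk'
        · simpa using i1.v1 k' hk'
      · simp only [Cmd.den]
        simp only [St.putI_ia_apply, St.putR_ia, St.setR_ia, St.putI_ra, St.setR_ra,
            St.putR_ra_apply]
        rcases (show r < 2 * k ∨ r = 2 * k ∨ r = 2 * k + 1 by omega) with h1 | h1 | h1
        · simpa [hr2.nz, show ¬ 2 * D.nz + r = D.nz + D.nz + (k + k) by omega,
            show ¬ 2 * D.nz + r = D.nz + D.nz + (k + k) + 1 by omega] using i2 r h1
        · subst h1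
          simp [hr2.nz, two_mul]
        · subst h1
          simp [hr2.nz, show D.nz + D.nz + (k + k + 1) = D.nz + D.nz + (k + k) + 1 by omega, two_mul]
      · simp only [Cmd.den]
        simp only [St.putI_ra, St.setR_ra, St.putR_ra_apply]
        rcases (show r < 2 * k ∨ r = 2 * k ∨ r = 2 * k + 1 by omega) with h1 | h1 | h1
        · simpa [show ¬ r = k + k by omega, show ¬ r = k + k + 1 by omega] using i3 r h1
        · subst h1
          simp [fb, hp2.nA, hp2.bn, two_mul, Csc.inst, show (k + k) % 2 = 0 by omega,
            show (k + k) / 2 = k by omega]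
        · subst h1
          simp [fb, hp2.nA, hp2.bn, two_mul, Csc.inst, show ¬ (k + k + 1) % 2 = 0 by omega,
            show (k + k + 1) / 2 = k by omega]
      · simpa [Cmd.den] using i4
      · simpa [Cmd.den] using i5
      · simpa [Cmd.den] using i6
    · rintro s2 ⟨⟨i1, i2, i3, i4, i5, i6⟩, hB2⟩
      have e3 : s2.ia 3 = s1.ia 3 := hB2.ia 3
      have e1 : s2.ia 1 = s1.ia 1 := hB2.ia 1
      have hcol := Entries.colOK (c := c) (ap := s1.ia 3) (E := E) hD hA i1 hap hap' i2 (by omega)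
      refine ⟨?_, ?_, ?_, ?_, i3⟩
      · rw [e1, i4, i5]; exact hrow
      · rw [e3]; exact hcol.1
      · rw [e3]; exact hcol.2
      · rw [i6]; exact hw
    · simp; omega
  · omega

end Loop

/-! ### The algorithm -/

namespace Loop

open Finset Regr

/-- Preparation of the data. -/
def setupCmd : Cmd := paramCmd ;; heightCmd ;; rowsCmd ;; colsCmd ;; levelCmd ;; treeCmd

/-- The algorithm. -/
def fullCmd : Cmd :=
  normCmd ;; .ifR (.arr 0 0) (.var 0) (setupCmd ;; mainCmd) (.loop 13 (.var 1) (.rput 0 (.var 13) 0))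

variable {D : Csc} {c W E H : ℕ} {ω : Tape}

lemma setupCmd_spec {s : St} (hD : D.OK c) (hb : Big D W E H) (hr : Raw D s) (hA : 0 < D.nA)
    (h0 : s.r 0 = D.nA) (h1 : s.r 1 = D.bn) (h10 : s.ia 1 0 = 0)
    (h1i : ∀ i < D.n, s.ia 1 (i + 1) = D.occ D.nz i) :
    Tri W E H ω setupCmd s (1100 * size D) fun s' => (∃ h, 2 ^ h < 2 * size D ∧
      Env D.inst h E W s' ∧ LenOK D.inst c (s'.ia 3) ∧ LeafOK D.inst h (fun _ => 0) (s'.ra 10) ∧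
      s'.r 12 = 1 + 2 * Real.log (1 / D.δ)) ∧ Below 3 0 0 0 false s s' := by
  refine Tri.frame ?_ (by decide)
  have hE := hb.hE
  have hW := hb.hW
  have hsz : size D = 2 * D.n + D.m + D.nz + 3 := rfl
  unfold setupCmd
  refine Tri.le (Tri.seq (paramCmd_spec hb hr h0 h1) (T₂ := 700 + 700 * size D) fun s1 hs1 =>
    Tri.le (Tri.seq (heightCmd_spec hb (hr.congr (hs1.2.mono id)))
      (T₂ := 650 + 660 * size D) fun s2 hs2 => ?_) ?_) ?_
  · obtain ⟨hp1, hB1⟩ := hs1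
    obtain ⟨⟨h, hh2⟩, hB2⟩ := hs2
    have hB12 : Below 3 0 16 16 false s s2 :=
      hB1.trans (hB2.mono id)
    have hr2 := hr.congr (hB12.mono id)
    have hp2 := hp1.congr (hB2.mono id)
    have hlt := hh2.lt
    refine Tri.le (Tri.seq (rowsCmd_spec hD hb hr2 (by rw [hB12.ia 1, h10])
      (by rw [hB12.ia 1]; exact h1i)) (T₂ := 600 + 600 * size D) fun s3 hs3 => ?_) ?_
    · obtain ⟨⟨r1, r2⟩, hB3⟩ := hs3
      have hr3 := hr2.congr (hB3.mono id)
      have hp3 := hp2.congr (hB3.mono id)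
      have hC : Cols D (fun _ => 0) 0 0 0 s3 := by
        refine ⟨⟨fun i hi => (r2 i hi).1.ge, fun i hi => ?_, fun i hi p p1 p2 => ?_,
          fun i hi p p1 p2 => ?_, fun i hi p p1 p2 => ?_, fun i hi => ?_, fun i hi => ?_⟩,
          fun i hi => ?_, ?_, ⟨?_, ?_, ?_, ?_⟩, by simp, by simp⟩
        · rw [(r2 i hi).1]; exact Csc.rp_le_succ hD hi
        · rw [(r2 i hi).1] at p2; omega
        · rw [(r2 i hi).1] at p2; omega
        · rw [(r2 i hi).1] at p2; omega
        · rw [if_pos (r2 i hi).1]; simp [Inst.cw]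
        · rw [(r2 i hi).2]; simp [Inst.cw]
        · rw [(r2 i hi.le).1]; simp [Csc.occ]
        · rw [(r2 _ le_rfl).1, add_zero]
        all_goals simp
      refine Tri.le (Tri.seq (colsCmd_spec hD hb hr3 hp3 hA hC) (T₂ := 500 + 300 * size D)
        fun s4 hs4 => ?_) (by omega)
      obtain ⟨hC4, hB4⟩ := hs4
      have hr4 := hr3.congr (hB4.mono id)
      have hp4 := hp3.congr (hB4.mono id)
      refine Tri.le (Tri.seq (levelCmd_spec hD hb hr4 hp4 hA hC4 hh2.ge (by omega) ?_)
        (T₂ := 10 + 100 * size D) fun s5 hs5 => ?_) (by omega)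
      · rw [hB4.ia 1]; exact r1
      obtain ⟨⟨l1, l2, l3, l4, l5⟩, hB5⟩ := hs5
      have hB25 : Below 11 28 1 1 false s2 s5 :=
        (hB3.mono id).trans
          ((hB4.mono id).trans
            (hB5.mono id))
      have hr5 := hr2.congr (hB25.mono id)
      have hp5 := hp2.congr (hB25.mono id)
      have hh5 : Height D h s5 := ⟨by rw [hB25.i 4, hh2.i4],
        by rw [hB25.i 5, hh2.i5], hh2.ge, hh2.lt⟩
      have en : D.inst.n = D.n := rfl
      have em : D.inst.m = D.m := rfl
      have hge := hh2.ge
      have henv : Env D.inst h E W s5 :=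
        { n := hr5.n, m := hr5.m, B0 := hp5.B0, ht := hh5.i4, H := hh5.i5, T0 := hp5.T0,
          τ := hp5.τ, μ := hp5.μ, t := hp5.t, θ := hp5.θ, zb := hp5.zb, cap := hp5.cap,
          inv := hp5.inv, row := l1, col := l2, w := l4, β := l5, hh := by rw [en, em]; omega,
          hE := by omega, hW := hW }
      refine (treeCmd_spec hb hh5).conseq ?_
      rintro s6 ⟨t1, hB6⟩
      refine ⟨h, hh2.lt, henv.congr (hB6.mono id), ?_, t1, ?_⟩
      · rw [hB6.ia 3]; exact l3
      · rw [hB6.r 12, hp5.runs]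
    · omega
  · omega
  · omega

/-- The algorithm on instances where the accuracy is not trivial. -/
lemma fullCmd_spec {s : St} {opt : ℝ} (hD : D.OK c) (ho : D.Opt opt) (hb : Big D W E H)
    (hr : Raw D s) (h11 : ∀ e, s.ra 11 e = 0) (h1 : ∀ e, s.ia 1 e = 0) (hε : D.ε < D.nA)
    {R : ℕ} (hR : 0 < R) (hR' : ⌈1 + 2 * Real.log (1 / D.δ)⌉₊ = R) :
    ∃ h T : ℕ, 2 ^ h < 2 * size D ∧
      (T : ℝ) ≤ 1300 * size D + 2000 * (R + 1) * runTime D.inst h c ∧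
      Tri W E H ω fullCmd s T fun s' => ∃ x : ℕ → ℝ, (∀ j, x j ∈ Set.Icc (-1 : ℝ) 1) ∧
        (∀ j < D.m, s'.ra 0 j = x j) ∧ ∀ r < R, ∃ i < 2 * D.n, ∀ i' < 2 * D.n,
          D.inst.row x i' ≤ D.inst.row (result D.inst (s.pos + r * D.inst.N) ω).x i := by
  have hA : 0 < D.nA := hD.hε.trans hε
  have hH := hb.hH
  have hE := hb.hE
  have hW := hb.hW
  have hsz : size D = 2 * D.n + D.m + D.nz + 3 := rfl
  have hn := normCmd_spec (W := W) (E := E) (H := H) (ω := ω) hD hb hr h11 h1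
  obtain ⟨⟨a1, a2, a3, a4⟩, hB1⟩ := hn.post
  have hr1 := hr.congr (hB1.mono id)
  have hs := setupCmd_spec (ω := ω) hD hb hr1 hA a1 a2 a3 a4
  obtain ⟨⟨h, hh, henv, hlen, hleaf, h12⟩, hB2⟩ := hs.post
  obtain ⟨T, hT, ht⟩ := mainCmd_spec (ω := ω) (H := H) (Csc.good hD ho hε) henv hlen hleaf hR
    (by rw [h12, hR']) (by change D.m ≤ H; omega)
  refine ⟨h, 30 + 80 * size D + (9 + (1100 * size D + T)), hh, ?_, ?_⟩
  · have : (1 : ℝ) ≤ size D := by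
      have : 1 ≤ size D := by omega
      exact_mod_cast this
    push_cast
    linarith
  · have hpos : (setupCmd.den ω (normCmd.den ω s)).pos = s.pos := by
      rw [hB2.pos rfl, hB1.pos rfl]
    rw [hpos] at ht
    refine Tri.step hn.ok hn.cost ((Tri.ifR (T := 1100 * size D + T) (by simp; omega) (by simp)
      (fun _ => Tri.step hs.ok hs.cost ht) fun hno => ?_).le ?_)
    · simp only [RE.eval_arr, RE.eval_var, IE.eval_ofNat, a1] at hno
      rw [hr1.ε] at hno
      exact absurd hε hno
    · simp

/-- The algorithm on trivial instances. -/
lemma fullCmd_zero {s : St} (hD : D.OK c) (hb : Big D W E H)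
    (hr : Raw D s) (h11 : ∀ e, s.ra 11 e = 0) (h1 : ∀ e, s.ia 1 e = 0) (hε : ¬ D.ε < D.nA) :
    Tri W E H ω fullCmd s (1300 * size D) fun s' => ∀ j < D.m, s'.ra 0 j = 0 := by
  have hH := hb.hH
  have hE := hb.hE
  have hW := hb.hW
  have hsz : size D = 2 * D.n + D.m + D.nz + 3 := rfl
  refine Tri.le (Tri.seq (normCmd_spec hD hb hr h11 h1) (T₂ := 100 + 20 * D.m)
    fun s1 hs1 => ?_) (by omega)
  obtain ⟨⟨a1, a2, a3, a4⟩, hB1⟩ := hs1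
  have hr1 := hr.congr (hB1.mono id)
  refine (Tri.ifR (T := 10 + 20 * D.m) (by simp; omega) (by simp) (fun hyes => ?_)
    fun _ => ?_).le (by simp; omega)
  · simp only [RE.eval_arr, RE.eval_var, IE.eval_ofNat, a1] at hyes
    rw [hr1.ε] at hyes
    exact absurd hyes hε
  · refine Tri.le ((Tri.loop_frame (T := 8) D.m (fun k s' => ∀ j < k, s'.ra 0 j = 0)
      (a := 13) (b := 1000) (p := 16) (q := 0) (z := false) (by decide) ?_ ?_ ?_ ?_ ?_).conseq ?_) ?_
    · simp
    · simp [hr1.m]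
    · omega
    · simp
    · rintro k hk s' i1 -
      refine ⟨by simp [Cmd.ok]; omega, by simp [Cmd.cost], fun j hj => ?_⟩
      simp only [Cmd.den]
      simp only [St.putR_ra_apply]
      by_cases h1 : j = k
      · simp [h1]
      · simp [h1, i1 j (by omega)]
    · rintro s' ⟨i1, -⟩
      exact i1
    · simp; omega

end Loop

/-! ### Decoding of the input -/

theorem Exec.unique {W : ℕ} {ω : Tape} {p : Prog} {σ σ₁ σ₂ : RamState} {t₁ t₂ : ℕ}
    (h₁ : Exec W ω p σ t₁ σ₁) (h₂ : Exec W ω p σ t₂ σ₂) : σ₁ = σ₂ := by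
  induction h₁ generalizing t₂ σ₂ with
  | instr i σ => cases h₂; rfl
  | seq _ _ ih ih' =>
    cases h₂ with
    | seq a b =>
      obtain rfl := ih a
      exact ih' b
  | ite_true hc _ ih =>
    cases h₂ with
    | ite_true _ h => exact ih h
    | ite_false hc' _ => exact absurd hc hc'
  | ite_false hc _ ih =>
    cases h₂ with
    | ite_true hc' _ => exact absurd hc' hc
    | ite_false _ h => exact ih h
  | loop_true hc _ _ ih ih' =>
    cases h₂ with
    | loop_true _ a b =>
      obtain rfl := ih a
      exact ih' b
    | loop_false hc' => exact absurd hc hc'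
  | loop_false hc =>
    cases h₂ with
    | loop_true hc' _ _ => exact absurd hc' hc
    | loop_false _ => rfl

namespace Loop

/-- Load the dimensions, and set up the memory layout. -/
def preludeProg : Prog :=
  (Prog.instr (.iload 0 5)).seq <| (Prog.instr (.iconst 7 1)).seq <|
  (Prog.instr (.iload 2 7)).seq <| (Prog.instr (.iconst 7 2)).seq <|
  (Prog.instr (.iadd 7 7 2)).seq <| (Prog.instr (.iload 4 7)).seq <|
  (Prog.instr (.iconst 1 5)).seq <| (Prog.instr (.iadd 1 1 0)).seq <|
  (Prog.instr (.iadd 1 1 2)).seq <| (Prog.instr (.iadd 1 1 4)).seq (.instr (.iconst 3 16))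

/-- The state after the dimensions are loaded. -/
noncomputable def startSt (n m nz : ℕ) (iw : ℕ → ℕ) (rw : ℕ → ℝ) : St where
  i v := if v = 0 then n else if v = 1 then m else if v = 2 then nz else 0
  r _ := 0
  ia a := if a = 0 then iw else fun _ => 0
  ra a := if a = 0 then rw else fun _ => 0
  pos := 0

lemma exec_preludeProg {W E H n m nz : ℕ} (ω : Tape) {σ : RamState} (hi : ∀ k, σ.ireg k = 0)
    (hr : ∀ k, σ.rreg k = 0) (hp : σ.pos = 0) (hn : σ.imem 0 = n) (hm : σ.imem 1 = m)
    (hnz : σ.imem (2 + m) = nz) (hH : H = n + m + nz + 5) (hW : H + 16 < W)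
    (h0 : ∀ k, H ≤ k → σ.imem k = 0) (h0' : ∀ k, H ≤ k → σ.rmem k = 0) :
    ∃ t σ', t ≤ 11 ∧ Exec W ω preludeProg σ t σ' ∧
      Rep E H σ' (startSt n m nz σ.imem σ.rmem) := by
  refine ⟨_, _, ?_, .seq (.instr _ _) <| .seq (.instr _ _) <| .seq (.instr _ _) <|
    .seq (.instr _ _) <| .seq (.instr _ _) <| .seq (.instr _ _) <| .seq (.instr _ _) <|
    .seq (.instr _ _) <| .seq (.instr _ _) <| .seq (.instr _ _) (.instr _ _), ?_⟩
  · norm_num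
  have m1 : 1 % W = 1 := Nat.mod_eq_of_lt (by omega)
  have m2 : 2 % W = 2 := Nat.mod_eq_of_lt (by omega)
  have m5 : 5 % W = 5 := Nat.mod_eq_of_lt (by omega)
  have m16 : 16 % W = 16 := Nat.mod_eq_of_lt (by omega)
  have q1 : (2 + m) % W = 2 + m := Nat.mod_eq_of_lt (by omega)
  have q2 : (5 + n) % W = 5 + n := Nat.mod_eq_of_lt (by omega)
  have q3 : (5 + n + m) % W = 5 + n + m := Nat.mod_eq_of_lt (by omega)
  have q4 : (5 + n + m + nz) % W = 5 + n + m + nz := Nat.mod_eq_of_lt (by omega)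
  have e : ∀ k, H ≤ loc H (k + 1) 0 := fun k => by simp [loc]
  constructor
  · intro v
    rcases v with - | - | - | v
    · simp [Instr.apply, hi, hn, startSt]
    · simp [Instr.apply, hi, hn, hm, startSt, RamState.setI, m1]
    · simp [Instr.apply, hi, hn, hm, startSt, RamState.setI, m1, m2, q1, hnz]
    · have a0 : 2 * (v + 1 + 1 + 1) ≠ 0 := by omega
      have a1 : 2 * (v + 1 + 1 + 1) ≠ 1 := by omega
      have a2 : 2 * (v + 1 + 1 + 1) ≠ 2 := by omega
      have a3 : 2 * (v + 1 + 1 + 1) ≠ 3 := by omega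
      have a4 : 2 * (v + 1 + 1 + 1) ≠ 4 := by omega
      have a7 : 2 * (v + 1 + 1 + 1) ≠ 7 := by omega
      have b1 : v + 1 + 1 + 1 ≠ 1 := by omega
      have b2 : v + 1 + 1 + 1 ≠ 2 := by omega
      simp only [Instr.apply, ireg_setI, startSt, a0, a1, a2, a3, a4, a7, b1, b2, if_false, hi]
      simp
  · intro v
    simp [Instr.apply, hr, startSt]
  · intro a k hk
    by_cases ha : a = 0
    · simp [Instr.apply, loc, ha, startSt, RamState.setI]
    · simp only [Instr.apply, loc, ha, startSt, RamState.setI, if_false]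
      exact h0 _ (by omega)
  · intro a k hk
    by_cases ha : a = 0
    · simp [Instr.apply, loc, ha, startSt, RamState.setI]
    · simp only [Instr.apply, loc, ha, startSt, RamState.setI, if_false]
      exact h0' _ (by omega)
  · simpa [Instr.apply, RamState.setI, startSt] using hp
  · simp [Instr.apply, hi, hn, hm, RamState.setI, m1, m2, m5, q1, q2, q3, q4, hnz]
    omega
  · simp [Instr.apply, m16]
  · simp [Instr.apply, hi]
  · simp [Instr.apply, hr]

end Loop

section Flat

open Finset

variable {α : Type*} {F : ℕ → List α} {N j k : ℕ} {d : α}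

lemma length_flatMap_range (F : ℕ → List α) (N : ℕ) :
    ((List.range N).flatMap F).length = ∑ j ∈ range N, (F j).length := by
  induction N with
  | zero => simp
  | succ N ih => rw [List.range_succ, List.flatMap_append, List.length_append, ih, sum_range_succ]; simp

lemma getD_flatMap_range (hj : j < N) (hk : k < (F j).length) :
    ((List.range N).flatMap F).getD (∑ j' ∈ range j, (F j').length + k) d = (F j).getD k d := by
  induction N with
  | zero => omega
  | succ N ih =>
    rw [List.range_succ, List.flatMap_append]
    have hN := length_flatMap_range F N
    rcases (Nat.lt_succ_iff.1 hj).lt_or_eq with h | rfl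
    · rw [List.getD_append, ih h]
      rw [hN]
      calc _ < ∑ j' ∈ range j, (F j').length + (F j).length := by omega
        _ = ∑ j' ∈ range (j + 1), (F j').length := (sum_range_succ _ _).symm
        _ ≤ _ := sum_le_sum_of_subset (range_mono h)
    · rw [List.getD_append_right _ _ _ _ (by omega), hN]
      simp

lemma flatMap_finRange {m : ℕ} (f : Fin m → List α) :
    (List.finRange m).flatMap f =
      (List.range m).flatMap fun j => if h : j < m then f ⟨j, h⟩ else [] := by
  rw [← List.map_coe_finRange_eq_range, List.flatMap_map]
  simp

end Flat

namespace Regr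

open Finset

variable {n m : ℕ}

/-- The row indices of column `j`. -/
noncomputable def rowsOf (A : Matrix (Fin n) (Fin m) ℝ) (j : ℕ) : List ℕ :=
  if h : j < m then (colSupport A ⟨j, h⟩).map fun i => i.val else []

/-- The entries of column `j`. -/
noncomputable def valsOf (A : Matrix (Fin n) (Fin m) ℝ) (j : ℕ) : List ℝ :=
  if h : j < m then (colSupport A ⟨j, h⟩).map fun i => A i ⟨j, h⟩ else []

/-- The problem given by a matrix and a right-hand side. -/
noncomputable def cscOf (A : Matrix (Fin n) (Fin m) ℝ) (b : Fin n → ℝ) (ε δ s : ℝ) : Csc where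
  n := n
  m := m
  A i j := if h : i < n ∧ j < m then A ⟨i, h.1⟩ ⟨j, h.2⟩ else 0
  b i := if h : i < n then b ⟨i, h⟩ else 0
  ε := ε
  δ := δ
  s := s
  cp j := ∑ j' ∈ range j, (rowsOf A j').length
  row e := ((List.range m).flatMap (rowsOf A)).getD e 0
  val e := ((List.range m).flatMap (valsOf A)).getD e 0

variable {A : Matrix (Fin n) (Fin m) ℝ} {b : Fin n → ℝ} {ε δ s : ℝ}

lemma length_rowsOf {j : ℕ} (hj : j < m) : (rowsOf A j).length = colNnz A ⟨j, hj⟩ := by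
  simp [rowsOf, hj, colNnz]

lemma length_valsOf (j : ℕ) : (valsOf A j).length = (rowsOf A j).length := by
  by_cases hj : j < m <;> simp [rowsOf, valsOf, hj]

lemma sum_colNnz {k : ℕ} (hk : k ≤ m) :
    ∑ j : Fin m with j.val < k, colNnz A j = ∑ j ∈ range k, (rowsOf A j).length := by
  rw [sum_filter]
  have e : ∀ j : Fin m, (if j.val < k then colNnz A j else 0) =
      (fun j : ℕ => if j < k then (rowsOf A j).length else 0) j.val := by
    intro j
    simp only [length_rowsOf j.2]
  rw [sum_congr rfl fun j _ => e j, Fin.sum_univ_eq_sum_range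
    (fun j : ℕ => if j < k then (rowsOf A j).length else 0) m, ← sum_filter]
  refine sum_congr ?_ fun _ _ => rfl
  ext j
  simp only [mem_filter, mem_range]
  omega

lemma nnz_eq : nnz A = ∑ j ∈ range m, (rowsOf A j).length := by
  rw [← sum_colNnz le_rfl, nnz]
  refine (sum_congr ?_ fun _ _ => rfl)
  ext j
  simp

lemma exists_col {cp : ℕ → ℕ} (h0 : cp 0 = 0) {e : ℕ} :
    ∀ m, e < cp m → ∃ j < m, cp j ≤ e ∧ e < cp (j + 1) := by
  intro m
  induction m with
  | zero => intro h; omega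
  | succ m ih =>
    intro h
    by_cases h1 : e < cp m
    · obtain ⟨j, h2, h3⟩ := ih h1
      exact ⟨j, by omega, h3⟩
    · exact ⟨m, by omega, by omega, h⟩

lemma cscOf_entry {j e : ℕ} (hj : j < m) (h1 : (cscOf A b ε δ s).cp j ≤ e)
    (h2 : e < (cscOf A b ε δ s).cp (j + 1)) :
    ∃ i : Fin n, (colSupport A ⟨j, hj⟩)[e - (cscOf A b ε δ s).cp j]? = some i ∧
      (cscOf A b ε δ s).row e = i.val ∧ (cscOf A b ε δ s).val e = A i ⟨j, hj⟩ := by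
  simp only [cscOf] at h1 h2 ⊢
  rw [sum_range_succ] at h2
  obtain ⟨k, rfl⟩ := Nat.exists_eq_add_of_le h1
  have hk : k < (rowsOf A j).length := by omega
  have hk' : k < (colSupport A ⟨j, hj⟩).length := by rwa [length_rowsOf hj] at hk
  refine ⟨(colSupport A ⟨j, hj⟩)[k], ?_, ?_, ?_⟩
  · rw [Nat.add_sub_cancel_left, List.getElem?_eq_getElem]
  · rw [getD_flatMap_range hj hk]
    simp [rowsOf, hj, hk']
  · have : ∑ j' ∈ range j, (rowsOf A j').length = ∑ j' ∈ range j, (valsOf A j').length :=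
      sum_congr rfl fun j' _ => (length_valsOf j').symm
    rw [this, getD_flatMap_range hj (by rwa [length_valsOf])]
    simp [valsOf, hj, hk']

lemma mem_colSupport {i : Fin n} {j : Fin m} : i ∈ colSupport A j ↔ A i j ≠ 0 := by
  simp [colSupport]

lemma cscOf_OK {c : ℕ} (hn : 0 < n) (hm : 0 < m) (hε : 0 < ε) (hc : ∀ j, colNnz A j ≤ c) :
    (cscOf A b ε δ s).OK c := by
  have hs : ∀ j, (cscOf A b ε δ s).cp (j + 1) =
    (cscOf A b ε δ s).cp j + (rowsOf A j).length := fun j => sum_range_succ _ _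
  refine
    { hn := hn, hm := hm, hε := hε, zero := by simp [cscOf], mono := fun j _ => by rw [hs]; omega,
      len := fun j hj => ?_, row := fun e he => ?_, val := fun j hj e h1 h2 => ?_,
      ne := fun e he => ?_, inj := fun j hj e e' h1 h2 h3 h4 h5 => ?_,
      cov := fun j hj i hi hA => ?_ }
  · replace hj : j < m := hj
    rw [hs, length_rowsOf hj]
    have := hc ⟨j, hj⟩
    omega
  · obtain ⟨j, hj, h1, h2⟩ := exists_col (cp := (cscOf A b ε δ s).cp) (by simp [cscOf]) _ he
    obtain ⟨i, -, e1, -⟩ := cscOf_entry (m := m) hj h1 h2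
    exact e1 ▸ i.2
  · obtain ⟨i, -, e1, e2⟩ := cscOf_entry (m := m) hj h1 h2
    rw [e1, e2]
    change _ = dite _ _ _
    rw [dif_pos ⟨i.2, hj⟩]
  · obtain ⟨j, hj, h1, h2⟩ := exists_col (cp := (cscOf A b ε δ s).cp) (by simp [cscOf]) _ he
    obtain ⟨i, e0, -, e2⟩ := cscOf_entry (m := m) hj h1 h2
    rw [e2]
    exact mem_colSupport.1 (List.mem_of_getElem? e0)
  · obtain ⟨i, e0, e1, -⟩ := cscOf_entry (m := m) hj h1 h2
    obtain ⟨i', e0', e1', -⟩ := cscOf_entry (m := m) hj h3 h4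
    obtain rfl : i = i' := Fin.ext (by rw [← e1, ← e1', h5])
    have hnd : (colSupport A ⟨j, hj⟩).Nodup := (List.nodup_finRange n).filter _
    have := (List.getElem?_inj (List.getElem?_eq_some_iff.1 e0).1 hnd).1 (e0.trans e0'.symm)
    omega
  · change dite _ _ _ ≠ 0 at hA
    replace hj : j < m := hj
    replace hi : i < n := hi
    rw [dif_pos ⟨hi, hj⟩] at hA
    obtain ⟨k, hk, hk'⟩ := List.getElem_of_mem (mem_colSupport.2 hA)
    have h2 : (cscOf A b ε δ s).cp j + k < (cscOf A b ε δ s).cp (j + 1) := by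
      rw [hs, length_rowsOf hj]
      exact Nat.add_lt_add_left hk _
    refine ⟨(cscOf A b ε δ s).cp j + k, Nat.le_add_right _ _, h2, ?_⟩
    obtain ⟨i', e0, e1, -⟩ := cscOf_entry hj (Nat.le_add_right _ _) h2
    rw [Nat.add_sub_cancel_left, List.getElem?_eq_getElem hk, hk', Option.some_inj] at e0
    rw [e1, ← e0]

lemma cscOf_nz : (cscOf A b ε δ s).nz = nnz A := nnz_eq.symm

end Regr

/-! ### The initial state, and optimality -/

namespace Regr

open Finset

variable {n m : ℕ} {A : Matrix (Fin n) (Fin m) ℝ} {b : Fin n → ℝ} {ε δ s : ℝ}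

lemma wordInput_eq : wordInput A = n :: m ::
    ((List.range (m + 1)).map (fun k => ∑ j : Fin m with j.val < k, colNnz A j) ++
      (List.range m).flatMap (rowsOf A)) := by
  simp only [wordInput, flatMap_finRange]
  rfl

lemma realInput_eq : realInput A b ε δ s = ε :: δ :: s ::
    (List.ofFn b ++ (List.range m).flatMap (valsOf A)) := by
  simp only [realInput, flatMap_finRange]
  rfl

lemma length_wordInput : (wordInput A).length = m + 3 + nnz A := by
  rw [wordInput_eq, nnz_eq, List.length_cons, List.length_cons, List.length_append,
    length_flatMap_range, List.length_map, List.length_range]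
  ring

lemma length_realInput : (realInput A b ε δ s).length = n + 3 + nnz A := by
  rw [realInput_eq, nnz_eq, List.length_cons, List.length_cons, List.length_cons,
    List.length_append, length_flatMap_range, List.length_ofFn,
    sum_congr rfl fun j _ => length_valsOf j]
  ring

lemma wordInput_col {j : ℕ} (hj : j ≤ m) :
    (wordInput A).getD (2 + j) 0 = ∑ j' ∈ range j, (rowsOf A j').length := by
  rw [wordInput_eq, add_comm 2 j, List.getD_cons_succ, List.getD_cons_succ,
    List.getD_append _ _ _ _ (by simp; omega), ← sum_colNnz hj,
    List.getD_eq_getElem _ _ (by simp; omega), List.getElem_map, List.getElem_range]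

lemma raw_start : Loop.Raw (cscOf A b ε δ s) (Loop.startSt n m (nnz A)
    (initState A b ε δ s).imem (initState A b ε δ s).rmem) where
  n := rfl
  m := rfl
  nz := cscOf_nz.symm
  cp j hj := wordInput_col hj
  row e he := by
    change (wordInput A).getD (3 + m + e) 0 = ((List.range m).flatMap (rowsOf A)).getD e 0
    rw [wordInput_eq, show 3 + m + e = (m + 1 + e) + 1 + 1 by ring, List.getD_cons_succ,
      List.getD_cons_succ, List.getD_append_right _ _ _ _ (by simp)]
    simp
  ε := by change (realInput A b ε δ s).getD 0 0 = ε; rw [realInput_eq]; rfl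
  δ := by change (realInput A b ε δ s).getD 1 0 = δ; rw [realInput_eq]; rfl
  lim := by change (realInput A b ε δ s).getD 2 0 = s; rw [realInput_eq]; rfl
  b i hi := by
    replace hi : i < n := hi
    change (realInput A b ε δ s).getD (3 + i) 0 = dite _ _ _
    rw [realInput_eq, show 3 + i = i + 1 + 1 + 1 by ring, List.getD_cons_succ,
      List.getD_cons_succ, List.getD_cons_succ, List.getD_append _ _ _ _ (by simpa), dif_pos hi,
      List.getD_eq_getElem _ _ (by simpa), List.getElem_ofFn]
  val e he := by
    change (realInput A b ε δ s).getD (3 + n + e) 0 = ((List.range m).flatMap (valsOf A)).getD e 0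
    rw [realInput_eq, show 3 + n + e = (n + e) + 1 + 1 + 1 by ring, List.getD_cons_succ,
      List.getD_cons_succ, List.getD_cons_succ, List.getD_append_right _ _ _ _ (by simp)]
    simp

lemma cscOf_res (x : ℕ → ℝ) (i : Fin n) :
    (cscOf A b ε δ s).res x i = (A.mulVec (fun j => x j) - b) i := by
  simp only [Csc.res, Pi.sub_apply, Matrix.mulVec, dotProduct]
  congr 1
  · rw [show (cscOf A b ε δ s).m = m from rfl, ← Fin.sum_univ_eq_sum_range
      (fun j => (cscOf A b ε δ s).A i j * x j) m]
    refine sum_congr rfl fun j _ => ?_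
    congr 1
    change dite _ _ _ = _
    rw [dif_pos ⟨i.2, j.2⟩]
  · change dite _ _ _ = _
    rw [dif_pos i.2]

lemma regObjective_le_iff {x : ℕ → ℝ} {y : ℝ} (hn : 0 < n) :
    regObjective A b (fun j => x j) ≤ y ↔ ∀ i < n, |(cscOf A b ε δ s).res x i| ≤ y := by
  have : Nonempty (Fin n) := ⟨⟨0, hn⟩⟩
  rw [regObjective, pi_norm_le_iff_of_nonempty]
  refine ⟨fun h i hi => ?_, fun h i => ?_⟩
  · have := h ⟨i, hi⟩
    rwa [← cscOf_res (ε := ε) (δ := δ) (s := s) x ⟨i, hi⟩, Real.norm_eq_abs] at this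
  · rw [← cscOf_res (ε := ε) (δ := δ) (s := s), Real.norm_eq_abs]
    exact h i i.2

lemma cscOf_opt (hn : 0 < n) {xs : Fin m → ℝ} (hxs : IsBoxMinimizer A b xs)
    (hs : ∑ j, xs j ^ 2 ≤ s) : (cscOf A b ε δ s).Opt (regObjective A b xs) := by
  refine ⟨⟨fun j => if h : j < m then xs ⟨j, h⟩ else 0, fun j => ?_, ?_, ?_⟩, fun x hx => ?_⟩
  · dsimp only
    split_ifs with h
    · exact hxs.1 _
    · norm_num
  · change ∑ j ∈ range m, _ ≤ s
    rw [← Fin.sum_univ_eq_sum_range (fun j => (if h : j < m then xs ⟨j, h⟩ else 0) ^ 2) m]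
    simpa using hs
  · refine (regObjective_le_iff hn).1 (le_of_eq ?_)
    simp
  · by_contra! h
    have h1 := isMinOn_iff.1 hxs.2 (fun j => x j) fun j => hx j
    have : Nonempty (Fin n) := ⟨⟨0, hn⟩⟩
    obtain ⟨i, -, hi⟩ := (univ : Finset (Fin n)).exists_max_image
      (fun i => |(cscOf A b ε δ s).res x i|) univ_nonempty
    exact absurd (h1.trans ((regObjective_le_iff hn).2 fun i' hi' => hi ⟨i', hi'⟩ (mem_univ _)))
      (not_le.2 (h i i.2))

lemma cscOf_nA_le : (cscOf A b ε δ s).nA ≤ matNormInf A := by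
  have hdef : matNormInf A = ((univ : Finset (Fin n)).sup fun i => ∑ j, ‖A i j‖₊ : NNReal) :=
    Matrix.linfty_opNorm_def A
  rw [hdef]
  refine runMax_le (NNReal.coe_nonneg _) fun i hi => ?_
  replace hi : i < n := hi
  have h := (NNReal.coe_le_coe.2 (le_sup (f := fun i => ∑ j, ‖A i j‖₊) (mem_univ (⟨i, hi⟩ : Fin n))))
  refine le_trans (le_of_eq ?_) h
  unfold Csc.rowAbs
  rw [show (cscOf A b ε δ s).m = m from rfl, ← Fin.sum_univ_eq_sum_range
    (fun j => |(cscOf A b ε δ s).A i j|) m]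
  push_cast
  refine sum_congr rfl fun j _ => ?_
  rw [Real.norm_eq_abs]
  congr 1
  change dite _ _ _ = _
  rw [dif_pos ⟨hi, j.2⟩]

/-- If the accuracy is larger than the norm of the matrix, then `0` is an approximate minimizer. -/
lemma isApproxMinimizer_zero (hn : 0 < n) (hA : (cscOf A b ε δ s).nA ≤ ε) :
    IsApproxMinimizer A b ε fun _ => 0 := by
  refine ⟨fun _ => by norm_num, fun y hy => ?_⟩
  refine (regObjective_le_iff (x := fun _ => 0) (ε := ε) (δ := δ) (s := s) hn).2 fun i hi => ?_
  set x : ℕ → ℝ := fun j => if h : j < m then y ⟨j, h⟩ else 0 with hx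
  have hxb : ∀ j, x j ∈ Set.Icc (-1 : ℝ) 1 := by
    intro j
    simp only [hx]
    split_ifs with h
    · exact hy _
    · norm_num
  have h1 := (regObjective_le_iff (A := A) (b := b) (ε := ε) (δ := δ) (s := s) (x := x) hn).1
    le_rfl i hi
  have h2 := (Csc.abs_mul_le (D := cscOf A b ε δ s) hxb i).trans
    (Csc.rowAbs_le (D := cscOf A b ε δ s) hi)
  have h3 : (fun j : Fin m => x j) = y := by ext j; simp [hx]
  rw [h3] at h1
  unfold Csc.res at h1 ⊢
  simp only [mul_zero, sum_const_zero]
  rw [abs_le] at h1 h2 ⊢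
  exact ⟨by linarith [h1.1, h1.2, h2.1, h2.2], by linarith [h1.1, h1.2, h2.1, h2.2]⟩

end Regr

/-! ### The running time, and the theorem -/

namespace Regr

open Finset

lemma pB_le {n m : ℕ} {e s : ℝ} (hs : 0 ≤ s) :
    pB n m e (open Classical in if (n : ℝ) < s then 2 * n else s) ≤
      (min n m : ℕ) + e * m + (2 * √(m * min (n : ℝ) s) + 1) := by
  set S : ℝ := (open Classical in if (n : ℝ) < s then 2 * n else s) with hS
  have h0 : 0 ≤ S := by rw [hS]; split_ifs <;> positivity
  have h1 : S ≤ 4 * min (n : ℝ) s := by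
    rw [hS]
    split_ifs with h
    · rw [min_eq_left h.le]
      have : (0 : ℝ) ≤ n := Nat.cast_nonneg n
      linarith
    · rw [min_eq_right (not_lt.1 h)]
      linarith
  unfold pB
  refine add_le_add_right ?_ _
  rcases (mul_nonneg (Nat.cast_nonneg (α := ℝ) m) h0).eq_or_lt with h | h
  · rw [← h, Real.log_zero, zero_div, Real.exp_zero]
    have := Real.sqrt_nonneg (m * min (n : ℝ) s)
    linarith
  · rw [Real.exp_half, Real.exp_log h]
    have h2 : √(m * S) ≤ √(2 ^ 2 * (m * min (n : ℝ) s)) := by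
      refine Real.sqrt_le_sqrt ?_
      calc m * S ≤ m * (4 * min (n : ℝ) s) := mul_le_mul_of_nonneg_left h1 (Nat.cast_nonneg m)
        _ = _ := by ring
    rw [Real.sqrt_mul (show (0 : ℝ) ≤ 2 ^ 2 by norm_num) (m * min (n : ℝ) s), Real.sqrt_sq (by norm_num)] at h2
    linarith

variable {D : Csc} {c h : ℕ} {F : ℝ}

lemma Csc.OK.n_le (hD : D.OK c) (hn : D.n ≤ D.nz) : D.n ≤ min D.n D.m * c := by
  have hnz : D.nz ≤ D.m * c := by
    have : ∀ j ≤ D.m, D.cp j ≤ j * c := by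
      intro j hj
      induction j with
      | zero => rw [hD.zero]; omega
      | succ j ih =>
        have h1 := ih (by omega)
        have h2 := hD.len j (by omega)
        rw [add_mul]
        omega
    exact this _ le_rfl
  have h0 := hD.hn
  rcases Nat.eq_zero_or_pos c with rfl | hc
  · omega
  rcases le_total D.n D.m with h | h
  · rw [min_eq_left h]
    exact Nat.le_mul_of_pos_right _ hc
  · rw [min_eq_right h]
    omega

lemma log_le_of_le_pow {x : ℝ} {k : ℕ} (hx : 0 < x) (h : x ≤ (2 + F) ^ k) :
    Real.log x ≤ k * Real.log (2 + F) := by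
  rw [← Real.log_pow]
  exact Real.log_le_log hx h

lemma runTime_le (hD : D.OK c) (hn : D.n ≤ D.nz) (hs : 0 ≤ D.s) (hε : D.ε < D.nA)
    (h1 : (D.m * c : ℝ) ≤ F)
    (h2 : D.m * c + ((min D.n D.m : ℕ) + √(D.m * min (D.n : ℝ) D.s)) * c / D.e ≤ F)
    (hh : (2 : ℝ) ^ h ≤ 14 * F) :
    Loop.runTime D.inst h c ≤ 900000000000 * F * Real.log (2 + F) ^ 4 := by
  have hc : 1 ≤ c := by
    by_contra hc
    have := hD.n_le hn
    have := hD.hn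
    obtain rfl : c = 0 := by omega
    omega
  have he : 0 < D.e := div_pos hD.hε (hD.hε.trans hε)
  have he1 : D.e < 1 := (div_lt_one (hD.hε.trans hε)).2 hε
  have hn1 : (1 : ℝ) ≤ D.n := by exact_mod_cast hD.hn
  have hm1 : (1 : ℝ) ≤ D.m := by exact_mod_cast hD.hm
  have hc1 : (1 : ℝ) ≤ c := by exact_mod_cast hc
  have hnat := hD.n_le hn
  obtain ⟨b0, hb0⟩ : ∃ b0, b0 = min D.n D.m := ⟨_, rfl⟩
  have hbm : b0 ≤ D.m := hb0 ▸ min_le_right _ _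
  have hb1 : (1 : ℝ) ≤ b0 := by
    have : 1 ≤ b0 := hb0 ▸ Nat.le_min.2 ⟨hD.hn, hD.hm⟩
    exact_mod_cast this
  rw [← hb0] at hnat h2
  have hbm' : (b0 : ℝ) * c ≤ D.m * c := by
    have : (b0 : ℝ) ≤ D.m := by exact_mod_cast hbm
    gcongr
  have hnb : (D.n : ℝ) ≤ b0 * c := by exact_mod_cast hnat
  have hmF : (D.m : ℝ) ≤ F := le_trans (le_mul_of_one_le_right (by linarith) hc1) h1
  have hF1 : 1 ≤ F := hm1.trans hmF
  have hnF : (D.n : ℝ) ≤ F := hnb.trans (hbm'.trans h1)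
  set L := Real.log (2 + F) with hL
  have hL1 : 1 ≤ L := by
    rw [hL, Real.le_log_iff_exp_le (by linarith)]
    linarith [Real.exp_one_lt_d9]
  have hroot := Real.sqrt_nonneg (D.m * min (D.n : ℝ) D.s)
  set rt := √(D.m * min (D.n : ℝ) D.s)
  have hQ : (b0 + rt) * c / D.e ≤ F - D.m * c := by linarith
  have hB : pB D.n D.m D.e D.S ≤ b0 + D.e * D.m + (2 * rt + 1) := by
    rw [hb0]; exact pB_le hs
  have hBce : pB D.n D.m D.e D.S * c / D.e ≤ 2 * F := by
    calc pB D.n D.m D.e D.S * c / D.e ≤ (2 * (b0 + rt) + D.e * D.m) * c / D.e := by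
          gcongr
          linarith
      _ = 2 * ((b0 + rt) * c / D.e) + D.m * c := by field_simp
      _ ≤ 2 * F := by nlinarith
  have hT : pT D.n ≤ 3000 * L := by
    have h3 : Real.log (2 * D.n) ≤ (2 : ℕ) * L :=
      log_le_of_le_pow (by linarith) (by nlinarith)
    unfold pT pL
    push_cast at h3
    linarith
  have hlog : Real.log (1000000 * (D.m + D.n : ℕ) / D.e) ≤ 16 * L := by
    have h4 : 1 / D.e ≤ F := by
      refine le_trans ?_ (hQ.trans (by linarith))
      have : 1 ≤ (b0 + rt) * c := by nlinarith
      gcongr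
    have h5 : (1000000 * (D.m + D.n : ℕ) / D.e : ℝ) ≤ 1000000 * (2 * F) * F := by
      rw [div_eq_mul_one_div]
      push_cast
      gcongr
      linarith
    refine log_le_of_le_pow (k := 16) (by push_cast; positivity) (h5.trans ?_)
    have h6 : (3 : ℝ) ^ 14 ≤ (2 + F) ^ 14 := pow_le_pow_left₀ (by norm_num) (by linarith) 14
    have h7 : F * F ≤ (2 + F) ^ 2 := by nlinarith
    calc 1000000 * (2 * F) * F = 2000000 * (F * F) := by ring
      _ ≤ (2 + F) ^ 14 * (2 + F) ^ 2 := by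
          refine mul_le_mul (le_trans (by norm_num) h6) h7 (by positivity) (by positivity)
      _ = _ := by ring
  have hlog0 : 0 ≤ Real.log (1000000 * (D.m + D.n : ℕ) / D.e) := by
    refine Real.log_nonneg ?_
    rw [le_div_iff₀ he]
    push_cast
    linarith
  have hT0 : 0 < pT D.n := by linarith [pT_ge hD.hn]
  have hBpos : 0 < pB D.n D.m D.e D.S := by linarith [one_le_pB (S := D.S) hD.hn hD.hm he]
  have hθ : 0 < pθ D.n D.m D.e D.S := pθ_pos hD.hn hD.hm he
  have hzb0 : 0 ≤ D.inst.zb := by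
    unfold Inst.zb
    exact div_nonneg (mul_nonneg zero_le_two hlog0) (mul_nonneg hθ.le (Nat.cast_nonneg _))
  have hZ : D.inst.zb * (b0 * c) ≤ 11520000000 * F * L ^ 3 := by
    have e1 : D.inst.zb * (b0 * c) = 40 * Real.log (1000000 * (D.m + D.n : ℕ) / D.e) *
        (pT D.n) ^ 2 * (pB D.n D.m D.e D.S * c / D.e) := by
      have hB0 : D.inst.B0 = b0 := hb0.symm
      have hth : D.inst.θ = D.e / (20 * pT D.n * pT D.n * pB D.n D.m D.e D.S) :=
        pθ_eq hD.hn hD.hm he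
      rw [Inst.zb, hB0, hth, show D.inst.m = D.m from rfl, show D.inst.n = D.n from rfl,
        show D.inst.e = D.e from rfl]
      field_simp
      ring
    rw [e1]
    have h6 : (pT D.n) ^ 2 ≤ (3000 * L) ^ 2 := pow_le_pow_left₀ hT0.le hT 2
    calc _ ≤ 40 * (16 * L) * (3000 * L) ^ 2 * (2 * F) := by gcongr
      _ = _ := by ring
  have hNb : (D.inst.Nb : ℝ) ≤ D.inst.zb + 1 := (Nat.ceil_lt_add_one hzb0).le
  have hsum : (D.n : ℝ) + D.m + D.inst.Nb * (D.n + b0 * (c + 1)) + D.n * (D.inst.cap + 1) ≤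
      100000000000 * F * L ^ 3 := by
    have i1 : (D.inst.Nb : ℝ) * (D.n + b0 * (c + 1)) ≤ (D.inst.zb + 1) * (3 * (b0 * c)) := by
      have : (b0 : ℝ) ≤ b0 * c := le_mul_of_one_le_right (by linarith) hc1
      refine mul_le_mul hNb (by linarith) (by positivity) (by linarith)
    have i2 : (D.n : ℝ) * (D.inst.cap + 1) ≤ 4 * (D.inst.zb * (b0 * c)) + 5 * F := by
      have := mul_le_mul_of_nonneg_left hnb hzb0
      unfold Inst.cap
      linarith
    have i3 : F ≤ F * L ^ 3 := le_mul_of_one_le_right (by linarith) (one_le_pow₀ hL1)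
    linarith
  have hhL : (1 + h : ℝ) ≤ 9 * L := by
    have h8 : (h : ℝ) * Real.log 2 ≤ (4 : ℕ) * L := by
      rw [← Real.log_pow]
      refine log_le_of_le_pow (by positivity) (hh.trans ?_)
      have h9 : (3 : ℝ) ^ 3 ≤ (2 + F) ^ 3 := pow_le_pow_left₀ (by norm_num) (by linarith) 3
      calc 14 * F ≤ (2 + F) ^ 3 * (2 + F) := by
            refine mul_le_mul (le_trans (by norm_num) h9) (by linarith) (by linarith) (by positivity)
        _ = _ := by ring
    have h10 := Real.log_two_gt_d9
    have h11 : (0 : ℝ) ≤ h := Nat.cast_nonneg h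
    push_cast at h8
    nlinarith
  unfold Loop.runTime
  rw [show D.inst.B0 = b0 from hb0.symm, show D.inst.m = D.m from rfl,
    show D.inst.n = D.n from rfl]
  calc _ ≤ 9 * L * (100000000000 * F * L ^ 3) :=
        mul_le_mul hhL hsum (by have := hzb0; unfold Inst.cap; positivity) (by linarith)
    _ = _ := by ring

lemma half_pow_le {δ : ℝ} (hδ : 0 < δ) (hδ1 : δ < 1) {R : ℕ}
    (hR : 1 + 2 * Real.log (1 / δ) ≤ R) : (1 / 2 : ENNReal) ^ R ≤ ENNReal.ofReal δ := by
  have h0 : (1 / 2 : ENNReal) = ENNReal.ofReal (1 / 2) := by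
    rw [ENNReal.ofReal_div_of_pos (by norm_num)]
    simp
  rw [h0, ← ENNReal.ofReal_pow (by norm_num)]
  refine ENNReal.ofReal_le_ofReal ?_
  rw [← Real.log_le_log_iff (by positivity) hδ, Real.log_pow, one_div, Real.log_inv]
  rw [one_div, Real.log_inv] at hR
  have h1 := Real.log_two_gt_d9
  have h2 := Real.log_neg hδ hδ1
  nlinarith

end Regr

namespace Regr

open Finset Loop

variable {n m : ℕ} {A : Matrix (Fin n) (Fin m) ℝ} {b : Fin n → ℝ} {ε δ s : ℝ}

/-- The program. -/
def mainProg : Prog := preludeProg.seq (fullCmd.comp 3)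

/-- Running a correct command on the input. -/
lemma exec_mainProg {W E H T : ℕ} {ω : Tape} {Q : St → Prop} (hW : H + 16 * E + 16 < W)
    (hH : H = n + m + nnz A + 5)
    (ht : Tri W E H ω fullCmd
      (startSt n m (nnz A) (initState A b ε δ s).imem (initState A b ε δ s).rmem) T Q) :
    ∃ t σ s', t ≤ T + 11 ∧ Exec W ω mainProg (initState A b ε δ s) t σ ∧ Q s' ∧
      ∀ j < m, σ.rmem j = s'.ra 0 j := by
  have hmz : (initState A b ε δ s).imem (2 + m) = nnz A :=
    (wordInput_col le_rfl).trans nnz_eq.symm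
  obtain ⟨t, σ, h1, h2, h3⟩ := exec_preludeProg (E := E) (W := W) (H := H) (n := n) (m := m) ω
    (σ := initState A b ε δ s) (fun _ => rfl) (fun _ => rfl) rfl (by
      change (wordInput A).getD 0 0 = n; rw [wordInput_eq]; rfl) (by
      change (wordInput A).getD 1 0 = m; rw [wordInput_eq]; rfl) hmz hH (by omega)
    (fun k hk => List.getD_eq_default _ _ (by rw [length_wordInput]; omega))
    (fun k hk => List.getD_eq_default _ _ (by rw [length_realInput]; omega))
  obtain ⟨σ', e1, -, e3⟩ := Cmd.exec_comp (by omega : H + 16 * E + 16 ≤ W) fullCmd le_rfl h3 ht.ok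
  refine ⟨_, σ', _, ?_, .seq h2 e1, ht.post, fun j hj => ?_⟩
  · have := ht.cost
    omega
  · have := e3.ra 0 j (by simp; omega)
    simpa [loc] using this

/-- One execution of the program; it fails only on a set of tapes of small probability. -/
lemma exists_bad {c K w : ℕ} (hK : 7 ≤ K) (hn : 0 < n) (hnz : n ≤ nnz A)
    (hc : ∀ j, colNnz A j ≤ c) (hε : 0 < ε) (hδ : 0 < δ) (hδ1 : δ < 1) {xs : Fin m → ℝ}
    (hxs : IsBoxMinimizer A b xs) (hs : ∑ j, xs j ^ 2 ≤ s)
    (hw : (2 + regressionBound A c ε s) ^ K ≤ (2 : ℝ) ^ w) :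
    ∃ Bad : Set Tape, tapeMeasure Bad ≤ ENNReal.ofReal δ ∧ ∀ ω, ∃ (t : ℕ) (σ : RamState),
      Exec (2 ^ w) ω mainProg (initState A b ε δ s) t σ ∧
      (t : ℝ) ≤ 10000000000000000 * regressionBound A c ε s *
        Real.log (2 + regressionBound A c ε s) ^ 4 * (1 + Real.log (1 / δ)) ∧
      (ω ∉ Bad → IsApproxMinimizer A b ε (σ.output m)) := by
  have hm : 0 < m := by
    rcases Nat.eq_zero_or_pos m with rfl | h
    · simp [nnz] at hnz; omega
    · exact h
  have hs0 : 0 ≤ s := le_trans (sum_nonneg fun _ _ => sq_nonneg _) hs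
  set D := cscOf A b ε δ s with hDdef
  have hD : D.OK c := cscOf_OK hn hm hε hc
  have ho : D.Opt (regObjective A b xs) := cscOf_opt hn hxs hs
  have hDz : D.nz = nnz A := cscOf_nz
  have hDn : D.n = n := rfl
  have hDm : D.m = m := rfl
  have hA' : D.nA ≤ matNormInf A := cscOf_nA_le
  have hA0 : 0 ≤ D.nA := runMax_nonneg _ _
  set F := regressionBound A c ε s with hF
  have hQ0 : 0 ≤ (min (m : ℝ) n + √(m * min (n : ℝ) s)) * c * matNormInf A / ε := by
    have := hA0.trans hA'
    positivity
  have hmc : (m * c : ℝ) ≤ F := by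
    rw [hF, regressionBound]
    linarith
  have hzc : nnz A ≤ m * c := by
    refine (sum_le_card_nsmul univ _ c fun j _ => hc j).trans ?_
    simp
  have hc1 : 0 < c := by
    by_contra h
    obtain rfl : c = 0 := by omega
    omega
  have hmmc : m ≤ m * c := Nat.le_mul_of_pos_right _ hc1
  have hF1 : 1 ≤ F := by
    have : 1 ≤ m * c := by omega
    exact le_trans (by exact_mod_cast this) hmc
  have hsz : size D = 2 * n + m + nnz A + 3 := by rw [size, hDn, hDm, hDz]
  have hszF : (size D : ℝ) ≤ 7 * F := by
    have h1 : size D ≤ 7 * (m * c) := by omega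
    have h2 : (size D : ℝ) ≤ 7 * (m * c) := by exact_mod_cast h1
    linarith
  obtain ⟨H, hH⟩ : ∃ H, H = n + m + nnz A + 5 := ⟨_, rfl⟩
  have hW : H + 16 * (4 * size D) + 16 < 2 ^ w := by
    have h1 : H + 16 * (4 * size D) + 16 + 1 ≤ 500 * (m * c) := by omega
    have h2 : ((H + 16 * (4 * size D) + 16 + 1 : ℕ) : ℝ) ≤ 500 * (m * c) := by exact_mod_cast h1
    have h3 : (500 : ℝ) * (m * c) ≤ (2 + F) ^ 7 := by
      have h4 : (3 : ℝ) ^ 6 ≤ (2 + F) ^ 6 := pow_le_pow_left₀ (by norm_num) (by linarith) 6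
      calc (500 : ℝ) * (m * c) ≤ (2 + F) ^ 6 * (2 + F) :=
            mul_le_mul (le_trans (by norm_num) h4) (by linarith) (by positivity) (by positivity)
        _ = _ := by ring
    have h5 := (h2.trans h3).trans ((pow_le_pow_right₀ (by linarith) hK).trans hw)
    exact Nat.lt_of_succ_le (by exact_mod_cast h5)
  have hb : Big D (2 ^ w) (4 * size D) H := by
    refine ⟨rfl, by rw [hH, hDn, hDm, hDz], by omega⟩
  have hraw := raw_start (A := A) (b := b) (ε := ε) (δ := δ) (s := s)
  have hL1 : 1 ≤ Real.log (2 + F) := by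
    rw [Real.le_log_iff_exp_le (by linarith)]
    linarith [Real.exp_one_lt_d9]
  have hL4 : 1 ≤ Real.log (2 + F) ^ 4 := one_le_pow₀ hL1
  have hd0 : 0 ≤ Real.log (1 / δ) := Real.log_nonneg (by rw [le_div_iff₀ hδ]; linarith)
  have hFL : F ≤ F * Real.log (2 + F) ^ 4 := le_mul_of_one_le_right (by linarith) hL4
  by_cases hεA : D.ε < D.nA
  · have hG := Csc.good hD ho hεA
    have hA : 0 < D.nA := hε.trans hεA
    obtain ⟨R, hR⟩ : ∃ R, ⌈1 + 2 * Real.log (1 / D.δ)⌉₊ = R := ⟨_, rfl⟩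
    have hδD : D.δ = δ := rfl
    have hR0 : 0 < R := by
      rw [← hR, Nat.ceil_pos, hδD]
      linarith
    have hRle : (R : ℝ) ≤ 2 + 2 * Real.log (1 / δ) := by
      have := Nat.ceil_lt_add_one (show 0 ≤ 1 + 2 * Real.log (1 / D.δ) by rw [hδD]; linarith)
      rw [hR, hδD] at this
      linarith
    refine ⟨{ω | ∀ r < R, ∃ i < 2 * D.inst.n,
        regObjective A b xs / D.nA - D.bn / D.nA + D.inst.e < D.inst.row
        (chain D.inst.init (fun k s (u : unitInterval) => D.inst.ustep k s u)
          (r * D.inst.N) ω D.inst.N).x i},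
      (Inst.measure_runs_le hG R).trans (half_pow_le hδ hδ1 (hR ▸ Nat.le_ceil _)), fun ω => ?_⟩
    obtain ⟨h, T, hh, hT, ht⟩ := fullCmd_spec (ω := ω) hD ho hb hraw
      (fun _ => rfl) (fun _ => rfl) hεA hR0 hR
    obtain ⟨t, σ, s', h1, h2, ⟨x, x1, x2, x3⟩, h4⟩ := exec_mainProg hW hH ht
    refine ⟨t, σ, h2, ?_, fun hω => ?_⟩
    · have hrt := runTime_le (F := F) (h := h) hD (by rw [hDz, hDn]; exact hnz) hs0 hεA hmc (by
        have e1 : D.e = ε / D.nA := rfl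
        rw [hF, regressionBound, e1, hDn, hDm, show D.s = s from rfl, div_div_eq_mul_div, min_comm n,
          Nat.cast_min]
        gcongr) (by
        have : (2 : ℝ) ^ h ≤ 2 * size D := by exact_mod_cast hh.le
        linarith)
      have hrt0 : 0 ≤ F * Real.log (2 + F) ^ 4 := by positivity
      have h5 : (t : ℝ) ≤ T + 11 := by exact_mod_cast h1
      have h6 : 2000 * ((R : ℝ) + 1) * runTime D.inst h c ≤
          2000 * (3 * (1 + Real.log (1 / δ))) * (900000000000 * F * Real.log (2 + F) ^ 4) := by
        refine mul_le_mul_of_nonneg' (by linarith) hrt ?_ (by positivity)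
        have := Inst.cap_pos hG
        unfold runTime
        positivity
      have h7 : F * Real.log (2 + F) ^ 4 ≤ F * Real.log (2 + F) ^ 4 * (1 + Real.log (1 / δ)) :=
        le_mul_of_one_le_right hrt0 (by linarith)
      linarith
    · simp only [Set.mem_ofPred_eq, not_forall, not_exists, not_and, not_lt] at hω
      obtain ⟨r, hr, hω⟩ := hω
      obtain ⟨i, hi, hi'⟩ := x3 r hr
      have hout : σ.output m = fun j : Fin m => x j := by
        ext j
        exact (h4 j j.2).trans (x2 j j.2)
      have hle : regObjective A b (fun j : Fin m => x j) ≤ regObjective A b xs + ε := by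
        refine (regObjective_le_iff (ε := ε) (δ := δ) (s := s) hn).2 fun i0 hi0 => ?_
        refine Csc.res_le_of_row (D := D) hA (fun r' hr' => ?_) hi0
        have h8 := hω i hi
        have h9 := hi' r' hr'
        rw [show (startSt n m (nnz A) (initState A b ε δ s).imem
          (initState A b ε δ s).rmem).pos = 0 from rfl, zero_add] at h9
        refine h9.trans (h8.trans (le_of_eq ?_))
        rw [show D.inst.e = ε / D.nA from rfl]
        ring
      rw [hout]
      refine ⟨fun j => x1 j, fun y hy => hle.trans ?_⟩
      have := isMinOn_iff.1 hxs.2 y hy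
      linarith
  · refine ⟨∅, by simp, fun ω => ?_⟩
    obtain ⟨t, σ, s', h1, h2, h3, h4⟩ := exec_mainProg hW hH (fullCmd_zero (ω := ω) hD hb hraw
      (fun _ => rfl) (fun _ => rfl) hεA)
    refine ⟨t, σ, h2, ?_, fun _ => ?_⟩
    · have h5 : (t : ℝ) ≤ 1300 * size D + 11 := by exact_mod_cast h1
      have h7 : F * Real.log (2 + F) ^ 4 ≤ F * Real.log (2 + F) ^ 4 * (1 + Real.log (1 / δ)) :=
        le_mul_of_one_le_right (by positivity) (by linarith)
      linarith
    · have hout : σ.output m = fun _ => 0 := by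
        ext j
        exact (h4 j j.2).trans (h3 j j.2)
      rw [hout]
      exact isApproxMinimizer_zero (δ := δ) (s := s) hn (not_lt.1 hεA)

end Regr

theorem theorem1 :
    ∃ (P : Prog) (K k : ℕ),
      ∀ (n m c : ℕ) (A : Matrix (Fin n) (Fin m) ℝ) (b : Fin n → ℝ) (ε δ s : ℝ),
        0 < n → n ≤ nnz A → (∀ j, colNnz A j ≤ c) →
        0 < ε → 0 < δ → δ < 1 →
        (∃ xs : Fin m → ℝ, IsBoxMinimizer A b xs ∧ ∑ j, xs j ^ 2 ≤ s) →
        ∀ w : ℕ, (2 + regressionBound A c ε s) ^ K ≤ (2 : ℝ) ^ w →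
          (∀ ω : Tape, ∃ (t : ℕ) (σ : RamState),
            Exec (2 ^ w) ω P (initState A b ε δ s) t σ ∧
            (t : ℝ) ≤ K * regressionBound A c ε s *
              Real.log (2 + regressionBound A c ε s) ^ k * (1 + Real.log (1 / δ))) ∧
          tapeMeasure {ω : Tape | ∃ (t : ℕ) (σ : RamState),
            Exec (2 ^ w) ω P (initState A b ε δ s) t σ ∧
            ¬ IsApproxMinimizer A b ε (σ.output m)} ≤ ENNReal.ofReal δ := by
  obtain ⟨K, hK⟩ : ∃ K : ℕ, K = 10000000000000000 := ⟨_, rfl⟩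
  refine ⟨Regr.mainProg, K, 4, ?_⟩
  rintro n m c A b ε δ s hn hnz hc hε hδ hδ1 ⟨xs, hxs, hs⟩ w hw
  obtain ⟨Bad, hBad, h⟩ := Regr.exists_bad (by omega : 7 ≤ K) hn hnz hc hε hδ hδ1 hxs hs hw
  have hK' : (K : ℝ) = 10000000000000000 := by rw [hK]; norm_num
  refine ⟨fun ω => ?_, (measure_mono fun ω hω => ?_).trans hBad⟩
  · obtain ⟨t, σ, h1, h2, -⟩ := h ω
    exact ⟨t, σ, h1, by rw [hK']; exact h2⟩
  · obtain ⟨t, σ, h1, h2⟩ := hω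
    obtain ⟨t', σ', h1', -, h3⟩ := h ω
    by_contra hno
    rw [Exec.unique h1 h1'] at h2
    exact h2 (h3 hno)
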